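/- **Conventions.** Let $\Gamma=(I,H)$ be a quiver (possibly infinite) without $1$-loops, with finitely many arrows $h_{i,j}$ from $i$ to $j$ for all $i,j\in I$. Put $Q_I=\bigoplus_{i\in I}\mathbb Z\alpha_i$, $Q_I^+=\bigoplus_{i\in I}\mathbb N\alpha_i$; for $\alpha=\sum_i d_i\alpha_i\in Q_I^+$ put $|\alpha|=\sum_i d_i$ and let $I^\alpha$ be the set of sequences $\mathbf i=(i_1,\dots,i_{|\alpha|})$ in $I$ with $\sum_r\alpha_{i_r}=\alpha$. Let $s_r$ exchange the entries $i_r,i_{r+1}$. Let $\mathbf k$ be a field. *KLR algebras.* Put $Q_{i,j}(u,v)=(v-u)^{h_{i,j}}(u-v)^{h_{j,i}}$ for $i\neq j$ and $Q_{i,i}=0$. For $\alpha\in Q_I^+$ with $|\alpha|=d$, $R_\alpha=R_{\alpha,\mathbf k}(\Gamma)$ is the unital $\mathbf k$-algebra with generators $e(\mathbf i)$ ($\mathbf i\in I^\alpha$), $x_1,\dots,x_d$, $\tau_1,\dots,\tau_{d-1}$ and relations: $e(\mathbf i)e(\mathbf j)=\delta_{\mathbf i,\mathbf j}e(\mathbf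 i)$; $\sum_{\mathbf i}e(\mathbf i)=1$; $x_re(\mathbf i)=e(\mathbf i)x_r$; $\tau_re(\mathbf i)=e(s_r(\mathbf i))\tau_r$; $x_rx_s=x_sx_r$; $\tau_rx_{r+1}e(\mathbf i)=(x_r\tau_r+\delta_{i_r,i_{r+1}})e(\mathbf i)$; $x_{r+1}\tau_re(\mathbf i)=(\tau_rx_r+\delta_{i_r,i_{r+1}})e(\mathbf i)$; $\tau_rx_s=x_s\tau_r$ if $s\neq r,r+1$; $\tau_r\tau_s=\tau_s\tau_r$ if $|r-s|>1$; $\tau_r^2e(\mathbf i)=Q_{i_r,i_{r+1}}(x_r,x_{r+1})e(\mathbf i)$; and $(\tau_{r+1}\tau_r\tau_{r+1}-\tau_r\tau_{r+1}\tau_r)e(\mathbf i)$ equals $(x_{r+2}-x_r)^{-1}\bigl(Q_{i_r,i_{r+1}}(x_{r+2},x_{r+1})-Q_{i_r,i_{r+1}}(x_r,x_{r+1})\bigr)e(\mathbf i)$ if $i_r=i_{r+2}$, and $0$ otherwise. Put $R_{d}=\bigoplus_{|\alpha|=d}R_\alpha$ (not unital if $\Gamma$ is infinite and $d>0$). *Quasi-categorical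 representations.* Functors between $\mathbf k$-linear categories are $\mathbf k$-linear. A $\mathfrak g_I$-quasi-categorical representation on a $\mathrm{Hom}$-finite $\mathbf k$-linear category $\mathcal C$ consists of (1) a decomposition $\mathcal C=\bigoplus_{\alpha\in Q_I}\mathcal C_\alpha$; (2) a pair $(E,F)$ of biadjoint exact endofunctors; (3) natural transformations $x\colon F\to F$, $\tau\colon F^2\to F^2$; (4) decompositions $E=\bigoplus_{i\in I}E_i$, $F=\bigoplus_{i\in I}F_i$, where for each object $M$ only finitely many $E_i(M)$, $F_i(M)$ are nonzero; such that (i) $E_i(\mathcal C_\alpha)\subset\mathcal C_{\alpha-\alpha_i}$ and $F_i(\mathcal C_\alpha)\subset\mathcal C_{\alpha+\alpha_i}$; (ii) for each $d\in\mathbb N$ there is an algebra homomorphism $\psi_d\colon R_{d}\to\mathrm{End}(F^d)^{\mathrm{op}}$ that sends $e(\mathbf i)$ to the projector to $F_{\mathbf i}:=F_{i_d}\cdots F_{i_1}$, $x_r$ to $F^{d-r}xF^{r-1}$ and $\tau_r$ to $F^{d-r-1}\tau F^{r-1}$ (for infinite $\Gamma$: sends $x_re(\mathbf i)$, $\tau_re(\mathbf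 i)$ to the products of these with the projector); (iii) $x$ induces a nilpotent endomorphism of $F(M)$ for each $M\in\mathcal C$. For $\alpha\in Q_I^+$ put $F_\alpha=\bigoplus_{\mathbf i\in I^\alpha}F_{\mathbf i}$ and let $\psi_\alpha\colon R_\alpha\to\mathrm{End}(F_\alpha)^{\mathrm{op}}$ be the $\alpha$-component of $\psi_{|\alpha|}$. *Doubled quiver.* Fix a decomposition $I=I_0\sqcup I_1$ such that there are no arrows between vertices of $I_1$. The quiver $\overline\Gamma=(\overline I,\overline H)$ has the vertices $i^0$ ($i\in I_0$) and $i^1,i^2$ ($i\in I_1$), and the arrows: $i^0\to j^0$ for each arrow $i\to j$ with $i,j\in I_0$; $i^0\to j^1$ for each arrow $i\to j$ with $i\in I_0$, $j\in I_1$; $i^2\to j^0$ for each arrow $i\to j$ with $i\in I_1$, $j\in I_0$; one arrow $i^1\to i^2$ for each $i\in I_1$. Let $\phi$ send a sequence in $I$ to the sequence in $\overline I$ obtained by replacing each entry $i\in I_0$ by $i^0$ and each entry $i\in I_1$ by $i^1,i^2$; also let $\phi\colon Q_I\to Q_{\overline I}$ be the linear map $\alpha_i\mapsto\alpha_{i^0}$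 ($i\in I_0$), $\alpha_i\mapsto\alpha_{i^1}+\alpha_{i^2}$ ($i\in I_1$), and write $\overline\alpha=\phi(\alpha)$. *Balanced KLR algebras.* A sequence in $\overline I$ is *well-ordered* if each entry $i^1$ is immediately followed by $i^2$ (same $i$), and *unordered* if some initial segment contains more entries of the form $i^2$ than entries of the form $i^1$. For $\alpha\in Q_I^+$ let $\mathbf e\in R_{\overline\alpha}=R_{\overline\alpha,\mathbf k}(\overline\Gamma)$ be the sum of $e(\mathbf i)$ over the well-ordered $\mathbf i\in\overline I^{\overline\alpha}$, and put $S_{\overline\alpha}=\mathbf eR_{\overline\alpha}\mathbf e\big/\sum_{\mathbf i}\mathbf eR_{\overline\alpha}e(\mathbf i)R_{\overline\alpha}\mathbf e$, the sum over the unordered $\mathbf i\in\overline I^{\overline\alpha}$. Let $\Phi_\alpha\colon R_\alpha\to S_{\overline\alpha}$ be the algebra homomorphism with $e(\mathbf i)\mapsto e(\phi(\mathbf i))$, $x_re(\mathbf i)\mapsto x_{r'}e(\phi(\mathbf i))$, $\tau_re(\mathbf i)\mapsto\tau_r^*e(\phi(\mathbf i))$, where $r'-1$ is the length of $\phi(i_1,\dots,i_{r-1})$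 and $\tau^*_re(\phi(\mathbf i))$ is $e(\phi(\mathbf i))$ multiplied on the left by: $\tau_{r'}$ if $i_r,i_{r+1}\in I_0$; $\tau_{r'}\tau_{r'+1}$ if $i_r\in I_1$, $i_{r+1}\in I_0$; $\tau_{r'+1}\tau_{r'}$ if $i_r\in I_0$, $i_{r+1}\in I_1$; $\tau_{r'+1}\tau_{r'+2}\tau_{r'}\tau_{r'+1}$ if $i_r\ne i_{r+1}$ are both in $I_1$; $-\tau_{r'+1}\tau_{r'+2}\tau_{r'}\tau_{r'+1}$ if $i_r=i_{r+1}\in I_1$. **Theorem.** Let $\overline{\mathcal C}$ be a $\mathrm{Hom}$-finite $\mathbf k$-linear abelian category with a $\mathfrak g_{\overline I}$-quasi-categorical representation given by $\overline{\mathcal C}=\bigoplus_{\beta\in Q_{\overline I}}\overline{\mathcal C}_\beta$, $\overline E=\bigoplus_{i\in\overline I}\overline E_i$, $\overline F=\bigoplus_{i\in\overline I}\overline F_i$ and homomorphisms $\overline\psi_d$ with components $\overline\psi_\beta$. Let $\mathcal C\subset\overline{\mathcal C}$ be an abelian subcategory (full, closed under isomorphisms, finite direct sums, kernels and cokernels)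 such that (a) $\mathcal C$ is stable under $\overline F_{i^0}$ and $\overline E_{i^0}$ for each $i\in I_0$; (b) $\mathcal C$ is stable under $\overline F_{i^2}\overline F_{i^1}$ and $\overline E_{i^1}\overline E_{i^2}$ for each $i\in I_1$; (c) $\overline F_{i^2}(\mathcal C)=0$ for each $i\in I_1$; (d) $\mathcal C=\bigoplus_{\alpha\in Q_I}\mathcal C_\alpha$, where $\mathcal C_\alpha=\mathcal C\cap\overline{\mathcal C}_{\overline\alpha}$. Define endofunctors of $\mathcal C$ by $F_i=\overline F_{i^0}|_{\mathcal C}$, $E_i=\overline E_{i^0}|_{\mathcal C}$ for $i\in I_0$ and $F_i=\overline F_{i^2}\overline F_{i^1}|_{\mathcal C}$, $E_i=\overline E_{i^1}\overline E_{i^2}|_{\mathcal C}$ for $i\in I_1$, so that $F_{\mathbf i}=\overline F_{\phi(\mathbf i)}|_{\mathcal C}$ and $F_\alpha=\bigoplus_{\mathbf i}\overline F_{\mathbf i}|_{\mathcal C}$, the sum over the well-ordered $\mathbf i\in\overline I^{\overline\alpha}$. Then for each $\alpha\in Q_I^+$ the homomorphism $\Phi_\alpha$ exists, and the homomorphism $\mathbf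 eR_{\overline\alpha}\mathbf e\to\mathrm{End}(F_\alpha)^{\mathrm{op}}$ induced by $\overline\psi_{\overline\alpha}$ factors through an algebra homomorphism $\overline\psi'_{\overline\alpha}\colon S_{\overline\alpha}\to\mathrm{End}(F_\alpha)^{\mathrm{op}}$; and there is a $\mathfrak g_I$-quasi-categorical representation on $\mathcal C$ with the decomposition $\mathcal C=\bigoplus_\alpha\mathcal C_\alpha$, the functors $E_i$, $F_i$ ($i\in I$) and the algebra homomorphisms $\psi_\alpha=\overline\psi'_{\overline\alpha}\circ\Phi_\alpha\colon R_\alpha\to\mathrm{End}(F_\alpha)^{\mathrm{op}}$, $\alpha\in Q_I^+$. -/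

import Mathlib

open CategoryTheory CategoryTheory.Limits

universe w v u v₁ u₁

namespace QuasiCat

/-! ### Quivers, weights and the doubled quiver -/

/-- The number `h_{i,j}` of arrows from `i` to `j`. -/
noncomputable def arrowCount {I : Type u} [Quiver.{v} I] (i j : I) : ℕ := Nat.card (i ⟶ j)

/-- The vertex set of the doubled quiver: `i⁰` for `i ∈ I₀` (the complement of `I₁`), and
`i¹`, `i²` for `i ∈ I₁`. -/
inductive Doubled {I : Type u} (I₁ : Set I) : Type u
  | zero (i : I) (h : i ∉ I₁) : Doubled I₁
  | one (i : I) (h : i ∈ I₁) : Doubled I₁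
  | two (i : I) (h : i ∈ I₁) : Doubled I₁

/-- The four kinds of arrows of the doubled quiver. -/
def Doubled.Arrow {I : Type u} [Quiver.{v} I] {I₁ : Set I} : Doubled I₁ → Doubled I₁ → Type v
  | .zero i _, .zero j _ => i ⟶ j
  | .zero i _, .one j _ => i ⟶ j
  | .two i _, .zero j _ => i ⟶ j
  | .one i _, .two j _ => ULift (PLift (i = j))
  | _, _ => PEmpty

instance {I : Type u} [Quiver.{v} I] (I₁ : Set I) : Quiver.{v} (Doubled I₁) :=
  ⟨Doubled.Arrow⟩

/-- The weight `∑ α_{i_r}` of a sequence of vertices. -/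
noncomputable def wt {I : Type u} (l : List I) : I →₀ ℕ :=
  (l.map fun i => Finsupp.single i 1).sum

/-- The set `I^α` of sequences of vertices of weight `α`. -/
def SeqOf {I : Type u} (α : I →₀ ℕ) : Type u := {l : List I // wt l = α}

/-- `s_r` exchanges the entries number `r` and `r + 1`; positions are counted from `0`. -/
def swapAt {I : Type u} : ℕ → List I → List I
  | 0, a :: b :: l => b :: a :: l
  | r + 1, a :: l => a :: swapAt r l
  | _, l => l

theorem swapAt_perm {I : Type u} (r : ℕ) (l : List I) : (swapAt r l).Perm l := by
  induction r generalizing l with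
  | zero =>
    match l with
    | [] => exact List.Perm.refl _
    | [_] => exact List.Perm.refl _
    | a :: b :: l => exact List.Perm.swap a b l
  | succ r ih =>
    match l with
    | [] => exact List.Perm.refl _
    | a :: l => exact (ih l).cons a

theorem wt_perm {I : Type u} {l l' : List I} (h : l.Perm l') : wt l = wt l' :=
  (h.map _).sum_eq

theorem count_eq_wt {I : Type u} [DecidableEq I] (l : List I) (i : I) : l.count i = wt l i := by
  induction l with
  | nil => simp [wt]
  | cons a l ih =>
    have h : wt (a :: l) = Finsupp.single a 1 + wt l := by simp [wt]
    rw [h, Finsupp.add_apply, ← ih, List.count_cons, Finsupp.single_apply, add_comm]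
    by_cases hai : a = i <;> simp [hai]

theorem perm_of_wt_eq {I : Type u} {l l' : List I} (h : wt l = wt l') : l.Perm l' := by
  classical
  rw [List.perm_iff_count]
  intro i
  rw [count_eq_wt, count_eq_wt, h]

instance {I : Type u} (α : I →₀ ℕ) : Finite (SeqOf α) := by
  classical
  by_cases hne : ∃ l₀ : List I, wt l₀ = α
  · obtain ⟨l₀, hl₀⟩ := hne
    have hfin : {l : List I | l ∈ l₀.permutations}.Finite := List.finite_toSet _
    exact (hfin.subset fun l (hl : wt l = α) =>
      List.mem_permutations.2 (perm_of_wt_eq (hl.trans hl₀.symm))).to_subtype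
  · exact ⟨⟨fun i => (hne ⟨i.1, i.2⟩).elim, fun i => Fin.elim0 i, fun i => (hne ⟨i.1, i.2⟩).elim,
      fun i => Fin.elim0 i⟩⟩

noncomputable instance {I : Type u} (α : I →₀ ℕ) : Fintype (SeqOf α) := Fintype.ofFinite _

/-- The action of `s_r` on `I^α`. -/
def SeqOf.swap {I : Type u} {α : I →₀ ℕ} (r : ℕ) (i : SeqOf α) : SeqOf α :=
  ⟨swapAt r i.1, (wt_perm (swapAt_perm r i.1)).trans i.2⟩

open Classical in
/-- The sequence `φ(i)`: it is `(i⁰)` if `i ∈ I₀` and `(i¹, i²)` if `i ∈ I₁`. -/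
noncomputable def phiVertex {I : Type u} (I₁ : Set I) (i : I) : List (Doubled I₁) :=
  if h : i ∈ I₁ then [.one i h, .two i h] else [.zero i h]

/-- The morphism of monoids `φ` from sequences in `I` to sequences in the doubled vertex set. -/
noncomputable def phiSeq {I : Type u} (I₁ : Set I) : List I → List (Doubled I₁)
  | [] => []
  | i :: l => phiVertex I₁ i ++ phiSeq I₁ l

open Classical in
/-- The additive map `φ` with `α_i ↦ α_{i⁰}` for `i ∈ I₀` and `α_i ↦ α_{i¹} + α_{i²}` for
`i ∈ I₁`, with coefficients in `M` (used for `M = ℕ` and `M = ℤ`). -/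
noncomputable def phiRoot {I : Type u} (I₁ : Set I) {M : Type} [AddCommMonoid M] :
    (I →₀ M) →+ (Doubled I₁ →₀ M) :=
  Finsupp.liftAddHom fun i =>
    if h : i ∈ I₁ then
      Finsupp.singleAddHom (Doubled.one i h) + Finsupp.singleAddHom (Doubled.two i h)
    else Finsupp.singleAddHom (Doubled.zero i h)

theorem wt_append {I : Type u} (l l' : List I) : wt (l ++ l') = wt l + wt l' := by
  simp [wt]

theorem wt_phiVertex {I : Type u} (I₁ : Set I) (i : I) :
    wt (phiVertex I₁ i) = phiRoot I₁ (Finsupp.single i 1) := by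
  by_cases h : i ∈ I₁ <;> simp [phiVertex, phiRoot, wt, h]

theorem wt_phiSeq {I : Type u} (I₁ : Set I) (l : List I) :
    wt (phiSeq I₁ l) = phiRoot I₁ (wt l) := by
  induction l with
  | nil => simp [phiSeq, wt]
  | cons i l ih =>
    have h : wt (i :: l) = Finsupp.single i 1 + wt l := by simp [wt]
    rw [phiSeq, wt_append, ih, wt_phiVertex, h, map_add]

/-! ### KLR algebras -/

open Classical in
/-- `Q_{i,j}(u,v) = (v - u)^{h_{i,j}} (u - v)^{h_{j,i}}` for `i ≠ j`, and `Q_{i,i} = 0`. -/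
noncomputable def klrQ {I : Type u} [Quiver.{v} I] {A : Type*} [Ring A] (i j : I) (a b : A) :
    A :=
  if i = j then 0 else (b - a) ^ arrowCount i j * (a - b) ^ arrowCount j i

open Classical in
/-- The divided difference `(c - a)⁻¹ (Q_{i,j}(c,b) - Q_{i,j}(a,b))`, written out as a polynomial
(see `klrQDiff_spec`). -/
noncomputable def klrQDiff {I : Type u} [Quiver.{v} I] {A : Type*} [Ring A] (i j : I)
    (a b c : A) : A :=
  if i = j then 0 else
    (-1) ^ arrowCount i j * ∑ m ∈ Finset.range (arrowCount i j + arrowCount j i),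
      (c - b) ^ m * (a - b) ^ (arrowCount i j + arrowCount j i - 1 - m)

theorem klrQDiff_spec {I : Type u} [Quiver.{v} I] {A : Type*} [CommRing A] (i j : I)
    (a b c : A) : (c - a) * klrQDiff i j a b c = klrQ i j c b - klrQ i j a b := by
  by_cases h : i = j
  · simp [klrQDiff, klrQ, h]
  · have key := (Commute.all (c - b) (a - b)).mul_geom_sum₂
      (arrowCount i j + arrowCount j i)
    simp only [klrQDiff, klrQ, h, if_false]
    have h1 : b - c = (-1) * (c - b) := by ring
    have h2 : b - a = (-1) * (a - b) := by ring
    have h3 : c - b - (a - b) = c - a := by ring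
    rw [h3] at key
    rw [h1, h2, mul_pow, mul_pow, mul_left_comm, key, pow_add, pow_add]
    ring

/-- Generators of the KLR algebra `R_α`. Positions are counted from `0`; the generators `x r` and
`t r` with `r` out of range are set to zero by the relations. -/
inductive KLRGen {I : Type u} (α : I →₀ ℕ) : Type u
  | e (i : SeqOf α) : KLRGen α
  | x (r : ℕ) : KLRGen α
  | t (r : ℕ) : KLRGen α

section Relations

variable (k : Type w) [Field k] {I : Type u} [Quiver.{v} I] (α : I →₀ ℕ)

/-- The free generator `e(i)`. -/
abbrev freeE (i : SeqOf α) : FreeAlgebra k (KLRGen α) := FreeAlgebra.ι k (KLRGen.e i)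

/-- The free generator `x_r`. -/
abbrev freeX (r : ℕ) : FreeAlgebra k (KLRGen α) := FreeAlgebra.ι k (KLRGen.x r)

/-- The free generator `τ_r`. -/
abbrev freeT (r : ℕ) : FreeAlgebra k (KLRGen α) := FreeAlgebra.ι k (KLRGen.t r)

/-- The defining relations of the KLR algebra `R_α`. The hypotheses `i.1[r]? = some a` say that
the entry number `r` of the sequence exists and is `a`. -/
inductive KLRRel : FreeAlgebra k (KLRGen α) → FreeAlgebra k (KLRGen α) → Prop
  | x_out (r : ℕ) (h : α.degree ≤ r) : KLRRel (freeX k α r) 0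
  | t_out (r : ℕ) (h : α.degree ≤ r + 1) : KLRRel (freeT k α r) 0
  | e_mul_self (i : SeqOf α) : KLRRel (freeE k α i * freeE k α i) (freeE k α i)
  | e_mul_ne (i j : SeqOf α) (h : i ≠ j) : KLRRel (freeE k α i * freeE k α j) 0
  | sum_e : KLRRel (∑ i, freeE k α i) 1
  | x_mul_e (r : ℕ) (i : SeqOf α) :
      KLRRel (freeX k α r * freeE k α i) (freeE k α i * freeX k α r)
  | t_mul_e (r : ℕ) (i : SeqOf α) :
      KLRRel (freeT k α r * freeE k α i) (freeE k α (i.swap r) * freeT k α r)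
  | x_mul_x (r s : ℕ) : KLRRel (freeX k α r * freeX k α s) (freeX k α s * freeX k α r)
  | t_x_eq (r : ℕ) (i : SeqOf α) (a : I) (h₀ : i.1[r]? = some a) (h₁ : i.1[r + 1]? = some a) :
      KLRRel (freeT k α r * freeX k α (r + 1) * freeE k α i)
        ((freeX k α r * freeT k α r + 1) * freeE k α i)
  | t_x_ne (r : ℕ) (i : SeqOf α) (a b : I) (h₀ : i.1[r]? = some a) (h₁ : i.1[r + 1]? = some b)
      (h : a ≠ b) :
      KLRRel (freeT k α r * freeX k α (r + 1) * freeE k α i)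
        (freeX k α r * freeT k α r * freeE k α i)
  | x_t_eq (r : ℕ) (i : SeqOf α) (a : I) (h₀ : i.1[r]? = some a) (h₁ : i.1[r + 1]? = some a) :
      KLRRel (freeX k α (r + 1) * freeT k α r * freeE k α i)
        ((freeT k α r * freeX k α r + 1) * freeE k α i)
  | x_t_ne (r : ℕ) (i : SeqOf α) (a b : I) (h₀ : i.1[r]? = some a) (h₁ : i.1[r + 1]? = some b)
      (h : a ≠ b) :
      KLRRel (freeX k α (r + 1) * freeT k α r * freeE k α i)
        (freeT k α r * freeX k α r * freeE k α i)
  | t_x_far (r s : ℕ) (h₀ : s ≠ r) (h₁ : s ≠ r + 1) :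
      KLRRel (freeT k α r * freeX k α s) (freeX k α s * freeT k α r)
  | t_t_far (r s : ℕ) (h : r + 1 < s) :
      KLRRel (freeT k α r * freeT k α s) (freeT k α s * freeT k α r)
  | t_sq (r : ℕ) (i : SeqOf α) (a b : I) (h₀ : i.1[r]? = some a) (h₁ : i.1[r + 1]? = some b) :
      KLRRel (freeT k α r * freeT k α r * freeE k α i)
        (klrQ a b (freeX k α r) (freeX k α (r + 1)) * freeE k α i)
  | braid_eq (r : ℕ) (i : SeqOf α) (a b : I) (h₀ : i.1[r]? = some a) (h₁ : i.1[r + 1]? = some b)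
      (h₂ : i.1[r + 2]? = some a) :
      KLRRel
        ((freeT k α (r + 1) * freeT k α r * freeT k α (r + 1) -
          freeT k α r * freeT k α (r + 1) * freeT k α r) * freeE k α i)
        (klrQDiff a b (freeX k α r) (freeX k α (r + 1)) (freeX k α (r + 2)) * freeE k α i)
  | braid_ne (r : ℕ) (i : SeqOf α) (a c : I) (h₀ : i.1[r]? = some a)
      (h₂ : i.1[r + 2]? = some c) (h : a ≠ c) :
      KLRRel
        ((freeT k α (r + 1) * freeT k α r * freeT k α (r + 1) -
          freeT k α r * freeT k α (r + 1) * freeT k α r) * freeE k α i) 0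

/-- The KLR algebra `R_α` over `k`. -/
def KLRAlg : Type (max u w) := RingQuot (KLRRel k α)

noncomputable instance : Ring (KLRAlg k α) := inferInstanceAs (Ring (RingQuot (KLRRel k α)))

noncomputable instance : Algebra k (KLRAlg k α) :=
  inferInstanceAs (Algebra k (RingQuot (KLRRel k α)))

/-- The quotient map from the free algebra. -/
noncomputable def KLRAlg.mk : FreeAlgebra k (KLRGen α) →ₐ[k] KLRAlg k α :=
  RingQuot.mkAlgHom k (KLRRel k α)

variable {α} in
/-- The idempotent `e(i)`. -/
noncomputable def KLRAlg.e (i : SeqOf α) : KLRAlg k α := KLRAlg.mk k α (freeE k α i)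

/-- The element `x_r`, positions counted from `0`. -/
noncomputable def KLRAlg.x (r : ℕ) : KLRAlg k α := KLRAlg.mk k α (freeX k α r)

/-- The element `τ_r`, positions counted from `0`. -/
noncomputable def KLRAlg.t (r : ℕ) : KLRAlg k α := KLRAlg.mk k α (freeT k α r)

theorem KLRAlg.e_mul_self (i : SeqOf α) : KLRAlg.e k i * KLRAlg.e k i = KLRAlg.e k i := by
  have h := RingQuot.mkAlgHom_rel k (KLRRel.e_mul_self (k := k) (α := α) i)
  rw [map_mul] at h
  exact h

theorem KLRAlg.e_mul_ne (i j : SeqOf α) (hij : i ≠ j) : KLRAlg.e k i * KLRAlg.e k j = 0 := by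
  have h := RingQuot.mkAlgHom_rel k (KLRRel.e_mul_ne (k := k) (α := α) i j hij)
  rw [map_mul, map_zero] at h
  exact h

variable (I) in
/-- The algebra `R_d = ⨁_{|α| = d} R_α`, as the non-unital subalgebra of the product that consists
of the families with finite support. If the quiver is finite it is the whole product. -/
def KLRd (d : ℕ) :
    NonUnitalSubalgebra k (∀ α : {α : I →₀ ℕ // α.degree = d}, KLRAlg k α.1) where
  carrier := {f | {α | f α ≠ 0}.Finite}
  add_mem' {f g} hf hg := (hf.union hg).subset fun α hα => by
    by_contra h
    simp only [Set.mem_union, Set.mem_ofPred_eq, not_or, not_not] at h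
    exact hα (by simp [h.1, h.2])
  zero_mem' := by simp
  mul_mem' {f g} hf _ := Set.Finite.subset hf fun α hα h => hα (by simp [h])
  smul_mem' c f hf := Set.Finite.subset hf fun α hα h => hα (by simp [h])

open Classical in
/-- The inclusion of the summand `R_α` in `R_d`. -/
noncomputable def KLRd.of {d : ℕ} (α : {α : I →₀ ℕ // α.degree = d}) (z : KLRAlg k α.1) :
    KLRd k I d :=
  ⟨Pi.single α z, (Set.finite_singleton α).subset fun β hβ => by
    by_contra h
    exact hβ (Function.update_of_ne h _ _)⟩

end Relations

/-! ### Balanced KLR algebras -/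

section Balanced

variable {I : Type u} {I₁ : Set I}

/-- The vertex lies in the first copy of `I₁`. -/
def Doubled.IsOne : Doubled I₁ → Prop
  | .one _ _ => True
  | _ => False

/-- The vertex lies in the second copy of `I₁`. -/
def Doubled.IsTwo : Doubled I₁ → Prop
  | .two _ _ => True
  | _ => False

open Classical in
/-- A sequence is unordered if some initial segment has more entries in the second copy of `I₁`
than in the first one. -/
def Unordered (l : List (Doubled I₁)) : Prop :=
  ∃ r ≤ l.length, (l.take r).countP (fun a => decide a.IsOne) <
    (l.take r).countP (fun a => decide a.IsTwo)

/-- A sequence is well-ordered if each entry `i¹` is immediately followed by `i²`. -/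
def WellOrdered (l : List (Doubled I₁)) : Prop :=
  ∀ (a : ℕ) (i : I) (h : i ∈ I₁), l[a]? = some (.one i h) → l[a + 1]? = some (.two i h)

theorem wellOrdered_phiSeq (I₁ : Set I) (l : List I) : WellOrdered (phiSeq I₁ l) := by
  induction l with
  | nil => intro a i h ha; simp [phiSeq] at ha
  | cons j l ih =>
    intro a i h ha
    by_cases hj : j ∈ I₁
    · simp only [phiSeq, phiVertex, hj, dite_true, List.cons_append, List.nil_append] at ha ⊢
      match a with
      | 0 => simp at ha; simp [ha]
      | 1 => simp at ha
      | a + 2 => exact ih a i h (by simpa using ha)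
    · simp only [phiSeq, phiVertex, hj, dite_false, List.cons_append, List.nil_append] at ha ⊢
      match a with
      | 0 => simp at ha
      | a + 1 => exact ih a i h (by simpa using ha)

/-- The set of well-ordered sequences of weight `α`. -/
abbrev OrdSeq (α : Doubled I₁ →₀ ℕ) : Type u := {i : SeqOf α // WellOrdered i.1}

noncomputable instance (α : Doubled I₁ →₀ ℕ) : Fintype (OrdSeq α) := Fintype.ofFinite _

/-- The map `φ : I^α → Ī^{φ(α)}`, with values in the well-ordered sequences. -/
noncomputable def phiOrd (I₁ : Set I) {α : I →₀ ℕ} (i : SeqOf α) : OrdSeq (phiRoot I₁ α) :=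
  ⟨⟨phiSeq I₁ i.1, by rw [wt_phiSeq, i.2]⟩, wellOrdered_phiSeq I₁ i.1⟩

variable (k : Type w) [Field k] [Quiver.{v} I] (α : Doubled I₁ →₀ ℕ)

/-- The idempotent `𝐞`, the sum of the `e(i)` over the well-ordered sequences `i`. -/
noncomputable def ordIdem : KLRAlg k α := ∑ i : OrdSeq α, KLRAlg.e k i.1

theorem ordIdem_idem : IsIdempotentElem (ordIdem k α) := by
  classical
  unfold IsIdempotentElem ordIdem
  rw [Finset.sum_mul_sum]
  refine Finset.sum_congr rfl fun i _ => ?_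
  rw [Finset.sum_eq_single i]
  · exact KLRAlg.e_mul_self k α i.1
  · intro j _ hj
    exact KLRAlg.e_mul_ne k α _ _ fun h => hj (Subtype.ext h.symm)
  · simp

/-- The algebra `𝐞 R_α 𝐞`, with unit `𝐞`. -/
abbrev OrdCorner : Type (max u w) := (ordIdem_idem k α).Corner

/-- The element `𝐞 z 𝐞` of `𝐞 R_α 𝐞`. -/
noncomputable def OrdCorner.mk (z : KLRAlg k α) : OrdCorner k α :=
  ⟨ordIdem k α * z * ordIdem k α, ⟨z, rfl⟩⟩

noncomputable instance : Algebra k (OrdCorner k α) :=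
  RingHom.toAlgebra'
    { toFun := fun c => ⟨c • ordIdem k α, ⟨c • ordIdem k α, by
        simp [(ordIdem_idem k α).eq]⟩⟩
      map_one' := Subtype.ext (one_smul k _)
      map_mul' := fun c d => Subtype.ext (by
        change (c * d) • ordIdem k α = (c • ordIdem k α) * (d • ordIdem k α)
        rw [smul_mul_smul_comm, (ordIdem_idem k α).eq])
      map_zero' := Subtype.ext (zero_smul k _)
      map_add' := fun c d => Subtype.ext (add_smul c d _) }
    fun c z => Subtype.ext (by
      have hz := (Subsemigroup.mem_corner_iff (ordIdem_idem k α)).1 z.2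
      change (c • ordIdem k α) * z.1 = z.1 * (c • ordIdem k α)
      rw [smul_mul_assoc, mul_smul_comm, hz.1, hz.2])

/-- The elements `𝐞 a e(i) b 𝐞` with `i` unordered are set to zero. -/
inductive BalancedRel : OrdCorner k α → OrdCorner k α → Prop
  | unordered (i : SeqOf α) (hi : Unordered i.1) (a b : KLRAlg k α) :
      BalancedRel (OrdCorner.mk k α (a * KLRAlg.e k i * b)) 0

/-- The balanced KLR algebra
`S_α = 𝐞 R_α 𝐞 / ∑_{i unordered} 𝐞 R_α e(i) R_α 𝐞`. -/
def BalancedKLR : Type (max u w) := RingQuot (BalancedRel k α)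

noncomputable instance : Ring (BalancedKLR k α) :=
  inferInstanceAs (Ring (RingQuot (BalancedRel k α)))

noncomputable instance : Algebra k (BalancedKLR k α) :=
  inferInstanceAs (Algebra k (RingQuot (BalancedRel k α)))

/-- The quotient map `𝐞 R_α 𝐞 → S_α`. -/
noncomputable def BalancedKLR.proj : OrdCorner k α →ₐ[k] BalancedKLR k α :=
  RingQuot.mkAlgHom k (BalancedRel k α)

/-- The class of `𝐞 z 𝐞` in `S_α`. -/
noncomputable def BalancedKLR.cls (z : KLRAlg k α) : BalancedKLR k α :=
  BalancedKLR.proj k α (OrdCorner.mk k α z)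

/-- The position (counted from `0`) at which the image of the entry number `r` of `l` begins in
the sequence `φ(l)`. -/
noncomputable def phiPos (I₁ : Set I) (l : List I) (r : ℕ) : ℕ := (phiSeq I₁ (l.take r)).length

open Classical in
/-- The product of the generators `τ` that crosses the strands labelled by `φ(a)` and `φ(b)`, where
the first of these strands is at position `p`. -/
noncomputable def tStar (p : ℕ) (a b : I) : KLRAlg k α :=
  if a ∈ I₁ then
    if b ∈ I₁ then
      if a = b then
        -(KLRAlg.t k α (p + 1) * KLRAlg.t k α (p + 2) * KLRAlg.t k α p * KLRAlg.t k α (p + 1))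
      else KLRAlg.t k α (p + 1) * KLRAlg.t k α (p + 2) * KLRAlg.t k α p * KLRAlg.t k α (p + 1)
    else KLRAlg.t k α p * KLRAlg.t k α (p + 1)
  else
    if b ∈ I₁ then KLRAlg.t k α (p + 1) * KLRAlg.t k α p
    else KLRAlg.t k α p

/-- The algebra homomorphism `Φ : R_α → S_{φ(α)}`, characterised by its values on generators:
`e(i) ↦ e(φ(i))`, `x_r e(i) ↦ x_{r'} e(φ(i))`, `τ_r e(i) ↦ τ*_r e(φ(i))`. -/
structure IsDoublingHom {β : I →₀ ℕ} (Φ : KLRAlg k β →ₐ[k] BalancedKLR k (phiRoot I₁ β)) :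
    Prop where
  map_e (i : SeqOf β) : Φ (KLRAlg.e k i) = BalancedKLR.cls k _ (KLRAlg.e k (phiOrd I₁ i).1)
  map_x (i : SeqOf β) (r : ℕ) (hr : r < i.1.length) :
    Φ (KLRAlg.x k β r * KLRAlg.e k i) =
      BalancedKLR.cls k _ (KLRAlg.x k _ (phiPos I₁ i.1 r) * KLRAlg.e k (phiOrd I₁ i).1)
  map_t (i : SeqOf β) (r : ℕ) (a b : I) (ha : i.1[r]? = some a) (hb : i.1[r + 1]? = some b) :
    Φ (KLRAlg.t k β r * KLRAlg.e k i) =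
      BalancedKLR.cls k _ (tStar k _ (phiPos I₁ i.1 r) a b * KLRAlg.e k (phiOrd I₁ i).1)

end Balanced

/-! ### Decompositions of categories and of functors -/

section Functors

variable {C : Type u₁} [Category.{v₁} C] [Preadditive C]

/-- The decomposition `C = ⨁_q C_q` of a category, where `C_q` is the full subcategory given by
`gr q`: there are no nonzero morphisms between different `C_q`, and each object is a finite direct
sum of objects of the `C_q`. -/
structure IsDecomposition {Q : Type*} (gr : Q → ObjectProperty C) : Prop where
  closedUnderIso (q : Q) : (gr q).IsClosedUnderIsomorphisms
  zero (q : Q) (X : C) (hX : IsZero X) : gr q X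
  hom_eq_zero (p q : Q) (hpq : p ≠ q) (X Y : C) (hX : gr p X) (hY : gr q Y) (f : X ⟶ Y) : f = 0
  exists_sum (X : C) : ∃ (s : Finset Q) (Y : s → C) (b : Bicone Y),
    (∀ q, gr q.1 (Y q)) ∧ Nonempty b.IsBilimit ∧ Nonempty (b.pt ≅ X)

/-- The data of a decomposition `F = ⨁_i F_i` of an endofunctor; for each object `M` only finitely
many `F_i(M)` are nonzero. -/
structure FunctorDecomp {I : Type u} (F : C ⥤ C) (Fi : I → (C ⥤ C)) where
  incl (i : I) : Fi i ⟶ F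
  proj (i : I) : F ⟶ Fi i
  incl_proj_self (i : I) : incl i ≫ proj i = 𝟙 (Fi i)
  incl_proj_ne (i j : I) (h : i ≠ j) : incl i ≫ proj j = 0
  locallyFinite (M : C) : {i | ¬ IsZero ((Fi i).obj M)}.Finite
  total (M : C) (s : Finset I) (hs : ∀ i ∉ s, IsZero ((Fi i).obj M)) :
    ∑ i ∈ s, (proj i).app M ≫ (incl i).app M = 𝟙 (F.obj M)

/-- The power `F^d`. -/
def iter (F : C ⥤ C) : ℕ → (C ⥤ C)
  | 0 => 𝟭 C
  | d + 1 => F ⋙ iter F d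

/-- `F_{(i_1, …, i_d)} = F_{i_d} ⋯ F_{i_1}`: the functor `F_{i_1}` is applied first. -/
def seqFunctor {I : Type u} (Fi : I → (C ⥤ C)) : List I → (C ⥤ C)
  | [] => 𝟭 C
  | i :: l => Fi i ⋙ seqFunctor Fi l

/-- The inclusion of the summand `F_{(i_1, …, i_d)}` in `F^d` (zero if the length is not `d`). -/
def FunctorDecomp.inclSeq {I : Type u} {F : C ⥤ C} {Fi : I → (C ⥤ C)} (D : FunctorDecomp F Fi) :
    (d : ℕ) → (l : List I) → (seqFunctor Fi l ⟶ iter F d)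
  | 0, [] => 𝟙 (𝟭 C)
  | d + 1, i :: l => D.incl i ◫ D.inclSeq d l
  | 0, _ :: _ => 0
  | _ + 1, [] => 0

/-- The projection of `F^d` to the summand `F_{(i_1, …, i_d)}` (zero if the length is not `d`). -/
def FunctorDecomp.projSeq {I : Type u} {F : C ⥤ C} {Fi : I → (C ⥤ C)} (D : FunctorDecomp F Fi) :
    (d : ℕ) → (l : List I) → (iter F d ⟶ seqFunctor Fi l)
  | 0, [] => 𝟙 (𝟭 C)
  | d + 1, i :: l => D.proj i ◫ D.projSeq d l
  | 0, _ :: _ => 0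
  | _ + 1, [] => 0

/-- `F^{d-r} x F^{r-1}` with `r` counted from `1`; here the positions are counted from `0`. -/
def powX {F : C ⥤ C} (x : F ⟶ F) : (d r : ℕ) → (iter F d ⟶ iter F d)
  | 0, _ => 0
  | d + 1, 0 => Functor.whiskerRight x (iter F d)
  | d + 1, r + 1 => Functor.whiskerLeft F (powX x d r)

/-- `F^{d-r-1} τ F^{r-1}` with `r` counted from `1`; here the positions are counted from `0`. -/
def powT {F : C ⥤ C} (τ : F ⋙ F ⟶ F ⋙ F) : (d r : ℕ) → (iter F d ⟶ iter F d)
  | 0, _ => 0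
  | 1, _ => 0
  | d + 2, 0 => (Functor.associator F F (iter F d)).inv ≫ Functor.whiskerRight τ (iter F d) ≫
      (Functor.associator F F (iter F d)).hom
  | d + 2, r + 1 => Functor.whiskerLeft F (powT τ (d + 1) r)

end Functors

/-! ### Quasi-categorical representations -/

/-- A `𝔤_I`-quasi-categorical representation on the `k`-linear category `C`, with the graded pieces
`C_α` given by `gr` and with the functors `E_i` and `F_i` given by `Ei` and `Fi`. -/
structure QuasiCatRep (k : Type w) [Field k] {I : Type u} [Quiver.{v} I]
    {C : Type u₁} [Category.{v₁} C] [Preadditive C] [Linear k C]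
    (gr : (I →₀ ℤ) → ObjectProperty C) (Ei Fi : I → (C ⥤ C)) where
  isDecomposition : IsDecomposition gr
  E : C ⥤ C
  F : C ⥤ C
  additive_E : E.Additive
  additive_F : F.Additive
  linear_E : E.Linear k
  linear_F : F.Linear k
  exact_E : PreservesFiniteLimits E ∧ PreservesFiniteColimits E
  exact_F : PreservesFiniteLimits F ∧ PreservesFiniteColimits F
  adjEF : E ⊣ F
  adjFE : F ⊣ E
  x : F ⟶ F
  τ : F ⋙ F ⟶ F ⋙ F
  decompE : FunctorDecomp E Ei
  decompF : FunctorDecomp F Fi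
  gr_E (i : I) (α : I →₀ ℤ) (X : C) (hX : gr α X) : gr (α - Finsupp.single i 1) ((Ei i).obj X)
  gr_F (i : I) (α : I →₀ ℤ) (X : C) (hX : gr α X) : gr (α + Finsupp.single i 1) ((Fi i).obj X)
  /-- The homomorphism `ψ_d : R_d → End(F^d)^op`. In `End(F^d)^op` the product of `a` and `b` is the
  composition `a ≫ b`. -/
  ψ (d : ℕ) : KLRd k I d →ₙₐ[k] (End (iter F d))ᵐᵒᵖ
  ψ_e (d : ℕ) (α : {α : I →₀ ℕ // α.degree = d}) (i : SeqOf α.1) :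
    (ψ d (KLRd.of k α (KLRAlg.e k i))).unop = decompF.projSeq d i.1 ≫ decompF.inclSeq d i.1
  ψ_x (d : ℕ) (α : {α : I →₀ ℕ // α.degree = d}) (i : SeqOf α.1) (r : ℕ) (hr : r < d) :
    (ψ d (KLRd.of k α (KLRAlg.x k α.1 r * KLRAlg.e k i))).unop =
      powX x d r ≫ decompF.projSeq d i.1 ≫ decompF.inclSeq d i.1
  ψ_t (d : ℕ) (α : {α : I →₀ ℕ // α.degree = d}) (i : SeqOf α.1) (r : ℕ) (hr : r + 1 < d) :
    (ψ d (KLRd.of k α (KLRAlg.t k α.1 r * KLRAlg.e k i))).unop =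
      powT τ d r ≫ decompF.projSeq d i.1 ≫ decompF.inclSeq d i.1
  nilpotent_x (M : C) : IsNilpotent (End.of (x.app M))

/-- The component `F_i ⟶ F_j` of `ψ_α(z)`, where `ψ_α : R_α → End(F_α)^op` is the `α`-component of
`ψ_d` and `F_α = ⨁_{i ∈ I^α} F_i`. -/
noncomputable def QuasiCatRep.comp {k : Type w} [Field k] {I : Type u} [Quiver.{v} I]
    {C : Type u₁} [Category.{v₁} C] [Preadditive C] [Linear k C]
    {gr : (I →₀ ℤ) → ObjectProperty C} {Ei Fi : I → (C ⥤ C)} (ρ : QuasiCatRep k gr Ei Fi)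
    (α : I →₀ ℕ) (z : KLRAlg k α) (i j : SeqOf α) :
    seqFunctor Fi i.1 ⟶ seqFunctor Fi j.1 :=
  ρ.decompF.inclSeq α.degree i.1 ≫ (ρ.ψ α.degree (KLRd.of k ⟨α, rfl⟩ z)).unop ≫
    ρ.decompF.projSeq α.degree j.1

/-! ### The subcategory and the restricted functors -/

section Subcategory

variable {I : Type u} {I₁ : Set I} {C : Type u₁} [Category.{v₁} C] [Abelian C]

/-- A full, replete subcategory of an abelian category, closed under finite direct sums, kernels and
cokernels (in other words, an abelian subcategory with exact inclusion functor). -/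
structure IsAbelianSubcategory (P : ObjectProperty C) : Prop where
  closedUnderIso : P.IsClosedUnderIsomorphisms
  finiteProducts : P.IsClosedUnderFiniteProducts
  kernels : P.IsClosedUnderKernels
  cokernels : P.IsClosedUnderCokernels

/-- The conditions on the subcategory: it is an abelian subcategory such that (a) it is stable under
`F_{i⁰}`, `E_{i⁰}` for `i ∈ I₀`, (b) it is stable under `F_{i²} F_{i¹}`, `E_{i¹} E_{i²}` for
`i ∈ I₁`, (c) `F_{i²}` vanishes on it for `i ∈ I₁`, (d) it is the direct sum of its intersections
with the graded pieces of degrees `φ(α)`, `α ∈ Q_I`. -/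
structure IsAdmissible (gr : (Doubled I₁ →₀ ℤ) → ObjectProperty C)
    (Ei Fi : Doubled I₁ → (C ⥤ C)) (P : ObjectProperty C) : Prop where
  abelian : IsAbelianSubcategory P
  stable_F_zero (i : I) (h : i ∉ I₁) (X : C) (hX : P X) : P ((Fi (.zero i h)).obj X)
  stable_E_zero (i : I) (h : i ∉ I₁) (X : C) (hX : P X) : P ((Ei (.zero i h)).obj X)
  stable_F_one_two (i : I) (h : i ∈ I₁) (X : C) (hX : P X) :
    P ((Fi (.two i h)).obj ((Fi (.one i h)).obj X))
  stable_E_two_one (i : I) (h : i ∈ I₁) (X : C) (hX : P X) :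
    P ((Ei (.one i h)).obj ((Ei (.two i h)).obj X))
  F_two_eq_zero (i : I) (h : i ∈ I₁) (X : C) (hX : P X) : IsZero ((Fi (.two i h)).obj X)
  decomposition :
    IsDecomposition fun α : I →₀ ℤ => (gr (phiRoot I₁ α)).inverseImage P.ι

variable {gr : (Doubled I₁ →₀ ℤ) → ObjectProperty C} {Ei Fi : Doubled I₁ → (C ⥤ C)}
  {P : ObjectProperty C}

theorem IsAdmissible.stable_F (hP : IsAdmissible gr Ei Fi P) (i : I) (X : P.FullSubcategory) :
    P ((P.ι ⋙ seqFunctor Fi (phiVertex I₁ i)).obj X) := by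
  by_cases h : i ∈ I₁
  · simp only [phiVertex, h, dite_true]
    exact hP.stable_F_one_two i h X.obj X.property
  · simp only [phiVertex, h, dite_false]
    exact hP.stable_F_zero i h X.obj X.property

theorem IsAdmissible.stable_E (hP : IsAdmissible gr Ei Fi P) (i : I) (X : P.FullSubcategory) :
    P ((P.ι ⋙ seqFunctor Ei (phiVertex I₁ i).reverse).obj X) := by
  by_cases h : i ∈ I₁
  · simp only [phiVertex, h, dite_true]
    exact hP.stable_E_two_one i h X.obj X.property
  · simp only [phiVertex, h, dite_false]
    exact hP.stable_E_zero i h X.obj X.property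

/-- The endofunctor of the subcategory that is the restriction of `F_{i⁰}` if `i ∈ I₀` and of
`F_{i²} F_{i¹}` if `i ∈ I₁`. -/
noncomputable def resF (hP : IsAdmissible gr Ei Fi P) (i : I) :
    P.FullSubcategory ⥤ P.FullSubcategory :=
  P.lift (P.ι ⋙ seqFunctor Fi (phiVertex I₁ i)) (hP.stable_F i)

/-- The endofunctor of the subcategory that is the restriction of `E_{i⁰}` if `i ∈ I₀` and of
`E_{i¹} E_{i²}` if `i ∈ I₁`. -/
noncomputable def resE (hP : IsAdmissible gr Ei Fi P) (i : I) :
    P.FullSubcategory ⥤ P.FullSubcategory :=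
  P.lift (P.ι ⋙ seqFunctor Ei (phiVertex I₁ i).reverse) (hP.stable_E i)

/-- The canonical isomorphism between the functor of a concatenation and the composite functor. -/
def seqFunctorAppend {D : Type u₁} [Category.{v₁} D] [Preadditive D] {J : Type u}
    (G : J → (D ⥤ D)) : (l l' : List J) →
      (seqFunctor G (l ++ l') ≅ seqFunctor G l ⋙ seqFunctor G l')
  | [], l' => (Functor.leftUnitor (seqFunctor G l')).symm
  | i :: l, l' => Functor.isoWhiskerLeft (G i) (seqFunctorAppend G l l') ≪≫
      (Functor.associator (G i) (seqFunctor G l) (seqFunctor G l')).symm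

/-- The canonical identification of the functor `F_l` on the subcategory with the restriction of the
functor `F_{φ(l)}`. -/
noncomputable def resSeqIso (hP : IsAdmissible gr Ei Fi P) :
    (l : List I) → (seqFunctor (resF hP) l ⋙ P.ι ≅ P.ι ⋙ seqFunctor Fi (phiSeq I₁ l))
  | [] => Functor.leftUnitor P.ι ≪≫ (Functor.rightUnitor P.ι).symm
  | i :: l =>
      Functor.associator (resF hP i) (seqFunctor (resF hP) l) P.ι ≪≫
      Functor.isoWhiskerLeft (resF hP i) (resSeqIso hP l) ≪≫
      (Functor.associator (resF hP i) P.ι (seqFunctor Fi (phiSeq I₁ l))).symm ≪≫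
      Functor.isoWhiskerRight (P.liftCompιIso (P.ι ⋙ seqFunctor Fi (phiVertex I₁ i))
        (hP.stable_F i)) (seqFunctor Fi (phiSeq I₁ l)) ≪≫
      Functor.associator P.ι (seqFunctor Fi (phiVertex I₁ i)) (seqFunctor Fi (phiSeq I₁ l)) ≪≫
      Functor.isoWhiskerLeft P.ι
        (seqFunctorAppend Fi (phiVertex I₁ i) (phiSeq I₁ l)).symm

instance (P : ObjectProperty C) (Fi : Doubled I₁ → (C ⥤ C)) (α : Doubled I₁ →₀ ℕ) :
    HasBiproduct fun i : OrdSeq α => P.ι ⋙ seqFunctor Fi i.1.1 :=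
  haveI : HasFiniteBiproducts (P.FullSubcategory ⥤ C) := HasFiniteBiproducts.of_hasFiniteProducts
  inferInstance

/-- The functor `F_α = ⨁ F_i|_P`, the sum over the well-ordered sequences of weight `α`, viewed as a
functor from the full subcategory to the ambient category. Since the inclusion functor is fully
faithful, the natural endomorphisms do not depend on this point of view. -/
noncomputable def ordFunctor (P : ObjectProperty C) (Fi : Doubled I₁ → (C ⥤ C))
    (α : Doubled I₁ →₀ ℕ) : P.FullSubcategory ⥤ C :=
  ⨁ fun i : OrdSeq α => P.ι ⋙ seqFunctor Fi i.1.1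

/-- The inclusion of the summand with index `i`. -/
noncomputable def ordIncl (P : ObjectProperty C) (Fi : Doubled I₁ → (C ⥤ C))
    {α : Doubled I₁ →₀ ℕ} (i : OrdSeq α) : P.ι ⋙ seqFunctor Fi i.1.1 ⟶ ordFunctor P Fi α :=
  biproduct.ι (fun i : OrdSeq α => P.ι ⋙ seqFunctor Fi i.1.1) i

/-- The projection to the summand with index `i`. -/
noncomputable def ordProj (P : ObjectProperty C) (Fi : Doubled I₁ → (C ⥤ C))
    {α : Doubled I₁ →₀ ℕ} (i : OrdSeq α) : ordFunctor P Fi α ⟶ P.ι ⋙ seqFunctor Fi i.1.1 :=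
  biproduct.π (fun i : OrdSeq α => P.ι ⋙ seqFunctor Fi i.1.1) i

end Subcategory

end QuasiCat

/-! The doubled quiver replaces a strand labelled by `i ∈ I₁` by a pair of strands `i¹, i²` (a
cable), and a crossing of two strands by the product of the crossings of their cables. The theorem
rests on three facts.

(1) Modulo the unordered idempotents the cabled dots and crossings satisfy the KLR relations of `Γ`.
On a pair `i¹, i²` the crossing `τ_r` leads to an unordered sequence and is zero, so `0 = τ_r² =
x_{r+1} - x_r`: both strands of a pair carry the same dot (`slides_pair`). For `a ∈ I₀`, `b ∈ I₁`
the arrows `a → b` are seen by `b¹` and the arrows `b → a` by `b²`, so the two squared crossings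
multiply to `Q_{a,b}` (`crossing_sq`). In the braid relation the correction terms coming from the
two strands of a pair add up to the divided difference of `Q_{a,b}` by the Leibniz rule
(`geom_sum_split`, `crossing_braid_eq`). For equal labels in `I₁` the constant `1` of the dot
relations comes from the words `τ τ τ` on `i² i¹ i²`, which equal `-1`; this accounts for the sign
in `τ*`. All of this is done for abstract systems of elements (`KLRSys`), at position `0` and with
two or three labels. `KLRSys.double_rel` assembles the relations and `exists_isDoublingHom` deduces
the existence of `Φ`.

(2) The action of `𝐞 R 𝐞` on the subcategory kills the ideal of the unordered idempotents.
Hypothesis (c) directly kills only sequences of the form `φ(i), j², …`, and a general unordered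
sequence is not of this form. The remedy is `eSeq_mul_mul_eSeq_mem`: modulo any two-sided ideal that
contains those special idempotents, the left ideal generated by `e(φ(m))` is spanned by vectors
whose sequences are not unordered. The strands are added one cable at a time, from right to left,
with the usual coset representatives for moving a strand to the right. If the first strand of a pair
overtakes the second one, braid moves rewrite the vector through vectors in which it does not; at
the bottom of this recursion the pair is exchanged at its initial place, and that vector is zero.
Applied to the annihilator of the subcategory this gives `balancedHom`.

(3) The remaining data. The grading makes `E_i` and `F_i` biadjoint, since the mixed components of
units and counits change the degree (`nonempty_componentAdjunction`). These adjunctions compose,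
restrict to the full subcategory and add up again, which also gives exactness. The transformations
`x` and `τ` on the subcategory are prescribed by their components (`diagHom`, `permHom`), and the
homomorphisms `ψ_d` by matrices (`matHom`). That the matrices of the generators are the required
ones follows by comparison with the ambient category, where placing further strands to the left or
to the right of a local element is whiskering (`IsLocal`). The result is `resRep`. -/

namespace QuasiCat

/-! ### Systems of elements that satisfy the KLR relations -/

/-- Elements `e(l)`, `x_r`, `τ_r` of a ring that satisfy the relations of the KLR algebras; the
sequences `l` are arbitrary, and `τ_r e(l) = e(s_r l) τ_r` is required for `r + 1 < |l|` only. -/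
structure KLRSys {J : Type u} [Quiver.{v} J] {A : Type*} [Ring A] (e : List J → A)
    (x t : ℕ → A) : Prop where
  e_mul_self (l : List J) : e l * e l = e l
  e_mul_ne (l l' : List J) (h : l ≠ l') : e l * e l' = 0
  x_mul_e (r : ℕ) (l : List J) : x r * e l = e l * x r
  t_mul_e (r : ℕ) (l : List J) (h : r + 1 < l.length) : t r * e l = e (swapAt r l) * t r
  x_mul_x (r s : ℕ) : x r * x s = x s * x r
  t_x_eq (r : ℕ) (l : List J) (a : J) (h₀ : l[r]? = some a) (h₁ : l[r + 1]? = some a) :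
    t r * x (r + 1) * e l = (x r * t r + 1) * e l
  t_x_ne (r : ℕ) (l : List J) (a b : J) (h₀ : l[r]? = some a) (h₁ : l[r + 1]? = some b)
    (h : a ≠ b) : t r * x (r + 1) * e l = x r * t r * e l
  x_t_eq (r : ℕ) (l : List J) (a : J) (h₀ : l[r]? = some a) (h₁ : l[r + 1]? = some a) :
    x (r + 1) * t r * e l = (t r * x r + 1) * e l
  x_t_ne (r : ℕ) (l : List J) (a b : J) (h₀ : l[r]? = some a) (h₁ : l[r + 1]? = some b)
    (h : a ≠ b) : x (r + 1) * t r * e l = t r * x r * e l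
  t_x_far (r s : ℕ) (h₀ : s ≠ r) (h₁ : s ≠ r + 1) : t r * x s = x s * t r
  t_t_far (r s : ℕ) (h : r + 1 < s) : t r * t s = t s * t r
  t_sq (r : ℕ) (l : List J) (a b : J) (h₀ : l[r]? = some a) (h₁ : l[r + 1]? = some b) :
    t r * t r * e l = klrQ a b (x r) (x (r + 1)) * e l
  braid_eq (r : ℕ) (l : List J) (a b : J) (h₀ : l[r]? = some a) (h₁ : l[r + 1]? = some b)
    (h₂ : l[r + 2]? = some a) :
    (t (r + 1) * t r * t (r + 1) - t r * t (r + 1) * t r) * e l =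
      klrQDiff a b (x r) (x (r + 1)) (x (r + 2)) * e l
  braid_ne (r : ℕ) (l : List J) (a c : J) (h₀ : l[r]? = some a) (h₂ : l[r + 2]? = some c)
    (h : a ≠ c) : (t (r + 1) * t r * t (r + 1) - t r * t (r + 1) * t r) * e l = 0

theorem length_swapAt {J : Type u} (r : ℕ) (l : List J) : (swapAt r l).length = l.length :=
  (swapAt_perm r l).length_eq

theorem swapAt_append_left {J : Type u} (pre l : List J) (r : ℕ) :
    swapAt (pre.length + r) (pre ++ l) = pre ++ swapAt r l := by
  induction pre with
  | nil => simp
  | cons a pre ih =>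
    rw [List.length_cons, Nat.add_right_comm]
    exact congrArg (List.cons a) ih

theorem swapAt_append_right {J : Type u} (l suf : List J) (r : ℕ) (h : r + 1 < l.length) :
    swapAt r (l ++ suf) = swapAt r l ++ suf := by
  induction l generalizing r with
  | nil => simp at h
  | cons a l ih =>
    match r, l with
    | 0, [] => simp at h
    | 0, b :: l => rfl
    | r + 1, l => exact congrArg (List.cons a) (ih r (by simpa using h))

theorem getElem?_local {J : Type u} (pre l suf : List J) (r : ℕ) (a : J) (h : l[r]? = some a) :
    (pre ++ l ++ suf)[pre.length + r]? = some a := by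
  have hr : r < l.length := (List.getElem?_eq_some_iff.1 h).1
  rw [List.append_assoc, List.getElem?_append_right (by omega), Nat.add_sub_cancel_left,
    List.getElem?_append_left hr, h]

namespace KLRSys

variable {J : Type u} [Quiver.{v} J] {A : Type*} [Ring A] {e : List J → A} {x t : ℕ → A}

/-- Each relation involves only neighbouring strands, so fixing the labels on both sides gives a
system of the same kind. This is why crossings need to be studied only at position `0` and with two
or three cables. -/
theorem local_append (K : KLRSys e x t) (pre suf : List J) :
    KLRSys (fun l => e (pre ++ l ++ suf)) (fun r => x (pre.length + r))
      (fun r => t (pre.length + r)) where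
  e_mul_self l := K.e_mul_self _
  e_mul_ne l l' h := K.e_mul_ne _ _ (by simpa using h)
  x_mul_e r l := K.x_mul_e _ _
  t_mul_e r l h := by
    have h1 := K.t_mul_e (pre.length + r) (pre ++ l ++ suf) (by simp; omega)
    rwa [List.append_assoc, swapAt_append_left, swapAt_append_right _ _ _ h,
      ← List.append_assoc, ← List.append_assoc] at h1
  x_mul_x r s := K.x_mul_x _ _
  t_x_eq r l a h₀ h₁ := K.t_x_eq _ _ a (getElem?_local _ _ _ _ _ h₀) (getElem?_local _ _ _ _ _ h₁)
  t_x_ne r l a b h₀ h₁ h :=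
    K.t_x_ne _ _ a b (getElem?_local _ _ _ _ _ h₀) (getElem?_local _ _ _ _ _ h₁) h
  x_t_eq r l a h₀ h₁ := K.x_t_eq _ _ a (getElem?_local _ _ _ _ _ h₀) (getElem?_local _ _ _ _ _ h₁)
  x_t_ne r l a b h₀ h₁ h :=
    K.x_t_ne _ _ a b (getElem?_local _ _ _ _ _ h₀) (getElem?_local _ _ _ _ _ h₁) h
  t_x_far r s h₀ h₁ := K.t_x_far _ _ (by omega) (by omega)
  t_t_far r s h := K.t_t_far _ _ (by omega)
  t_sq r l a b h₀ h₁ :=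
    K.t_sq _ _ a b (getElem?_local _ _ _ _ _ h₀) (getElem?_local _ _ _ _ _ h₁)
  braid_eq r l a b h₀ h₁ h₂ :=
    K.braid_eq _ _ a b (getElem?_local _ _ _ _ _ h₀) (getElem?_local _ _ _ _ _ h₁)
      (getElem?_local _ _ _ _ _ h₂)
  braid_ne r l a c h₀ h₂ h :=
    K.braid_ne _ _ a c (getElem?_local _ _ _ _ _ h₀) (getElem?_local _ _ _ _ _ h₂) h

end KLRSys

/-! ### Vectors of a given type -/

/-- The element `v` lies in `e(l) A`. -/
def Ty {J : Type u} {A : Type*} [Ring A] (e : List J → A) (l : List J) (v : A) : Prop :=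
  e l * v = v

theorem Ty.eq {J : Type u} {A : Type*} [Ring A] {e : List J → A} {l : List J} {v : A}
    (h : Ty e l v) : e l * v = v := h

/-- The defining relations hold only after multiplication by an idempotent on the right; this is how
they are applied to vectors. -/
theorem Ty.mul_eq_mul {J : Type u} {A : Type*} [Ring A] {e : List J → A} {l : List J} {v : A}
    (h : Ty e l v) {z z' : A} (hz : z * e l = z' * e l) : z * v = z' * v := by
  rw [← h.eq, ← mul_assoc, ← mul_assoc, hz]

theorem Ty.zero {J : Type u} {A : Type*} [Ring A] {e : List J → A} {l : List J} :
    Ty e l (0 : A) := mul_zero _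

theorem Ty.add {J : Type u} {A : Type*} [Ring A] {e : List J → A} {l : List J} {v w : A}
    (hv : Ty e l v) (hw : Ty e l w) : Ty e l (v + w) := by
  unfold Ty at *; rw [mul_add, hv, hw]

theorem Ty.sub {J : Type u} {A : Type*} [Ring A] {e : List J → A} {l : List J} {v w : A}
    (hv : Ty e l v) (hw : Ty e l w) : Ty e l (v - w) := by
  unfold Ty at *; rw [mul_sub, hv, hw]

theorem Ty.neg {J : Type u} {A : Type*} [Ring A] {e : List J → A} {l : List J} {v : A}
    (hv : Ty e l v) : Ty e l (-v) := by
  unfold Ty at *; rw [mul_neg, hv]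

namespace KLRSys

variable {J : Type u} [Quiver.{v} J] {A : Type*} [Ring A] {e : List J → A} {x t : ℕ → A}
variable (K : KLRSys e x t) {l : List J} {v : A}
include K

theorem ty_e (l : List J) : Ty e l (e l) := K.e_mul_self l

theorem ty_x (r : ℕ) (h : Ty e l v) : Ty e l (x r * v) := by
  unfold Ty; rw [← mul_assoc, ← K.x_mul_e, mul_assoc, h.eq]

theorem ty_t (r : ℕ) (hr : r + 1 < l.length) (h : Ty e l v) : Ty e (swapAt r l) (t r * v) := by
  unfold Ty; rw [← mul_assoc, ← K.t_mul_e r l hr, mul_assoc, h.eq]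

theorem x_x (r s : ℕ) (v : A) : x r * (x s * v) = x s * (x r * v) := by
  rw [← mul_assoc, K.x_mul_x, mul_assoc]

theorem t_x_eq' (r : ℕ) (a : J) (h : Ty e l v) (h₀ : l[r]? = some a) (h₁ : l[r + 1]? = some a) :
    t r * (x (r + 1) * v) = x r * (t r * v) + v := by
  have := h.mul_eq_mul (K.t_x_eq r l a h₀ h₁)
  rwa [add_mul, one_mul, mul_assoc, mul_assoc] at this

theorem t_x_ne' (r : ℕ) (a b : J) (h : Ty e l v) (h₀ : l[r]? = some a) (h₁ : l[r + 1]? = some b)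
    (hab : a ≠ b) : t r * (x (r + 1) * v) = x r * (t r * v) := by
  have := h.mul_eq_mul (K.t_x_ne r l a b h₀ h₁ hab)
  rwa [mul_assoc, mul_assoc] at this

theorem x_t_eq' (r : ℕ) (a : J) (h : Ty e l v) (h₀ : l[r]? = some a) (h₁ : l[r + 1]? = some a) :
    x (r + 1) * (t r * v) = t r * (x r * v) + v := by
  have := h.mul_eq_mul (K.x_t_eq r l a h₀ h₁)
  rwa [add_mul, one_mul, mul_assoc, mul_assoc] at this

theorem x_t_ne' (r : ℕ) (a b : J) (h : Ty e l v) (h₀ : l[r]? = some a) (h₁ : l[r + 1]? = some b)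
    (hab : a ≠ b) : x (r + 1) * (t r * v) = t r * (x r * v) := by
  have := h.mul_eq_mul (K.x_t_ne r l a b h₀ h₁ hab)
  rwa [mul_assoc, mul_assoc] at this

theorem x_t_far' (r s : ℕ) (h₀ : s ≠ r) (h₁ : s ≠ r + 1) (v : A) :
    x s * (t r * v) = t r * (x s * v) := by
  rw [← mul_assoc, ← K.t_x_far r s h₀ h₁, mul_assoc]

theorem t_t_far' (r s : ℕ) (h : r + 1 < s ∨ s + 1 < r) (v : A) :
    t r * (t s * v) = t s * (t r * v) := by
  rcases h with h | h
  · rw [← mul_assoc, K.t_t_far r s h, mul_assoc]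
  · rw [← mul_assoc, ← K.t_t_far s r h, mul_assoc]

theorem t_sq' (r : ℕ) (a b : J) (h : Ty e l v) (h₀ : l[r]? = some a) (h₁ : l[r + 1]? = some b) :
    t r * (t r * v) = klrQ a b (x r) (x (r + 1)) * v := by
  have := h.mul_eq_mul (K.t_sq r l a b h₀ h₁)
  rwa [mul_assoc] at this

theorem braid_eq' (r : ℕ) (a b : J) (h : Ty e l v) (h₀ : l[r]? = some a)
    (h₁ : l[r + 1]? = some b) (h₂ : l[r + 2]? = some a) :
    t (r + 1) * (t r * (t (r + 1) * v)) = t r * (t (r + 1) * (t r * v)) +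
      klrQDiff a b (x r) (x (r + 1)) (x (r + 2)) * v := by
  have := h.mul_eq_mul (K.braid_eq r l a b h₀ h₁ h₂)
  rw [sub_mul] at this
  rw [← this]
  simp only [mul_assoc]
  abel

theorem braid_ne' (r : ℕ) (a c : J) (h : Ty e l v) (h₀ : l[r]? = some a)
    (h₂ : l[r + 2]? = some c) (hac : a ≠ c) :
    t (r + 1) * (t r * (t (r + 1) * v)) = t r * (t (r + 1) * (t r * v)) := by
  have := h.mul_eq_mul ((K.braid_ne r l a c h₀ h₂ hac).trans (zero_mul _).symm)
  rw [sub_mul, zero_mul, sub_eq_zero] at this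
  simpa only [mul_assoc] using this

end KLRSys

/-- The braid relation for strands with the labels `a`, `b`, `c` has no error term. -/
def NoErr {J : Type u} [Quiver.{v} J] (a b c : J) : Prop :=
  a = c → a = b ∨ (arrowCount a b = 0 ∧ arrowCount b a = 0)

/-- The product of the `τ_r`, `r ∈ ws`, applied to `v`. -/
def act {A : Type*} [Ring A] (t : ℕ → A) (ws : List ℕ) (v : A) : A :=
  ws.foldr (fun r u => t r * u) v

/-- Exchange of two neighbouring letters of a word that differ by at least two. -/
def farSwap : ℕ → List ℕ → List ℕ
  | 0, r :: s :: ws => if r + 1 < s ∨ s + 1 < r then s :: r :: ws else r :: s :: ws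
  | n + 1, r :: ws => r :: farSwap n ws
  | _, ws => ws

theorem act_cons {A : Type*} [Ring A] (t : ℕ → A) (r : ℕ) (ws : List ℕ) (v : A) :
    act t (r :: ws) v = t r * act t ws v := rfl

theorem act_append {A : Type*} [Ring A] (t : ℕ → A) (ws ws' : List ℕ) (v : A) :
    act t (ws ++ ws') v = act t ws (act t ws' v) := List.foldr_append

theorem act_add {A : Type*} [Ring A] (t : ℕ → A) (ws : List ℕ) (v v' : A) :
    act t ws (v + v') = act t ws v + act t ws v' := by
  induction ws with
  | nil => rfl
  | cons r ws ih => rw [act_cons, act_cons, act_cons, ih, mul_add]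

theorem act_neg {A : Type*} [Ring A] (t : ℕ → A) (ws : List ℕ) (v : A) :
    act t ws (-v) = -act t ws v := by
  induction ws with
  | nil => rfl
  | cons r ws ih => rw [act_cons, act_cons, ih, mul_neg]

theorem act_zero {A : Type*} [Ring A] (t : ℕ → A) (ws : List ℕ) :
    act t ws (0 : A) = 0 := by
  induction ws with
  | nil => rfl
  | cons r ws ih => rw [act_cons, ih, mul_zero]

/-- Divided differences vanish on constants: `Q` is `0` for equal labels and `1` for different
labels that are not joined by arrows. -/
theorem klrQDiff_of_noErr {J : Type u} [Quiver.{v} J] {A : Type*} [Ring A] {a b : J}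
    (h : NoErr a b a) (y₁ y₂ y₃ : A) : klrQDiff a b y₁ y₂ y₃ = 0 := by
  unfold klrQDiff
  rcases h rfl with h | ⟨h, h'⟩
  · rw [if_pos h]
  · simp [h, h']

namespace KLRSys

variable {J : Type u} [Quiver.{v} J] {A : Type*} [Ring A] {e : List J → A} {x t : ℕ → A}
variable (K : KLRSys e x t) {l : List J} {v : A}
include K

theorem braid_noErr (r : ℕ) (a b c : J) (h : Ty e l v) (h₀ : l[r]? = some a)
    (h₁ : l[r + 1]? = some b) (h₂ : l[r + 2]? = some c) (hn : NoErr a b c) :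
    t (r + 1) * (t r * (t (r + 1) * v)) = t r * (t (r + 1) * (t r * v)) := by
  by_cases hac : a = c
  · subst hac
    rw [K.braid_eq' r a b h h₀ h₁ h₂, klrQDiff_of_noErr hn, zero_mul, add_zero]
  · exact K.braid_ne' r a c h h₀ h₂ hac

theorem act_farSwap (ws : List ℕ) (n : ℕ) : act t (farSwap n ws) v = act t ws v := by
  induction n generalizing ws with
  | zero =>
    match ws with
    | [] => rfl
    | [_] => rfl
    | r :: s :: ws =>
      unfold farSwap
      split_ifs with h
      · exact (K.t_t_far' r s h _).symm
      · rfl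
  | succ n ih =>
    match ws with
    | [] => rfl
    | r :: ws => exact congrArg (t r * ·) (ih ws)

/-- A chain of commutations is recorded by the list of positions at which neighbouring letters are
exchanged; for concrete words the resulting word is found by evaluation. -/
theorem act_farSwaps (ns ws : List ℕ) : act t ws v = act t (ns.foldl (fun ws n => farSwap n ws) ws) v := by
  induction ns generalizing ws with
  | nil => rfl
  | cons n ns ih => rw [List.foldl_cons, ← ih, K.act_farSwap]

theorem ty_act (h : Ty e l v) (ws : List ℕ) (hws : ∀ r ∈ ws, r + 1 < l.length) :
    Ty e (ws.foldr swapAt l) (act t ws v) ∧ (ws.foldr swapAt l).length = l.length := by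
  induction ws with
  | nil => exact ⟨h, rfl⟩
  | cons r ws ih =>
    have ih := ih fun s hs => hws s (List.mem_cons_of_mem _ hs)
    exact ⟨K.ty_t r (by rw [ih.2]; exact hws r List.mem_cons_self) ih.1,
      (length_swapAt _ _).trans ih.2⟩

/-- A braid move in the middle of a word. -/
theorem act_braid (h : Ty e l v) (pre : List ℕ) (r : ℕ) (suf : List ℕ) (a b c : J)
    (h₀ : (suf.foldr swapAt l)[r]? = some a) (h₁ : (suf.foldr swapAt l)[r + 1]? = some b)
    (h₂ : (suf.foldr swapAt l)[r + 2]? = some c) (hn : NoErr a b c)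
    (hsuf : ∀ s ∈ suf, s + 1 < l.length) :
    act t (pre ++ (r + 1) :: r :: (r + 1) :: suf) v =
      act t (pre ++ r :: (r + 1) :: r :: suf) v := by
  rw [act_append, act_append]
  exact congrArg _ (K.braid_noErr r a b c (K.ty_act h suf hsuf).1 h₀ h₁ h₂ hn)

/-- A braid move with an error term in the middle of a word. -/
theorem act_braid_eq (h : Ty e l v) (pre : List ℕ) (r : ℕ) (suf : List ℕ) (a b : J)
    (h₀ : (suf.foldr swapAt l)[r]? = some a) (h₁ : (suf.foldr swapAt l)[r + 1]? = some b)
    (h₂ : (suf.foldr swapAt l)[r + 2]? = some a)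
    (hsuf : ∀ s ∈ suf, s + 1 < l.length) :
    act t (pre ++ (r + 1) :: r :: (r + 1) :: suf) v =
      act t (pre ++ r :: (r + 1) :: r :: suf) v +
        act t pre (klrQDiff a b (x r) (x (r + 1)) (x (r + 2)) * act t suf v) := by
  rw [act_append, act_append, ← act_add]
  exact congrArg _ (K.braid_eq' r a b (K.ty_act h suf hsuf).1 h₀ h₁ h₂)

end KLRSys

/-! ### Braid relations for strands that are replaced by pairs of strands -/

namespace KLRSys

variable {J : Type u} [Quiver.{v} J] {A : Type*} [Ring A] {e : List J → A} {x t : ℕ → A}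
variable (K : KLRSys e x t) {l : List J} {v : A}
include K

/-- In this lemma and the six that follow, the two words are reduced words of the permutation that
reverses the order of three cables, so they are connected by commutations and braid moves. Each
triple of strands, one from each cable, is met by exactly one braid move, and contributes one
hypothesis on its labels. -/
theorem cable_single_single_pair {a b c₁ c₂ : J} (h : Ty e [a, b, c₁, c₂] v)
    (h1 : NoErr a b c₂)    (h2 : NoErr a b c₁)
    : act t [2, 1, 0, 2, 1] v = act t [1, 0, 2, 1, 0] v := by
  calc
    _ = act t [2, 1, 2, 0, 1] v := K.act_farSwaps [2] _
    _ = act t [1, 2, 1, 0, 1] v := K.act_braid h [] 1 [0, 1] a b c₂ rfl rfl rfl h1 (by simp)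
    _ = act t [1, 2, 0, 1, 0] v := K.act_braid h [1, 2] 0 [] a b c₁ rfl rfl rfl h2 (by simp)
    _ = act t [1, 0, 2, 1, 0] v := K.act_farSwaps [1] _

theorem cable_single_pair_single {a b₁ b₂ c : J} (h : Ty e [a, b₁, b₂, c] v)
    (h1 : NoErr a b₁ c)    (h2 : NoErr a b₂ c)
    : act t [2, 1, 0, 1, 2] v = act t [0, 1, 2, 1, 0] v := by
  calc
    _ = act t [2, 0, 1, 0, 2] v := K.act_braid h [2] 0 [2] a b₁ c rfl rfl rfl h1 (by simp)
    _ = act t [0, 2, 1, 2, 0] v := K.act_farSwaps [0, 3] _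
    _ = act t [0, 1, 2, 1, 0] v := K.act_braid h [0] 1 [0] a b₂ c rfl rfl rfl h2 (by simp)

theorem cable_pair_single_single {a₁ a₂ b c : J} (h : Ty e [a₁, a₂, b, c] v)
    (h1 : NoErr a₂ b c)    (h2 : NoErr a₁ b c)
    : act t [1, 2, 0, 1, 2] v = act t [0, 1, 2, 0, 1] v := by
  calc
    _ = act t [1, 0, 2, 1, 2] v := K.act_farSwaps [1] _
    _ = act t [1, 0, 1, 2, 1] v := K.act_braid h [1, 0] 1 [] a₂ b c rfl rfl rfl h1 (by simp)
    _ = act t [0, 1, 0, 2, 1] v := K.act_braid h [] 0 [2, 1] a₁ b c rfl rfl rfl h2 (by simp)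
    _ = act t [0, 1, 2, 0, 1] v := K.act_farSwaps [2] _

theorem cable_single_pair_pair {a b₁ b₂ c₁ c₂ : J} (h : Ty e [a, b₁, b₂, c₁, c₂] v)
    (h1 : NoErr a b₁ c₂)    (h2 : NoErr a b₁ c₁)    (h3 : NoErr a b₂ c₂)    (h4 : NoErr a b₂ c₁)
    : act t [3, 2, 1, 0, 2, 3, 1, 2] v = act t [1, 2, 0, 1, 3, 2, 1, 0] v := by
  calc
    _ = act t [3, 2, 1, 2, 0, 3, 1, 2] v := K.act_farSwaps [3] _
    _ = act t [3, 1, 2, 1, 0, 3, 1, 2] v := K.act_braid h [3] 1 [0, 3, 1, 2] a b₁ c₂ rfl rfl rfl h1 (by simp)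
    _ = act t [3, 1, 2, 1, 0, 1, 3, 2] v := K.act_farSwaps [5] _
    _ = act t [3, 1, 2, 0, 1, 0, 3, 2] v := K.act_braid h [3, 1, 2] 0 [3, 2] a b₁ c₁ rfl rfl rfl h2 (by simp)
    _ = act t [1, 3, 2, 3, 0, 1, 0, 2] v := K.act_farSwaps [0, 5, 4, 3] _
    _ = act t [1, 2, 3, 2, 0, 1, 0, 2] v := K.act_braid h [1] 2 [0, 1, 0, 2] a b₂ c₂ rfl rfl rfl h3 (by simp)
    _ = act t [1, 2, 3, 0, 2, 1, 2, 0] v := K.act_farSwaps [3, 6] _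
    _ = act t [1, 2, 3, 0, 1, 2, 1, 0] v := K.act_braid h [1, 2, 3, 0] 1 [0] a b₂ c₁ rfl rfl rfl h4 (by simp)
    _ = act t [1, 2, 0, 1, 3, 2, 1, 0] v := K.act_farSwaps [2, 3] _

theorem cable_pair_single_pair {a₁ a₂ b c₁ c₂ : J} (h : Ty e [a₁, a₂, b, c₁, c₂] v)
    (h1 : NoErr a₂ b c₂)    (h2 : NoErr a₁ b c₂)    (h3 : NoErr a₂ b c₁)    (h4 : NoErr a₁ b c₁)
    : act t [2, 3, 1, 2, 0, 1, 3, 2] v = act t [1, 0, 2, 3, 1, 2, 0, 1] v := by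
  calc
    _ = act t [2, 1, 3, 2, 3, 0, 1, 2] v := K.act_farSwaps [1, 5, 4] _
    _ = act t [2, 1, 2, 3, 2, 0, 1, 2] v := K.act_braid h [2, 1] 2 [0, 1, 2] a₂ b c₂ rfl rfl rfl h1 (by simp)
    _ = act t [1, 2, 1, 3, 2, 0, 1, 2] v := K.act_braid h [] 1 [3, 2, 0, 1, 2] a₁ b c₂ rfl rfl rfl h2 (by simp)
    _ = act t [1, 2, 1, 3, 0, 2, 1, 2] v := K.act_farSwaps [4] _
    _ = act t [1, 2, 1, 3, 0, 1, 2, 1] v := K.act_braid h [1, 2, 1, 3, 0] 1 [] a₂ b c₁ rfl rfl rfl h3 (by simp)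
    _ = act t [1, 2, 3, 1, 0, 1, 2, 1] v := K.act_farSwaps [2] _
    _ = act t [1, 2, 3, 0, 1, 0, 2, 1] v := K.act_braid h [1, 2, 3] 0 [2, 1] a₁ b c₁ rfl rfl rfl h4 (by simp)
    _ = act t [1, 0, 2, 3, 1, 2, 0, 1] v := K.act_farSwaps [2, 1, 5] _

theorem cable_pair_pair_single {a₁ a₂ b₁ b₂ c : J} (h : Ty e [a₁, a₂, b₁, b₂, c] v)
    (h1 : NoErr a₂ b₁ c)    (h2 : NoErr a₁ b₁ c)    (h3 : NoErr a₂ b₂ c)    (h4 : NoErr a₁ b₂ c)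
    : act t [2, 3, 1, 2, 0, 1, 2, 3] v = act t [0, 1, 2, 3, 1, 2, 0, 1] v := by
  calc
    _ = act t [2, 3, 1, 0, 2, 1, 2, 3] v := K.act_farSwaps [3] _
    _ = act t [2, 3, 1, 0, 1, 2, 1, 3] v := K.act_braid h [2, 3, 1, 0] 1 [3] a₂ b₁ c rfl rfl rfl h1 (by simp)
    _ = act t [2, 3, 0, 1, 0, 2, 1, 3] v := K.act_braid h [2, 3] 0 [2, 1, 3] a₁ b₁ c rfl rfl rfl h2 (by simp)
    _ = act t [2, 0, 1, 0, 3, 2, 3, 1] v := K.act_farSwaps [1, 2, 3, 6] _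
    _ = act t [2, 0, 1, 0, 2, 3, 2, 1] v := K.act_braid h [2, 0, 1, 0] 2 [1] a₂ b₂ c rfl rfl rfl h3 (by simp)
    _ = act t [0, 2, 1, 2, 0, 3, 2, 1] v := K.act_farSwaps [0, 3] _
    _ = act t [0, 1, 2, 1, 0, 3, 2, 1] v := K.act_braid h [0] 1 [0, 3, 2, 1] a₁ b₂ c rfl rfl rfl h4 (by simp)
    _ = act t [0, 1, 2, 3, 1, 2, 0, 1] v := K.act_farSwaps [4, 3, 5] _

/-- The moves for the triples `(a₂, b₁, c₂)` and `(a₁, b₂, c₁)` are the hypotheses `H1` and `H2`: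
for three equal pairs these triples read `i² i¹ i²` and `i¹ i² i¹`, where the braid relation does
have a correction term. -/
theorem cable_pair_pair_pair {a₁ a₂ b₁ b₂ c₁ c₂ : J} (h : Ty e [a₁, a₂, b₁, b₂, c₁, c₂] v)
    (h1 : NoErr a₁ b₁ c₂)    (h2 : NoErr a₂ b₁ c₁)    (h3 : NoErr a₁ b₁ c₁)    (h4 : NoErr a₂ b₂ c₂)    (h5 : NoErr a₁ b₂ c₂)    (h6 : NoErr a₂ b₂ c₁)
    (H1 : act t [3, 4, 2, 1, 3, 2, 3, 0, 1, 4, 2, 3] v = act t [3, 4, 2, 1, 2, 3, 2, 0, 1, 4, 2, 3] v)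
    (H2 : act t [1, 2, 3, 4, 0, 2, 1, 2, 0, 3, 2, 1] v = act t [1, 2, 3, 4, 0, 1, 2, 1, 0, 3, 2, 1] v)
    : act t [3, 4, 2, 3, 1, 2, 0, 1, 3, 4, 2, 3] v = act t [1, 2, 0, 1, 3, 4, 2, 3, 1, 2, 0, 1] v := by
  calc
    _ = act t [3, 4, 2, 1, 3, 2, 3, 0, 1, 4, 2, 3] v := K.act_farSwaps [3, 7, 6] _
    _ = act t [3, 4, 2, 1, 2, 3, 2, 0, 1, 4, 2, 3] v := H1
    _ = act t [3, 4, 1, 2, 1, 3, 2, 0, 1, 4, 2, 3] v := K.act_braid h [3, 4] 1 [3, 2, 0, 1, 4, 2, 3] a₁ b₁ c₂ rfl rfl rfl h1 (by simp)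
    _ = act t [3, 4, 1, 2, 1, 3, 0, 2, 1, 2, 4, 3] v := K.act_farSwaps [6, 9] _
    _ = act t [3, 4, 1, 2, 1, 3, 0, 1, 2, 1, 4, 3] v := K.act_braid h [3, 4, 1, 2, 1, 3, 0] 1 [4, 3] a₂ b₁ c₁ rfl rfl rfl h2 (by simp)
    _ = act t [3, 4, 1, 2, 3, 1, 0, 1, 2, 1, 4, 3] v := K.act_farSwaps [4] _
    _ = act t [3, 4, 1, 2, 3, 0, 1, 0, 2, 1, 4, 3] v := K.act_braid h [3, 4, 1, 2, 3] 0 [2, 1, 4, 3] a₁ b₁ c₁ rfl rfl rfl h3 (by simp)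
    _ = act t [3, 1, 2, 4, 3, 4, 0, 1, 0, 2, 1, 3] v := K.act_farSwaps [1, 2, 9, 8, 7, 6, 5] _
    _ = act t [3, 1, 2, 3, 4, 3, 0, 1, 0, 2, 1, 3] v := K.act_braid h [3, 1, 2] 3 [0, 1, 0, 2, 1, 3] a₂ b₂ c₂ rfl rfl rfl h4 (by simp)
    _ = act t [1, 3, 2, 3, 4, 3, 0, 1, 0, 2, 1, 3] v := K.act_farSwaps [0] _
    _ = act t [1, 2, 3, 2, 4, 3, 0, 1, 0, 2, 1, 3] v := K.act_braid h [1] 2 [4, 3, 0, 1, 0, 2, 1, 3] a₁ b₂ c₂ rfl rfl rfl h5 (by simp)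
    _ = act t [1, 2, 3, 2, 4, 0, 1, 0, 3, 2, 3, 1] v := K.act_farSwaps [5, 6, 7, 10] _
    _ = act t [1, 2, 3, 2, 4, 0, 1, 0, 2, 3, 2, 1] v := K.act_braid h [1, 2, 3, 2, 4, 0, 1, 0] 2 [1] a₂ b₂ c₁ rfl rfl rfl h6 (by simp)
    _ = act t [1, 2, 3, 4, 0, 2, 1, 2, 0, 3, 2, 1] v := K.act_farSwaps [3, 4, 7] _
    _ = act t [1, 2, 3, 4, 0, 1, 2, 1, 0, 3, 2, 1] v := H2
    _ = act t [1, 2, 0, 1, 3, 4, 2, 3, 1, 2, 0, 1] v := K.act_farSwaps [3, 2, 4, 3, 8, 7, 9] _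

end KLRSys

/-! ### The doubled quiver -/

section Arrows

variable {I : Type u} [Quiver.{v} I] {I₁ : Set I} {i j : I}

theorem arrowCount_zero_zero (hi : i ∉ I₁) (hj : j ∉ I₁) :
    arrowCount (Doubled.zero i hi) (Doubled.zero j hj) = arrowCount i j := rfl

theorem arrowCount_zero_one (hi : i ∉ I₁) (hj : j ∈ I₁) :
    arrowCount (Doubled.zero i hi) (Doubled.one j hj) = arrowCount i j := rfl

theorem arrowCount_two_zero (hi : i ∈ I₁) (hj : j ∉ I₁) :
    arrowCount (Doubled.two i hi) (Doubled.zero j hj) = arrowCount i j := rfl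

theorem arrowCount_zero_two (hi : i ∉ I₁) (hj : j ∈ I₁) :
    arrowCount (Doubled.zero i hi) (Doubled.two j hj) = 0 :=
  Nat.card_of_isEmpty (α := PEmpty)

theorem arrowCount_one_zero (hi : i ∈ I₁) (hj : j ∉ I₁) :
    arrowCount (Doubled.one i hi) (Doubled.zero j hj) = 0 :=
  Nat.card_of_isEmpty (α := PEmpty)

theorem arrowCount_one_one (hi : i ∈ I₁) (hj : j ∈ I₁) :
    arrowCount (Doubled.one i hi) (Doubled.one j hj) = 0 :=
  Nat.card_of_isEmpty (α := PEmpty)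

theorem arrowCount_two_one (hi : i ∈ I₁) (hj : j ∈ I₁) :
    arrowCount (Doubled.two i hi) (Doubled.one j hj) = 0 :=
  Nat.card_of_isEmpty (α := PEmpty)

theorem arrowCount_two_two (hi : i ∈ I₁) (hj : j ∈ I₁) :
    arrowCount (Doubled.two i hi) (Doubled.two j hj) = 0 :=
  Nat.card_of_isEmpty (α := PEmpty)

theorem arrowCount_one_two_self (hi : i ∈ I₁) (hj : i ∈ I₁) :
    arrowCount (Doubled.one i hi) (Doubled.two i hj) = 1 := by
  change Nat.card (ULift (PLift (i = i))) = 1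
  simp

theorem arrowCount_one_two_ne (hi : i ∈ I₁) (hj : j ∈ I₁) (h : i ≠ j) :
    arrowCount (Doubled.one i hi) (Doubled.two j hj) = 0 := by
  have : IsEmpty (ULift.{v} (PLift (i = j))) := ⟨fun x => h x.down.down⟩
  exact Nat.card_of_isEmpty (α := ULift.{v} (PLift (i = j)))

end Arrows

/-- `ok n l`: no initial segment of `l` has more than `n` entries of the form `i²` in excess of the
entries of the form `i¹`. -/
def ok {I : Type u} {I₁ : Set I} : ℕ → List (Doubled I₁) → Prop
  | _, [] => True
  | n, .zero _ _ :: l => ok n l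
  | n, .one _ _ :: l => ok (n + 1) l
  | 0, .two _ _ :: _ => False
  | n + 1, .two _ _ :: l => ok n l

section Ok

variable {I : Type u} {I₁ : Set I}

theorem not_isOne_zero (i : I) (h : i ∉ I₁) : ¬ (Doubled.zero i h).IsOne := fun h => h
theorem isOne_one (i : I) (h : i ∈ I₁) : (Doubled.one i h).IsOne := trivial
theorem not_isOne_two (i : I) (h : i ∈ I₁) : ¬ (Doubled.two i h).IsOne := fun h => h
theorem not_isTwo_zero (i : I) (h : i ∉ I₁) : ¬ (Doubled.zero i h).IsTwo := fun h => h
theorem not_isTwo_one (i : I) (h : i ∈ I₁) : ¬ (Doubled.one i h).IsTwo := fun h => h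
theorem isTwo_two (i : I) (h : i ∈ I₁) : (Doubled.two i h).IsTwo := trivial

open Classical in
-- The number `n` is a credit that the recursion on the list needs: an entry `i¹` raises it and an
-- entry `i²` uses it up. At `n = 0` the condition is that the sequence is not unordered, in a form
-- that can be evaluated on concrete lists.
theorem ok_iff (n : ℕ) (l : List (Doubled I₁)) :
    ok n l ↔ ∀ r, (l.take r).countP (fun a => decide a.IsTwo) ≤
      n + (l.take r).countP (fun a => decide a.IsOne) := by
  induction l generalizing n with
  | nil => simp [ok]
  | cons a l ih =>
    -- The empty initial segment imposes no condition, so only segments that contain the head need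
    -- to be considered.
    rw [show (∀ r, ((a :: l).take r).countP (fun a => decide a.IsTwo) ≤
        n + ((a :: l).take r).countP (fun a => decide a.IsOne)) ↔
        ∀ r, ((a :: l).take (r + 1)).countP (fun a => decide a.IsTwo) ≤
          n + ((a :: l).take (r + 1)).countP (fun a => decide a.IsOne) from
      ⟨fun H r => H _, fun H r => by
        match r with
        | 0 => simp
        | r + 1 => exact H r⟩]
    simp only [List.take_succ_cons, List.countP_cons, decide_eq_true_eq]
    match a, n with
    | .zero i h, n =>
      rw [ok, ih]
      simp only [if_neg (not_isOne_zero i h), if_neg (not_isTwo_zero i h), add_zero]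
    | .one i h, n =>
      rw [ok, ih]
      refine forall_congr' fun r => ?_
      simp only [if_pos (isOne_one i h), if_neg (not_isTwo_one i h)]
      omega
    | .two i h, 0 =>
      rw [ok]
      refine ⟨False.elim, fun H => ?_⟩
      have := H 0
      simp only [if_neg (not_isOne_two i h), if_pos (isTwo_two i h)] at this
      simp at this
    | .two i h, n + 1 =>
      rw [ok, ih]
      refine forall_congr' fun r => ?_
      simp only [if_neg (not_isOne_two i h), if_pos (isTwo_two i h)]
      omega

theorem unordered_iff (l : List (Doubled I₁)) : Unordered l ↔ ¬ ok 0 l := by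
  classical
  rw [ok_iff]
  push Not
  unfold Unordered
  constructor
  · rintro ⟨r, -, h⟩
    exact ⟨r, by simpa using h⟩
  · rintro ⟨r, h⟩
    by_cases hr : r ≤ l.length
    · exact ⟨r, hr, by simpa using h⟩
    · rw [List.take_of_length_le (by omega)] at h
      exact ⟨l.length, le_rfl, by simpa using h⟩

/-- Each block `φ(a)` returns the credit that it creates. -/
theorem ok_phiSeq_append (n : ℕ) (i : List I) (l : List (Doubled I₁)) :
    ok n (phiSeq I₁ i ++ l) ↔ ok n l := by
  induction i with
  | nil => rfl
  | cons a i ih =>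
    by_cases h : a ∈ I₁
    · simpa [phiSeq, phiVertex, h, ok] using ih
    · simpa [phiSeq, phiVertex, h, ok] using ih

theorem ok_append_right (n : ℕ) (l l' : List (Doubled I₁)) (h : ok n (l ++ l')) : ok n l := by
  induction l generalizing n with
  | nil => trivial
  | cons a l ih =>
    match a, n with
    | .zero _ _, n => exact ih n h
    | .one _ _, n => exact ih (n + 1) h
    | .two _ _, 0 => exact h
    | .two _ _, n + 1 => exact ih n h

end Ok

/-! ### Moving polynomials through other elements -/

section Slide

variable {J : Type u} {A : Type*} [Ring A] {e : List J → A} {l : List J} {s : A}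

/-- On the vectors `v` of type `l` one has `z s v = s z' v`. -/
structure Slides (e : List J → A) (l : List J) (s z z' : A) : Prop where
  slide (v : A) (hv : Ty e l v) : z * (s * v) = s * (z' * v)
  ty (v : A) (hv : Ty e l v) : Ty e l (z' * v)

/-- The pairs `(z, z')` that slide are closed under the ring operations, hence under polynomials
such as `klrQ` and `klrQDiff`; it is enough to slide single dots. -/
theorem Slides.sub {z z' y y' : A} (hz : Slides e l s z z') (hy : Slides e l s y y') :
    Slides e l s (z - y) (z' - y') where
  slide _ hv := by rw [sub_mul, sub_mul, mul_sub, hz.slide _ hv, hy.slide _ hv]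
  ty _ hv := by rw [sub_mul]; exact (hz.ty _ hv).sub (hy.ty _ hv)

theorem Slides.add {z z' y y' : A} (hz : Slides e l s z z') (hy : Slides e l s y y') :
    Slides e l s (z + y) (z' + y') where
  slide _ hv := by rw [add_mul, add_mul, mul_add, hz.slide _ hv, hy.slide _ hv]
  ty _ hv := by rw [add_mul]; exact (hz.ty _ hv).add (hy.ty _ hv)

theorem Slides.mul {z z' y y' : A} (hz : Slides e l s z z') (hy : Slides e l s y y') :
    Slides e l s (z * y) (z' * y') where
  slide _ hv := by
    rw [mul_assoc, mul_assoc, hy.slide _ hv, hz.slide _ (hy.ty _ hv)]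
  ty _ hv := by rw [mul_assoc]; exact hz.ty _ (hy.ty _ hv)

theorem Slides.zero : Slides e l s 0 0 where
  slide _ _ := by simp
  ty _ _ := by rw [zero_mul]; exact Ty.zero

theorem Slides.one : Slides e l s 1 1 where
  slide _ _ := by simp
  ty _ hv := by rwa [one_mul]

theorem Slides.neg {z z' : A} (hz : Slides e l s z z') : Slides e l s (-z) (-z') where
  slide _ hv := by rw [neg_mul, neg_mul, mul_neg, hz.slide _ hv]
  ty _ hv := by rw [neg_mul]; exact (hz.ty _ hv).neg

theorem Slides.pow {z z' : A} (hz : Slides e l s z z') (n : ℕ) :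
    Slides e l s (z ^ n) (z' ^ n) := by
  induction n with
  | zero => simpa using Slides.one
  | succ n ih => rw [pow_succ, pow_succ]; exact ih.mul hz

theorem Slides.sum {ι : Type*} (S : Finset ι) {z z' : ι → A}
    (h : ∀ i, Slides e l s (z i) (z' i)) : Slides e l s (∑ i ∈ S, z i) (∑ i ∈ S, z' i) := by
  classical
  induction S using Finset.induction_on with
  | empty => simpa using Slides.zero
  | insert a S ha ih => rw [Finset.sum_insert ha, Finset.sum_insert ha]; exact (h a).add ih

variable {I : Type*} [Quiver.{v} I]

theorem Slides.klrQ (i j : I) {a a' b b' : A} (ha : Slides e l s a a') (hb : Slides e l s b b') :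
    Slides e l s (klrQ i j a b) (klrQ i j a' b') := by
  unfold QuasiCat.klrQ
  split_ifs
  · exact Slides.zero
  · exact ((hb.sub ha).pow _).mul ((ha.sub hb).pow _)

theorem Slides.klrQDiff (i j : I) {a a' b b' c c' : A} (ha : Slides e l s a a')
    (hb : Slides e l s b b') (hc : Slides e l s c c') :
    Slides e l s (klrQDiff i j a b c) (klrQDiff i j a' b' c') := by
  unfold QuasiCat.klrQDiff
  split_ifs
  · exact Slides.zero
  · exact (Slides.one.neg.pow _).mul
      (Slides.sum _ fun m => ((hc.sub hb).pow _).mul ((ha.sub hb).pow _))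

/-- Composition of slides. -/
theorem Slides.comp {l' : List J} {s' z z' z'' : A} (h : Slides e l' s z z')
    (h' : Slides e l s' z' z'') (hs : ∀ v, Ty e l v → Ty e l' (s' * v)) :
    Slides e l (s * s') z z'' where
  slide _ hv := by
    rw [mul_assoc, h.slide _ (hs _ hv), h'.slide _ hv, mul_assoc]
  ty _ hv := h'.ty _ hv

end Slide

namespace KLRSys

variable {J : Type u} [Quiver.{v} J] {A : Type*} [Ring A] {e : List J → A} {x t : ℕ → A}
variable (K : KLRSys e x t) {l : List J}
include K

theorem slides_x_one (r : ℕ) : Slides e l 1 (x r) (x r) where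
  slide v _ := by simp
  ty _ hv := K.ty_x r hv

theorem slides_hi (r : ℕ) (a b : J) (h₀ : l[r]? = some a) (h₁ : l[r + 1]? = some b)
    (hab : a ≠ b) : Slides e l (t r) (x (r + 1)) (x r) where
  slide _ hv := K.x_t_ne' r a b hv h₀ h₁ hab
  ty _ hv := K.ty_x r hv

theorem slides_lo (r : ℕ) (a b : J) (h₀ : l[r]? = some a) (h₁ : l[r + 1]? = some b)
    (hab : a ≠ b) : Slides e l (t r) (x r) (x (r + 1)) where
  slide _ hv := (K.t_x_ne' r a b hv h₀ h₁ hab).symm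
  ty _ hv := K.ty_x _ hv

theorem slides_far (r s : ℕ) (h₀ : s ≠ r) (h₁ : s ≠ r + 1) : Slides e l (t r) (x s) (x s) where
  slide v _ := K.x_t_far' r s h₀ h₁ v
  ty _ hv := K.ty_x _ hv

end KLRSys

/-! ### Crossings of strands and pairs of strands -/

section Crossing

variable {I : Type u} {I₁ : Set I} {A : Type*} [Ring A]

open Classical in
/-- The product of elements `τ` that crosses the strands labelled by `φ(a)` and `φ(b)`. -/
noncomputable def crossing (I₁ : Set I) (t : ℕ → A) (p : ℕ) (a b : I) : A :=
  if a ∈ I₁ then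
    if b ∈ I₁ then
      if a = b then -(t (p + 1) * t (p + 2) * t p * t (p + 1))
      else t (p + 1) * t (p + 2) * t p * t (p + 1)
    else t p * t (p + 1)
  else
    if b ∈ I₁ then t (p + 1) * t p
    else t p

theorem crossing_single_single {a b : I} (ha : a ∉ I₁) (hb : b ∉ I₁) (t : ℕ → A) (p : ℕ) :
    crossing I₁ t p a b = t p := by simp [crossing, ha, hb]

theorem crossing_single_pair {a b : I} (ha : a ∉ I₁) (hb : b ∈ I₁) (t : ℕ → A) (p : ℕ) :
    crossing I₁ t p a b = t (p + 1) * t p := by simp [crossing, ha, hb]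

theorem crossing_pair_single {a b : I} (ha : a ∈ I₁) (hb : b ∉ I₁) (t : ℕ → A) (p : ℕ) :
    crossing I₁ t p a b = t p * t (p + 1) := by simp [crossing, ha, hb]

theorem crossing_pair_pair {a b : I} (ha : a ∈ I₁) (hb : b ∈ I₁) (hab : a ≠ b) (t : ℕ → A)
    (p : ℕ) : crossing I₁ t p a b = t (p + 1) * t (p + 2) * t p * t (p + 1) := by
  simp [crossing, ha, hb, hab]

theorem crossing_pair_self {a : I} (ha : a ∈ I₁) (t : ℕ → A) (p : ℕ) :
    crossing I₁ t p a a = -(t (p + 1) * t (p + 2) * t p * t (p + 1)) := by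
  simp [crossing, ha]

theorem phiVertex_pair {a : I} (ha : a ∈ I₁) : phiVertex I₁ a = [.one a ha, .two a ha] := by
  simp [phiVertex, ha]

theorem phiVertex_single {a : I} (ha : a ∉ I₁) : phiVertex I₁ a = [.zero a ha] := by
  simp [phiVertex, ha]

end Crossing

/-! ### Values of `Q` and of its divided differences for the doubled quiver -/

section Constants

variable {I : Type u} [Quiver.{v} I] {I₁ : Set I} {A : Type*} [Ring A]

/-- The single arrow `i¹ → i²` gives `Q_{i²,i¹}(u,v) = u - v`, of slope `1` in `u`; with the labels
exchanged the slope is `-1`. These two constants are the source of all signs below. -/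
theorem klrQDiff_two_one {i : I} (hi : i ∈ I₁) (y₁ y₂ y₃ : A) :
    klrQDiff (Doubled.two i hi) (Doubled.one i hi) y₁ y₂ y₃ = 1 := by
  simp [klrQDiff, arrowCount_two_one, arrowCount_one_two_self]

theorem klrQDiff_one_two {i : I} (hi : i ∈ I₁) (y₁ y₂ y₃ : A) :
    klrQDiff (Doubled.one i hi) (Doubled.two i hi) y₁ y₂ y₃ = -1 := by
  simp [klrQDiff, arrowCount_two_one, arrowCount_one_two_self]

theorem klrQ_one_two {i : I} (hi : i ∈ I₁) (y₁ y₂ : A) :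
    klrQ (Doubled.one i hi) (Doubled.two i hi) y₁ y₂ = y₂ - y₁ := by
  simp [klrQ, arrowCount_two_one, arrowCount_one_two_self]

theorem klrQ_self (i : I) (y₁ y₂ : A) : klrQ i i y₁ y₂ = 0 := by simp [klrQ]

theorem klrQ_eq_one {i j : I} (h : i ≠ j) (h₁ : arrowCount i j = 0) (h₂ : arrowCount j i = 0)
    (y₁ y₂ : A) : klrQ i j y₁ y₂ = 1 := by simp [klrQ, h, h₁, h₂]

theorem klrQ_eq_pow {i j : I} (h : i ≠ j) (h₂ : arrowCount j i = 0)
    (y₁ y₂ : A) : klrQ i j y₁ y₂ = (y₂ - y₁) ^ arrowCount i j := by simp [klrQ, h, h₂]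

theorem klrQ_eq_pow' {i j : I} (h : i ≠ j) (h₁ : arrowCount i j = 0)
    (y₁ y₂ : A) : klrQ i j y₁ y₂ = (y₁ - y₂) ^ arrowCount j i := by simp [klrQ, h, h₁]

theorem klrQDiff_eq_of_arrowCount {i j : I} (h : i ≠ j) (y₁ y₂ y₃ : A) :
    klrQDiff i j y₁ y₂ y₃ = (-1) ^ arrowCount i j *
      ∑ m ∈ Finset.range (arrowCount i j + arrowCount j i),
        (y₃ - y₂) ^ m * (y₁ - y₂) ^ (arrowCount i j + arrowCount j i - 1 - m) := by
  simp [klrQDiff, h]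

/-- Leibniz rule for the divided difference in `u` of `(b - u)^h (u - b)^n` between `u = a` and `u =
c`, where `P = c - b` and `M = a - b`: the difference of the first factor times the second one at
`c`, plus the first factor at `a` times the difference of the second one. -/
theorem geom_sum_split {P M : A} (hPM : Commute P M) (h n : ℕ) :
    P ^ n * ((-1) ^ h * ∑ m ∈ Finset.range h, P ^ m * M ^ (h - 1 - m)) +
        (-M) ^ h * ∑ m ∈ Finset.range n, P ^ m * M ^ (n - 1 - m) =
      (-1) ^ h * ∑ m ∈ Finset.range (h + n), P ^ m * M ^ (h + n - 1 - m) := by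
  -- On the right, the terms with `m < n` give the second summand and the terms with `n ≤ m` give
  -- the first one.
  rw [add_comm h n, Finset.sum_range_add, mul_add, add_comm]
  congr 1
  · rw [neg_pow, mul_assoc, Finset.mul_sum]
    congr 1
    refine Finset.sum_congr rfl fun m hm => ?_
    rw [Finset.mem_range] at hm
    rw [← mul_assoc, (hPM.symm.pow_pow h m).eq, mul_assoc, ← pow_add]
    congr 2; omega
  · have h1 : Commute (P ^ n) ((-1) ^ h) := ((Commute.neg_one_left P).pow_pow h n).symm
    rw [← mul_assoc, h1.eq, mul_assoc, Finset.mul_sum]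
    congr 1
    refine Finset.sum_congr rfl fun m hm => ?_
    rw [Finset.mem_range] at hm
    rw [← mul_assoc, ← pow_add]
    congr 2; omega

end Constants

/-! ### Dots and crossings when the unordered idempotents vanish -/

namespace KLRSys

variable {I : Type u} [Quiver.{v} I] {I₁ : Set I} {A : Type*} [Ring A]
  {e : List (Doubled I₁) → A} {x t : ℕ → A}
variable (K : KLRSys e x t) (hun : ∀ l, ¬ ok 0 l → e l = 0)
variable {l : List (Doubled I₁)} {v : A} {a b c : I}

section
include K hun

/-- The vector `τ_r v` has the type `s_r(l)`, and the idempotent of an unordered sequence is zero.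
-/
theorem t_eq_zero (h : Ty e l v) (r : ℕ) (hr : r + 1 < l.length) (hl : ¬ ok 0 (swapAt r l)) :
    t r * v = 0 := by
  rw [← (K.ty_t r hr h).eq, hun _ hl, zero_mul]

/-- Exchanging the two strands of the pair leads to an unordered sequence, so `τ_r` vanishes and `0
= τ_r² = Q_{i¹,i²}(x_r, x_{r+1}) = x_{r+1} - x_r`. Thus the two strands of a pair carry the same
dot. -/
theorem slides_pair (r : ℕ) (i : I) (hi : i ∈ I₁) (h₀ : l[r]? = some (.one i hi))
    (h₁ : l[r + 1]? = some (.two i hi)) (hr : r + 1 < l.length) (hl : ¬ ok 0 (swapAt r l)) :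
    Slides e l 1 (x (r + 1)) (x r) where
  slide v hv := by
    have h := K.t_sq' r _ _ hv h₀ h₁
    rw [K.t_eq_zero hun hv r hr hl, mul_zero, klrQ_one_two, sub_mul] at h
    simp [sub_eq_zero.1 h.symm]
  ty v hv := K.ty_x _ hv

/-- One side of the braid relation begins with a crossing that leads to an unordered sequence; what
is left is the constant correction term of `klrQDiff_two_one`. The next lemma is the mirror image,
for `i¹ i² i¹`. -/
theorem t_t_t_two (hv : Ty e l v) (r : ℕ) (i : I) (hi : i ∈ I₁) (h₀ : l[r]? = some (.two i hi))
    (h₁ : l[r + 1]? = some (.one i hi)) (h₂ : l[r + 2]? = some (.two i hi))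
    (hr : r + 2 < l.length) (hl : ¬ ok 0 (swapAt (r + 1) l)) :
    t r * (t (r + 1) * (t r * v)) = -v := by
  have h := K.braid_eq' r _ _ hv h₀ h₁ h₂
  rw [K.t_eq_zero hun hv (r + 1) hr hl, mul_zero, mul_zero, klrQDiff_two_one, one_mul] at h
  exact eq_neg_of_add_eq_zero_left h.symm

theorem t_t_t_one (hv : Ty e l v) (r : ℕ) (i : I) (hi : i ∈ I₁) (h₀ : l[r]? = some (.one i hi))
    (h₁ : l[r + 1]? = some (.two i hi)) (h₂ : l[r + 2]? = some (.one i hi))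
    (hr : r + 1 < l.length) (hl : ¬ ok 0 (swapAt r l)) :
    t (r + 1) * (t r * (t (r + 1) * v)) = -v := by
  have h := K.braid_eq' r _ _ hv h₀ h₁ h₂
  rwa [K.t_eq_zero hun hv r hr hl, mul_zero, mul_zero, klrQDiff_one_two, zero_add,
    neg_one_mul] at h

end

section
include K

theorem ty_crossing (h : Ty e (phiVertex I₁ a ++ phiVertex I₁ b) v) :
    Ty e (phiVertex I₁ b ++ phiVertex I₁ a) (crossing I₁ t 0 a b * v) := by
  by_cases ha : a ∈ I₁ <;> by_cases hb : b ∈ I₁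
  · rw [phiVertex_pair ha, phiVertex_pair hb] at *
    have h1 := (K.ty_act h [1, 2, 0, 1] (by simp)).1
    by_cases hab : a = b
    · subst hab
      rw [crossing_pair_self ha, neg_mul]
      simp only [mul_assoc]
      exact h1.neg
    · rw [crossing_pair_pair ha hb hab]
      simp only [mul_assoc]
      exact h1
  · rw [phiVertex_pair ha, phiVertex_single hb] at *
    rw [crossing_pair_single ha hb, mul_assoc]
    exact (K.ty_act h [0, 1] (by simp)).1
  · rw [phiVertex_single ha, phiVertex_pair hb] at *
    rw [crossing_single_pair ha hb, mul_assoc]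
    exact (K.ty_act h [1, 0] (by simp)).1
  · rw [phiVertex_single ha, phiVertex_single hb] at *
    rw [crossing_single_single ha hb]
    exact K.ty_t 0 (by simp) h

/-- The dot of a cable is taken on its first strand. Since `a ≠ b`, this strand crosses only strands
with labels different from its own, so the dot slides without correction. -/
theorem slides_crossing_left (hab : a ≠ b) :
    Slides e (phiVertex I₁ a ++ phiVertex I₁ b) (crossing I₁ t 0 a b) (x 0)
      (x (phiVertex I₁ a).length) := by
  by_cases ha : a ∈ I₁ <;> by_cases hb : b ∈ I₁
  · rw [crossing_pair_pair ha hb hab, phiVertex_pair ha, phiVertex_pair hb]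
    refine Slides.comp (l' := ([.one a ha, .one b hb, .two a ha, .two b hb] : List (Doubled I₁)))
      (Slides.comp (l' := ([.one b hb, .one a ha, .two a ha, .two b hb] : List (Doubled I₁)))
        (Slides.comp (l' := ([.one b hb, .one a ha, .two b hb, .two a ha] : List (Doubled I₁)))
          (K.slides_far 1 0 (by simp) (by simp)) (K.slides_far 2 0 (by simp) (by simp))
          fun v hv => K.ty_t 2 (by simp) hv)
        (K.slides_lo 0 _ _ rfl rfl (by simpa using hab)) fun v hv => K.ty_t 0 (by simp) hv)
      (K.slides_lo 1 _ _ rfl rfl (by simp)) fun v hv => K.ty_t 1 (by simp) hv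
  · rw [crossing_pair_single ha hb, phiVertex_pair ha, phiVertex_single hb]
    exact Slides.comp (l' := ([.one a ha, .zero b hb, .two a ha] : List (Doubled I₁)))
      (K.slides_lo 0 _ _ rfl rfl (by simp)) (K.slides_lo 1 _ _ rfl rfl (by simp))
      fun v hv => K.ty_t 1 (by simp) hv
  · rw [crossing_single_pair ha hb, phiVertex_single ha, phiVertex_pair hb]
    exact Slides.comp (l' := ([.one b hb, .zero a ha, .two b hb] : List (Doubled I₁)))
      (K.slides_far 1 0 (by simp) (by simp)) (K.slides_lo 0 _ _ rfl rfl (by simp))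
      fun v hv => K.ty_t 0 (by simp) hv
  · rw [crossing_single_single ha hb, phiVertex_single ha, phiVertex_single hb]
    exact K.slides_lo 0 _ _ rfl rfl (by simpa using hab)

theorem slides_crossing_right (hab : a ≠ b) :
    Slides e (phiVertex I₁ a ++ phiVertex I₁ b) (crossing I₁ t 0 a b)
      (x (phiVertex I₁ b).length) (x 0) := by
  by_cases ha : a ∈ I₁ <;> by_cases hb : b ∈ I₁
  · rw [crossing_pair_pair ha hb hab, phiVertex_pair ha, phiVertex_pair hb]
    refine Slides.comp (l' := ([.one a ha, .one b hb, .two a ha, .two b hb] : List (Doubled I₁)))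
      (Slides.comp (l' := ([.one b hb, .one a ha, .two a ha, .two b hb] : List (Doubled I₁)))
        (Slides.comp (l' := ([.one b hb, .one a ha, .two b hb, .two a ha] : List (Doubled I₁)))
          (K.slides_hi 1 _ _ rfl rfl (by simp)) (K.slides_far 2 1 (by simp) (by simp))
          fun v hv => K.ty_t 2 (by simp) hv)
        (K.slides_hi 0 _ _ rfl rfl (by simpa using hab)) fun v hv => K.ty_t 0 (by simp) hv)
      (K.slides_far 1 0 (by simp) (by simp)) fun v hv => K.ty_t 1 (by simp) hv
  · rw [crossing_pair_single ha hb, phiVertex_pair ha, phiVertex_single hb]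
    exact Slides.comp (l' := ([.one a ha, .zero b hb, .two a ha] : List (Doubled I₁)))
      (K.slides_hi 0 _ _ rfl rfl (by simp)) (K.slides_far 1 0 (by simp) (by simp))
      fun v hv => K.ty_t 1 (by simp) hv
  · rw [crossing_single_pair ha hb, phiVertex_single ha, phiVertex_pair hb]
    exact Slides.comp (l' := ([.one b hb, .zero a ha, .two b hb] : List (Doubled I₁)))
      (K.slides_hi 1 _ _ rfl rfl (by simp)) (K.slides_hi 0 _ _ rfl rfl (by simp))
      fun v hv => K.ty_t 0 (by simp) hv
  · rw [crossing_single_single ha hb, phiVertex_single ha, phiVertex_single hb]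
    exact K.slides_hi 0 _ _ rfl rfl (by simpa using hab)

end

section
include K hun

/-- For `a ∈ I₁` the dot meets its own label once, where the two strands `a¹` cross. The correction
removes `τ₀` from `τ₁ τ₂ τ₀ τ₁` and leaves `τ₁ τ₂ τ₁ v = -v`, which the sign in the crossing turns
into `+v`. -/
theorem crossing_mul_x_self (h : Ty e (phiVertex I₁ a ++ phiVertex I₁ a) v) :
    crossing I₁ t 0 a a * (x (phiVertex I₁ a).length * v) =
      x 0 * (crossing I₁ t 0 a a * v) + v := by
  by_cases ha : a ∈ I₁
  · rw [phiVertex_pair ha] at *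
    rw [crossing_pair_self ha]
    have h1 : Ty e [.one a ha, .one a ha, .two a ha, .two a ha] (t 1 * v) :=
      K.ty_t 1 (by simp) h
    have e1 : t 1 * (x 2 * v) = x 1 * (t 1 * v) :=
      K.t_x_ne' 1 _ _ h rfl rfl (by simp)
    have e2 : t 0 * (x 1 * (t 1 * v)) = x 0 * (t 0 * (t 1 * v)) + t 1 * v :=
      K.t_x_eq' 0 _ h1 rfl rfl
    have e3 : t 1 * (t 2 * (t 1 * v)) = -v :=
      K.t_t_t_two hun h 1 a ha rfl rfl rfl (by simp) (by simp [swapAt, ok])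
    simp only [List.length_cons, List.length_nil, zero_add,
      neg_mul, mul_assoc, Nat.reduceAdd, e1, e2, mul_add, e3, mul_neg]
    rw [K.x_t_far' 1 0 (by simp) (by simp), K.x_t_far' 2 0 (by simp) (by simp)]
    abel
  · rw [phiVertex_single ha] at *
    rw [crossing_single_single ha ha]
    exact K.t_x_eq' 0 _ h rfl rfl

theorem x_mul_crossing_self (h : Ty e (phiVertex I₁ a ++ phiVertex I₁ a) v) :
    x (phiVertex I₁ a).length * (crossing I₁ t 0 a a * v) =
      crossing I₁ t 0 a a * (x 0 * v) + v := by
  by_cases ha : a ∈ I₁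
  · rw [phiVertex_pair ha] at *
    rw [crossing_pair_self ha]
    have h1 : Ty e [.one a ha, .one a ha, .two a ha, .two a ha] (t 1 * v) :=
      K.ty_t 1 (by simp) h
    have h2 : Ty e [.one a ha, .one a ha, .two a ha, .two a ha] (t 2 * (t 0 * (t 1 * v))) :=
      (K.ty_act h [2, 0, 1] (by simp)).1
    have e1 : x 2 * (t 1 * (t 2 * (t 0 * (t 1 * v)))) =
        t 1 * (x 1 * (t 2 * (t 0 * (t 1 * v)))) := K.x_t_ne' 1 _ _ h2 rfl rfl (by simp)
    have e2 : x 1 * (t 0 * (t 1 * v)) = t 0 * (x 0 * (t 1 * v)) + t 1 * v :=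
      K.x_t_eq' 0 _ h1 rfl rfl
    have e3 : t 1 * (t 2 * (t 1 * v)) = -v :=
      K.t_t_t_two hun h 1 a ha rfl rfl rfl (by simp) (by simp [swapAt, ok])
    simp only [List.length_cons, List.length_nil, zero_add,
      neg_mul, mul_assoc, Nat.reduceAdd, e1, mul_neg]
    rw [K.x_t_far' 2 1 (by simp) (by simp), e2, K.x_t_far' 1 0 (by simp) (by simp), mul_add,
      mul_add, e3]
    abel
  · rw [phiVertex_single ha] at *
    rw [crossing_single_single ha ha]
    exact K.x_t_eq' 0 _ h rfl rfl

end

end KLRSys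

/-! ### Triples of labels without a correction term -/

section NoErr

variable {I : Type u} [Quiver.{v} I] {I₁ : Set I} {a b c : I}

theorem NoErr.of_ne {a b c : I} (h : a ≠ c) : NoErr a b c := fun h' => absurd h' h

theorem noErr_one_one (ha : a ∈ I₁) (hb : b ∈ I₁) (z : Doubled I₁) :
    NoErr (Doubled.one a ha) (.one b hb) z := fun _ =>
  Or.inr ⟨arrowCount_one_one ha hb, arrowCount_one_one hb ha⟩

theorem noErr_two_two (ha : a ∈ I₁) (hb : b ∈ I₁) (z : Doubled I₁) :
    NoErr (Doubled.two a ha) (.two b hb) z := fun _ =>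
  Or.inr ⟨arrowCount_two_two ha hb, arrowCount_two_two hb ha⟩

theorem noErr_one_two_one (ha : a ∈ I₁) (hb : b ∈ I₁) (hc : c ∈ I₁) (h : ¬ (a = b ∧ b = c)) :
    NoErr (Doubled.one a ha) (.two b hb) (.one c hc) := by
  intro h'
  have hac : a = c := by simpa using h'
  subst hac
  have hab : a ≠ b := fun hab => h ⟨hab, hab.symm⟩
  exact Or.inr ⟨arrowCount_one_two_ne ha hb hab, arrowCount_two_one hb ha⟩

theorem noErr_two_one_two (ha : a ∈ I₁) (hb : b ∈ I₁) (hc : c ∈ I₁) (h : ¬ (a = b ∧ b = c)) :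
    NoErr (Doubled.two a ha) (.one b hb) (.two c hc) := by
  intro h'
  have hac : a = c := by simpa using h'
  subst hac
  have hab : b ≠ a := fun hab => h ⟨hab.symm, hab⟩
  exact Or.inr ⟨arrowCount_two_one ha hb, arrowCount_one_two_ne hb ha hab⟩

end NoErr

/-! ### The quadratic relation for crossings of cables, and braid relations without correction -/

namespace KLRSys

section

variable {J : Type u} [Quiver.{v} J] {A : Type*} [Ring A] {e : List J → A} {x t : ℕ → A}
variable (K : KLRSys e x t) {l : List J} {v : A}
include K

theorem t_t_eq_self (h : Ty e l v) (r : ℕ) (a b : J)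
    (h₀ : l[r]? = some a) (h₁ : l[r + 1]? = some b) (hab : a ≠ b) (h₂ : arrowCount a b = 0)
    (h₃ : arrowCount b a = 0) : t r * (t r * v) = v := by
  rw [K.t_sq' r a b h h₀ h₁, klrQ_eq_one hab h₂ h₃, one_mul]

theorem t_t_eq_zero (h : Ty e l v) (r : ℕ) (a : J)
    (h₀ : l[r]? = some a) (h₁ : l[r + 1]? = some a) : t r * (t r * v) = 0 := by
  rw [K.t_sq' r a a h h₀ h₁, klrQ_self, zero_mul]

end

variable {I : Type u} [Quiver.{v} I] {I₁ : Set I} {A : Type*} [Ring A]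
  {e : List (Doubled I₁) → A} {x t : ℕ → A}
variable (K : KLRSys e x t)
variable {l : List (Doubled I₁)} {v : A} {a b c : I}

section
include K

variable (hun : ∀ l, ¬ ok 0 l → e l = 0)
variable (hI : ∀ i ∈ I₁, ∀ j ∈ I₁, arrowCount i j = 0)

/-- The two middle factors `τ₁²` act on the labels `a¹ a²` and give `x₂ - x₁`. The dot `x₂` commutes
with `τ₀` and the dot `x₁` with `τ₂`, so the first term contains `τ₀²` and the second one `τ₂²`,
each on two equal labels. -/
theorem crossing_sq_self (ha : a ∈ I₁)
    (h : Ty e (phiVertex I₁ a ++ phiVertex I₁ a) v) :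
    crossing I₁ t 0 a a * (crossing I₁ t 0 a a * v) = 0 := by
  rw [phiVertex_pair ha] at h
  rw [crossing_pair_self ha]
  have h1 : Ty e [.one a ha, .one a ha, .two a ha, .two a ha] (t 1 * v) := K.ty_t 1 (by simp) h
  have h2 : Ty e [.one a ha, .one a ha, .two a ha, .two a ha] (t 2 * (t 0 * (t 1 * v))) :=
    (K.ty_act h [2, 0, 1] (by simp)).1
  have h3 : Ty e [.one a ha, .one a ha, .two a ha, .two a ha] (t 0 * (t 1 * v)) :=
    (K.ty_act h [0, 1] (by simp)).1
  have e1 := K.t_sq' 1 _ _ h2 rfl rfl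
  rw [klrQ_one_two, sub_mul] at e1
  have e2 : t 2 * (t 2 * (t 0 * (t 1 * v))) = 0 := K.t_t_eq_zero h3 2 _ rfl rfl
  have e3 : t 0 * (t 2 * (t 0 * (t 1 * v))) = 0 := by
    rw [K.t_t_far' 0 2 (by simp), K.t_t_eq_zero h1 0 _ rfl rfl, mul_zero]
  simp only [zero_add, neg_mul, mul_neg, neg_neg, mul_assoc]
  rw [e1, mul_sub, mul_sub, ← K.x_t_far' 0 2 (by simp) (by simp), e3, K.t_t_far' 2 0 (by simp),
    ← K.x_t_far' 2 1 (by simp) (by simp), e2]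
  simp

/-- For `a ≠ b` in `I₁` no arrow of the doubled quiver joins a strand of `φ(a)` to a strand of
`φ(b)`, so each of the four crossings squares to `1`. -/
theorem crossing_sq_pair_pair (ha : a ∈ I₁) (hb : b ∈ I₁) (hab : a ≠ b)
    (h : Ty e (phiVertex I₁ a ++ phiVertex I₁ b) v) :
    crossing I₁ t 0 b a * (crossing I₁ t 0 a b * v) = v := by
  rw [phiVertex_pair ha, phiVertex_pair hb] at h
  rw [crossing_pair_pair ha hb hab, crossing_pair_pair hb ha hab.symm]
  have h1 : Ty e [.one a ha, .one b hb, .two a ha, .two b hb] (t 1 * v) := K.ty_t 1 (by simp) h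
  have h2 := K.ty_t 0 (by simp) h1
  have h3 := K.ty_t 2 (by simp [swapAt]) h2
  simp only [zero_add, mul_assoc]
  rw [K.t_t_eq_self h3 1 (.one a ha) (.two b hb) rfl rfl (by simp)
      (arrowCount_one_two_ne ha hb hab) (arrowCount_two_one hb ha),
    K.t_t_far' 0 2 (by simp),
    K.t_t_eq_self h1 0 (.one a ha) (.one b hb) rfl rfl (by simpa using hab)
      (arrowCount_one_one ha hb) (arrowCount_one_one hb ha),
    K.t_t_eq_self h1 2 (.two a ha) (.two b hb) rfl rfl (by simpa using hab)
      (arrowCount_two_two ha hb) (arrowCount_two_two hb ha),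
    K.t_t_eq_self h 1 (.two a ha) (.one b hb) rfl rfl (by simp)
      (arrowCount_two_one ha hb) (arrowCount_one_two_ne hb ha hab.symm)]

include hun

/-- The double crossing with `b¹` contributes the factor for the arrows `a → b`, the one with `b²`
the factor for the arrows `b → a`. They multiply to `Q_{a,b}` because the dots on `b¹` and `b²`
agree. -/
theorem crossing_sq_single_pair (ha : a ∉ I₁) (hb : b ∈ I₁)
    (h : Ty e (phiVertex I₁ a ++ phiVertex I₁ b) v) :
    crossing I₁ t 0 b a * (crossing I₁ t 0 a b * v) = klrQ a b (x 0) (x 1) * v := by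
  rw [phiVertex_single ha, phiVertex_pair hb] at h
  have hab : a ≠ b := fun h => ha (h ▸ hb)
  rw [crossing_single_pair ha hb, crossing_pair_single hb ha]
  have h1 : Ty e [.one b hb, .zero a ha, .two b hb] (t 0 * v) := K.ty_t 0 (by simp) h
  simp only [zero_add, mul_assoc]
  have s1 : Slides e ([.zero a ha] ++ [.one b hb, .two b hb]) (t 0)
      (klrQ (Doubled.zero a ha) (.two b hb) (x 1) (x 2))
      (klrQ (Doubled.zero a ha) (.two b hb) (x 0) (x 2)) :=
    Slides.klrQ _ _ (K.slides_hi 0 _ _ rfl rfl (by simp)) (K.slides_far 0 2 (by simp) (by simp))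
  have s2 : Slides e ([.zero a ha] ++ [.one b hb, .two b hb]) 1
      (klrQ (Doubled.zero a ha) (.two b hb) (x 0) (x 2))
      (klrQ (Doubled.zero a ha) (.two b hb) (x 0) (x 1)) :=
    Slides.klrQ _ _ (K.slides_x_one 0)
      (K.slides_pair hun 1 b hb rfl rfl (by simp) (by simp [swapAt, ok]))
  have e2 := s2.slide v h
  rw [one_mul, one_mul] at e2
  rw [K.t_sq' 1 _ _ h1 rfl rfl, s1.slide v h, e2, K.t_sq' 0 _ _ (s2.ty v h) rfl rfl,
    klrQ_eq_pow (by simp) (arrowCount_one_zero hb ha),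
    klrQ_eq_pow' (by simp) (arrowCount_zero_two ha hb), arrowCount_zero_one, arrowCount_two_zero,
    ← mul_assoc]
  simp [klrQ, hab]

theorem crossing_sq_pair_single (ha : a ∈ I₁) (hb : b ∉ I₁)
    (h : Ty e (phiVertex I₁ a ++ phiVertex I₁ b) v) :
    crossing I₁ t 0 b a * (crossing I₁ t 0 a b * v) = klrQ a b (x 0) (x 2) * v := by
  rw [phiVertex_pair ha, phiVertex_single hb] at h
  have hab : a ≠ b := fun h => hb (h ▸ ha)
  rw [crossing_pair_single ha hb, crossing_single_pair hb ha]
  have h1 : Ty e [.one a ha, .zero b hb, .two a ha] (t 1 * v) := K.ty_t 1 (by simp) h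
  simp only [zero_add, mul_assoc]
  have s1 : Slides e ([.one a ha, .two a ha] ++ [.zero b hb]) (t 1)
      (klrQ (Doubled.one a ha) (.zero b hb) (x 0) (x 1))
      (klrQ (Doubled.one a ha) (.zero b hb) (x 0) (x 2)) :=
    Slides.klrQ _ _ (K.slides_far 1 0 (by simp) (by simp)) (K.slides_lo 1 _ _ rfl rfl (by simp))
  have s0 : Slides e ([.one a ha, .two a ha] ++ [.zero b hb]) 1
      (klrQ (Doubled.one a ha) (.zero b hb) (x 0) (x 2))
      (klrQ (Doubled.one a ha) (.zero b hb) (x 0) (x 2)) :=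
    Slides.klrQ _ _ (K.slides_x_one 0) (K.slides_x_one 2)
  have s2 : Slides e ([.one a ha, .two a ha] ++ [.zero b hb]) 1
      (klrQ (Doubled.two a ha) (.zero b hb) (x 1) (x 2))
      (klrQ (Doubled.two a ha) (.zero b hb) (x 0) (x 2)) :=
    Slides.klrQ _ _ (K.slides_pair hun 0 a ha rfl rfl (by simp) (by simp [swapAt, ok]))
      (K.slides_x_one 2)
  have e2 := s2.slide _ (s0.ty v h)
  rw [one_mul, one_mul] at e2
  rw [K.t_sq' 0 _ _ h1 rfl rfl, s1.slide v h, K.t_sq' 1 _ _ (s0.ty v h) rfl rfl, e2,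
    klrQ_eq_pow (by simp) (arrowCount_zero_two hb ha),
    klrQ_eq_pow' (by simp) (arrowCount_one_zero ha hb), arrowCount_zero_one, arrowCount_two_zero,
    ← mul_assoc]
  simp [klrQ, hab]

include hI in
theorem crossing_sq (h : Ty e (phiVertex I₁ a ++ phiVertex I₁ b) v) :
    crossing I₁ t 0 b a * (crossing I₁ t 0 a b * v) =
      klrQ a b (x 0) (x (phiVertex I₁ a).length) * v := by
  by_cases ha : a ∈ I₁ <;> by_cases hb : b ∈ I₁
  · by_cases hab : a = b
    · subst hab
      rw [K.crossing_sq_self ha h, klrQ_self, zero_mul]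
    · rw [K.crossing_sq_pair_pair ha hb hab h,
        klrQ_eq_one hab (hI a ha b hb) (hI b hb a ha), one_mul]
  · rw [K.crossing_sq_pair_single hun ha hb h, phiVertex_pair ha]; rfl
  · rw [K.crossing_sq_single_pair hun ha hb h, phiVertex_single ha]; rfl
  · rw [phiVertex_single ha, phiVertex_single hb] at h
    rw [crossing_single_single ha hb, crossing_single_single hb ha,
      K.t_sq' 0 _ _ h rfl rfl, phiVertex_single ha]
    by_cases hab : a = b <;> simp [klrQ, arrowCount_zero_zero, hab]

end

section
include K

/-- The two braid moves with a correction term do no harm: each correction term contains the square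
of a crossing of two strands with the same label. -/
theorem cable_pair_pair_pair_self (ha : a ∈ I₁)
    (h : Ty e [.one a ha, .two a ha, .one a ha, .two a ha, .one a ha, .two a ha] v) :
    act t [3, 4, 2, 3, 1, 2, 0, 1, 3, 4, 2, 3] v =
      act t [1, 2, 0, 1, 3, 4, 2, 3, 1, 2, 0, 1] v := by
  refine K.cable_pair_pair_pair h (noErr_one_one _ _ _) (NoErr.of_ne (by simp))
    (noErr_one_one _ _ _) (noErr_two_two _ _ _) (NoErr.of_ne (by simp)) (noErr_two_two _ _ _) ?_ ?_
  · have h1 := K.act_braid_eq h [3, 4, 2, 1] 2 [0, 1, 4, 2, 3] _ _ rfl rfl rfl (by simp)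
    refine h1.trans ?_
    -- Far commutations bring the two letters `4` together, where they act on two strands labelled
    -- `a²`.
    have h4 : act t ([3, 4, 2, 1] ++ [0, 1, 4, 2, 3]) v =
        act t ([3, 2, 1, 0, 1] ++ [4, 4, 2, 3]) v := K.act_farSwaps [1, 2, 3, 4] _
    have h5 : act t [4, 4, 2, 3] v = 0 :=
      K.t_t_eq_zero (K.ty_act h [2, 3] (by simp)).1 4 _ rfl rfl
    rw [act_append _ [3, 2, 1, 0, 1], h5, act_zero] at h4
    rw [klrQDiff_two_one, one_mul, ← act_append, h4, add_zero]
    rfl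
  · have h1 := K.act_braid_eq h [1, 2, 3, 4, 0] 1 [0, 3, 2, 1] _ _ rfl rfl rfl (by simp)
    refine h1.trans ?_
    -- Here the two letters `0` are already adjacent and act on two strands labelled `a¹`.
    have h4 : act t ([1, 2, 3, 4, 0] ++ [0, 3, 2, 1]) v =
        act t ([1, 2, 3, 4] ++ [0, 0, 3, 2, 1]) v := rfl
    have h5 : act t [0, 0, 3, 2, 1] v = 0 :=
      K.t_t_eq_zero (K.ty_act h [3, 2, 1] (by simp)).1 0 _ rfl rfl
    rw [act_append _ [1, 2, 3, 4], h5, act_zero] at h4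
    rw [klrQDiff_one_two, neg_one_mul, act_neg, ← act_append, h4, neg_zero, add_zero]
    rfl

/-- Both sides contain the crossings of `a, b`, of `a, c` and of `b, c` exactly once, so the signs
agree and each case is a cable lemma or the ordinary braid relation. Under `hne` no correction
survives. -/
theorem crossing_braid_ne (hne : a ≠ c ∨ (a ∈ I₁ ∧ b ∈ I₁))
    (h : Ty e (phiVertex I₁ a ++ phiVertex I₁ b ++ phiVertex I₁ c) v) :
    crossing I₁ t (phiVertex I₁ c).length a b *
        (crossing I₁ t 0 a c * (crossing I₁ t (phiVertex I₁ a).length b c * v)) =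
      crossing I₁ t 0 b c *
        (crossing I₁ t (phiVertex I₁ b).length a c * (crossing I₁ t 0 a b * v)) := by
  by_cases ha : a ∈ I₁ <;> by_cases hb : b ∈ I₁ <;> by_cases hc : c ∈ I₁
  · rw [phiVertex_pair ha, phiVertex_pair hb, phiVertex_pair hc] at *
    have key : act t [3, 4, 2, 3, 1, 2, 0, 1, 3, 4, 2, 3] v =
        act t [1, 2, 0, 1, 3, 4, 2, 3, 1, 2, 0, 1] v := by
      by_cases habc : a = b ∧ b = c
      · obtain ⟨rfl, rfl⟩ := habc
        exact K.cable_pair_pair_pair_self ha h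
      · exact K.cable_pair_pair_pair h (noErr_one_one _ _ _) (NoErr.of_ne (by simp))
          (noErr_one_one _ _ _) (noErr_two_two _ _ _) (NoErr.of_ne (by simp)) (noErr_two_two _ _ _)
          (K.act_braid h [3, 4, 2, 1] 2 [0, 1, 4, 2, 3] _ _ _ rfl rfl rfl
            (noErr_two_one_two ha hb hc habc) (by simp))
          (K.act_braid h [1, 2, 3, 4, 0] 1 [0, 3, 2, 1] _ _ _ rfl rfl rfl
            (noErr_one_two_one ha hb hc habc) (by simp))
    simp only [crossing, ha, hb, hc, if_true]
    split_ifs <;> simp only [neg_mul, mul_neg, mul_assoc, neg_inj] <;> exact key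
  · rw [phiVertex_pair ha, phiVertex_pair hb, phiVertex_single hc] at *
    have key := K.cable_pair_pair_single h (NoErr.of_ne (by simp)) (NoErr.of_ne (by simp))
      (NoErr.of_ne (by simp)) (NoErr.of_ne (by simp))
    simp only [crossing, ha, hb, hc, if_true, if_false]
    split_ifs <;> simp only [neg_mul, mul_neg, mul_assoc, neg_inj] <;> exact key
  · have hac : a ≠ c := hne.resolve_right fun h => hb h.2
    rw [phiVertex_pair ha, phiVertex_single hb, phiVertex_pair hc] at *
    have key := K.cable_pair_single_pair h (NoErr.of_ne (by simpa using hac))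
      (NoErr.of_ne (by simp)) (NoErr.of_ne (by simp)) (NoErr.of_ne (by simpa using hac))
    simp only [crossing, ha, hb, hc, if_true, if_false, hac, mul_assoc]
    exact key
  · rw [phiVertex_pair ha, phiVertex_single hb, phiVertex_single hc] at *
    have key := K.cable_pair_single_single h (NoErr.of_ne (by simp)) (NoErr.of_ne (by simp))
    simp only [crossing, ha, hb, hc, if_true, if_false, mul_assoc]
    exact key
  · rw [phiVertex_single ha, phiVertex_pair hb, phiVertex_pair hc] at *
    have key := K.cable_single_pair_pair h (NoErr.of_ne (by simp)) (NoErr.of_ne (by simp))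
      (NoErr.of_ne (by simp)) (NoErr.of_ne (by simp))
    simp only [crossing, ha, hb, hc, if_true, if_false]
    split_ifs <;> simp only [neg_mul, mul_neg, mul_assoc, neg_inj] <;> exact key
  · have hac : a ≠ c := hne.resolve_right fun h => ha h.1
    rw [phiVertex_single ha, phiVertex_pair hb, phiVertex_single hc] at *
    have key := K.cable_single_pair_single h (NoErr.of_ne (by simpa using hac))
      (NoErr.of_ne (by simpa using hac))
    simp only [crossing, ha, hb, hc, if_true, if_false, mul_assoc]
    exact key
  · rw [phiVertex_single ha, phiVertex_single hb, phiVertex_pair hc] at *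
    have key := K.cable_single_single_pair h (NoErr.of_ne (by simp)) (NoErr.of_ne (by simp))
    simp only [crossing, ha, hb, hc, if_true, if_false, mul_assoc]
    exact key
  · have hac : a ≠ c := hne.resolve_right fun h => ha h.1
    rw [phiVertex_single ha, phiVertex_single hb, phiVertex_single hc] at *
    simp only [crossing, ha, hb, hc, if_false]
    exact K.braid_ne' 0 _ _ h rfl rfl (by simpa using hac)

end

end KLRSys

/-! ### Braid relations with a correction term -/

namespace KLRSys

variable {I : Type u} [Quiver.{v} I] {I₁ : Set I} {A : Type*} [Ring A]
  {e : List (Doubled I₁) → A} {x t : ℕ → A}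
variable (K : KLRSys e x t)
variable {l : List (Doubled I₁)} {v : A} {a b c : I}
variable (hun : ∀ l, ¬ ok 0 l → e l = 0)
variable (hI : ∀ i ∈ I₁, ∀ j ∈ I₁, arrowCount i j = 0)
include K

theorem commute_x_sub (p q r s : ℕ) : Commute (x p - x q) (x r - x s) :=
  ((Commute.sub_right (K.x_mul_x p r) (K.x_mul_x p s)).sub_left
    (Commute.sub_right (K.x_mul_x q r) (K.x_mul_x q s)))

include hun

/-- Two braid moves have correction terms, for the triples `a, b¹, a` and `a, b², a`. In each of
them the other strand of the pair still crosses a strand `a` twice, which contributes its quadratic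
factor. The sum is the divided difference of `Q_{a,b}` by the Leibniz rule. -/
theorem crossing_braid_single_pair (ha : a ∉ I₁) (hb : b ∈ I₁)
    (h : Ty e (phiVertex I₁ a ++ phiVertex I₁ b ++ phiVertex I₁ a) v) :
    crossing I₁ t 1 a b * (crossing I₁ t 0 a a * (crossing I₁ t 1 b a * v)) =
      crossing I₁ t 0 b a * (crossing I₁ t 2 a a * (crossing I₁ t 0 a b * v)) +
        klrQDiff a b (x 0) (x 1) (x 3) * v := by
  have hab : a ≠ b := fun h => ha (h ▸ hb)
  rw [phiVertex_single ha, phiVertex_pair hb] at h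
  rw [crossing_single_pair ha hb, crossing_single_single ha ha, crossing_single_single ha ha,
    crossing_single_pair ha hb, crossing_pair_single hb ha, crossing_pair_single hb ha]
  simp only [mul_assoc, zero_add, Nat.reduceAdd]
  have h1 : act t [2, 1, 0, 1, 2] v = act t [2, 0, 1, 0, 2] v +
      act t [2] (klrQDiff (Doubled.zero a ha) (.one b hb) (x 0) (x 1) (x 2) * act t [2] v) :=
    K.act_braid_eq h [2] 0 [2] _ _ rfl rfl rfl (by simp)
  have h2 : act t [2, 0, 1, 0, 2] v = act t [0, 2, 1, 2, 0] v := K.act_farSwaps [0, 3] _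
  have h3 : act t [0, 2, 1, 2, 0] v = act t [0, 1, 2, 1, 0] v +
      act t [0] (klrQDiff (Doubled.zero a ha) (.two b hb) (x 1) (x 2) (x 3) * act t [0] v) :=
    K.act_braid_eq h [0] 1 [0] _ _ rfl rfl rfl (by simp)
  have s1 : Slides e ([Doubled.zero a ha] ++ [.one b hb, .two b hb] ++ [.zero a ha]) (t 2)
      (klrQDiff (Doubled.zero a ha) (.one b hb) (x 0) (x 1) (x 2))
      (klrQDiff (Doubled.zero a ha) (.one b hb) (x 0) (x 1) (x 3)) :=
    Slides.klrQDiff _ _ (K.slides_far 2 0 (by simp) (by simp)) (K.slides_far 2 1 (by simp) (by simp))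
      (K.slides_lo 2 _ _ rfl rfl (by simp))
  have s2 : Slides e ([Doubled.zero a ha] ++ [.one b hb, .two b hb] ++ [.zero a ha]) (t 0)
      (klrQDiff (Doubled.zero a ha) (.two b hb) (x 1) (x 2) (x 3))
      (klrQDiff (Doubled.zero a ha) (.two b hb) (x 0) (x 2) (x 3)) :=
    Slides.klrQDiff _ _ (K.slides_hi 0 _ _ rfl rfl (by simp)) (K.slides_far 0 2 (by simp) (by simp))
      (K.slides_far 0 3 (by simp) (by simp))
  have s3 : Slides e ([Doubled.zero a ha] ++ [.one b hb, .two b hb] ++ [.zero a ha]) 1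
      (klrQDiff (Doubled.zero a ha) (.two b hb) (x 0) (x 2) (x 3))
      (klrQDiff (Doubled.zero a ha) (.two b hb) (x 0) (x 1) (x 3)) :=
    Slides.klrQDiff _ _ (K.slides_x_one 0)
      (K.slides_pair hun 1 b hb rfl rfl (by simp) (by simp [swapAt, ok])) (K.slides_x_one 3)
  have s4 : Slides e ([Doubled.zero a ha] ++ [.one b hb, .two b hb] ++ [.zero a ha]) 1
      (klrQ (Doubled.two b hb) (.zero a ha) (x 2) (x 3))
      (klrQ (Doubled.two b hb) (.zero a ha) (x 1) (x 3)) :=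
    Slides.klrQ _ _
      (K.slides_pair hun 1 b hb rfl rfl (by simp) (by simp [swapAt, ok])) (K.slides_x_one 3)
  have e3 := s3.slide v h
  have e4 := s4.slide _ (s1.ty v h)
  rw [one_mul, one_mul] at e3 e4
  have f1 : act t [2] (klrQDiff (Doubled.zero a ha) (.one b hb) (x 0) (x 1) (x 2) * act t [2] v) =
      klrQ (Doubled.two b hb) (.zero a ha) (x 1) (x 3) *
        (klrQDiff (Doubled.zero a ha) (.one b hb) (x 0) (x 1) (x 3) * v) := by
    change t 2 * (_ * (t 2 * v)) = _
    rw [s1.slide v h, K.t_sq' 2 _ _ (s1.ty v h) rfl rfl, e4]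
  have f2 : act t [0] (klrQDiff (Doubled.zero a ha) (.two b hb) (x 1) (x 2) (x 3) * act t [0] v) =
      klrQ (Doubled.zero a ha) (.one b hb) (x 0) (x 1) *
        (klrQDiff (Doubled.zero a ha) (.two b hb) (x 0) (x 1) (x 3) * v) := by
    change t 0 * (_ * (t 0 * v)) = _
    rw [s2.slide v h, K.t_sq' 0 _ _ (s2.ty v h) rfl rfl, e3]
  refine h1.trans ?_
  rw [h2, h3, f1, f2, add_assoc]
  refine congrArg₂ (· + ·) rfl ?_
  rw [← mul_assoc, ← mul_assoc, ← add_mul]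
  congr 1
  -- Only commuting dots are left; this is `geom_sum_split` for `P = x₃ - x₁` and `M = x₀ - x₁`.
  rw [klrQ_eq_pow (by simp) (arrowCount_zero_two ha hb),
    klrQ_eq_pow (by simp) (arrowCount_one_zero hb ha),
    klrQDiff_eq_of_arrowCount (by simp), klrQDiff_eq_of_arrowCount (by simp),
    klrQDiff_eq_of_arrowCount hab, arrowCount_zero_two, arrowCount_one_zero, arrowCount_zero_one,
    arrowCount_two_zero]
  have g := geom_sum_split (K.commute_x_sub 3 1 0 1) (arrowCount a b) (arrowCount b a)
  rw [neg_sub, add_comm] at g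
  simpa using g

/-- The correction terms come from the triples `a², b, a²` and `a¹, b, a¹`. In each of them the
crossings among the strands of the two pairs reduce to a word `τ τ τ` with the value `-1`, and a
squared crossing with `b` remains. Each side contains one crossing of `φ(a)` with itself, whose sign
corrects the sign of the total. -/
theorem crossing_braid_pair_single (ha : a ∈ I₁) (hb : b ∉ I₁)
    (h : Ty e (phiVertex I₁ a ++ phiVertex I₁ b ++ phiVertex I₁ a) v) :
    crossing I₁ t 2 a b * (crossing I₁ t 0 a a * (crossing I₁ t 2 b a * v)) =
      crossing I₁ t 0 b a * (crossing I₁ t 1 a a * (crossing I₁ t 0 a b * v)) +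
        klrQDiff a b (x 0) (x 2) (x 3) * v := by
  have hab : a ≠ b := fun h => hb (h ▸ ha)
  rw [phiVertex_single hb, phiVertex_pair ha] at h
  have h1 : act t [2, 3, 1, 2, 0, 1, 3, 2] v = act t [2, 1, 3, 2, 3, 0, 1, 2] v :=
    K.act_farSwaps [1, 5, 4] _
  have h2 : act t [2, 1, 3, 2, 3, 0, 1, 2] v = act t [2, 1, 2, 3, 2, 0, 1, 2] v +
      act t [2, 1] (klrQDiff (Doubled.two a ha) (.zero b hb) (x 2) (x 3) (x 4) *
        act t [0, 1, 2] v) := K.act_braid_eq h [2, 1] 2 [0, 1, 2] _ _ rfl rfl rfl (by simp)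
  have h3 : act t [2, 1, 2, 3, 2, 0, 1, 2] v = act t [1, 2, 1, 3, 2, 0, 1, 2] v :=
    K.act_braid h [] 1 [3, 2, 0, 1, 2] _ _ _ rfl rfl rfl (NoErr.of_ne (by simp)) (by simp)
  have h4 : act t [1, 2, 1, 3, 2, 0, 1, 2] v = act t [1, 2, 1, 3, 0, 2, 1, 2] v :=
    K.act_farSwaps [4] _
  have h5 : act t [1, 2, 1, 3, 0, 2, 1, 2] v = act t [1, 2, 1, 3, 0, 1, 2, 1] v :=
    K.act_braid h [1, 2, 1, 3, 0] 1 [] _ _ _ rfl rfl rfl (NoErr.of_ne (by simp)) (by simp)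
  have h6 : act t [1, 2, 1, 3, 0, 1, 2, 1] v = act t [1, 2, 3, 1, 0, 1, 2, 1] v :=
    K.act_farSwaps [2] _
  have h7 : act t [1, 2, 3, 1, 0, 1, 2, 1] v = act t [1, 2, 3, 0, 1, 0, 2, 1] v +
      act t [1, 2, 3] (klrQDiff (Doubled.one a ha) (.zero b hb) (x 0) (x 1) (x 2) *
        act t [2, 1] v) := K.act_braid_eq h [1, 2, 3] 0 [2, 1] _ _ rfl rfl rfl (by simp)
  have h8 : act t [1, 2, 3, 0, 1, 0, 2, 1] v = act t [1, 0, 2, 3, 1, 2, 0, 1] v :=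
    K.act_farSwaps [2, 1, 5] _
  let L : List (Doubled I₁) := [.one a ha, .two a ha, .zero b hb, .one a ha, .two a ha]
  have s1 : Slides e L (t 0 * t 1 * t 2)
      (klrQDiff (Doubled.two a ha) (.zero b hb) (x 2) (x 3) (x 4))
      (klrQDiff (Doubled.two a ha) (.zero b hb) (x 1) (x 2) (x 4)) := by
    refine Slides.comp (l' := ([.one a ha, .two a ha, .one a ha, .zero b hb, .two a ha] :
        List (Doubled I₁)))
      (Slides.comp (l' := ([.one a ha, .one a ha, .two a ha, .zero b hb, .two a ha] :
        List (Doubled I₁)))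
        (Slides.klrQDiff _ _ (K.slides_far 0 2 (by simp) (by simp))
          (K.slides_far 0 3 (by simp) (by simp)) (K.slides_far 0 4 (by simp) (by simp)))
        (Slides.klrQDiff _ _ (K.slides_hi 1 _ _ rfl rfl (by simp))
          (K.slides_far 1 3 (by simp) (by simp)) (K.slides_far 1 4 (by simp) (by simp)))
        fun v hv => K.ty_t 1 (by simp) hv)
      (Slides.klrQDiff _ _ (K.slides_far 2 1 (by simp) (by simp))
          (K.slides_hi 2 _ _ rfl rfl (by simp)) (K.slides_far 2 4 (by simp) (by simp)))
      fun v hv => K.ty_t 2 (by simp [L]) hv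
  have s2 : Slides e L (t 2 * t 1)
      (klrQDiff (Doubled.one a ha) (.zero b hb) (x 0) (x 1) (x 2))
      (klrQDiff (Doubled.one a ha) (.zero b hb) (x 0) (x 2) (x 3)) := by
    refine Slides.comp (l' := ([.one a ha, .zero b hb, .two a ha, .one a ha, .two a ha] :
        List (Doubled I₁)))
      (Slides.klrQDiff _ _ (K.slides_far 2 0 (by simp) (by simp))
          (K.slides_far 2 1 (by simp) (by simp)) (K.slides_lo 2 _ _ rfl rfl (by simp)))
      (Slides.klrQDiff _ _ (K.slides_far 1 0 (by simp) (by simp))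
        (K.slides_lo 1 _ _ rfl rfl (by simp)) (K.slides_far 1 3 (by simp) (by simp)))
      fun v hv => K.ty_t 1 (by simp [L]) hv
  have p0 : Slides e L 1 (x 1) (x 0) :=
    K.slides_pair hun 0 a ha rfl rfl (by simp [L]) (by simp [L, swapAt, ok])
  have p3 : Slides e L 1 (x 4) (x 3) :=
    K.slides_pair hun 3 a ha rfl rfl (by simp [L]) (by simp [L, swapAt, ok])
  have s3 : Slides e L 1 (klrQDiff (Doubled.two a ha) (.zero b hb) (x 1) (x 2) (x 4))
      (klrQDiff (Doubled.two a ha) (.zero b hb) (x 0) (x 2) (x 3)) :=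
    Slides.klrQDiff _ _ p0 (K.slides_x_one 2) p3
  have s4 : Slides e L 1 (klrQ (Doubled.two a ha) (.zero b hb) (x 1) (x 2))
      (klrQ (Doubled.two a ha) (.zero b hb) (x 0) (x 2)) :=
    Slides.klrQ _ _ p0 (K.slides_x_one 2)
  have e3 := s3.slide v h
  have e4 := s4.slide _ (s2.ty v h)
  rw [one_mul, one_mul] at e3 e4
  -- After the divided difference has been moved to the right, the word contains `τ₁ τ₀ τ₁` on the
  -- labels `a¹ a² a¹`, enclosed by two factors `τ₂`.
  have f1 : act t [2, 1] (klrQDiff (Doubled.two a ha) (.zero b hb) (x 2) (x 3) (x 4) *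
      act t [0, 1, 2] v) = -(klrQ (Doubled.zero b hb) (.one a ha) (x 2) (x 3) *
        (klrQDiff (Doubled.two a ha) (.zero b hb) (x 0) (x 2) (x 3) * v)) := by
    have g := s1.slide v h
    have h9 := s1.ty v h
    rw [e3] at g h9
    simp only [mul_assoc] at g
    change t 2 * (t 1 * (_ * (t 0 * (t 1 * (t 2 * v))))) = _
    rw [g, K.t_t_t_one hun (K.ty_t 2 (by simp [L]) h9) 0 a ha rfl rfl rfl
        (by simp [length_swapAt, L]) (by simp [L, swapAt, ok]),
      mul_neg, K.t_sq' 2 _ _ h9 rfl rfl]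
  -- Likewise for `τ₂ τ₃ τ₂` on the labels `a² a¹ a²`, enclosed by two factors `τ₁`.
  have f2 : act t [1, 2, 3] (klrQDiff (Doubled.one a ha) (.zero b hb) (x 0) (x 1) (x 2) *
      act t [2, 1] v) = -(klrQ (Doubled.two a ha) (.zero b hb) (x 0) (x 2) *
        (klrQDiff (Doubled.one a ha) (.zero b hb) (x 0) (x 2) (x 3) * v)) := by
    have g := s2.slide v h
    have h9 := s2.ty v h
    simp only [mul_assoc] at g
    change t 1 * (t 2 * (t 3 * (_ * (t 2 * (t 1 * v))))) = _
    rw [g, K.t_t_t_two hun (K.ty_t 1 (by simp [L]) h9) 2 a ha rfl rfl rfl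
        (by simp [length_swapAt, L]) (by simp [L, swapAt, ok]),
      mul_neg, K.t_sq' 1 _ _ h9 rfl rfl, e4]
  have key : act t [2, 3, 1, 2, 0, 1, 3, 2] v + klrQDiff a b (x 0) (x 2) (x 3) * v =
      act t [1, 0, 2, 3, 1, 2, 0, 1] v := by
    rw [h1, h2, h3, h4, h5, h6, h7, h8, f1, f2, add_assoc, add_assoc]
    refine add_eq_left.2 ?_
    rw [← mul_assoc, ← mul_assoc, ← add_assoc, ← neg_add, ← add_mul, neg_add_eq_zero]
    congr 1
    rw [klrQ_eq_pow (by simp) (arrowCount_one_zero ha hb),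
      klrQ_eq_pow (by simp) (arrowCount_zero_two hb ha),
      klrQDiff_eq_of_arrowCount (by simp), klrQDiff_eq_of_arrowCount (by simp),
      klrQDiff_eq_of_arrowCount hab, arrowCount_zero_two, arrowCount_one_zero,
      arrowCount_zero_one, arrowCount_two_zero]
    have g := geom_sum_split (K.commute_x_sub 3 2 0 2) (arrowCount a b) (arrowCount b a)
    rw [neg_sub, add_comm] at g
    simpa using g
  rw [crossing_pair_single ha hb, crossing_pair_self ha, crossing_pair_self ha,
    crossing_pair_single ha hb, crossing_single_pair hb ha, crossing_single_pair hb ha]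
  simp only [mul_assoc, zero_add, Nat.reduceAdd, neg_mul, mul_neg]
  -- The signs of the self-crossings carry the correction term to the other side, as in `key`.
  rw [← sub_eq_iff_eq_add, ← neg_add', neg_inj]
  exact key

include hI in
-- The case of two labels in `I₁` needs no computation: there are no arrows between them, so the
-- correction term is zero.
theorem crossing_braid_eq
    (h : Ty e (phiVertex I₁ a ++ phiVertex I₁ b ++ phiVertex I₁ a) v) :
    crossing I₁ t (phiVertex I₁ a).length a b *
        (crossing I₁ t 0 a a * (crossing I₁ t (phiVertex I₁ a).length b a * v)) =
      crossing I₁ t 0 b a *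
        (crossing I₁ t (phiVertex I₁ b).length a a * (crossing I₁ t 0 a b * v)) +
      klrQDiff a b (x 0) (x (phiVertex I₁ a).length)
        (x ((phiVertex I₁ a).length + (phiVertex I₁ b).length)) * v := by
  by_cases ha : a ∈ I₁ <;> by_cases hb : b ∈ I₁
  · rw [K.crossing_braid_ne (Or.inr ⟨ha, hb⟩) h,
      klrQDiff_of_noErr fun _ => Or.inr ⟨hI a ha b hb, hI b hb a ha⟩, zero_mul, add_zero]
  · have := K.crossing_braid_pair_single hun ha hb h
    rw [phiVertex_pair ha, phiVertex_single hb]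
    exact this
  · have := K.crossing_braid_single_pair hun ha hb h
    rw [phiVertex_pair hb, phiVertex_single ha]
    exact this
  · rw [phiVertex_single ha, phiVertex_single hb] at *
    simp only [crossing, ha, hb, if_false]
    have := K.braid_eq' 0 _ _ h rfl rfl rfl
    have hQ : klrQDiff (Doubled.zero a ha) (Doubled.zero b hb) (x 0) (x (0 + 1)) (x (0 + 2)) =
        klrQDiff a b (x 0) (x (0 + 1)) (x (0 + 2)) := by
      by_cases hab : a = b <;> simp [klrQDiff, arrowCount_zero_zero, hab]
    rwa [hQ] at this

end KLRSys

/-! ### Sequences, exchanges of entries, and the map `φ` -/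

section Lists

variable {I : Type u} {I₁ : Set I}

theorem phiSeq_append (l l' : List I) : phiSeq I₁ (l ++ l') = phiSeq I₁ l ++ phiSeq I₁ l' := by
  induction l with
  | nil => rfl
  | cons a l ih => simp [phiSeq, ih]

theorem phiSeq_injective : Function.Injective (phiSeq I₁) := by
  intro l
  induction l with
  | nil =>
    intro l' h
    match l' with
    | [] => rfl
    | a :: l' => by_cases ha : a ∈ I₁ <;> simp [phiSeq, phiVertex, ha] at h
  | cons a l ih =>
    intro l' h
    match l' with
    | [] => by_cases ha : a ∈ I₁ <;> simp [phiSeq, phiVertex, ha] at h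
    | b :: l' =>
      by_cases ha : a ∈ I₁ <;> by_cases hb : b ∈ I₁ <;>
        simp [phiSeq, phiVertex, ha, hb] at h
      · exact congrArg₂ _ h.1 (ih h.2)
      · exact congrArg₂ _ h.1 (ih h.2)

theorem swapAt_append_cons_cons (l₁ : List I) (a b : I) (l₂ : List I) :
    swapAt l₁.length (l₁ ++ a :: b :: l₂) = l₁ ++ b :: a :: l₂ :=
  swapAt_append_left l₁ (a :: b :: l₂) 0

theorem swapAt_swapAt (r : ℕ) (l : List I) : swapAt r (swapAt r l) = l := by
  induction r generalizing l with
  | zero =>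
    match l with
    | [] => rfl
    | [_] => rfl
    | a :: b :: l => rfl
  | succ r ih =>
    match l with
    | [] => rfl
    | a :: l => exact congrArg (List.cons a) (ih l)

theorem exists_eq_append_cons_cons {l : List I} {r : ℕ} (h : r + 1 < l.length) :
    ∃ l₁ a b l₂, l = l₁ ++ a :: b :: l₂ ∧ l₁.length = r :=
  ⟨l.take r, l[r], l[r + 1], l.drop (r + 2), by simp, by simp; omega⟩

theorem eq_append_cons_of_getElem? {l : List I} {r : ℕ} {a : I} (ha : l[r]? = some a) :
    ∃ l₁ l₂, l = l₁ ++ a :: l₂ ∧ l₁.length = r := by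
  obtain ⟨h, rfl⟩ := List.getElem?_eq_some_iff.1 ha
  exact ⟨l.take r, l.drop (r + 1), by simp, by simp; omega⟩

theorem eq_append_cons_cons_of_getElem? {l : List I} {r : ℕ} {a b : I} (ha : l[r]? = some a)
    (hb : l[r + 1]? = some b) : ∃ l₁ l₂, l = l₁ ++ a :: b :: l₂ ∧ l₁.length = r := by
  obtain ⟨h, rfl⟩ := List.getElem?_eq_some_iff.1 ha
  obtain ⟨h', rfl⟩ := List.getElem?_eq_some_iff.1 hb
  exact ⟨l.take r, l.drop (r + 2), by simp, by simp; omega⟩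

theorem eq_append_cons_cons_cons_of_getElem? {l : List I} {r : ℕ} {a c : I} (ha : l[r]? = some a)
    (hc : l[r + 2]? = some c) : ∃ b l₁ l₂, l = l₁ ++ a :: b :: c :: l₂ ∧ l₁.length = r := by
  obtain ⟨h, rfl⟩ := List.getElem?_eq_some_iff.1 ha
  obtain ⟨h', rfl⟩ := List.getElem?_eq_some_iff.1 hc
  exact ⟨l[r + 1], l.take r, l.drop (r + 3), by simp, by simp; omega⟩

theorem phiPos_append_cons (l₁ l₂ : List I) (a : I) :
    phiPos I₁ (l₁ ++ a :: l₂) l₁.length = (phiSeq I₁ l₁).length := by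
  simp [phiPos]

theorem phiPos_append_cons_cons (l₁ l₂ : List I) (a b : I) :
    phiPos I₁ (l₁ ++ a :: b :: l₂) (l₁.length + 1) =
      (phiSeq I₁ l₁).length + (phiVertex I₁ a).length := by
  rw [phiPos, show l₁ ++ a :: b :: l₂ = (l₁ ++ [a]) ++ b :: l₂ by simp,
    List.take_left' (by simp), phiSeq_append, List.length_append]
  simp [phiSeq]

end Lists

section Crossing

variable {I : Type u} {I₁ : Set I} {A : Type*} [Ring A]

theorem crossing_shift (t : ℕ → A) (p q : ℕ) (a b : I) :
    crossing I₁ (fun r => t (p + r)) q a b = crossing I₁ t (p + q) a b := rfl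

/-- An element that commutes with the generators commutes with the crossing. -/
theorem crossing_commute (t : ℕ → A) (p : ℕ) (a b : I) (z : A)
    (h : ∀ r, p ≤ r → r + 1 < p + (phiVertex I₁ a).length + (phiVertex I₁ b).length →
      Commute (t r) z) : Commute (crossing I₁ t p a b) z := by
  by_cases ha : a ∈ I₁ <;> by_cases hb : b ∈ I₁ <;>
    simp only [phiVertex, ha, hb, dite_true, dite_false, List.length_cons, List.length_nil] at h <;>
    simp only [crossing, ha, hb, if_true, if_false]
  · have h0 := h p (by omega) (by omega)
    have h1 := h (p + 1) (by omega) (by omega)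
    have h2 := h (p + 2) (by omega) (by omega)
    have h3 : Commute (t (p + 1) * t (p + 2) * t p * t (p + 1)) z :=
      ((h1.mul_left h2).mul_left h0).mul_left h1
    split_ifs
    · exact h3.neg_left
    · exact h3
  · exact (h p (by omega) (by omega)).mul_left (h (p + 1) (by omega) (by omega))
  · exact (h (p + 1) (by omega) (by omega)).mul_left (h p (by omega) (by omega))
  · exact h p (by omega) (by omega)

end Crossing

theorem KLRSys.e_mul_of_ne {J : Type u} [Quiver.{v} J] {A : Type*} [Ring A] {e : List J → A}
    {x t : ℕ → A} (K : KLRSys e x t) {l l' : List J} {v : A} (h : Ty e l v) (hl : l' ≠ l) :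
    e l' * v = 0 := by
  rw [← h.eq, ← mul_assoc, K.e_mul_ne _ _ hl, zero_mul]

/-! ### The system of elements obtained by doubling -/

section Doubling

variable {I : Type u} [Quiver.{v} I] {I₁ : Set I} {A : Type*} [Ring A]
  {e : List (Doubled I₁) → A} {x t : ℕ → A}

/-- The element `∑_i x_{r'} e(φ(i))`. -/
noncomputable def doubleX {ι : Type*} [Fintype ι] (s : ι → List I)
    (e : List (Doubled I₁) → A) (x : ℕ → A) (r : ℕ) : A :=
  ∑ i, if r < (s i).length then x (phiPos I₁ (s i) r) * e (phiSeq I₁ (s i)) else 0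

/-- The element `∑_i τ*_r e(φ(i))`. -/
noncomputable def doubleT {ι : Type*} [Fintype ι] (s : ι → List I)
    (e : List (Doubled I₁) → A) (t : ℕ → A) (r : ℕ) : A :=
  ∑ i, if h : r + 1 < (s i).length then
    crossing I₁ t (phiPos I₁ (s i) r) (s i)[r] (s i)[r + 1] * e (phiSeq I₁ (s i)) else 0

namespace KLRSys

variable (K : KLRSys e x t) {ι : Type*} [Fintype ι] {s : ι → List I} {v : A}

include K

section
variable (hs : Function.Injective s) (hB : ∀ l, l ∉ Set.range s → e (phiSeq I₁ l) = 0)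
include hs hB

/-- On a vector of type `φ(l)` only the summand of `l` survives, because `φ` is injective; if `l` is
not in the family, `hB` makes the vector itself zero. -/
theorem doubleX_mul_of_lt {l : List I} {r : ℕ} (hr : r < l.length) (h : Ty e (phiSeq I₁ l) v) :
    doubleX s e x r * v = x (phiPos I₁ l r) * v := by
  classical
  by_cases hl : l ∈ Set.range s
  · obtain ⟨i, rfl⟩ := hl
    rw [doubleX, Finset.sum_mul, Finset.sum_eq_single i]
    · rw [if_pos hr, mul_assoc, h.eq]
    · intro j _ hj
      split_ifs
      · rw [mul_assoc, K.e_mul_of_ne h fun h' => hj (hs (phiSeq_injective h')), mul_zero]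
      · rw [zero_mul]
    · simp
  · rw [← h.eq, hB l hl]; simp

theorem doubleX_mul {l₁ l₂ : List I} {a : I} {r : ℕ} (hr : l₁.length = r)
    (h : Ty e (phiSeq I₁ (l₁ ++ a :: l₂)) v) :
    doubleX s e x r * v = x (phiSeq I₁ l₁).length * v := by
  subst hr
  rw [K.doubleX_mul_of_lt hs hB (by simp) h, phiPos_append_cons]

theorem doubleT_mul {l₁ l₂ : List I} {a b : I} {r : ℕ} (hr : l₁.length = r)
    (h : Ty e (phiSeq I₁ (l₁ ++ a :: b :: l₂)) v) :
    doubleT s e t r * v = crossing I₁ t (phiSeq I₁ l₁).length a b * v := by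
  classical
  subst hr
  by_cases hl : (l₁ ++ a :: b :: l₂) ∈ Set.range s
  · obtain ⟨i, hi⟩ := hl
    rw [doubleT, Finset.sum_mul, Finset.sum_eq_single i]
    · rw [dif_pos (by rw [hi]; simp), mul_assoc]
      simp only [hi, phiPos_append_cons, h.eq]
      simp
    · intro j _ hj
      split_ifs
      · rw [mul_assoc, K.e_mul_of_ne h fun h' => hj (hs (phiSeq_injective (h'.trans
          (congrArg _ hi.symm)))), mul_zero]
      · rw [zero_mul]
    · simp
  · rw [← h.eq, hB _ hl]; simp

omit hs hB in
theorem doubleX_mul_of_le {l : List I} {r : ℕ} (hr : l.length ≤ r) (h : Ty e (phiSeq I₁ l) v) :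
    doubleX s e x r * v = 0 := by
  rw [doubleX, Finset.sum_mul]
  refine Finset.sum_eq_zero fun i _ => ?_
  split_ifs with hi
  · rw [mul_assoc, K.e_mul_of_ne h fun h' => ?_, mul_zero]
    rw [phiSeq_injective h'] at hi
    omega
  · rw [zero_mul]

omit hs hB in
theorem doubleT_mul_of_le {l : List I} {r : ℕ} (hr : l.length ≤ r + 1)
    (h : Ty e (phiSeq I₁ l) v) : doubleT s e t r * v = 0 := by
  rw [doubleT, Finset.sum_mul]
  refine Finset.sum_eq_zero fun i _ => ?_
  split_ifs with hi
  · rw [mul_assoc, K.e_mul_of_ne h fun h' => ?_, mul_zero]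
    rw [phiSeq_injective h'] at hi
    omega
  · rw [zero_mul]

theorem ty_doubleX {l : List I} (r : ℕ) (h : Ty e (phiSeq I₁ l) v) :
    Ty e (phiSeq I₁ l) (doubleX s e x r * v) := by
  by_cases hr : r < l.length
  · rw [K.doubleX_mul_of_lt hs hB hr h]
    exact K.ty_x _ h
  · rw [K.doubleX_mul_of_le (not_lt.1 hr) h]
    exact Ty.zero

end

/-- The restriction of the system to the strands in the middle. -/
theorem local_phi (l₁ l₂ : List I) :
    KLRSys (fun l => e (phiSeq I₁ l₁ ++ l ++ phiSeq I₁ l₂))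
      (fun r => x ((phiSeq I₁ l₁).length + r)) (fun r => t ((phiSeq I₁ l₁).length + r)) :=
  K.local_append _ _

omit K [Quiver.{v} I] in
-- The block `φ(l₁)` in front is balanced, and an initial segment that violates the condition
-- remains one when entries are appended.
theorem local_unordered (hun : ∀ l : List (Doubled I₁), ¬ ok 0 l → e l = 0) (l₁ l₂ : List I)
    (l : List (Doubled I₁)) (hl : ¬ ok 0 l) : e (phiSeq I₁ l₁ ++ l ++ phiSeq I₁ l₂) = 0 :=
  hun _ fun h => hl (ok_append_right 0 l (phiSeq I₁ l₂) ((ok_phiSeq_append 0 l₁ _).1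
    (by rwa [List.append_assoc] at h)))

omit K [Quiver.{v} I] in
theorem ty_local {l₁ l₂ m : List I} (h : Ty e (phiSeq I₁ (l₁ ++ m ++ l₂)) v) :
    Ty (fun l => e (phiSeq I₁ l₁ ++ l ++ phiSeq I₁ l₂)) (phiSeq I₁ m) v := by
  rw [phiSeq_append, phiSeq_append] at h
  exact h

theorem ty_crossing_append {l₁ l₂ : List I} {a b : I}
    (h : Ty e (phiSeq I₁ (l₁ ++ a :: b :: l₂)) v) :
    Ty e (phiSeq I₁ (l₁ ++ b :: a :: l₂)) (crossing I₁ t (phiSeq I₁ l₁).length a b * v) := by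
  have h1 := (K.local_phi l₁ l₂).ty_crossing (a := a) (b := b) (v := v)
    (by simpa [phiSeq] using ty_local (l₁ := l₁) (m := [a, b]) (l₂ := l₂) (by simpa using h))
  rw [crossing_shift, add_zero] at h1
  unfold Ty at h1 ⊢
  rw [show l₁ ++ b :: a :: l₂ = l₁ ++ [b, a] ++ l₂ by simp, phiSeq_append, phiSeq_append]
  simpa [phiSeq] using h1

end KLRSys
end Doubling

/-! ### Positions of the blocks in `φ(l)` -/

section PhiPos

variable {I : Type u} {I₁ : Set I}

theorem length_le_length_phiSeq (l : List I) : l.length ≤ (phiSeq I₁ l).length := by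
  induction l with
  | nil => simp
  | cons a l ih =>
    have h : 1 ≤ (phiVertex I₁ a).length := by by_cases ha : a ∈ I₁ <;> simp [phiVertex, ha]
    simp only [phiSeq, List.length_append, List.length_cons]
    omega

theorem phiPos_append_of_lt (l₁ l₂ : List I) {s : ℕ} (hs : s < l₁.length) :
    phiPos I₁ (l₁ ++ l₂) s < (phiSeq I₁ l₁).length := by
  have h : (phiSeq I₁ l₁).length = (phiSeq I₁ (l₁.take s)).length +
      (phiSeq I₁ (l₁.drop s)).length := by
    rw [← List.length_append, ← phiSeq_append, List.take_append_drop]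
  have h' := length_le_length_phiSeq (I₁ := I₁) (l₁.drop s)
  rw [phiPos, List.take_append_of_le_length hs.le, h]
  rw [List.length_drop] at h'
  omega

theorem phiPos_append_of_ge (l₁ l₂ : List I) {s m : ℕ} (hs : s = l₁.length + m) :
    phiPos I₁ (l₁ ++ l₂) s = (phiSeq I₁ l₁).length + phiPos I₁ l₂ m := by
  subst hs
  rw [phiPos, List.take_length_add_append, phiSeq_append, List.length_append, phiPos]

end PhiPos

namespace KLRSys

variable {I : Type u} [Quiver.{v} I] {I₁ : Set I} {A : Type*} [Ring A]
  {e : List (Doubled I₁) → A} {x t : ℕ → A}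
  (K : KLRSys e x t) (hun : ∀ l, ¬ ok 0 l → e l = 0)
  (hI : ∀ i ∈ I₁, ∀ j ∈ I₁, arrowCount i j = 0)
  {ι : Type*} [Fintype ι] {s : ι → List I}
  (hs : Function.Injective s) (hB : ∀ l, l ∉ Set.range s → e (phiSeq I₁ l) = 0) {v : A}

include K

theorem crossing_far (p q : ℕ) (a b : I)
    (hq : q < p ∨ p + (phiVertex I₁ a).length + (phiVertex I₁ b).length ≤ q) :
    Commute (crossing I₁ t p a b) (x q) :=
  crossing_commute t p a b _ fun r hr hr' => K.t_x_far r q (by omega) (by omega)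

theorem crossing_crossing_far (p q : ℕ) (a b c d : I)
    (hq : p + (phiVertex I₁ a).length + (phiVertex I₁ b).length ≤ q) :
    Commute (crossing I₁ t p a b) (crossing I₁ t q c d) :=
  crossing_commute t p a b _ fun r hr hr' =>
    (crossing_commute t q c d _ fun r' h h' => (K.t_t_far r r' (by omega)).symm).symm

include hs hB

theorem slides_doubleX {l : List I} {r : ℕ} (hr : r < l.length) :
    Slides e (phiSeq I₁ l) 1 (doubleX s e x r) (x (phiPos I₁ l r)) where
  slide w hw := by rw [one_mul, one_mul, K.doubleX_mul_of_lt hs hB hr hw]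
  ty _ hw := K.ty_x _ hw

theorem doubleX_doubleX {l : List I} (r r' : ℕ) (h : Ty e (phiSeq I₁ l) v) :
    doubleX s e x r * (doubleX s e x r' * v) = doubleX s e x r' * (doubleX s e x r * v) := by
  have hT (r : ℕ) := K.ty_doubleX hs hB r h
  by_cases hr : r < l.length
  · by_cases hr' : r' < l.length
    · rw [K.doubleX_mul_of_lt hs hB hr (hT r'), K.doubleX_mul_of_lt hs hB hr' (hT r),
        K.doubleX_mul_of_lt hs hB hr h, K.doubleX_mul_of_lt hs hB hr' h, K.x_x]
    · rw [K.doubleX_mul_of_le (not_lt.1 hr') h, K.doubleX_mul_of_le (not_lt.1 hr') (hT r),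
        mul_zero]
  · rw [K.doubleX_mul_of_le (not_lt.1 hr) h, K.doubleX_mul_of_le (not_lt.1 hr) (hT r'), mul_zero]

theorem ty_doubleT {l : List I} {r : ℕ} (hr : r + 1 < l.length) (h : Ty e (phiSeq I₁ l) v) :
    Ty e (phiSeq I₁ (swapAt r l)) (doubleT s e t r * v) := by
  obtain ⟨l₁, a, b, l₂, rfl, rfl⟩ := exists_eq_append_cons_cons hr
  rw [K.doubleT_mul hs hB rfl h, swapAt_append_cons_cons]
  exact K.ty_crossing_append h

theorem doubleT_doubleX_far {l : List I} (r r' : ℕ) (h₀ : r' ≠ r) (h₁ : r' ≠ r + 1)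
    (h : Ty e (phiSeq I₁ l) v) :
    doubleT s e t r * (doubleX s e x r' * v) = doubleX s e x r' * (doubleT s e t r * v) := by
  have hT := K.ty_doubleX hs hB r' h
  by_cases hr : r + 1 < l.length
  · have hT' := K.ty_doubleT hs hB hr h
    by_cases hr' : r' < l.length
    · rw [K.doubleX_mul_of_lt hs hB hr' h, K.doubleX_mul_of_lt hs hB (by rwa [length_swapAt]) hT']
      rw [K.doubleX_mul_of_lt hs hB hr' h] at hT
      obtain ⟨l₁, a, b, l₂, rfl, hl⟩ := exists_eq_append_cons_cons hr
      rw [K.doubleT_mul hs hB hl h, K.doubleT_mul hs hB hl hT, ← mul_assoc, ← mul_assoc]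
      have e1 : swapAt r (l₁ ++ a :: b :: l₂) = l₁ ++ b :: a :: l₂ := by
        rw [← hl, swapAt_append_cons_cons]
      congr 1
      -- The dot lies to the left of both cables or to the right of both. In the second case its
      -- position does not change, since the two cables only exchange their lengths.
      rcases Nat.lt_or_ge r' l₁.length with h2 | h2
      · have e2 : phiPos I₁ (swapAt r (l₁ ++ a :: b :: l₂)) r' =
            phiPos I₁ (l₁ ++ a :: b :: l₂) r' := by
          rw [e1, phiPos, phiPos, List.take_append_of_le_length h2.le,
            List.take_append_of_le_length h2.le]
        rw [e2]
        exact K.crossing_far _ _ _ _ (Or.inl (phiPos_append_of_lt _ _ h2))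
      · obtain ⟨m, hm⟩ := Nat.exists_eq_add_of_le (show l₁.length + 2 ≤ r' by omega)
        have e2 (a b : I) : phiPos I₁ (l₁ ++ a :: b :: l₂) r' = (phiSeq I₁ l₁).length +
            ((phiVertex I₁ a).length + (phiVertex I₁ b).length) + phiPos I₁ l₂ m := by
          rw [show l₁ ++ a :: b :: l₂ = (l₁ ++ [a, b]) ++ l₂ by simp,
            phiPos_append_of_ge _ _ (m := m) (by simp; omega), phiSeq_append]
          simp [phiSeq]
        rw [e1, e2, e2, add_comm (phiVertex I₁ b).length]
        exact K.crossing_far _ _ _ _ (Or.inr (by omega))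
    · rw [K.doubleX_mul_of_le (not_lt.1 hr') h, mul_zero,
        K.doubleX_mul_of_le (by rw [length_swapAt]; omega) hT']
  · rw [K.doubleT_mul_of_le (not_lt.1 hr) h, K.doubleT_mul_of_le (not_lt.1 hr) hT, mul_zero]

theorem doubleT_doubleT_far {l : List I} (r r' : ℕ) (h₀ : r + 1 < r')
    (h : Ty e (phiSeq I₁ l) v) :
    doubleT s e t r * (doubleT s e t r' * v) = doubleT s e t r' * (doubleT s e t r * v) := by
  by_cases hr' : r' + 1 < l.length
  · obtain ⟨l₁, a, b, l₂, rfl, rfl⟩ := exists_eq_append_cons_cons (l := l) (r := r) (by omega)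
    obtain ⟨m, rfl⟩ := Nat.exists_eq_add_of_le (show l₁.length + 2 ≤ r' by omega)
    obtain ⟨m₁, c, d, m₂, rfl, hm⟩ := exists_eq_append_cons_cons (l := l₂) (r := m)
      (by simp at hr'; omega)
    have e1 (a b c d : I) : l₁ ++ a :: b :: (m₁ ++ c :: d :: m₂) =
      (l₁ ++ a :: b :: m₁) ++ c :: d :: m₂ := by simp
    have e2 (a b : I) : (l₁ ++ a :: b :: m₁).length = l₁.length + 2 + m := by simp; omega
    have h1 := h
    rw [e1] at h1
    have h2 := K.ty_crossing_append h1
    rw [← e1] at h2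
    have h3 := K.ty_crossing_append h
    rw [K.doubleT_mul hs hB (e2 a b) h1, K.doubleT_mul hs hB rfl h, K.doubleT_mul hs hB rfl h2]
    rw [e1] at h3
    rw [K.doubleT_mul hs hB (e2 b a) h3, ← mul_assoc, ← mul_assoc]
    have e3 (a b : I) : (phiSeq I₁ (l₁ ++ a :: b :: m₁)).length = (phiSeq I₁ l₁).length +
        ((phiVertex I₁ a).length + (phiVertex I₁ b).length) + (phiSeq I₁ m₁).length := by
      rw [show l₁ ++ a :: b :: m₁ = (l₁ ++ [a, b]) ++ m₁ by simp, phiSeq_append, phiSeq_append]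
      simp [phiSeq, add_assoc]
    rw [e3, e3, add_comm (phiVertex I₁ b).length]
    congr 1
    exact K.crossing_crossing_far _ _ _ _ _ _ (by omega)
  · have h0 := K.doubleT_mul_of_le (s := s) (not_lt.1 hr') h
    rw [h0, mul_zero]
    by_cases hr : r + 1 < l.length
    · rw [K.doubleT_mul_of_le (by rw [length_swapAt]; omega) (K.ty_doubleT hs hB hr h)]
    · rw [K.doubleT_mul_of_le (not_lt.1 hr) h, mul_zero]

section TwoStrands
variable {l₁ l₂ : List I} {a b : I}

theorem doubleX_succ_mul {r : ℕ} (hr : l₁.length = r)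
    (h : Ty e (phiSeq I₁ (l₁ ++ a :: b :: l₂)) v) :
    doubleX s e x (r + 1) * v = x ((phiSeq I₁ l₁).length + (phiVertex I₁ a).length) * v := by
  subst hr
  rw [K.doubleX_mul_of_lt hs hB (by simp) h, phiPos_append_cons_cons]

omit K hs hB [Quiver.{v} I] [Fintype ι] in
theorem ty_local_two (h : Ty e (phiSeq I₁ (l₁ ++ a :: b :: l₂)) v) :
    Ty (fun l => e (phiSeq I₁ l₁ ++ l ++ phiSeq I₁ l₂)) (phiVertex I₁ a ++ phiVertex I₁ b) v := by
  simpa [phiSeq] using ty_local (l₁ := l₁) (m := [a, b]) (l₂ := l₂) (by simpa using h)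

theorem doubleT_doubleX_ne {r : ℕ} (hr : l₁.length = r)
    (h : Ty e (phiSeq I₁ (l₁ ++ a :: b :: l₂)) v) (hab : a ≠ b) :
    doubleT s e t r * (doubleX s e x (r + 1) * v) =
      doubleX s e x r * (doubleT s e t r * v) := by
  have h1 (q : ℕ) : Ty e (phiSeq I₁ (l₁ ++ a :: b :: l₂)) (x q * v) := K.ty_x q h
  rw [K.doubleX_succ_mul hs hB hr h, K.doubleT_mul hs hB hr (h1 _), K.doubleT_mul hs hB hr h,
    K.doubleX_mul hs hB hr (K.ty_crossing_append h)]
  exact (((K.local_phi l₁ l₂).slides_crossing_left hab).slide v (ty_local_two h)).symm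

theorem doubleX_doubleT_ne {r : ℕ} (hr : l₁.length = r)
    (h : Ty e (phiSeq I₁ (l₁ ++ a :: b :: l₂)) v) (hab : a ≠ b) :
    doubleX s e x (r + 1) * (doubleT s e t r * v) =
      doubleT s e t r * (doubleX s e x r * v) := by
  have h1 (q : ℕ) : Ty e (phiSeq I₁ (l₁ ++ a :: b :: l₂)) (x q * v) := K.ty_x q h
  rw [K.doubleX_mul hs hB hr h, K.doubleT_mul hs hB hr (h1 _), K.doubleT_mul hs hB hr h,
    K.doubleX_succ_mul hs hB hr (K.ty_crossing_append h)]
  exact (((K.local_phi l₁ l₂).slides_crossing_right hab).slide v (ty_local_two h))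

include hun

theorem doubleT_doubleX_self {r : ℕ} (hr : l₁.length = r)
    (h : Ty e (phiSeq I₁ (l₁ ++ a :: a :: l₂)) v) :
    doubleT s e t r * (doubleX s e x (r + 1) * v) =
      doubleX s e x r * (doubleT s e t r * v) + v := by
  have h1 (q : ℕ) : Ty e (phiSeq I₁ (l₁ ++ a :: a :: l₂)) (x q * v) := K.ty_x q h
  rw [K.doubleX_succ_mul hs hB hr h, K.doubleT_mul hs hB hr (h1 _), K.doubleT_mul hs hB hr h,
    K.doubleX_mul hs hB hr (K.ty_crossing_append h)]
  exact (K.local_phi l₁ l₂).crossing_mul_x_self (local_unordered hun l₁ l₂) (ty_local_two h)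

theorem doubleX_doubleT_self {r : ℕ} (hr : l₁.length = r)
    (h : Ty e (phiSeq I₁ (l₁ ++ a :: a :: l₂)) v) :
    doubleX s e x (r + 1) * (doubleT s e t r * v) =
      doubleT s e t r * (doubleX s e x r * v) + v := by
  have h1 (q : ℕ) : Ty e (phiSeq I₁ (l₁ ++ a :: a :: l₂)) (x q * v) := K.ty_x q h
  rw [K.doubleX_mul hs hB hr h, K.doubleT_mul hs hB hr (h1 _), K.doubleT_mul hs hB hr h,
    K.doubleX_succ_mul hs hB hr (K.ty_crossing_append h)]
  exact (K.local_phi l₁ l₂).x_mul_crossing_self (local_unordered hun l₁ l₂) (ty_local_two h)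

include hI

theorem doubleT_doubleT {r : ℕ} (hr : l₁.length = r)
    (h : Ty e (phiSeq I₁ (l₁ ++ a :: b :: l₂)) v) :
    doubleT s e t r * (doubleT s e t r * v) =
      klrQ a b (doubleX s e x r) (doubleX s e x (r + 1)) * v := by
  have h2 := (Slides.klrQ a b
    (K.slides_doubleX hs hB (l := l₁ ++ a :: b :: l₂) (r := r) (by simp; omega))
    (K.slides_doubleX hs hB (l := l₁ ++ a :: b :: l₂) (r := r + 1) (by simp; omega))).slide v h
  rw [one_mul, one_mul] at h2
  subst hr
  rw [h2, K.doubleT_mul hs hB rfl h, K.doubleT_mul hs hB rfl (K.ty_crossing_append h),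
    phiPos_append_cons, phiPos_append_cons_cons]
  exact (K.local_phi l₁ l₂).crossing_sq (local_unordered hun l₁ l₂) hI (ty_local_two h)

end TwoStrands

section ThreeStrands
variable {l₁ l₂ : List I} {a b c : I} {r : ℕ} (hr : l₁.length = r)
  (h : Ty e (phiSeq I₁ (l₁ ++ a :: b :: c :: l₂)) v)
include hr h

omit K hs hB hr [Quiver.{v} I] [Fintype ι] in
theorem ty_local_three :
    Ty (fun l => e (phiSeq I₁ l₁ ++ l ++ phiSeq I₁ l₂))
      (phiVertex I₁ a ++ phiVertex I₁ b ++ phiVertex I₁ c) v := by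
  simpa [phiSeq] using ty_local (l₁ := l₁) (m := [a, b, c]) (l₂ := l₂) (by simpa using h)

theorem doubleT_succ_mul :
    doubleT s e t (r + 1) * v =
      crossing I₁ t ((phiSeq I₁ l₁).length + (phiVertex I₁ a).length) b c * v ∧
    Ty e (phiSeq I₁ (l₁ ++ a :: c :: b :: l₂)) (doubleT s e t (r + 1) * v) := by
  have h1 : Ty e (phiSeq I₁ ((l₁ ++ [a]) ++ b :: c :: l₂)) v := by simpa using h
  have h2 := K.ty_crossing_append h1
  have h3 := K.doubleT_mul hs hB (r := r + 1) (by simp; omega) h1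
  rw [← h3] at h2
  refine ⟨h3.trans ?_, by simpa using h2⟩
  rw [phiSeq_append]
  simp [phiSeq]

theorem doubleT_mul_ty :
    doubleT s e t r * v = crossing I₁ t (phiSeq I₁ l₁).length a b * v ∧
    Ty e (phiSeq I₁ (l₁ ++ b :: a :: c :: l₂)) (doubleT s e t r * v) := by
  have h2 := K.ty_crossing_append h
  have h3 := K.doubleT_mul hs hB hr h
  rw [← h3] at h2
  exact ⟨h3, h2⟩

theorem doubleT_braid_left :
    doubleT s e t (r + 1) * (doubleT s e t r * (doubleT s e t (r + 1) * v)) =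
      crossing I₁ t ((phiSeq I₁ l₁).length + (phiVertex I₁ c).length) a b *
        (crossing I₁ t (phiSeq I₁ l₁).length a c *
          (crossing I₁ t ((phiSeq I₁ l₁).length + (phiVertex I₁ a).length) b c * v)) := by
  have h1 := K.doubleT_succ_mul hs hB hr h
  have h2 := K.doubleT_mul_ty hs hB hr h1.2
  have h3 := K.doubleT_succ_mul hs hB hr h2.2
  rw [h3.1, h2.1, h1.1]

theorem doubleT_braid_right :
    doubleT s e t r * (doubleT s e t (r + 1) * (doubleT s e t r * v)) =
      crossing I₁ t (phiSeq I₁ l₁).length b c *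
        (crossing I₁ t ((phiSeq I₁ l₁).length + (phiVertex I₁ b).length) a c *
          (crossing I₁ t (phiSeq I₁ l₁).length a b * v)) := by
  have h1 := K.doubleT_mul_ty hs hB hr h
  have h2 := K.doubleT_succ_mul hs hB hr h1.2
  have h3 := K.doubleT_mul_ty hs hB hr h2.2
  rw [h3.1, h2.1, h1.1]

theorem doubleT_braid_ne (hac : a ≠ c) :
    doubleT s e t (r + 1) * (doubleT s e t r * (doubleT s e t (r + 1) * v)) =
      doubleT s e t r * (doubleT s e t (r + 1) * (doubleT s e t r * v)) := by
  rw [K.doubleT_braid_left hs hB hr h, K.doubleT_braid_right hs hB hr h]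
  exact (K.local_phi l₁ l₂).crossing_braid_ne (Or.inl hac) (ty_local_three h)

end ThreeStrands

include hun hI in
theorem doubleT_braid_eq {l₁ l₂ : List I} {a b : I} {r : ℕ} (hr : l₁.length = r)
    (h : Ty e (phiSeq I₁ (l₁ ++ a :: b :: a :: l₂)) v) :
    doubleT s e t (r + 1) * (doubleT s e t r * (doubleT s e t (r + 1) * v)) =
      doubleT s e t r * (doubleT s e t (r + 1) * (doubleT s e t r * v)) +
        klrQDiff a b (doubleX s e x r) (doubleX s e x (r + 1)) (doubleX s e x (r + 2)) * v := by
  have h2 := (Slides.klrQDiff a b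
    (K.slides_doubleX hs hB (l := l₁ ++ a :: b :: a :: l₂) (r := r) (by simp; omega))
    (K.slides_doubleX hs hB (l := l₁ ++ a :: b :: a :: l₂) (r := r + 1) (by simp; omega))
    (K.slides_doubleX hs hB (l := l₁ ++ a :: b :: a :: l₂) (r := r + 2)
      (by simp; omega))).slide v h
  rw [one_mul, one_mul] at h2
  rw [K.doubleT_braid_left hs hB hr h, K.doubleT_braid_right hs hB hr h, h2]
  subst hr
  rw [phiPos_append_cons, phiPos_append_cons_cons,
    show l₁ ++ a :: b :: a :: l₂ = (l₁ ++ [a, b]) ++ a :: l₂ by simp,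
    phiPos_append_of_ge _ _ (m := 0) (by simp), phiSeq_append]
  have h3 := (K.local_phi l₁ l₂).crossing_braid_eq (local_unordered hun l₁ l₂) hI
    (ty_local_three h)
  simp only [phiPos, phiSeq, List.take_zero, List.length_nil, List.length_append, add_zero,
    List.append_nil]
  exact h3

omit hs hB in
theorem doubleX_mul_sum (r : ℕ) (hs : Function.Injective s) :
    doubleX s e x r * ∑ i, e (phiSeq I₁ (s i)) = doubleX s e x r := by
  classical
  rw [doubleX, Finset.sum_mul]
  refine Finset.sum_congr rfl fun i _ => ?_
  split_ifs
  · rw [mul_assoc, Finset.mul_sum, Finset.sum_eq_single i, K.e_mul_self]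
    · intro j _ hj
      exact K.e_mul_ne _ _ fun h => hj (hs (phiSeq_injective h)).symm
    · simp
  · rw [zero_mul]

omit hs hB in
theorem doubleT_mul_sum (r : ℕ) (hs : Function.Injective s) :
    doubleT s e t r * ∑ i, e (phiSeq I₁ (s i)) = doubleT s e t r := by
  classical
  rw [doubleT, Finset.sum_mul]
  refine Finset.sum_congr rfl fun i _ => ?_
  split_ifs
  · rw [mul_assoc, Finset.mul_sum, Finset.sum_eq_single i, K.e_mul_self]
    · intro j _ hj
      exact K.e_mul_ne _ _ fun h => hj (hs (phiSeq_injective h)).symm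
    · simp
  · rw [zero_mul]

end KLRSys

/-! ### The KLR algebra as a system of elements -/

section Weights

variable {I : Type u} {I₁ : Set I}

theorem wt_cons (a : I) (l : List I) : wt (a :: l) = Finsupp.single a 1 + wt l := by simp [wt]

theorem degree_wt (l : List I) : (wt l).degree = l.length := by
  induction l with
  | nil => simp [wt]
  | cons a l ih => rw [wt_cons, map_add, ih, Finsupp.degree_single, List.length_cons, add_comm]

theorem SeqOf.length_eq {α : I →₀ ℕ} (i : SeqOf α) : i.1.length = α.degree := by
  rw [← degree_wt, i.2]

theorem SeqOf.exists_val {α : I →₀ ℕ} {l : List I} (h : wt l = α) : ∃ i : SeqOf α, i.1 = l :=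
  ⟨⟨l, h⟩, rfl⟩

theorem SeqOf.val_swap {α : I →₀ ℕ} (r : ℕ) (i : SeqOf α) : (i.swap r).1 = swapAt r i.1 := rfl

theorem phiRoot_apply_zero {M : Type} [AddCommMonoid M] (f : I →₀ M) (i : I) (h : i ∉ I₁) :
    phiRoot I₁ f (.zero i h) = f i := by
  classical
  induction f using Finsupp.induction_linear with
  | zero => simp
  | add f g hf hg => simp [hf, hg]
  | single j a =>
    by_cases hj : j ∈ I₁
    · have : j ≠ i := fun h' => h (h' ▸ hj)
      simp [phiRoot, hj, this]
    · simp [phiRoot, hj, Finsupp.single_apply]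

theorem phiRoot_apply_one {M : Type} [AddCommMonoid M] (f : I →₀ M) (i : I) (h : i ∈ I₁) :
    phiRoot I₁ f (.one i h) = f i := by
  classical
  induction f using Finsupp.induction_linear with
  | zero => simp
  | add f g hf hg => simp [hf, hg]
  | single j a =>
    by_cases hj : j ∈ I₁
    · simp [phiRoot, hj, Finsupp.single_apply]
    · have : j ≠ i := fun h' => hj (h' ▸ h)
      simp [phiRoot, hj, this]

theorem phiRoot_apply_two {M : Type} [AddCommMonoid M] (f : I →₀ M) (i : I) (h : i ∈ I₁) :
    phiRoot I₁ f (.two i h) = f i := by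
  classical
  induction f using Finsupp.induction_linear with
  | zero => simp
  | add f g hf hg => simp [hf, hg]
  | single j a =>
    by_cases hj : j ∈ I₁
    · simp [phiRoot, hj, Finsupp.single_apply]
    · have : j ≠ i := fun h' => hj (h' ▸ h)
      simp [phiRoot, hj, this]

theorem phiRoot_injective {M : Type} [AddCommMonoid M] :
    Function.Injective (phiRoot I₁ : (I →₀ M) →+ _) := by
  intro f g h
  ext i
  by_cases hi : i ∈ I₁
  · rw [← phiRoot_apply_one f i hi, h, phiRoot_apply_one]
  · rw [← phiRoot_apply_zero f i hi, h, phiRoot_apply_zero]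

theorem WellOrdered.of_cons {a : Doubled I₁} {l : List (Doubled I₁)} (h : WellOrdered (a :: l)) :
    WellOrdered l := fun r i hi hr => h (r + 1) i hi hr

/-- Each entry `i¹` is followed by an entry `i²` of its own. -/
theorem WellOrdered.wt_le {l : List (Doubled I₁)} (h : WellOrdered l) (i : I) (hi : i ∈ I₁) :
    wt l (.one i hi) ≤ wt l (.two i hi) := by
  classical
  match l with
  | [] => simp [wt]
  | .zero j hj :: l =>
    have := h.of_cons.wt_le i hi
    simpa [wt_cons] using this
  | .two j hj :: l =>
    have := h.of_cons.wt_le i hi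
    simp only [wt_cons, Finsupp.add_apply, Finsupp.single_apply, reduceCtorEq, if_false]
    omega
  | [.one j hj] => simpa using h 0 j hj rfl
  | .one j hj :: b :: l =>
    have hb : b = .two j hj := by simpa using h 0 j hj rfl
    subst hb
    have := h.of_cons.of_cons.wt_le i hi
    simp only [wt_cons, Finsupp.add_apply, Finsupp.single_apply, reduceCtorEq, if_false,
      Doubled.one.injEq, Doubled.two.injEq]
    omega
termination_by l.length

/-- A well-ordered sequence falls into blocks `φ(a)` and additional entries `i²`; the condition on
the weights excludes the latter. -/
theorem WellOrdered.exists_phiSeq {l : List (Doubled I₁)} (h : WellOrdered l)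
    (hw : ∀ i hi, wt l (.two i hi) ≤ wt l (.one i hi)) : ∃ m, phiSeq I₁ m = l := by
  classical
  match l with
  | [] => exact ⟨[], rfl⟩
  | .zero j hj :: l =>
    obtain ⟨m, rfl⟩ := h.of_cons.exists_phiSeq fun i hi => by
      have := hw i hi
      simpa [wt_cons] using this
    exact ⟨j :: m, by simp [phiSeq, phiVertex, hj]⟩
  | .two j hj :: l =>
    -- An initial `j²` has no partner: the rest already contains at least as many `j²` as `j¹`.
    have h1 := h.of_cons.wt_le j hj
    have h2 := hw j hj
    simp only [wt_cons, Finsupp.add_apply, Finsupp.single_apply, reduceCtorEq, if_false,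
      if_true] at h2
    omega
  | [.one j hj] => simpa using h 0 j hj rfl
  | .one j hj :: b :: l =>
    have hb : b = .two j hj := by simpa using h 0 j hj rfl
    subst hb
    obtain ⟨m, rfl⟩ := h.of_cons.of_cons.exists_phiSeq fun i hi => by
      have := hw i hi
      simp only [wt_cons, Finsupp.add_apply, Finsupp.single_apply, reduceCtorEq, if_false,
        Doubled.one.injEq, Doubled.two.injEq] at this
      omega
    exact ⟨j :: m, by simp [phiSeq, phiVertex, hj]⟩
termination_by l.length

/-- Consequently `𝐞` is the sum of the `e(φ(i))` for `i ∈ I^β`, and `F_β` on the subcategory has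
exactly the summands of `ordFunctor`. -/
theorem phiOrd_bijective (β : I →₀ ℕ) :
    Function.Bijective (phiOrd I₁ : SeqOf β → OrdSeq (phiRoot I₁ β)) := by
  constructor
  · intro i j h
    exact Subtype.ext (phiSeq_injective (congrArg (fun z => z.1.1) h))
  · rintro ⟨⟨l, hl⟩, hw⟩
    obtain ⟨m, rfl⟩ := WellOrdered.exists_phiSeq hw fun i hi => by
      rw [hl, phiRoot_apply_one, phiRoot_apply_two]
    rw [wt_phiSeq] at hl
    exact ⟨⟨m, phiRoot_injective hl⟩, rfl⟩

end Weights

section Map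

theorem map_klrQ {J : Type u} [Quiver.{v} J] {A B : Type*} [Ring A] [Ring B] (f : A →+* B)
    (i j : J) (a b : A) : f (klrQ i j a b) = klrQ i j (f a) (f b) := by
  unfold klrQ
  split_ifs <;> simp

theorem map_klrQDiff {J : Type u} [Quiver.{v} J] {A B : Type*} [Ring A] [Ring B] (f : A →+* B)
    (i j : J) (a b c : A) : f (klrQDiff i j a b c) = klrQDiff i j (f a) (f b) (f c) := by
  unfold klrQDiff
  split_ifs <;> simp

theorem KLRSys.map {J : Type u} [Quiver.{v} J] {A B : Type*} [Ring A] [Ring B] {e : List J → A}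
    {x t : ℕ → A} (K : KLRSys e x t) (f : A →+* B) :
    KLRSys (fun l => f (e l)) (fun r => f (x r)) (fun r => f (t r)) where
  e_mul_self l := by rw [← map_mul, K.e_mul_self]
  e_mul_ne l l' h := by rw [← map_mul, K.e_mul_ne l l' h, map_zero]
  x_mul_e r l := by rw [← map_mul, K.x_mul_e, map_mul]
  t_mul_e r l h := by rw [← map_mul, K.t_mul_e r l h, map_mul]
  x_mul_x r s := by rw [← map_mul, K.x_mul_x, map_mul]
  t_x_eq r l a h₀ h₁ := by simpa using congrArg f (K.t_x_eq r l a h₀ h₁)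
  t_x_ne r l a b h₀ h₁ h := by simpa using congrArg f (K.t_x_ne r l a b h₀ h₁ h)
  x_t_eq r l a h₀ h₁ := by simpa using congrArg f (K.x_t_eq r l a h₀ h₁)
  x_t_ne r l a b h₀ h₁ h := by simpa using congrArg f (K.x_t_ne r l a b h₀ h₁ h)
  t_x_far r s h₀ h₁ := by rw [← map_mul, K.t_x_far r s h₀ h₁, map_mul]
  t_t_far r s h := by rw [← map_mul, K.t_t_far r s h, map_mul]
  t_sq r l a b h₀ h₁ := by
    simpa [map_klrQ] using congrArg f (K.t_sq r l a b h₀ h₁)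
  braid_eq r l a b h₀ h₁ h₂ := by
    simpa [map_klrQDiff] using congrArg f (K.braid_eq r l a b h₀ h₁ h₂)
  braid_ne r l a c h₀ h₂ h := by simpa using congrArg f (K.braid_ne r l a c h₀ h₂ h)

end Map

namespace KLRAlg

variable (k : Type w) [Field k] {J : Type u} [Quiver.{v} J] (α : J →₀ ℕ)

open Classical in
/-- The idempotent `e(l)` for an arbitrary sequence; it is zero if `l` is not of weight `α`. -/
noncomputable def eSeq (l : List J) : KLRAlg k α := if h : wt l = α then e k (⟨l, h⟩ : SeqOf α) else 0

variable {α} in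
theorem eSeq_val (i : SeqOf α) : eSeq k α i.1 = e k i := dif_pos i.2

variable {α} in
theorem eSeq_of_ne {l : List J} (h : wt l ≠ α) : eSeq k α l = 0 := dif_neg h

variable {k α} in
theorem mk_rel {a b : FreeAlgebra k (KLRGen α)} (h : KLRRel k α a b) : mk k α a = mk k α b :=
  RingQuot.mkAlgHom_rel k h

@[simp] theorem mk_freeE (i : SeqOf α) : mk k α (freeE k α i) = e k i := rfl
@[simp] theorem mk_freeX (r : ℕ) : mk k α (freeX k α r) = x k α r := rfl
@[simp] theorem mk_freeT (r : ℕ) : mk k α (freeT k α r) = t k α r := rfl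

theorem t_mul_e (r : ℕ) (i : SeqOf α) : t k α r * e k i = e k (i.swap r) * t k α r := by
  simpa using mk_rel (KLRRel.t_mul_e r i)

theorem sum_e : ∑ i : SeqOf α, e k i = 1 := by
  simpa using mk_rel (KLRRel.sum_e (k := k) (α := α))

theorem t_out (r : ℕ) (h : α.degree ≤ r + 1) : t k α r = 0 := by
  simpa using mk_rel (KLRRel.t_out (k := k) (α := α) r h)

theorem x_out (r : ℕ) (h : α.degree ≤ r) : x k α r = 0 := by
  simpa using mk_rel (KLRRel.x_out (k := k) (α := α) r h)

theorem map_mk_klrQ (a b : J) (y z : FreeAlgebra k (KLRGen α)) :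
    mk k α (klrQ a b y z) = klrQ a b (mk k α y) (mk k α z) :=
  map_klrQ (mk k α : _ →+* KLRAlg k α) a b y z

theorem map_mk_klrQDiff (a b : J) (y z y' : FreeAlgebra k (KLRGen α)) :
    mk k α (klrQDiff a b y z y') = klrQDiff a b (mk k α y) (mk k α z) (mk k α y') :=
  map_klrQDiff (mk k α : _ →+* KLRAlg k α) a b y z y'

/-- With the idempotents extended by zero to sequences of other weights, each relation is either a
defining one or `0 = 0`. This frees the computations above from all conditions on weights. -/
theorem klrSys : KLRSys (eSeq k α) (x k α) (t k α) where
  e_mul_self l := by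
    by_cases h : wt l = α
    · obtain ⟨i, rfl⟩ := SeqOf.exists_val h
      rw [eSeq_val, e_mul_self]
    · rw [eSeq_of_ne k h, mul_zero]
  e_mul_ne l l' hl := by
    by_cases h : wt l = α
    · by_cases h' : wt l' = α
      · obtain ⟨i, rfl⟩ := SeqOf.exists_val h
        obtain ⟨j, rfl⟩ := SeqOf.exists_val h'
        rw [eSeq_val, eSeq_val, e_mul_ne k α i j fun h => hl (congrArg Subtype.val h)]
      · rw [eSeq_of_ne k h', mul_zero]
    · rw [eSeq_of_ne k h, zero_mul]
  x_mul_e r l := by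
    by_cases h : wt l = α
    · obtain ⟨i, rfl⟩ := SeqOf.exists_val h
      rw [eSeq_val]
      simpa using mk_rel (KLRRel.x_mul_e (k := k) r i)
    · rw [eSeq_of_ne k h, mul_zero, zero_mul]
  t_mul_e r l _ := by
    by_cases h : wt l = α
    · obtain ⟨i, rfl⟩ := SeqOf.exists_val h
      rw [eSeq_val, ← SeqOf.val_swap, eSeq_val]
      exact t_mul_e k α r i
    · have h' : wt (swapAt r l) ≠ α := fun h' => h ((wt_perm (swapAt_perm r l)).symm.trans h')
      rw [eSeq_of_ne k h, eSeq_of_ne k h', mul_zero, zero_mul]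
  x_mul_x r s := by simpa using mk_rel (KLRRel.x_mul_x (k := k) (α := α) r s)
  t_x_eq r l a h₀ h₁ := by
    by_cases h : wt l = α
    · obtain ⟨i, rfl⟩ := SeqOf.exists_val h
      rw [eSeq_val]
      simpa using mk_rel (KLRRel.t_x_eq (k := k) r i a h₀ h₁)
    · simp [eSeq_of_ne k h]
  t_x_ne r l a b h₀ h₁ hab := by
    by_cases h : wt l = α
    · obtain ⟨i, rfl⟩ := SeqOf.exists_val h
      rw [eSeq_val]
      simpa using mk_rel (KLRRel.t_x_ne (k := k) r i a b h₀ h₁ hab)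
    · simp [eSeq_of_ne k h]
  x_t_eq r l a h₀ h₁ := by
    by_cases h : wt l = α
    · obtain ⟨i, rfl⟩ := SeqOf.exists_val h
      rw [eSeq_val]
      simpa using mk_rel (KLRRel.x_t_eq (k := k) r i a h₀ h₁)
    · simp [eSeq_of_ne k h]
  x_t_ne r l a b h₀ h₁ hab := by
    by_cases h : wt l = α
    · obtain ⟨i, rfl⟩ := SeqOf.exists_val h
      rw [eSeq_val]
      simpa using mk_rel (KLRRel.x_t_ne (k := k) r i a b h₀ h₁ hab)
    · simp [eSeq_of_ne k h]
  t_x_far r s h₀ h₁ := by simpa using mk_rel (KLRRel.t_x_far (k := k) (α := α) r s h₀ h₁)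
  t_t_far r s h := by simpa using mk_rel (KLRRel.t_t_far (k := k) (α := α) r s h)
  t_sq r l a b h₀ h₁ := by
    by_cases h : wt l = α
    · obtain ⟨i, rfl⟩ := SeqOf.exists_val h
      rw [eSeq_val]
      simpa [map_mk_klrQ] using mk_rel (KLRRel.t_sq (k := k) r i a b h₀ h₁)
    · simp [eSeq_of_ne k h]
  braid_eq r l a b h₀ h₁ h₂ := by
    by_cases h : wt l = α
    · obtain ⟨i, rfl⟩ := SeqOf.exists_val h
      rw [eSeq_val]
      simpa [map_mk_klrQDiff] using mk_rel (KLRRel.braid_eq (k := k) r i a b h₀ h₁ h₂)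
    · simp [eSeq_of_ne k h]
  braid_ne r l a c h₀ h₂ hac := by
    by_cases h : wt l = α
    · obtain ⟨i, rfl⟩ := SeqOf.exists_val h
      rw [eSeq_val]
      simpa using mk_rel (KLRRel.braid_ne (k := k) r i a c h₀ h₂ hac)
    · simp [eSeq_of_ne k h]

end KLRAlg

/-! ### The homomorphism from the KLR algebra to the balanced KLR algebra of the doubled quiver -/

section MapDouble

variable {I : Type u} {I₁ : Set I} {A B : Type*} [Ring A] [Ring B] (f : A →+* B)

theorem map_crossing (t : ℕ → A) (p : ℕ) (a b : I) :
    f (crossing I₁ t p a b) = crossing I₁ (fun r => f (t r)) p a b := by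
  unfold crossing
  split_ifs <;> simp

variable {ι : Type*} [Fintype ι] (s : ι → List I)

theorem map_doubleX (e : List (Doubled I₁) → A) (x : ℕ → A) (r : ℕ) :
    f (doubleX s e x r) = doubleX s (fun l => f (e l)) (fun r => f (x r)) r := by
  unfold doubleX
  rw [map_sum]
  refine Finset.sum_congr rfl fun i _ => ?_
  split_ifs <;> simp

theorem map_doubleT (e : List (Doubled I₁) → A) (t : ℕ → A) (r : ℕ) :
    f (doubleT s e t r) = doubleT s (fun l => f (e l)) (fun r => f (t r)) r := by
  unfold doubleT
  rw [map_sum]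
  refine Finset.sum_congr rfl fun i _ => ?_
  split_ifs <;> simp [map_crossing]

end MapDouble

section DoublingHom

variable (k : Type w) [Field k] {I : Type u} [Quiver.{v} I] (I₁ : Set I) (β : I →₀ ℕ)

/-- The element `∑ x_{r'} e(φ(i))` of the KLR algebra of the doubled quiver. -/
noncomputable def dblX (r : ℕ) : KLRAlg k (phiRoot I₁ β) :=
  doubleX (fun i : SeqOf β => i.1) (KLRAlg.eSeq k (phiRoot I₁ β)) (KLRAlg.x k _) r

/-- The element `∑ τ*_r e(φ(i))` of the KLR algebra of the doubled quiver. -/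
noncomputable def dblT (r : ℕ) : KLRAlg k (phiRoot I₁ β) :=
  doubleT (fun i : SeqOf β => i.1) (KLRAlg.eSeq k (phiRoot I₁ β)) (KLRAlg.t k _) r

variable {β} in
theorem eSeq_phiSeq (i : SeqOf β) :
    KLRAlg.eSeq k (phiRoot I₁ β) (phiSeq I₁ i.1) = KLRAlg.e k (phiOrd I₁ i).1 :=
  KLRAlg.eSeq_val k (phiOrd I₁ i).1

theorem eSeq_phiSeq_eq_zero (l : List I) (h : l ∉ Set.range (fun i : SeqOf β => i.1)) :
    KLRAlg.eSeq k (phiRoot I₁ β) (phiSeq I₁ l) = 0 := by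
  refine KLRAlg.eSeq_of_ne k fun h' => h ?_
  rw [wt_phiSeq] at h'
  exact ⟨⟨l, phiRoot_injective h'⟩, rfl⟩

theorem sum_eSeq_phiSeq :
    ∑ i : SeqOf β, KLRAlg.eSeq k (phiRoot I₁ β) (phiSeq I₁ i.1) = ordIdem k (phiRoot I₁ β) := by
  simp only [eSeq_phiSeq]
  exact (phiOrd_bijective β).sum_comp fun j : OrdSeq (phiRoot I₁ β) => KLRAlg.e k j.1

variable {k I₁ β}

theorem ordIdem_mul_of_ty (i : SeqOf β) {z : KLRAlg k (phiRoot I₁ β)}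
    (h : Ty (KLRAlg.eSeq k (phiRoot I₁ β)) (phiSeq I₁ i.1) z) :
    ordIdem k (phiRoot I₁ β) * z = z := by
  classical
  rw [← sum_eSeq_phiSeq, Finset.sum_mul, Finset.sum_eq_single i]
  · exact h
  · intro j _ hj
    exact (KLRAlg.klrSys k _).e_mul_of_ne h
      fun h' => hj (Subtype.ext (phiSeq_injective h'))
  · simp

theorem dblX_mul_ordIdem (r : ℕ) :
    dblX k I₁ β r * ordIdem k (phiRoot I₁ β) = dblX k I₁ β r := by
  rw [← sum_eSeq_phiSeq]
  exact (KLRAlg.klrSys k (phiRoot I₁ β)).doubleX_mul_sum r (s := fun i : SeqOf β => i.1) Subtype.val_injective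

theorem dblT_mul_ordIdem (r : ℕ) :
    dblT k I₁ β r * ordIdem k (phiRoot I₁ β) = dblT k I₁ β r := by
  rw [← sum_eSeq_phiSeq]
  exact (KLRAlg.klrSys k (phiRoot I₁ β)).doubleT_mul_sum r (s := fun i : SeqOf β => i.1) Subtype.val_injective

theorem ordIdem_mul_dblX (r : ℕ) :
    ordIdem k (phiRoot I₁ β) * dblX k I₁ β r = dblX k I₁ β r := by
  rw [dblX, doubleX, Finset.mul_sum]
  refine Finset.sum_congr rfl fun i _ => ?_
  split_ifs
  · exact ordIdem_mul_of_ty i ((KLRAlg.klrSys k _).ty_x _ ((KLRAlg.klrSys k _).ty_e _))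
  · rw [mul_zero]

theorem ty_tStar (i : SeqOf β) (r : ℕ) (hr : r + 1 < i.1.length) :
    Ty (KLRAlg.eSeq k (phiRoot I₁ β)) (phiSeq I₁ (i.swap r).1)
      (crossing I₁ (KLRAlg.t k (phiRoot I₁ β)) (phiPos I₁ i.1 r) i.1[r] i.1[r + 1] *
        KLRAlg.eSeq k (phiRoot I₁ β) (phiSeq I₁ i.1)) := by
  rw [SeqOf.val_swap]
  suffices key : ∀ (l : List I) (hr : r + 1 < l.length),
      Ty (KLRAlg.eSeq k (phiRoot I₁ β)) (phiSeq I₁ (swapAt r l))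
        (crossing I₁ (KLRAlg.t k (phiRoot I₁ β)) (phiPos I₁ l r) l[r] l[r + 1] *
          KLRAlg.eSeq k (phiRoot I₁ β) (phiSeq I₁ l)) from key i.1 hr
  intro l hr
  obtain ⟨l₁, a, b, l₂, rfl, rfl⟩ := exists_eq_append_cons_cons hr
  rw [phiPos_append_cons, swapAt_append_cons_cons]
  have h := (KLRAlg.klrSys k (phiRoot I₁ β)).ty_crossing_append
    ((KLRAlg.klrSys k _).ty_e (phiSeq I₁ (l₁ ++ a :: b :: l₂)))
  simpa using h

theorem ordIdem_mul_dblT (r : ℕ) :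
    ordIdem k (phiRoot I₁ β) * dblT k I₁ β r = dblT k I₁ β r := by
  rw [dblT, doubleT, Finset.mul_sum]
  refine Finset.sum_congr rfl fun i _ => ?_
  split_ifs with h
  · exact ordIdem_mul_of_ty (i.swap r) (ty_tStar i r h)
  · rw [mul_zero]

theorem mul_ordIdem_e (i : SeqOf β) : KLRAlg.e k (phiOrd I₁ i).1 * ordIdem k (phiRoot I₁ β) =
    KLRAlg.e k (phiOrd I₁ i).1 := by
  classical
  rw [ordIdem, Finset.mul_sum, Finset.sum_eq_single (phiOrd I₁ i), KLRAlg.e_mul_self]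
  · intro j _ hj
    exact KLRAlg.e_mul_ne k _ _ _ fun h => hj (Subtype.ext h).symm
  · simp

theorem ordIdem_mul_e (i : SeqOf β) : ordIdem k (phiRoot I₁ β) * KLRAlg.e k (phiOrd I₁ i).1 =
    KLRAlg.e k (phiOrd I₁ i).1 := by
  rw [← eSeq_phiSeq]
  exact ordIdem_mul_of_ty i ((KLRAlg.klrSys k _).ty_e _)

variable (k I₁ β)

/-- The images of the generators in the KLR algebra of the doubled quiver. -/
noncomputable def dblGen : KLRGen β → KLRAlg k (phiRoot I₁ β)
  | .e i => KLRAlg.e k (phiOrd I₁ i).1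
  | .x r => dblX k I₁ β r
  | .t r => dblT k I₁ β r

/-- The homomorphism from the free algebra to the KLR algebra of the doubled quiver. -/
noncomputable def dblFree : FreeAlgebra k (KLRGen β) →ₐ[k] KLRAlg k (phiRoot I₁ β) :=
  FreeAlgebra.lift k (dblGen k I₁ β)

/-- The homomorphism from the free algebra to `𝐞 R 𝐞`. -/
noncomputable def dblCorner : FreeAlgebra k (KLRGen β) →ₐ[k] OrdCorner k (phiRoot I₁ β) :=
  FreeAlgebra.lift k fun g => OrdCorner.mk k _ (dblGen k I₁ β g)

variable {k I₁ β}

theorem OrdCorner.val_mk {J : Type u} {J₁ : Set J} [Quiver.{v} J] {α : Doubled J₁ →₀ ℕ}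
    (z : KLRAlg k α) : (OrdCorner.mk k α z).1 = ordIdem k α * z * ordIdem k α := rfl

theorem OrdCorner.val_mul {J : Type u} {J₁ : Set J} [Quiver.{v} J] {α : Doubled J₁ →₀ ℕ}
    (y z : OrdCorner k α) : (y * z).1 = y.1 * z.1 := rfl

theorem OrdCorner.val_add {J : Type u} {J₁ : Set J} [Quiver.{v} J] {α : Doubled J₁ →₀ ℕ}
    (y z : OrdCorner k α) : (y + z).1 = y.1 + z.1 := rfl

theorem OrdCorner.mk_val {J : Type u} {J₁ : Set J} [Quiver.{v} J] {α : Doubled J₁ →₀ ℕ}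
    (z : OrdCorner k α) : OrdCorner.mk k α z.1 = z := by
  have hz := (Subsemigroup.mem_corner_iff (ordIdem_idem k α)).1 z.2
  exact Subtype.ext (by rw [OrdCorner.val_mk, hz.1, hz.2])

theorem OrdCorner.mk_add {J : Type u} {J₁ : Set J} [Quiver.{v} J] {α : Doubled J₁ →₀ ℕ}
    (y z : KLRAlg k α) : OrdCorner.mk k α (y + z) = OrdCorner.mk k α y + OrdCorner.mk k α z :=
  Subtype.ext (by simp only [OrdCorner.val_mk, OrdCorner.val_add, mul_add, add_mul])

theorem OrdCorner.mk_zero {J : Type u} {J₁ : Set J} [Quiver.{v} J] {α : Doubled J₁ →₀ ℕ} :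
    OrdCorner.mk k α 0 = 0 :=
  Subtype.ext (by rw [OrdCorner.val_mk, mul_zero, zero_mul]; rfl)

theorem dblGen_mul_ordIdem (g : KLRGen β) :
    dblGen k I₁ β g * ordIdem k (phiRoot I₁ β) = dblGen k I₁ β g := by
  match g with
  | .e i => exact mul_ordIdem_e i
  | .x r => exact dblX_mul_ordIdem r
  | .t r => exact dblT_mul_ordIdem r

theorem ordIdem_mul_dblGen (g : KLRGen β) :
    ordIdem k (phiRoot I₁ β) * dblGen k I₁ β g = dblGen k I₁ β g := by
  match g with
  | .e i => exact ordIdem_mul_e i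
  | .x r => exact ordIdem_mul_dblX r
  | .t r => exact ordIdem_mul_dblT r

/-- The images of the generators are fixed by `𝐞` on both sides, so the two homomorphisms differ
only in the unit, which is `1` for one and `𝐞` for the other. Relations in the corner can therefore
be checked in the full KLR algebra, to which `KLRSys` applies. -/
theorem dblCorner_val (z : FreeAlgebra k (KLRGen β)) :
    (dblCorner k I₁ β z).1 = dblFree k I₁ β z * ordIdem k (phiRoot I₁ β) ∧
    Commute (ordIdem k (phiRoot I₁ β)) (dblFree k I₁ β z) := by
  induction z using FreeAlgebra.induction with
  | grade0 c =>
    rw [AlgHom.commutes, AlgHom.commutes]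
    exact ⟨(Algebra.smul_def c _), (Algebra.commutes c _).symm⟩
  | grade1 g =>
    rw [dblCorner, dblFree, FreeAlgebra.lift_ι_apply, FreeAlgebra.lift_ι_apply, OrdCorner.val_mk,
      ordIdem_mul_dblGen]
    exact ⟨rfl, (ordIdem_mul_dblGen g).trans (dblGen_mul_ordIdem g).symm⟩
  | mul a b ha hb =>
    rw [map_mul, map_mul, OrdCorner.val_mul, ha.1, hb.1]
    refine ⟨?_, ha.2.mul_right hb.2⟩
    rw [mul_assoc, ← mul_assoc (ordIdem k _) (dblFree k I₁ β b), hb.2.eq, mul_assoc, mul_assoc,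
      (ordIdem_idem k _).eq]
  | add a b ha hb =>
    rw [map_add, map_add, OrdCorner.val_add, ha.1, hb.1, add_mul]
    exact ⟨rfl, ha.2.add_right hb.2⟩

/-! ### The ideal generated by the unordered idempotents -/

theorem BalancedKLR.cls_add {J : Type u} {J₁ : Set J} [Quiver.{v} J] {α : Doubled J₁ →₀ ℕ}
    (y z : KLRAlg k α) : cls k α (y + z) = cls k α y + cls k α z := by
  rw [cls, OrdCorner.mk_add, map_add]; rfl

theorem BalancedKLR.cls_zero {J : Type u} {J₁ : Set J} [Quiver.{v} J] {α : Doubled J₁ →₀ ℕ} :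
    cls k α 0 = 0 := by
  rw [cls, OrdCorner.mk_zero, map_zero]

theorem BalancedKLR.cls_neg {J : Type u} {J₁ : Set J} [Quiver.{v} J] {α : Doubled J₁ →₀ ℕ}
    (y : KLRAlg k α) : cls k α (-y) = -cls k α y := by
  rw [eq_neg_iff_add_eq_zero, ← cls_add, neg_add_cancel, cls_zero]

theorem BalancedKLR.cls_unordered {J : Type u} {J₁ : Set J} [Quiver.{v} J] {α : Doubled J₁ →₀ ℕ}
    (i : SeqOf α) (hi : Unordered i.1) (a b : KLRAlg k α) : cls k α (a * KLRAlg.e k i * b) = 0 := by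
  have h := RingQuot.mkAlgHom_rel k (BalancedRel.unordered (k := k) i hi a b)
  rw [map_zero] at h
  exact h

variable (k) in
/-- The largest two-sided ideal contained in the kernel of `z ↦ 𝐞 z 𝐞`, viewed in the balanced KLR
algebra. -/
noncomputable def clsIdeal {J : Type u} {J₁ : Set J} [Quiver.{v} J] (α : Doubled J₁ →₀ ℕ) :
    TwoSidedIdeal (KLRAlg k α) :=
  .mk' {z | ∀ a b, BalancedKLR.cls k α (a * z * b) = 0}
    (fun a b => by rw [mul_zero, zero_mul, BalancedKLR.cls_zero])
    (fun {y z} hy hz a b => by rw [mul_add, add_mul, BalancedKLR.cls_add, hy, hz, add_zero])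
    (fun {y} hy a b => by rw [mul_neg, neg_mul, BalancedKLR.cls_neg, hy, neg_zero])
    (fun {y z} hz a b => by rw [← mul_assoc a]; exact hz (a * y) b)
    (fun {y z} hy a b => by
      rw [← mul_assoc a, mul_assoc (a * y)]; exact hy a (z * b))

theorem mem_clsIdeal {J : Type u} {J₁ : Set J} [Quiver.{v} J] {α : Doubled J₁ →₀ ℕ}
    {z : KLRAlg k α} : z ∈ clsIdeal k α ↔ ∀ a b, BalancedKLR.cls k α (a * z * b) = 0 :=
  TwoSidedIdeal.mem_mk' _ _ _ _ _ _ _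

theorem mk'_eq_mk'_iff {R : Type*} [Ring R] (K : TwoSidedIdeal R) (y z : R) :
    K.ringCon.mk' y = K.ringCon.mk' z ↔ y - z ∈ K :=
  (RingCon.eq _).trans (K.rel_iff _ _)

/-- The case `a = b = 1` in the definition of `clsIdeal`. Relations in the balanced algebra can thus
be verified in a quotient of the full KLR algebra. -/
theorem BalancedKLR.proj_eq_proj {J : Type u} {J₁ : Set J} [Quiver.{v} J] {α : Doubled J₁ →₀ ℕ}
    {y z : OrdCorner k α} (h : (clsIdeal k α).ringCon.mk' y.1 = (clsIdeal k α).ringCon.mk' z.1) :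
    proj k α y = proj k α z := by
  rw [mk'_eq_mk'_iff, mem_clsIdeal] at h
  have h1 := h 1 1
  rw [one_mul, mul_one, sub_eq_add_neg, cls_add, cls_neg, add_neg_eq_zero, cls, cls,
    OrdCorner.mk_val, OrdCorner.mk_val] at h1
  exact h1

/-- This supplies, for the quotient by `clsIdeal`, the hypothesis `hun` of the computations with
crossings. -/
theorem mk'_eSeq_of_not_ok {J : Type u} {J₁ : Set J} [Quiver.{v} J] (α : Doubled J₁ →₀ ℕ)
    (l : List (Doubled J₁)) (hl : ¬ ok 0 l) :
    (clsIdeal k α).ringCon.mk' (KLRAlg.eSeq k α l) = 0 := by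
  by_cases h : wt l = α
  · obtain ⟨i, rfl⟩ := SeqOf.exists_val h
    rw [← map_zero (clsIdeal k α).ringCon.mk', mk'_eq_mk'_iff, sub_zero, mem_clsIdeal,
      KLRAlg.eSeq_val]
    exact BalancedKLR.cls_unordered i ((unordered_iff i.1).2 hl)
  · rw [KLRAlg.eSeq_of_ne k h, map_zero]

end DoublingHom

/-! ### The doubled elements satisfy the defining relations -/

section DoubleRel

variable {k : Type w} [Field k] {I : Type u} [Quiver.{v} I] {I₁ : Set I} {β : I →₀ ℕ}
  {B : Type*} [Ring B] {e : List (Doubled I₁) → B} {x t : ℕ → B}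

/-- The factor `e(φ(j))` is necessary because the sum of the `e(φ(i))` is not the unit of `B`. -/
theorem KLRSys.double_rel (K : KLRSys e x t) (hun : ∀ l, ¬ ok 0 l → e l = 0)
    (hI : ∀ i ∈ I₁, ∀ j ∈ I₁, arrowCount i j = 0)
    (hB : ∀ l, l ∉ Set.range (fun i : SeqOf β => i.1) → e (phiSeq I₁ l) = 0)
    (G : FreeAlgebra k (KLRGen β) →+* B)
    (hGe : ∀ i, G (freeE k β i) = e (phiSeq I₁ i.1))
    (hGx : ∀ r, G (freeX k β r) = doubleX (fun i : SeqOf β => i.1) e x r)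
    (hGt : ∀ r, G (freeT k β r) = doubleT (fun i : SeqOf β => i.1) e t r)
    {a b : FreeAlgebra k (KLRGen β)} (h : KLRRel k β a b) (j : SeqOf β) :
    G a * e (phiSeq I₁ j.1) = G b * e (phiSeq I₁ j.1) := by
  classical
  have hs : Function.Injective (fun i : SeqOf β => i.1) := Subtype.val_injective
  have hne (i : SeqOf β) (h : i ≠ j) : e (phiSeq I₁ i.1) * e (phiSeq I₁ j.1) = 0 :=
    K.e_mul_ne _ _ fun h' => h (Subtype.ext (phiSeq_injective h'))
  have hj := K.ty_e (phiSeq I₁ j.1)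
  -- A relation that ends in `e(i)` has to be checked only on vectors of type `φ(i)`; for `i ≠ j`
  -- both sides vanish.
  have red (i : SeqOf β) (y z : FreeAlgebra k (KLRGen β))
      (hyz : ∀ v, Ty e (phiSeq I₁ i.1) v → G y * v = G z * v) :
      G (y * freeE k β i) * e (phiSeq I₁ j.1) = G (z * freeE k β i) * e (phiSeq I₁ j.1) := by
    rw [map_mul, map_mul, hGe, mul_assoc, mul_assoc]
    by_cases hij : i = j
    · subst hij
      rw [K.e_mul_self]
      exact hyz _ hj
    · rw [hne i hij, mul_zero, mul_zero]
  cases h with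
  | x_out r h =>
    rw [map_zero, zero_mul, hGx, K.doubleX_mul_of_le (by rwa [j.length_eq]) hj]
  | t_out r h =>
    rw [map_zero, zero_mul, hGt, K.doubleT_mul_of_le (by rwa [j.length_eq]) hj]
  | e_mul_self i => rw [map_mul, hGe, K.e_mul_self]
  | e_mul_ne i i' h =>
    rw [map_mul, hGe, hGe, K.e_mul_ne _ _ fun h' => h (Subtype.ext (phiSeq_injective h')), map_zero]
  | sum_e =>
    rw [map_one, one_mul, map_sum, Finset.sum_mul, Finset.sum_eq_single j]
    · rw [hGe, K.e_mul_self]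
    · intro i _ hi
      rw [hGe, hne i hi]
    · simp
  | x_mul_e r i =>
    rw [map_mul, map_mul, hGe, hGx, mul_assoc, mul_assoc]
    have hT := K.ty_doubleX hs hB r hj
    by_cases hij : i = j
    · subst hij
      rw [K.e_mul_self, hT.eq]
    · rw [hne i hij, mul_zero,
        K.e_mul_of_ne hT fun h' => hij (Subtype.ext (phiSeq_injective h'))]
  | t_mul_e r i =>
    rw [map_mul, map_mul, hGe, hGe, hGt, mul_assoc, mul_assoc]
    by_cases hr : r + 1 < β.degree
    · have hT := K.ty_doubleT hs hB (r := r) (by rwa [j.length_eq]) hj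
      by_cases hij : i = j
      · subst hij
        rw [K.e_mul_self, SeqOf.val_swap, hT.eq]
      · rw [hne i hij, mul_zero, K.e_mul_of_ne hT]
        intro h'
        have h2 : swapAt r i.1 = swapAt r j.1 := phiSeq_injective h'
        exact hij (Subtype.ext (by rw [← swapAt_swapAt r i.1, h2, swapAt_swapAt]))
    · rw [K.doubleT_mul_of_le (by rw [j.length_eq]; omega) hj, mul_zero]
      by_cases hij : i = j
      · subst hij
        rw [K.e_mul_self, K.doubleT_mul_of_le (by rw [i.length_eq]; omega) hj]
      · rw [hne i hij, mul_zero]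
  | x_mul_x r r' =>
    rw [map_mul, map_mul, hGx, hGx, mul_assoc, mul_assoc]
    exact K.doubleX_doubleX hs hB r r' hj
  | t_x_eq r i a h₀ h₁ =>
    refine red i _ _ fun v hv => ?_
    obtain ⟨l₁, l₂, hl, hr⟩ := eq_append_cons_cons_of_getElem? h₀ h₁
    rw [hl] at hv
    simp only [map_mul, map_add, map_one, hGx, hGt, mul_assoc, add_mul, one_mul]
    exact K.doubleT_doubleX_self hun hs hB hr hv
  | t_x_ne r i a b h₀ h₁ h =>
    refine red i _ _ fun v hv => ?_
    obtain ⟨l₁, l₂, hl, hr⟩ := eq_append_cons_cons_of_getElem? h₀ h₁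
    rw [hl] at hv
    simp only [map_mul, hGx, hGt, mul_assoc]
    exact K.doubleT_doubleX_ne hs hB hr hv h
  | x_t_eq r i a h₀ h₁ =>
    refine red i _ _ fun v hv => ?_
    obtain ⟨l₁, l₂, hl, hr⟩ := eq_append_cons_cons_of_getElem? h₀ h₁
    rw [hl] at hv
    simp only [map_mul, map_add, map_one, hGx, hGt, mul_assoc, add_mul, one_mul]
    exact K.doubleX_doubleT_self hun hs hB hr hv
  | x_t_ne r i a b h₀ h₁ h =>
    refine red i _ _ fun v hv => ?_
    obtain ⟨l₁, l₂, hl, hr⟩ := eq_append_cons_cons_of_getElem? h₀ h₁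
    rw [hl] at hv
    simp only [map_mul, hGx, hGt, mul_assoc]
    exact K.doubleX_doubleT_ne hs hB hr hv h
  | t_x_far r r' h₀ h₁ =>
    rw [map_mul, map_mul, hGx, hGt, mul_assoc, mul_assoc]
    exact K.doubleT_doubleX_far hs hB r r' h₀ h₁ hj
  | t_t_far r r' h =>
    rw [map_mul, map_mul, hGt, hGt, mul_assoc, mul_assoc]
    exact K.doubleT_doubleT_far hs hB r r' h hj
  | t_sq r i a b h₀ h₁ =>
    refine red i _ _ fun v hv => ?_
    obtain ⟨l₁, l₂, hl, hr⟩ := eq_append_cons_cons_of_getElem? h₀ h₁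
    rw [hl] at hv
    simp only [map_mul, map_klrQ, hGx, hGt, mul_assoc]
    exact K.doubleT_doubleT hun hI hs hB hr hv
  | braid_eq r i a b h₀ h₁ h₂ =>
    refine red i _ _ fun v hv => ?_
    obtain ⟨b', l₁, l₂, hl, hr⟩ := eq_append_cons_cons_cons_of_getElem? h₀ h₂
    obtain rfl : b' = b := by
      rw [hl, ← hr] at h₁
      simpa using h₁
    rw [hl] at hv
    simp only [map_mul, map_sub, map_klrQDiff, hGx, hGt, mul_assoc, sub_mul]
    rw [K.doubleT_braid_eq hun hI hs hB hr hv, add_sub_cancel_left]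
  | braid_ne r i a c h₀ h₂ h =>
    have h0 := red i (freeT k β (r + 1) * freeT k β r * freeT k β (r + 1) -
          freeT k β r * freeT k β (r + 1) * freeT k β r) 0 fun v hv => by
      obtain ⟨b', l₁, l₂, hl, hr⟩ := eq_append_cons_cons_cons_of_getElem? h₀ h₂
      rw [hl] at hv
      simp only [map_mul, map_sub, map_zero, hGt, mul_assoc, sub_mul, zero_mul]
      rw [K.doubleT_braid_ne hs hB hr hv h, sub_self]
    rwa [zero_mul] at h0

end DoubleRel

/-! ### Existence of `Φ` -/

section Exists

variable (k : Type w) [Field k] {I : Type u} [Quiver.{v} I] (I₁ : Set I) (β : I →₀ ℕ)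

/-- Since `𝐞` is the sum of the `e(φ(j))`, this is the sum over `j` of `double_rel` in the quotient
by `clsIdeal`. -/
theorem dblFree_rel (hI : ∀ i ∈ I₁, ∀ j ∈ I₁, arrowCount i j = 0)
    {a b : FreeAlgebra k (KLRGen β)} (h : KLRRel k β a b) :
    (clsIdeal k (phiRoot I₁ β)).ringCon.mk' (dblFree k I₁ β a * ordIdem k (phiRoot I₁ β)) =
      (clsIdeal k (phiRoot I₁ β)).ringCon.mk' (dblFree k I₁ β b * ordIdem k (phiRoot I₁ β)) := by
  set p := (clsIdeal k (phiRoot I₁ β)).ringCon.mk'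
  have key := ((KLRAlg.klrSys k (phiRoot I₁ β)).map p).double_rel (k := k) (β := β)
    (mk'_eSeq_of_not_ok (phiRoot I₁ β)) hI
    (fun l hl => by rw [eSeq_phiSeq_eq_zero k I₁ β l hl, map_zero])
    (p.comp (dblFree k I₁ β : _ →+* KLRAlg k (phiRoot I₁ β)))
    (fun i => by
      change p (dblFree k I₁ β (FreeAlgebra.ι k (KLRGen.e i))) = _
      rw [dblFree, FreeAlgebra.lift_ι_apply, eSeq_phiSeq]
      rfl)
    (fun r => by
      change p (dblFree k I₁ β (FreeAlgebra.ι k (KLRGen.x r))) = _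
      rw [dblFree, FreeAlgebra.lift_ι_apply, ← map_doubleX]
      rfl)
    (fun r => by
      change p (dblFree k I₁ β (FreeAlgebra.ι k (KLRGen.t r))) = _
      rw [dblFree, FreeAlgebra.lift_ι_apply, ← map_doubleT]
      rfl) h
  rw [← sum_eSeq_phiSeq, map_mul, map_mul, map_sum, Finset.mul_sum, Finset.mul_sum]
  exact Finset.sum_congr rfl fun j _ => key j

/-- The homomorphism `Φ` exists. -/
theorem exists_isDoublingHom (hI : ∀ i ∈ I₁, ∀ j ∈ I₁, arrowCount i j = 0) :
    ∃ Φ : KLRAlg k β →ₐ[k] BalancedKLR k (phiRoot I₁ β), IsDoublingHom k Φ := by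
  let f : FreeAlgebra k (KLRGen β) →ₐ[k] BalancedKLR k (phiRoot I₁ β) :=
    (BalancedKLR.proj k (phiRoot I₁ β)).comp (dblCorner k I₁ β)
  have hf ⦃a b : FreeAlgebra k (KLRGen β)⦄ (h : KLRRel k β a b) : f a = f b := by
    refine BalancedKLR.proj_eq_proj ?_
    exact ((congrArg _ (dblCorner_val a).1).trans (dblFree_rel k I₁ β hI h)).trans
      (congrArg _ (dblCorner_val b).1.symm)
  let Φ : KLRAlg k β →ₐ[k] BalancedKLR k (phiRoot I₁ β) := RingQuot.liftAlgHom k ⟨f, hf⟩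
  have hΦ (z : FreeAlgebra k (KLRGen β)) : Φ (KLRAlg.mk k β z) = f z :=
    RingQuot.liftAlgHom_mkAlgHom_apply k f hf z
  -- The values of `Φ` are read off in the full KLR algebra, after multiplication by `𝐞`.
  have hcls (z : FreeAlgebra k (KLRGen β)) (y : KLRAlg k (phiRoot I₁ β))
      (h : dblFree k I₁ β z * ordIdem k (phiRoot I₁ β) =
        ordIdem k (phiRoot I₁ β) * y * ordIdem k (phiRoot I₁ β)) :
      Φ (KLRAlg.mk k β z) = BalancedKLR.cls k _ y := by
    rw [hΦ]
    refine congrArg (BalancedKLR.proj k (phiRoot I₁ β)) (Subtype.ext ?_)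
    exact (dblCorner_val z).1.trans h
  have K := KLRAlg.klrSys k (phiRoot I₁ β)
  have hs : Function.Injective (fun i : SeqOf β => i.1) := Subtype.val_injective
  have hB := eSeq_phiSeq_eq_zero k I₁ β
  have he (i : SeqOf β) : dblFree k I₁ β (freeE k β i) =
      KLRAlg.eSeq k (phiRoot I₁ β) (phiSeq I₁ i.1) := by
    rw [eSeq_phiSeq]
    exact FreeAlgebra.lift_ι_apply (dblGen k I₁ β) (KLRGen.e i)
  have hx (r : ℕ) : dblFree k I₁ β (freeX k β r) = dblX k I₁ β r :=
    FreeAlgebra.lift_ι_apply (dblGen k I₁ β) (KLRGen.x r)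
  have ht (r : ℕ) : dblFree k I₁ β (freeT k β r) = dblT k I₁ β r :=
    FreeAlgebra.lift_ι_apply (dblGen k I₁ β) (KLRGen.t r)
  refine ⟨Φ, ⟨fun i => ?_, fun i r hr => ?_, fun i r a b ha hb => ?_⟩⟩
  · refine hcls (freeE k β i) _ ?_
    rw [he, eSeq_phiSeq, ordIdem_mul_e]
  · have h1 := hcls (freeX k β r * freeE k β i)
      (KLRAlg.x k _ (phiPos I₁ i.1 r) * KLRAlg.e k (phiOrd I₁ i).1) (by
        rw [map_mul, he, hx, dblX, K.doubleX_mul_of_lt hs hB hr (K.ty_e _),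
          ← eSeq_phiSeq, ordIdem_mul_of_ty i (K.ty_x _ (K.ty_e _))])
    rw [map_mul] at h1
    exact h1
  · obtain ⟨h₀, rfl⟩ := List.getElem?_eq_some_iff.1 ha
    obtain ⟨h₁, rfl⟩ := List.getElem?_eq_some_iff.1 hb
    have h1 := hcls (freeT k β r * freeE k β i)
      (tStar k _ (phiPos I₁ i.1 r) i.1[r] i.1[r + 1] * KLRAlg.e k (phiOrd I₁ i).1) (by
        rw [map_mul, he, ht, dblT, ← eSeq_phiSeq]
        change _ = ordIdem k (phiRoot I₁ β) * (crossing I₁ (KLRAlg.t k (phiRoot I₁ β))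
          (phiPos I₁ i.1 r) i.1[r] i.1[r + 1] * _) * _
        rw [ordIdem_mul_of_ty (i.swap r) (ty_tStar i r h₁)]
        congr 1
        suffices key : ∀ (l : List I) (hr : r + 1 < l.length), doubleT (fun i : SeqOf β => i.1)
            (KLRAlg.eSeq k (phiRoot I₁ β)) (KLRAlg.t k _) r *
              KLRAlg.eSeq k (phiRoot I₁ β) (phiSeq I₁ l) =
            crossing I₁ (KLRAlg.t k (phiRoot I₁ β)) (phiPos I₁ l r) l[r] l[r + 1] *
              KLRAlg.eSeq k (phiRoot I₁ β) (phiSeq I₁ l) from key i.1 h₁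
        intro l hr
        obtain ⟨l₁, a, b, l₂, rfl, rfl⟩ := exists_eq_append_cons_cons hr
        rw [K.doubleT_mul hs hB rfl (K.ty_e _), phiPos_append_cons]
        simp)
    rw [map_mul] at h1
    exact h1

end Exists

/-! ### Moving a strand to the right -/

section Ok

variable {I : Type u} {I₁ : Set I}

theorem ok_insert_zero (n : ℕ) (l l' : List (Doubled I₁)) (i : I) (h : i ∉ I₁) :
    ok n (l ++ .zero i h :: l') ↔ ok n (l ++ l') := by
  induction l generalizing n with
  | nil => rfl
  | cons a l ih =>
    match a with
    | .zero j hj => exact ih n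
    | .one j hj => exact ih (n + 1)
    | .two j hj =>
      match n with
      | 0 => exact Iff.rfl
      | n + 1 => exact ih n

theorem ok_insert_two {n : ℕ} {l l' : List (Doubled I₁)} (i : I) (h : i ∈ I₁)
    (hl : ok n (l ++ l')) : ok (n + 1) (l ++ .two i h :: l') := by
  induction l generalizing n with
  | nil => exact hl
  | cons a l ih =>
    match a with
    | .zero j hj => exact ih hl
    | .one j hj => exact ih (n := n + 1) hl
    | .two j hj =>
      match n with
      | 0 => exact hl.elim
      | n + 1 => exact ih (n := n) hl

/-- The entry `i¹` adds one to the credit on the stretch up to the inserted `i²`, which takes it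
back. -/
theorem ok_insert_one_two {n : ℕ} {l₁ l₂ l₃ : List (Doubled I₁)} (i : I) (h : i ∈ I₁)
    (hl : ok n (l₁ ++ (l₂ ++ l₃))) : ok n (l₁ ++ .one i h :: (l₂ ++ .two i h :: l₃)) := by
  induction l₁ generalizing n with
  | nil => exact ok_insert_two i h hl
  | cons a l ih =>
    match a with
    | .zero j hj => exact ih hl
    | .one j hj => exact ih (n := n + 1) hl
    | .two j hj =>
      match n with
      | 0 => exact hl.elim
      | n + 1 => exact ih (n := n) hl

end Ok

/-- The product `τ_{p+n-1} ⋯ τ_{p+1} τ_p`, which moves the strand at position `p` by `n` places. -/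
def strandMove {A : Type*} [Ring A] (t : ℕ → A) (p : ℕ) : ℕ → A
  | 0 => 1
  | n + 1 => t (p + n) * strandMove t p n

/-- A subspace that is spanned by vectors with types `pre ++ l`, where `l` satisfies `Q`, and that
is stable under the `x_r` and under the `τ_r` with `p ≤ r`. -/
structure IsStrandModule (k : Type w) [Field k] {J : Type u} {A : Type*} [Ring A] [Algebra k A]
    (e : List J → A) (x t : ℕ → A) (pre : List J) (p : ℕ) (Q : List J → Prop)
    (Y : Submodule k A) : Prop where
  mem_span : ∀ y ∈ Y, y ∈ Submodule.span k {z | z ∈ Y ∧ ∃ l, Q l ∧ Ty e (pre ++ l) z}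
  x_mem : ∀ r, ∀ y ∈ Y, x r * y ∈ Y
  t_mem : ∀ r, p ≤ r → ∀ y ∈ Y, t r * y ∈ Y

theorem mul_mem_of_mem_span {k : Type w} [Field k] {A : Type*} [Ring A] [Algebra k A] {S : Set A}
    {N : Submodule k A} {a y : A} (hy : y ∈ Submodule.span k S) (h : ∀ z ∈ S, a * z ∈ N) :
    a * y ∈ N := by
  induction hy using Submodule.span_induction with
  | mem z hz => exact h z hz
  | zero => rw [mul_zero]; exact N.zero_mem
  | add y z _ _ hy hz => rw [mul_add]; exact N.add_mem hy hz
  | smul c y _ hy => rw [mul_smul_comm]; exact N.smul_mem c hy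

/-- The subring of the elements that stabilize a subspace. -/
def stabilizerRing {k : Type w} [Field k] {A : Type*} [Ring A] [Algebra k A] (N : Submodule k A) :
    Subring A where
  carrier := {a | ∀ z ∈ N, a * z ∈ N}
  mul_mem' {a b} ha hb z hz := by rw [mul_assoc]; exact ha _ (hb z hz)
  one_mem' z hz := by rwa [one_mul]
  add_mem' {a b} ha hb z hz := by rw [add_mul]; exact N.add_mem (ha z hz) (hb z hz)
  zero_mem' z _ := by rw [zero_mul]; exact N.zero_mem
  neg_mem' {a} ha z hz := by rw [neg_mul]; exact N.neg_mem (ha z hz)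

section Mem

variable {J : Type u} [Quiver.{v} J] {A : Type*} [Ring A] {S : Subring A} (i j : J)

theorem klrQ_mem {a b : A} (ha : a ∈ S) (hb : b ∈ S) : klrQ i j a b ∈ S := by
  unfold klrQ
  split_ifs
  · exact S.zero_mem
  · exact S.mul_mem (S.pow_mem (S.sub_mem hb ha) _) (S.pow_mem (S.sub_mem ha hb) _)

theorem klrQDiff_mem {a b c : A} (ha : a ∈ S) (hb : b ∈ S) (hc : c ∈ S) :
    klrQDiff i j a b c ∈ S := by
  unfold klrQDiff
  split_ifs
  · exact S.zero_mem
  · exact S.mul_mem (S.pow_mem (S.neg_mem S.one_mem) _) (S.sum_mem fun m _ =>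
      S.mul_mem (S.pow_mem (S.sub_mem hc hb) _) (S.pow_mem (S.sub_mem ha hb) _))

end Mem

/-! ### Entries of a sequence in which one strand has been moved -/

section Moved

variable {J : Type u} (pre : List J) (a : J) {l : List J} {n : ℕ}

theorem getElem?_moved (h : n ≤ l.length) :
    (pre ++ (l.take n ++ a :: l.drop n))[pre.length + n]? = some a := by
  rw [List.getElem?_append_right (by omega), Nat.add_sub_cancel_left,
    List.getElem?_append_right (by simp)]
  simp [h]

theorem getElem?_moved_succ (h : n < l.length) :
    (pre ++ (l.take n ++ a :: l.drop n))[pre.length + n + 1]? = some l[n] := by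
  rw [List.getElem?_append_right (by omega), List.getElem?_append_right (by simp; omega),
    show pre.length + n + 1 - pre.length - (l.take n).length = 1 by simp; omega]
  simp [h]

theorem getElem?_moved_add_two (h : n + 1 < l.length) :
    (pre ++ (l.take n ++ a :: l.drop n))[pre.length + n + 2]? = some l[n + 1] := by
  rw [List.getElem?_append_right (by omega), List.getElem?_append_right (by simp; omega),
    show pre.length + n + 2 - pre.length - (l.take n).length = 2 by simp; omega]
  simp [h]

end Moved

/-! ### Moving a single strand -/

namespace KLRSys

variable {k : Type w} [Field k] {J : Type u} [Quiver.{v} J] {A : Type*} [Ring A] [Algebra k A]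
  {e : List J → A} {x t : ℕ → A}

section Commute

variable (K : KLRSys e x t)
include K

theorem strandMove_commute (p n r : ℕ) (h : p + n < r) : Commute (t r) (strandMove t p n) := by
  induction n with
  | zero => exact Commute.one_right _
  | succ n ih =>
    exact Commute.mul_right (K.t_t_far (p + n) r (by omega)).symm (ih (by omega))

variable (hout : ∀ r l, l.length ≤ r + 1 → t r * e l = 0)
include hout

omit K [Quiver.{v} J] in
theorem t_mul_eq_zero {l : List J} {y : A} (hy : Ty e l y) (r : ℕ) (hr : l.length ≤ r + 1) :
    t r * y = 0 := by
  rw [← hy.eq, ← mul_assoc, hout r l hr, zero_mul]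

/-- The number `n` is not bounded in `strandMove`; a move beyond the last strand is zero by `hout`.
-/
theorem strandMove_ty {pre l : List J} {a : J} {y : A} (hy : Ty e (pre ++ a :: l) y) (n : ℕ) :
    (n ≤ l.length ∧ Ty e (pre ++ (l.take n ++ a :: l.drop n)) (strandMove t pre.length n * y)) ∨
      strandMove t pre.length n * y = 0 := by
  induction n with
  | zero => exact Or.inl ⟨Nat.zero_le _, by simpa [strandMove] using hy⟩
  | succ n ih =>
    rw [strandMove, mul_assoc]
    rcases ih with ⟨hn, h⟩ | h
    · rcases hn.lt_or_eq with hlt | rfl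
      · refine Or.inl ⟨hlt, ?_⟩
        have hd : l.drop n = l[n] :: l.drop (n + 1) := List.drop_eq_getElem_cons hlt
        have h1 := K.ty_t (pre.length + n) (by simp; omega) h
        rw [swapAt_append_left, hd] at h1
        have h2 : swapAt n (l.take n ++ a :: l[n] :: l.drop (n + 1)) =
            l.take n ++ l[n] :: a :: l.drop (n + 1) := by
          have h3 := swapAt_append_cons_cons (l.take n) a l[n] (l.drop (n + 1))
          rwa [List.length_take_of_le hn] at h3
        rw [h2] at h1
        rw [List.take_succ_eq_append_getElem hlt, List.append_assoc, List.singleton_append]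
        exact h1
      · exact Or.inr (t_mul_eq_zero hout h _ (by simp; omega))
    · rw [h, mul_zero]
      exact Or.inr rfl

end Commute

section Step

variable (K : KLRSys e x t) (hout : ∀ r l, l.length ≤ r + 1 → t r * e l = 0)
  {pre : List J} {a : J} {Q : List J → Prop} {Y : Submodule k A}

variable (t pre Y) in
/-- The span of the vectors that are obtained by moving the strand at position `|pre|` by at most
`n` places. -/
def moveSpan (n : ℕ) : Submodule k A :=
  Submodule.span k {z | ∃ m ≤ n, ∃ y ∈ Y, z = strandMove t pre.length m * y}

variable (t pre Y) in
/-- The span of the vectors that are obtained by moving the strand at position `|pre|`. -/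
def moveSpanAll : Submodule k A :=
  Submodule.span k {z | ∃ m, ∃ y ∈ Y, z = strandMove t pre.length m * y}

omit [Quiver.{v} J] in
theorem mem_moveSpan {m n : ℕ} (h : m ≤ n) {y : A} (hy : y ∈ Y) :
    strandMove t pre.length m * y ∈ moveSpan t pre Y n :=
  Submodule.subset_span ⟨m, h, y, hy, rfl⟩

omit [Quiver.{v} J] in
theorem moveSpan_mono {m n : ℕ} (h : m ≤ n) : moveSpan t pre Y m ≤ moveSpan t pre Y n :=
  Submodule.span_mono fun _ ⟨m', hm', y, hy, hz⟩ => ⟨m', hm'.trans h, y, hy, hz⟩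

omit [Quiver.{v} J] in
theorem moveSpan_le (n : ℕ) : moveSpan t pre Y n ≤ moveSpanAll t pre Y :=
  Submodule.span_mono fun _ ⟨m', _, y, hy, hz⟩ => ⟨m', y, hy, hz⟩

omit [Quiver.{v} J] in
theorem mem_moveSpanAll {y : A} (hy : y ∈ Y) : y ∈ moveSpanAll t pre Y :=
  Submodule.subset_span ⟨0, y, hy, (one_mul y).symm⟩

variable (hY : IsStrandModule k e x t (pre ++ [a]) (pre.length + 1) Q Y)
include K hY

theorem t_mul_moveSpan (n : ℕ) {z : A} (hz : z ∈ moveSpan t pre Y n) :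
    t (pre.length + n) * z ∈ moveSpan t pre Y (n + 1) := by
  refine mul_mem_of_mem_span hz ?_
  rintro _ ⟨m, hm, y, hy, rfl⟩
  rcases hm.lt_or_eq with h | rfl
  · rw [← mul_assoc, (K.strandMove_commute _ m _ (by omega)).eq, mul_assoc]
    exact mem_moveSpan (by omega) (hY.t_mem _ (by omega) y hy)
  · rw [← mul_assoc]
    exact mem_moveSpan (m := m + 1) le_rfl hy

include hout

/-- A dot passes each crossing up to a correction in which that crossing is missing. Hence the
filtration by the length of the move is preserved, by induction on `n`. -/
theorem x_mul_moveSpan (n r : ℕ) {z : A} (hz : z ∈ moveSpan t pre Y n) :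
    x r * z ∈ moveSpan t pre Y n := by
  induction n generalizing r z with
  | zero =>
    refine mul_mem_of_mem_span hz ?_
    rintro _ ⟨m, hm, y, hy, rfl⟩
    obtain rfl : m = 0 := by omega
    rw [strandMove, one_mul]
    simpa [strandMove] using mem_moveSpan (t := t) (pre := pre) (Nat.zero_le 0) (hY.x_mem r y hy)
  | succ n ih =>
    refine mul_mem_of_mem_span hz ?_
    rintro _ ⟨m, hm, y, hy, rfl⟩
    by_cases hmn : m ≤ n
    · exact moveSpan_mono (Nat.le_succ n) (ih r (mem_moveSpan hmn hy))
    · obtain rfl : m = n + 1 := by omega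
      rw [← mul_assoc]
      refine mul_mem_of_mem_span (hY.mem_span y hy) ?_
      rintro y ⟨hy, l, -, hl⟩
      rw [mul_assoc, strandMove, mul_assoc]
      rw [List.append_assoc, List.singleton_append] at hl
      have hw : strandMove t pre.length n * y ∈ moveSpan t pre Y n := mem_moveSpan le_rfl hy
      rcases K.strandMove_ty hout hl n with ⟨hn, h⟩ | h
      · rcases hn.lt_or_eq with hlt | rfl
        · have g₀ := getElem?_moved pre a hn
          have g₁ := getElem?_moved_succ pre a hlt
          by_cases h1 : r = pre.length + n + 1
          · subst h1
            by_cases hab : a = l[n]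
            · rw [K.x_t_eq' _ a h g₀ (hab ▸ g₁)]
              exact Submodule.add_mem _ (K.t_mul_moveSpan hY n (ih _ hw))
                (moveSpan_mono (Nat.le_succ n) hw)
            · rw [K.x_t_ne' _ a l[n] h g₀ g₁ hab]
              exact K.t_mul_moveSpan hY n (ih _ hw)
          · by_cases h2 : r = pre.length + n
            · subst h2
              by_cases hab : a = l[n]
              · have h3 := K.t_x_eq' _ a h g₀ (hab ▸ g₁)
                rw [← sub_eq_iff_eq_add] at h3
                rw [← h3]
                exact Submodule.sub_mem _ (K.t_mul_moveSpan hY n (ih _ hw))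
                  (moveSpan_mono (Nat.le_succ n) hw)
              · rw [← K.t_x_ne' _ a l[n] h g₀ g₁ hab]
                exact K.t_mul_moveSpan hY n (ih _ hw)
            · rw [K.x_t_far' _ _ h2 h1]
              exact K.t_mul_moveSpan hY n (ih _ hw)
        · rw [t_mul_eq_zero hout h _ (by simp; omega), mul_zero]
          exact Submodule.zero_mem _
      · rw [h, mul_zero, mul_zero]
        exact Submodule.zero_mem _

theorem x_mul_moveSpanAll (r : ℕ) {z : A} (hz : z ∈ moveSpanAll t pre Y) :
    x r * z ∈ moveSpanAll t pre Y := by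
  refine mul_mem_of_mem_span hz ?_
  rintro _ ⟨m, y, hy, rfl⟩
  exact moveSpan_le m (K.x_mul_moveSpan hout hY m r (mem_moveSpan le_rfl hy))

theorem klrQ_mul_moveSpan (n r s : ℕ) (b c : J) {z : A} (hz : z ∈ moveSpan t pre Y n) :
    klrQ b c (x r) (x s) * z ∈ moveSpan t pre Y n :=
  klrQ_mem (S := stabilizerRing (moveSpan t pre Y n)) b c (fun _ h => K.x_mul_moveSpan hout hY n r h)
    (fun _ h => K.x_mul_moveSpan hout hY n s h) z hz

theorem klrQDiff_mul_moveSpan (n r s q : ℕ) (b c : J) {z : A} (hz : z ∈ moveSpan t pre Y n) :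
    klrQDiff b c (x r) (x s) (x q) * z ∈ moveSpan t pre Y n :=
  klrQDiff_mem (S := stabilizerRing (moveSpan t pre Y n)) b c
    (fun _ h => K.x_mul_moveSpan hout hY n r h)
    (fun _ h => K.x_mul_moveSpan hout hY n s h) (fun _ h => K.x_mul_moveSpan hout hY n q h) z hz

/-- The two leftmost crossings form a square, which is a polynomial in the dots; the rest is a move
shorter by one. -/
theorem t_mul_strandMove_succ (n : ℕ) {y : A} (hy : y ∈ Y) :
    t (pre.length + n) * (strandMove t pre.length (n + 1) * y) ∈ moveSpan t pre Y n := by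
  rw [← mul_assoc]
  refine mul_mem_of_mem_span (hY.mem_span y hy) ?_
  rintro y ⟨hy, l, -, hl⟩
  rw [mul_assoc, strandMove, mul_assoc]
  rw [List.append_assoc, List.singleton_append] at hl
  have hw : strandMove t pre.length n * y ∈ moveSpan t pre Y n := mem_moveSpan le_rfl hy
  rcases K.strandMove_ty hout hl n with ⟨hn, h⟩ | h
  · rcases hn.lt_or_eq with hlt | rfl
    · rw [K.t_sq' _ a l[n] h (getElem?_moved _ _ hn) (getElem?_moved_succ _ _ hlt)]
      exact K.klrQ_mul_moveSpan hout hY n _ _ _ _ hw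
    · rw [t_mul_eq_zero hout h _ (by simp; omega), mul_zero]
      exact Submodule.zero_mem _
  · rw [h, mul_zero, mul_zero]
    exact Submodule.zero_mem _

/-- Write `p = |pre|` and let `U_n` be the move by `n` places. The braid relation exchanges `τ_{p+n}
U_{n+2}` and `U_{n+2} τ_{p+n+1}` up to a polynomial in the dots times `U_n`, and `τ_{p+n+1}`
preserves `Y`. -/
theorem t_mul_strandMove_add_two (n : ℕ) {y : A} (hy : y ∈ Y) :
    t (pre.length + n) * (strandMove t pre.length (n + 2) * y) ∈ moveSpan t pre Y (n + 2) := by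
  rw [← mul_assoc]
  refine mul_mem_of_mem_span (hY.mem_span y hy) ?_
  rintro y ⟨hy, l, -, hl⟩
  rw [mul_assoc, strandMove, strandMove, mul_assoc, mul_assoc]
  rw [List.append_assoc, List.singleton_append] at hl
  have hw : strandMove t pre.length n * y ∈ moveSpan t pre Y n := mem_moveSpan le_rfl hy
  have hm : t (pre.length + (n + 1)) * (t (pre.length + n) * (t (pre.length + (n + 1)) *
      (strandMove t pre.length n * y))) ∈ moveSpan t pre Y (n + 2) := by
    rw [← mul_assoc (t _) (strandMove _ _ _), (K.strandMove_commute _ n _ (by omega)).eq, mul_assoc,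
      ← mul_assoc (t _) (strandMove _ _ _), ← mul_assoc (t _) (t _ * _)]
    exact mem_moveSpan (m := n + 2) le_rfl (hY.t_mem _ (by omega) y hy)
  rcases K.strandMove_ty hout hl n with ⟨hn, h⟩ | h
  · by_cases hlt : n + 1 < l.length
    · have g₀ := getElem?_moved pre a hn
      have g₁ := getElem?_moved_succ pre a (l := l) (n := n) (by omega)
      have g₂ := getElem?_moved_add_two pre a hlt
      by_cases hac : a = l[n + 1]
      · have h1 := K.braid_eq' (pre.length + n) a l[n] h g₀ g₁ (hac ▸ g₂)
        rw [← sub_eq_iff_eq_add] at h1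
        rw [← add_assoc] at hm ⊢
        rw [← h1]
        exact Submodule.sub_mem _ hm (moveSpan_mono (by omega)
          (K.klrQDiff_mul_moveSpan hout hY n _ _ _ _ _ hw))
      · have h1 := K.braid_ne' (pre.length + n) a l[n + 1] h g₀ g₂ hac
        rw [← add_assoc] at hm ⊢
        rw [← h1]
        exact hm
    · rcases hn.lt_or_eq with hlt' | rfl
      · have h1 := K.ty_t (pre.length + n) (by simp; omega) h
        rw [t_mul_eq_zero hout h1 _ (by rw [length_swapAt]; simp; omega), mul_zero]
        exact Submodule.zero_mem _
      · rw [t_mul_eq_zero hout h _ (by simp; omega), mul_zero, mul_zero]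
        exact Submodule.zero_mem _
  · rw [h, mul_zero, mul_zero, mul_zero]
    exact Submodule.zero_mem _

/-- The moves `U_n` correspond to coset representatives of a symmetric group modulo the subgroup
that fixes the first letter. With `p = |pre|`, left multiplication by `τ_{p+j}` extends the move for
`j = n`, passes through to `Y` for `j > n`, and for `j < n` commutes past the leftmost crossings
until one of the two preceding lemmas applies. -/
theorem t_mul_strandMove (j n : ℕ) {y : A} (hy : y ∈ Y) :
    t (pre.length + j) * (strandMove t pre.length n * y) ∈ moveSpan t pre Y (max n (j + 1)) := by
  rcases lt_trichotomy j n with h | rfl | h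
  · rw [max_eq_left h]
    obtain ⟨m, rfl⟩ := Nat.exists_eq_add_of_lt h
    induction m with
    | zero => exact moveSpan_mono (by omega) (K.t_mul_strandMove_succ hout hY j hy)
    | succ m ih =>
      match m with
      | 0 => exact K.t_mul_strandMove_add_two hout hY j hy
      | m + 1 =>
        rw [show j + (m + 1 + 1) + 1 = (j + (m + 1) + 1) + 1 by omega, strandMove, mul_assoc,
          K.t_t_far' _ _ (Or.inl (by omega))]
        exact K.t_mul_moveSpan hY _ (ih (by omega))
  · rw [← mul_assoc]
    exact mem_moveSpan (m := j + 1) (by omega) hy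
  · rw [← mul_assoc, (K.strandMove_commute _ n _ (by omega)).eq, mul_assoc]
    exact mem_moveSpan (by omega) (hY.t_mem _ (by omega) y hy)

/-- The inductive step for a single strand: stability under the crossings to the right of it is
extended to the crossings that involve it. In the new types the label `a` is inserted at an
arbitrary place. -/
theorem isStrandModule_moveSpanAll :
    IsStrandModule k e x t pre pre.length
      (fun l' => ∃ l n, Q l ∧ n ≤ l.length ∧ l' = l.take n ++ a :: l.drop n)
      (moveSpanAll t pre Y) where
  mem_span z hz := by
    refine Submodule.span_le.2 ?_ hz
    rintro _ ⟨m, y, hy, rfl⟩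
    refine mul_mem_of_mem_span (hY.mem_span y hy) ?_
    rintro y ⟨hy, l, hQ, hl⟩
    rw [List.append_assoc, List.singleton_append] at hl
    rcases K.strandMove_ty hout hl m with ⟨hn, h⟩ | h
    · exact Submodule.subset_span ⟨Submodule.subset_span ⟨m, y, hy, rfl⟩, _,
        ⟨l, m, hQ, hn, rfl⟩, h⟩
    · rw [h]
      exact Submodule.zero_mem _
  x_mem r z hz := K.x_mul_moveSpanAll hout hY r hz
  t_mem r hr z hz := by
    refine mul_mem_of_mem_span hz ?_
    rintro _ ⟨m, y, hy, rfl⟩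
    obtain ⟨j, rfl⟩ := Nat.exists_eq_add_of_le hr
    exact moveSpan_le _ (K.t_mul_strandMove hout hY j m hy)

end Step
end KLRSys

/-! ### Unordered idempotents and almost ordered idempotents -/

namespace KLRSys

variable {k : Type w} [Field k] {I : Type u} [Quiver.{v} I] {I₁ : Set I} {A : Type*} [Ring A]
  [Algebra k A] {e : List (Doubled I₁) → A} {x t : ℕ → A}

/-! ### Moving a pair of strands -/

section Pair

variable {pre : List (Doubled I₁)} {i : I} {hi : i ∈ I₁} {Y : Submodule k A}

variable (t pre Y) in
/-- The span of the vectors obtained by moving the two strands of a pair, such that they stay in the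
right order and the second one is moved by `n - 1` places. -/
def pairSpan (n : ℕ) : Submodule k A :=
  Submodule.span k {z | ∃ j n', n' + 1 = n ∧ j ≤ n' ∧ ∃ y ∈ Y,
    z = strandMove t pre.length j * (strandMove t (pre.length + 1) n' * y)}

variable (K : KLRSys e x t) (hout : ∀ r l, l.length ≤ r + 1 → t r * e l = 0)
  (hkill : ∀ l, e (pre ++ Doubled.two i hi :: l) = 0)
  (hY : IsStrandModule k e x t (pre ++ [Doubled.one i hi] ++ [Doubled.two i hi]) (pre.length + 2) (ok 0) Y)
include K hY

theorem t_mul_pairSpan_far (n r : ℕ) (hr : pre.length + n < r) {z : A}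
    (hz : z ∈ pairSpan t pre Y n) : t r * z ∈ pairSpan t pre Y n := by
  refine mul_mem_of_mem_span hz ?_
  rintro _ ⟨j, n', hn, hj, y, hy, rfl⟩
  rw [← mul_assoc, (K.strandMove_commute _ j r (by omega)).eq, mul_assoc, ← mul_assoc (t r),
    (K.strandMove_commute _ n' r (by omega)).eq, mul_assoc]
  exact Submodule.subset_span ⟨j, n', hn, hj, _, hY.t_mem r (by omega) y hy, rfl⟩

omit hY in
theorem t_mul_pairSpan (n : ℕ) {z : A} (hz : z ∈ pairSpan t pre Y n) :
    t (pre.length + n) * z ∈ pairSpan t pre Y (n + 1) := by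
  refine mul_mem_of_mem_span hz ?_
  rintro _ ⟨j, n', rfl, hj, y, hy, rfl⟩
  rw [← mul_assoc, (K.strandMove_commute _ j _ (by omega)).eq, mul_assoc, ← mul_assoc (t _)]
  refine Submodule.subset_span ⟨j, n' + 1, rfl, by omega, y, hy, ?_⟩
  rw [strandMove, add_assoc pre.length 1, add_comm 1 n']

include hout

omit hY in
theorem pair_ty {l : List (Doubled I₁)} {y : A}
    (hy : Ty e (pre ++ [Doubled.one i hi] ++ [Doubled.two i hi] ++ l) y) (j n : ℕ) :
    (n ≤ l.length ∧
      Ty e (pre ++ ((l.take n ++ Doubled.two i hi :: l.drop n).take j ++ Doubled.one i hi ::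
        (l.take n ++ Doubled.two i hi :: l.drop n).drop j))
        (strandMove t pre.length j * (strandMove t (pre.length + 1) n * y))) ∨
      strandMove t pre.length j * (strandMove t (pre.length + 1) n * y) = 0 := by
  have hy' : Ty e ((pre ++ [Doubled.one i hi]) ++ Doubled.two i hi :: l) y := by simpa using hy
  rcases K.strandMove_ty hout hy' n with ⟨hn, h⟩ | h
  · rw [List.length_append, List.length_singleton] at h
    rw [List.append_assoc, List.singleton_append] at h
    rcases K.strandMove_ty hout h j with ⟨-, h'⟩ | h'
    · exact Or.inl ⟨hn, h'⟩
    · exact Or.inr h'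
  · rw [List.length_append, List.length_singleton] at h
    rw [h, mul_zero]
    exact Or.inr rfl

include hkill

/-- If the first strand of the pair overtakes the second one, the vector is a combination of vectors
in which it does not. The induction on `n` undoes the overtaking by a braid move, until the pair is
exchanged at its initial place, where `hkill` applies. -/
theorem strandMove_mem_pairSpan (n m : ℕ) (h : n + 1 ≤ m) {y : A} (hy : y ∈ Y) :
    strandMove t pre.length m * (strandMove t (pre.length + 1) n * y) ∈ pairSpan t pre Y n := by
  induction n generalizing m y with
  -- `pairSpan` with the parameter `0` is the zero space, because `n' + 1 = 0` has no solution; so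
  -- the claim here is that the vector vanishes.
  | zero =>
    induction m, h using Nat.le_induction with
    | base =>
      rw [← mul_assoc]
      refine mul_mem_of_mem_span (hY.mem_span y hy) ?_
      rintro y ⟨hy, l, -, hl⟩
      have h1 : Ty e (pre ++ Doubled.one i hi :: Doubled.two i hi :: l) y := by simpa using hl
      have h2 := K.ty_t pre.length (by simp) h1
      rw [swapAt_append_cons_cons] at h2
      simp only [strandMove, mul_one, add_zero]
      rw [← h2.eq, hkill, zero_mul]
      exact Submodule.zero_mem _
    | succ m hm ih =>
      rw [show strandMove t pre.length (m + 1) = t (pre.length + m) * strandMove t pre.length m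
        from rfl, mul_assoc]
      exact K.t_mul_pairSpan_far hY 0 _ (by omega) ih
  | succ n ih =>
    induction m, h using Nat.le_induction with
    | succ m hm ih' =>
      rw [show strandMove t pre.length (m + 1) = t (pre.length + m) * strandMove t pre.length m
        from rfl, mul_assoc]
      exact K.t_mul_pairSpan_far hY _ _ (by omega) ih'
    | base =>
      rw [← mul_assoc]
      refine mul_mem_of_mem_span (hY.mem_span y hy) ?_
      rintro y ⟨hy, l, -, hl⟩
      -- This is the other side of the braid relation: the inductive hypothesis for the shorter
      -- move, followed by `τ_{p+n+1}`, which preserves the span, and by `τ_{p+n}`, which raises its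
      -- parameter; here `p = |pre|`.
      have h1 := K.t_mul_pairSpan n (K.t_mul_pairSpan_far hY n (pre.length + n + 1) (by omega)
        (ih (n + 1) le_rfl hy))
      -- The last crossing of the second move commutes with the first `n` crossings of the first
      -- move. This produces the three crossings of a braid move of the pair and the strand next to
      -- it.
      have h2 : strandMove t pre.length (n + 1 + 1) * strandMove t (pre.length + 1) (n + 1) * y =
          t (pre.length + n + 1) * (t (pre.length + n) * (t (pre.length + n + 1) *
            (strandMove t pre.length n * (strandMove t (pre.length + 1) n * y)))) := by
        rw [strandMove, strandMove, strandMove, ← add_assoc,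
          show pre.length + 1 + n = pre.length + n + 1 by omega]
        simp only [mul_assoc]
        rw [← mul_assoc (strandMove t pre.length n) (t _),
          ← (K.strandMove_commute _ n _ (by omega)).eq, mul_assoc]
      rw [h2]
      rw [strandMove, mul_assoc] at h1
      have hw : strandMove t pre.length n * (strandMove t (pre.length + 1) n * y) ∈
          pairSpan t pre Y (n + 1) :=
        Submodule.subset_span ⟨n, n, rfl, le_rfl, y, hy, rfl⟩
      rcases K.pair_ty hout hl n n with ⟨hn, h⟩ | h
      · have hn' : n ≤ (l.take n ++ Doubled.two i hi :: l.drop n).length := by simp; omega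
        have g₀ := getElem?_moved pre (Doubled.one i hi) hn'
        by_cases hlt : n < l.length
        · have g₁ := getElem?_moved_succ pre (Doubled.one i hi)
            (l := l.take n ++ Doubled.two i hi :: l.drop n) (n := n) (by simp; omega)
          have g₂ := getElem?_moved_add_two pre (Doubled.one i hi)
            (l := l.take n ++ Doubled.two i hi :: l.drop n) (n := n) (by simp; omega)
          have e₁ : (l.take n ++ Doubled.two i hi :: l.drop n)[n]'(by simp; omega) =
              Doubled.two i hi := by
            rw [List.getElem_append_right (by simp)]
            simp [hn]
          rw [e₁] at g₁
          -- A correction term occurs only if the next strand is again labelled `i¹`. It is the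
          -- negative of a vector in which the pair keeps its order.
          by_cases hac : (Doubled.one i hi) =
            (l.take n ++ Doubled.two i hi :: l.drop n)[n + 1]'(by simp; omega)
          · rw [K.braid_eq' (pre.length + n) _ _ h g₀ g₁ (hac ▸ g₂), klrQDiff_one_two hi]
            refine Submodule.add_mem _ h1 ?_
            rw [neg_one_mul]
            exact Submodule.neg_mem _ hw
          · rw [K.braid_ne' (pre.length + n) _ _ h g₀ g₂ hac]
            exact h1
        · rw [t_mul_eq_zero hout h _ (by simp; omega), mul_zero, mul_zero]
          exact Submodule.zero_mem _
      · rw [h, mul_zero, mul_zero, mul_zero]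
        exact Submodule.zero_mem _


/-- The inductive step for a doubled label. Two applications of the step for a single strand give
stability, but also allow types in which `i²` precedes `i¹`; the vectors with the wrong order are
eliminated by `strandMove_mem_pairSpan`. -/
theorem isStrandModule_pair :
    IsStrandModule k e x t pre pre.length (ok 0)
      (moveSpanAll t pre (moveSpanAll t (pre ++ [Doubled.one i hi]) Y)) := by
  have hY' : IsStrandModule k e x t (pre ++ [Doubled.one i hi] ++ [Doubled.two i hi])
      ((pre ++ [Doubled.one i hi]).length + 1) (ok 0) Y := by simpa using hY
  have hY₁ := K.isStrandModule_moveSpanAll hout hY'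
  rw [List.length_append, List.length_singleton] at hY₁
  have hY₂ := K.isStrandModule_moveSpanAll hout hY₁
  refine ⟨fun z hz => ?_, hY₂.x_mem, hY₂.t_mem⟩
  have hmem (j n : ℕ) {y : A} (hy : y ∈ Y) :
      strandMove t pre.length j * (strandMove t (pre.length + 1) n * y) ∈
        moveSpanAll t pre (moveSpanAll t (pre ++ [Doubled.one i hi]) Y) :=
    Submodule.subset_span ⟨j, _, Submodule.subset_span ⟨n, y, hy, by simp⟩, rfl⟩
  -- For `j ≤ n` the strand `i¹` stays in front of `i²`, so the new type arises from an ordered one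
  -- by an admissible insertion of both entries.
  have hgood (j n : ℕ) (hj : j ≤ n) {y : A} (hy : y ∈ Y) :
      strandMove t pre.length j * (strandMove t (pre.length + 1) n * y) ∈
        Submodule.span k {z | z ∈ moveSpanAll t pre (moveSpanAll t (pre ++ [Doubled.one i hi]) Y) ∧
          ∃ l, ok 0 l ∧ Ty e (pre ++ l) z} := by
    rw [← mul_assoc]
    refine mul_mem_of_mem_span (hY.mem_span y hy) ?_
    rintro y ⟨hy, l, hok, hl⟩
    rw [mul_assoc]
    rcases K.pair_ty hout hl j n with ⟨hn, h⟩ | h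
    · refine Submodule.subset_span ⟨hmem j n hy, _, ?_, h⟩
      have e₁ : l = l.take j ++ ((l.drop j).take (n - j) ++ l.drop n) := by
        have h1 : l.drop n = (l.drop j).drop (n - j) := by
          rw [List.drop_drop, Nat.add_sub_cancel' hj]
        rw [h1, List.take_append_drop, List.take_append_drop]
      rw [List.take_append_of_le_length (by simp; omega), List.take_take, min_eq_left hj,
        List.drop_append_of_le_length (by simp; omega), List.drop_take]
      exact ok_insert_one_two i hi (e₁ ▸ hok)
    · rw [h]
      exact Submodule.zero_mem _
  refine Submodule.span_le.2 ?_ hz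
  rintro _ ⟨m, y', hy', rfl⟩
  refine mul_mem_of_mem_span hy' ?_
  rintro _ ⟨n, y, hy, rfl⟩
  rw [List.length_append, List.length_singleton]
  by_cases hmn : m ≤ n
  · exact hgood m n hmn hy
  · refine Submodule.span_le.2 ?_ (K.strandMove_mem_pairSpan hout hkill hY n m (by omega) hy)
    rintro _ ⟨j, n', -, hj, y, hy, rfl⟩
    exact hgood j n' hj hy

end Pair

variable (K : KLRSys e x t) (hout : ∀ r l, l.length ≤ r + 1 → t r * e l = 0)
  (hkill : ∀ (pre : List I) (i : I) (hi : i ∈ I₁) (suf : List (Doubled I₁)),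
    e (phiSeq I₁ pre ++ Doubled.two i hi :: suf) = 0)
include K hout hkill

variable (k) in
-- Induction on `m`: the cables are added from right to left, and the prefix `φ(pre)` is not moved.
theorem exists_isStrandModule (pre m : List I) :
    ∃ Y : Submodule k A, e (phiSeq I₁ (pre ++ m)) ∈ Y ∧
      IsStrandModule k e x t (phiSeq I₁ pre) (phiSeq I₁ pre).length (ok 0) Y := by
  induction m generalizing pre with
  | nil =>
    -- With no strands to the right of the prefix, the vectors of the type of the prefix will do:
    -- the remaining `τ_r` are out of range and act by zero.
    set E := e (phiSeq I₁ (pre ++ [])) with hE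
    have hT : Ty e (phiSeq I₁ pre ++ []) E := by
      rw [hE, List.append_nil, List.append_nil]
      exact K.ty_e _
    let N : Submodule k A := Submodule.span k {z | Ty e (phiSeq I₁ pre ++ []) z}
    refine ⟨N, Submodule.subset_span hT, ⟨fun y hy => ?_, fun r y hy => ?_, fun r hr y hy => ?_⟩⟩
    · refine Submodule.span_mono ?_ hy
      intro z hz
      exact ⟨Submodule.subset_span hz, [], trivial, hz⟩
    · exact mul_mem_of_mem_span hy fun z hz => Submodule.subset_span (K.ty_x r hz)
    · refine mul_mem_of_mem_span hy fun z hz => ?_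
      rw [t_mul_eq_zero hout hz r (by simp; omega)]
      exact Submodule.zero_mem _
  | cons a m ih =>
    obtain ⟨Y, hE, hY⟩ := ih (pre ++ [a])
    rw [List.append_assoc, List.singleton_append] at hE
    by_cases ha : a ∈ I₁
    · have hφ : phiSeq I₁ (pre ++ [a]) = phiSeq I₁ pre ++ [Doubled.one a ha] ++ [Doubled.two a ha] := by
        simp [phiSeq_append, phiSeq, phiVertex_pair ha]
      rw [hφ] at hY
      have hY' : IsStrandModule k e x t (phiSeq I₁ pre ++ [Doubled.one a ha] ++ [Doubled.two a ha])
          ((phiSeq I₁ pre).length + 2) (ok 0) Y := by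
        simpa using hY
      exact ⟨_, mem_moveSpanAll (mem_moveSpanAll hE),
        K.isStrandModule_pair hout (hkill pre a ha) hY'⟩
    · have hφ : phiSeq I₁ (pre ++ [a]) = phiSeq I₁ pre ++ [Doubled.zero a ha] := by
        simp [phiSeq_append, phiSeq, phiVertex_single ha]
      rw [hφ] at hY
      have hY' : IsStrandModule k e x t (phiSeq I₁ pre ++ [Doubled.zero a ha])
          ((phiSeq I₁ pre).length + 1) (ok 0) Y := by
        simpa using hY
      have hY₁ := K.isStrandModule_moveSpanAll hout hY'
      refine ⟨_, mem_moveSpanAll hE, ⟨fun z hz => ?_, hY₁.x_mem, hY₁.t_mem⟩⟩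
      refine Submodule.span_mono ?_ (hY₁.mem_span z hz)
      rintro z ⟨hz, l', ⟨l, n, hl, hn, rfl⟩, hT⟩
      refine ⟨hz, _, ?_, hT⟩
      rw [ok_insert_zero, List.take_append_drop]
      exact hl

end KLRSys

/-! ### Vanishing of `e(l) z e(φ(m))` for unordered `l` -/

section Vanishing

variable {k : Type w} [Field k] {I : Type u} [Quiver.{v} I] {I₁ : Set I} {γ : Doubled I₁ →₀ ℕ}

/-- Modulo an ideal that contains the idempotents of the sequences `φ(i), j², …`, each element
`e(l) z e(φ(m))` with `l` unordered vanishes. -/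
theorem eSeq_mul_mul_eSeq_mem (S : TwoSidedIdeal (KLRAlg k γ))
    (hS : ∀ (pre : List I) (i : I) (hi : i ∈ I₁) (suf : List (Doubled I₁)),
      KLRAlg.eSeq k γ (phiSeq I₁ pre ++ Doubled.two i hi :: suf) ∈ S)
    (l : List (Doubled I₁)) (hl : ¬ ok 0 l) (z : KLRAlg k γ) (m : List I) :
    KLRAlg.eSeq k γ l * z * KLRAlg.eSeq k γ (phiSeq I₁ m) ∈ S := by
  set p := S.ringCon.mk'
  have hp (y : KLRAlg k γ) : p y = 0 ↔ y ∈ S := by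
    rw [← map_zero p, mk'_eq_mk'_iff, sub_zero]
  have K := (KLRAlg.klrSys k γ).map p
  obtain ⟨Y, hE, hY⟩ := K.exists_isStrandModule k (I₁ := I₁)
    (fun r l h => by
      rw [← map_mul]
      by_cases hw : wt l = γ
      · rw [KLRAlg.t_out k γ r (by rw [← hw, degree_wt]; exact h), zero_mul, map_zero]
      · rw [KLRAlg.eSeq_of_ne k hw, mul_zero, map_zero])
    (fun pre i hi suf => (hp _).2 (hS pre i hi suf)) [] m
  have hspan := hY.mem_span
  simp only [phiSeq, List.nil_append] at hspan hE
  -- For the empty prefix `Y` is stable under all generators, so it contains the left ideal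
  -- generated by `e(φ(m))`.
  have hz (z : KLRAlg k γ) : ∀ y ∈ Y, p z * y ∈ Y := by
    obtain ⟨f, rfl⟩ : ∃ f, KLRAlg.mk k γ f = z := RingQuot.mkAlgHom_surjective k (KLRRel k γ) z
    induction f using FreeAlgebra.induction with
    | grade0 c =>
      intro y hy
      rw [AlgHom.commutes]
      have : p (algebraMap k _ c) * y = c • y := (Algebra.smul_def c y).symm
      rw [this]
      exact Y.smul_mem c hy
    | grade1 g =>
      intro y hy
      match g with
      | .e i =>
        refine mul_mem_of_mem_span (hspan y hy) ?_
        rintro y ⟨hy, l, -, hT⟩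
        have h1 : p (KLRAlg.mk k γ (FreeAlgebra.ι k (KLRGen.e i))) = p (KLRAlg.eSeq k γ i.1) := by
          rw [KLRAlg.eSeq_val]; rfl
        rw [h1]
        by_cases hil : i.1 = l
        · subst hil
          rw [hT.eq]
          exact hy
        · rw [K.e_mul_of_ne hT hil]
          exact Y.zero_mem
      | .x r => exact hY.x_mem r y hy
      | .t r => exact hY.t_mem r (Nat.zero_le r) y hy
    | mul a b ha hb =>
      intro y hy
      rw [map_mul, map_mul, mul_assoc]
      exact ha _ (hb y hy)
    | add a b ha hb =>
      intro y hy
      rw [map_add, map_add, add_mul]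
      exact Y.add_mem (ha y hy) (hb y hy)
  -- The space `Y` is spanned by vectors whose types are not unordered, and `e(l)` annihilates each
  -- of them.
  rw [← hp, map_mul, map_mul, mul_assoc, ← Submodule.mem_bot k]
  refine mul_mem_of_mem_span (hspan _ (hz z _ hE)) ?_
  rintro y ⟨-, l', hok, hT⟩
  rw [K.e_mul_of_ne hT (by rintro rfl; exact hl hok)]
  exact Submodule.zero_mem _

end Vanishing

/-! ### Decompositions of functors -/

section App

variable {C : Type u₁} [Category.{v₁} C]

end App

section Decomp

variable {C : Type u₁} [Category.{v₁} C] [Preadditive C] {I : Type u}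

theorem zero_of_isZero {X Y : C} (h : IsZero X) (f : X ⟶ Y) : f = 0 := h.eq_of_src f 0

instance seqFunctor_additive (G : I → (C ⥤ C)) [∀ i, (G i).Additive] (l : List I) :
    (seqFunctor G l).Additive := by
  induction l with
  | nil => exact inferInstanceAs (𝟭 C).Additive
  | cons i l ih => exact inferInstanceAs (G i ⋙ seqFunctor G l).Additive

instance iter_additive (F : C ⥤ C) [F.Additive] (d : ℕ) : (iter F d).Additive := by
  induction d with
  | zero => exact inferInstanceAs (𝟭 C).Additive
  | succ d ih => exact inferInstanceAs (F ⋙ iter F d).Additive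

instance seqFunctor_linear (k : Type w) [Field k] [Linear k C] (G : I → (C ⥤ C))
    [∀ i, (G i).Linear k] (l : List I) : (seqFunctor G l).Linear k := by
  induction l with
  | nil => exact inferInstanceAs ((𝟭 C).Linear k)
  | cons i l ih => exact inferInstanceAs ((G i ⋙ seqFunctor G l).Linear k)

theorem zero_app_eq {F G : C ⥤ C} (X : C) : (0 : F ⟶ G).app X = 0 := rfl

theorem sum_app_eq {ι : Type*} (S : Finset ι) {F G : C ⥤ C} (α : ι → (F ⟶ G)) (X : C) :
    (∑ i ∈ S, α i).app X = ∑ i ∈ S, (α i).app X := by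
  classical
  induction S using Finset.induction_on with
  | empty => rfl
  | insert a S ha ih => rw [Finset.sum_insert ha, Finset.sum_insert ha, ← ih]; rfl

namespace FunctorDecomp

variable {F : C ⥤ C} {Fi : I → (C ⥤ C)} (D : FunctorDecomp F Fi)

/-- The finite set of the nonzero components at an object. -/
noncomputable def supp (M : C) : Finset I := (D.locallyFinite M).toFinset

theorem isZero_of_notMem_supp {M : C} {i : I} (h : i ∉ D.supp M) : IsZero ((Fi i).obj M) := by
  by_contra h'
  exact h ((Set.Finite.mem_toFinset _).2 h')

theorem total_supp (M : C) :
    ∑ i ∈ D.supp M, (D.proj i).app M ≫ (D.incl i).app M = 𝟙 (F.obj M) :=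
  D.total M _ fun _ h => D.isZero_of_notMem_supp h

theorem incl_proj_self_app (i : I) (M : C) :
    (D.incl i).app M ≫ (D.proj i).app M = 𝟙 ((Fi i).obj M) :=
  NatTrans.congr_app (D.incl_proj_self i) M

theorem incl_proj_self_app_assoc (i : I) {M N : C} (f : (Fi i).obj M ⟶ N) :
    (D.incl i).app M ≫ (D.proj i).app M ≫ f = f := by
  rw [← Category.assoc, incl_proj_self_app, Category.id_comp]

theorem incl_proj_ne_app {i j : I} (h : i ≠ j) (M : C) :
    (D.incl i).app M ≫ (D.proj j).app M = 0 :=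
  NatTrans.congr_app (D.incl_proj_ne i j h) M

theorem hom_ext_left {M N : C} {f g : F.obj M ⟶ N}
    (h : ∀ i, (D.incl i).app M ≫ f = (D.incl i).app M ≫ g) : f = g := by
  rw [← Category.id_comp f, ← Category.id_comp g, ← D.total_supp M, Preadditive.sum_comp,
    Preadditive.sum_comp]
  simp only [Category.assoc, h]

theorem hom_ext_right {M N : C} {f g : N ⟶ F.obj M}
    (h : ∀ i, f ≫ (D.proj i).app M = g ≫ (D.proj i).app M) : f = g := by
  rw [← Category.comp_id f, ← Category.comp_id g, ← D.total_supp M, Preadditive.comp_sum,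
    Preadditive.comp_sum]
  simp only [← Category.assoc, h]

/-- The morphism with given restrictions to the summands. -/
noncomputable def desc {M N : C} (f : ∀ i, (Fi i).obj M ⟶ N) : F.obj M ⟶ N :=
  ∑ i ∈ D.supp M, (D.proj i).app M ≫ f i

/-- The morphism with given components. -/
noncomputable def lift {M N : C} (f : ∀ i, N ⟶ (Fi i).obj M) : N ⟶ F.obj M :=
  ∑ i ∈ D.supp M, f i ≫ (D.incl i).app M

theorem incl_desc {M N : C} (f : ∀ i, (Fi i).obj M ⟶ N) (i : I) :
    (D.incl i).app M ≫ D.desc f = f i := by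
  classical
  by_cases hi : i ∈ D.supp M
  · rw [desc, Preadditive.comp_sum, Finset.sum_eq_single_of_mem i hi]
    · rw [incl_proj_self_app_assoc]
    · intro j _ hj
      rw [← Category.assoc, D.incl_proj_ne_app hj.symm, zero_comp]
  · exact (D.isZero_of_notMem_supp hi).eq_of_src _ _

theorem incl_desc_assoc {M N N' : C} (f : ∀ i, (Fi i).obj M ⟶ N) (i : I) (g : N ⟶ N') :
    (D.incl i).app M ≫ D.desc f ≫ g = f i ≫ g := by
  rw [← Category.assoc, incl_desc]

theorem lift_proj {M N : C} (f : ∀ i, N ⟶ (Fi i).obj M) (i : I) :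
    D.lift f ≫ (D.proj i).app M = f i := by
  classical
  by_cases hi : i ∈ D.supp M
  · rw [lift, Preadditive.sum_comp, Finset.sum_eq_single_of_mem i hi]
    · rw [Category.assoc, incl_proj_self_app, Category.comp_id]
    · intro j _ hj
      rw [Category.assoc, D.incl_proj_ne_app hj, comp_zero]
  · exact (D.isZero_of_notMem_supp hi).eq_of_tgt _ _

theorem lift_proj_assoc {M N N' : C} (f : ∀ i, N ⟶ (Fi i).obj M) (i : I)
    (g : (Fi i).obj M ⟶ N') : D.lift f ≫ (D.proj i).app M ≫ g = f i ≫ g := by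
  rw [← Category.assoc, lift_proj]

theorem map_eq (i : I) {M N : C} (f : M ⟶ N) :
    (Fi i).map f = (D.incl i).app M ≫ F.map f ≫ (D.proj i).app N := by
  rw [(D.proj i).naturality, incl_proj_self_app_assoc]

include D in
-- The component `F_i` is a retract of `F`, and so its action on morphisms is that of `F` between an
-- inclusion and a projection.
theorem additive_component [F.Additive] (i : I) : (Fi i).Additive where
  map_add {M N f g} := by
    rw [D.map_eq, D.map_eq, D.map_eq, F.map_add, Preadditive.add_comp, Preadditive.comp_add]

include D in
theorem linear_component {k : Type w} [Field k] [Linear k C] [F.Linear k] (i : I) :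
    (Fi i).Linear k where
  map_smul {M N} f r := by
    rw [D.map_eq, D.map_eq, F.map_smul, Linear.smul_comp, Linear.comp_smul]

include D in
theorem additive [∀ i, (Fi i).Additive] : F.Additive where
  map_add {M N f g} := D.hom_ext_left fun i => by
    rw [Preadditive.comp_add, ← (D.incl i).naturality, ← (D.incl i).naturality,
      ← (D.incl i).naturality, (Fi i).map_add, Preadditive.add_comp]

include D in
theorem linear {k : Type w} [Field k] [Linear k C] [∀ i, (Fi i).Linear k] : F.Linear k where
  map_smul {M N} f r := D.hom_ext_left fun i => by
    rw [Linear.comp_smul, ← (D.incl i).naturality, ← (D.incl i).naturality, (Fi i).map_smul,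
      Linear.smul_comp]

theorem inclSeq_cons (d : ℕ) (i : I) (l : List I) (M : C) :
    (D.inclSeq (d + 1) (i :: l)).app M =
      (D.inclSeq d l).app ((Fi i).obj M) ≫ (iter F d).map ((D.incl i).app M) := rfl

theorem projSeq_cons (d : ℕ) (i : I) (l : List I) (M : C) :
    (D.projSeq (d + 1) (i :: l)).app M =
      (D.projSeq d l).app (F.obj M) ≫ (seqFunctor Fi l).map ((D.proj i).app M) := rfl

theorem inclSeq_of_length_ne {d : ℕ} {l : List I} (h : l.length ≠ d) : D.inclSeq d l = 0 := by
  induction l generalizing d with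
  | nil =>
    match d with
    | 0 => exact absurd rfl h
    | d + 1 => rfl
  | cons i l ih =>
    match d with
    | 0 => rfl
    | d + 1 =>
      ext M
      rw [inclSeq_cons, ih (by simpa using h), zero_app_eq, zero_comp, zero_app_eq]
      rfl

theorem projSeq_of_length_ne {d : ℕ} {l : List I} (h : l.length ≠ d) : D.projSeq d l = 0 := by
  induction l generalizing d with
  | nil =>
    match d with
    | 0 => exact absurd rfl h
    | d + 1 => rfl
  | cons i l ih =>
    match d with
    | 0 => rfl
    | d + 1 =>
      ext M
      rw [projSeq_cons, ih (by simpa using h), zero_app_eq, zero_comp, zero_app_eq]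
      rfl

/-- Naturality collects everything that concerns the functor applied first on the right and leaves
an entry for the shorter sequence. All recursions for matrix entries are instances of this identity.
-/
theorem conj_cons (d : ℕ) (a b : I) (m l : List I) (β : iter F d ⟶ iter F d) {M N : C}
    (f : F.obj M ⟶ F.obj N) :
    ((D.inclSeq d m).app ((Fi a).obj M) ≫ (iter F d).map ((D.incl a).app M)) ≫
        (β.app (F.obj M) ≫ (iter F d).map f) ≫ (D.projSeq d l).app (F.obj N) ≫
          (seqFunctor Fi l).map ((D.proj b).app N) =
      (D.inclSeq d m ≫ β ≫ D.projSeq d l).app ((Fi a).obj M) ≫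
        (seqFunctor Fi l).map ((D.incl a).app M ≫ f ≫ (D.proj b).app N) := by
  simp only [NatTrans.comp_app, Category.assoc, Functor.map_comp, NatTrans.naturality_assoc]

theorem inclSeq_projSeq_cons (d : ℕ) (a b : I) (m l : List I) (M : C) :
    (D.inclSeq (d + 1) (a :: m) ≫ D.projSeq (d + 1) (b :: l)).app M =
      (D.inclSeq d m ≫ D.projSeq d l).app ((Fi a).obj M) ≫
        (seqFunctor Fi l).map ((D.incl a).app M ≫ (D.proj b).app M) := by
  have h := D.conj_cons d a b m l (𝟙 _) (𝟙 (F.obj M))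
  rw [NatTrans.id_app, CategoryTheory.Functor.map_id, Category.id_comp, Category.id_comp, Category.id_comp,
    Category.id_comp] at h
  exact h

theorem inclSeq_projSeq_self {d : ℕ} {l : List I} (h : l.length = d) :
    D.inclSeq d l ≫ D.projSeq d l = 𝟙 _ := by
  induction l generalizing d with
  | nil =>
    subst h
    exact Category.id_comp _
  | cons i l ih =>
    subst h
    ext M
    rw [List.length_cons, inclSeq_projSeq_cons, ih rfl, incl_proj_self_app, CategoryTheory.Functor.map_id,
      NatTrans.id_app, Category.id_comp]
    rfl

theorem inclSeq_projSeq_ne [F.Additive] {d : ℕ} {l l' : List I} (h : l ≠ l') :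
    D.inclSeq d l ≫ D.projSeq d l' = 0 := by
  classical
  induction l generalizing d l' with
  | nil =>
    by_cases hl' : l'.length = d
    · rw [D.inclSeq_of_length_ne, zero_comp]
      rintro rfl
      exact h (List.length_eq_zero_iff.1 hl'.symm.symm).symm
    · rw [D.projSeq_of_length_ne hl', comp_zero]
  | cons i l ih =>
    match d, l' with
    | 0, l' => rw [D.inclSeq_of_length_ne (by simp), zero_comp]
    | d + 1, [] => rw [D.projSeq_of_length_ne (by simp), comp_zero]
    | d + 1, j :: l' =>
      ext M
      rw [inclSeq_projSeq_cons]
      by_cases hij : i = j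
      · subst hij
        rw [ih (by simpa using h), zero_app_eq, zero_comp]
        rfl
      · have := D.additive_component
        rw [D.incl_proj_ne_app hij, Functor.map_zero, comp_zero]
        rfl

/-- The decomposition of `F` is finite only at each object, so the one of `F^d` is used one factor
at a time. -/
theorem iter_hom_ext_left [F.Additive] (d : ℕ) {M N : C} {f g : (iter F d).obj M ⟶ N}
    (h : ∀ l : List I, l.length = d →
      (D.inclSeq d l).app M ≫ f = (D.inclSeq d l).app M ≫ g) : f = g := by
  induction d generalizing M with
  | zero => exact (Category.id_comp f).symm.trans ((h [] rfl).trans (Category.id_comp g))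
  | succ d ih =>
    have h1 (i : I) : (iter F d).map ((D.incl i).app M) ≫ f =
        (iter F d).map ((D.incl i).app M) ≫ g := ih fun l hl =>
      (Category.assoc _ _ _).symm.trans ((h (i :: l) (by simp [hl])).trans (Category.assoc _ _ _))
    have h3 : 𝟙 ((iter F d).obj (F.obj M)) = ∑ i ∈ D.supp M,
        (iter F d).map ((D.proj i).app M) ≫ (iter F d).map ((D.incl i).app M) := by
      rw [← (iter F d).map_id, ← D.total_supp, Functor.map_sum]
      simp only [Functor.map_comp]
    have h4 (f : (iter F d).obj (F.obj M) ⟶ N) : f = ∑ i ∈ D.supp M,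
        (iter F d).map ((D.proj i).app M) ≫ (iter F d).map ((D.incl i).app M) ≫ f := by
      conv_lhs => rw [← Category.id_comp f, h3, Preadditive.sum_comp]
      simp only [Category.assoc]
    exact (h4 f).trans ((Finset.sum_congr rfl fun i _ => congrArg _ (h1 i)).trans (h4 g).symm)

end FunctorDecomp

/-- The entry of `powX` with respect to the decompositions of the power. -/
def entX {F : C ⥤ C} {Fi : I → (C ⥤ C)} (D : FunctorDecomp F Fi) (x : F ⟶ F) (d r : ℕ)
    (m l : List I) : seqFunctor Fi m ⟶ seqFunctor Fi l :=
  D.inclSeq d m ≫ powX x d r ≫ D.projSeq d l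

/-- The entry of `powT` with respect to the decompositions of the power. -/
def entT {F : C ⥤ C} {Fi : I → (C ⥤ C)} (D : FunctorDecomp F Fi) (τ : F ⋙ F ⟶ F ⋙ F) (d r : ℕ)
    (m l : List I) : seqFunctor Fi m ⟶ seqFunctor Fi l :=
  D.inclSeq d m ≫ powT τ d r ≫ D.projSeq d l

section Powers

variable {F : C ⥤ C} (x : F ⟶ F) (τ : F ⋙ F ⟶ F ⋙ F)

theorem powX_of_le {d r : ℕ} (h : d ≤ r) : powX x d r = 0 := by
  induction d generalizing r with
  | zero => rfl
  | succ d ih =>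
    match r with
    | r + 1 =>
      ext M
      change (powX x d r).app (F.obj M) = 0
      rw [ih (by omega)]
      rfl

theorem powT_of_le {d r : ℕ} (h : d ≤ r + 1) : powT τ d r = 0 := by
  induction d generalizing r with
  | zero => rfl
  | succ d ih =>
    match d, r with
    | 0, r => rfl
    | d + 1, r + 1 =>
      ext M
      change (powT τ (d + 1) r).app (F.obj M) = 0
      rw [ih (by omega)]
      rfl

end Powers

/-! ### Matrix entries of `x` and `τ` on the powers of a decomposed functor -/

section Entries

variable {F : C ⥤ C} {Fi : I → (C ⥤ C)} (D : FunctorDecomp F Fi) (x : F ⟶ F)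
  (τ : F ⋙ F ⟶ F ⋙ F)

theorem entX_succ' (d r : ℕ) (a b : I) (m l : List I) (M : C) :
    (entX D x (d + 1) (r + 1) (a :: m) (b :: l)).app M =
      (entX D x d r m l).app ((Fi a).obj M) ≫
        (seqFunctor Fi l).map ((D.incl a).app M ≫ (D.proj b).app M) := by
  have h := D.conj_cons d a b m l (powX x d r) (𝟙 (F.obj M))
  rw [CategoryTheory.Functor.map_id, Category.comp_id, Category.id_comp] at h
  exact h

theorem entT_succ' (d r : ℕ) (a b : I) (m l : List I) (M : C) :
    (entT D τ (d + 1) (r + 1) (a :: m) (b :: l)).app M =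
      (entT D τ d r m l).app ((Fi a).obj M) ≫
        (seqFunctor Fi l).map ((D.incl a).app M ≫ (D.proj b).app M) := by
  match d with
  | 0 =>
    rw [entT, entT, powT_of_le τ (by omega), powT_of_le τ (by omega), zero_comp, zero_comp,
      comp_zero, comp_zero, zero_app_eq, zero_app_eq, zero_comp]
    rfl
  | d + 1 =>
    have h := D.conj_cons (d + 1) a b m l (powT τ (d + 1) r) (𝟙 (F.obj M))
    rw [CategoryTheory.Functor.map_id, Category.comp_id, Category.id_comp] at h
    exact h

theorem entX_succ (d r : ℕ) (a : I) (m l : List I) (M : C) :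
    (entX D x (d + 1) (r + 1) (a :: m) (a :: l)).app M =
      (entX D x d r m l).app ((Fi a).obj M) := by
  rw [entX_succ', D.incl_proj_self_app, CategoryTheory.Functor.map_id]
  exact Category.comp_id _

theorem entT_succ (d r : ℕ) (a : I) (m l : List I) (M : C) :
    (entT D τ (d + 1) (r + 1) (a :: m) (a :: l)).app M =
      (entT D τ d r m l).app ((Fi a).obj M) := by
  rw [entT_succ', D.incl_proj_self_app, CategoryTheory.Functor.map_id]
  exact Category.comp_id _

/-- The component of `x` between two summands. -/
def compX (a b : I) (M : C) : (Fi a).obj M ⟶ (Fi b).obj M :=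
  (D.incl a).app M ≫ x.app M ≫ (D.proj b).app M

/-- The component of `τ` between two summands. -/
def compT (a b a' b' : I) (M : C) : (Fi b).obj ((Fi a).obj M) ⟶ (Fi b').obj ((Fi a').obj M) :=
  (D.incl b).app ((Fi a).obj M) ≫ F.map ((D.incl a).app M) ≫ τ.app M ≫
    (D.proj b').app (F.obj M) ≫ (Fi b').map ((D.proj a').app M)

theorem entX_zero' (d : ℕ) (a b : I) (m l : List I) (M : C) :
    (entX D x (d + 1) 0 (a :: m) (b :: l)).app M =
      (D.inclSeq d m ≫ D.projSeq d l).app ((Fi a).obj M) ≫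
        (seqFunctor Fi l).map (compX D x a b M) := by
  have h := D.conj_cons d a b m l (𝟙 _) (x.app M)
  rw [NatTrans.id_app, Category.id_comp, Category.id_comp] at h
  exact h

theorem entT_zero' (d : ℕ) (a b a' b' : I) (m l : List I) (M : C) :
    (entT D τ (d + 2) 0 (a :: b :: m) (a' :: b' :: l)).app M =
      (D.inclSeq d m ≫ D.projSeq d l).app ((Fi b).obj ((Fi a).obj M)) ≫
        (seqFunctor Fi l).map (compT D τ a b a' b' M) := by
  -- The identity morphisms match the associators in the definition of `powT`.
  have key (T : F.obj (F.obj M) ⟶ F.obj (F.obj M)) :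
      (((D.inclSeq d m).app ((Fi b).obj ((Fi a).obj M)) ≫
        (iter F d).map ((D.incl b).app ((Fi a).obj M))) ≫
          (iter F d).map (F.map ((D.incl a).app M))) ≫
        (𝟙 ((iter F d).obj (F.obj (F.obj M))) ≫ (iter F d).map T ≫
          𝟙 ((iter F d).obj (F.obj (F.obj M)))) ≫
        ((D.projSeq d l).app (F.obj (F.obj M)) ≫
          (seqFunctor Fi l).map ((D.proj b').app (F.obj M))) ≫
            (seqFunctor Fi l).map ((Fi b').map ((D.proj a').app M)) =
      (D.inclSeq d m ≫ D.projSeq d l).app ((Fi b).obj ((Fi a).obj M)) ≫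
        (seqFunctor Fi l).map ((D.incl b).app ((Fi a).obj M) ≫ F.map ((D.incl a).app M) ≫ T ≫
          (D.proj b').app (F.obj M) ≫ (Fi b').map ((D.proj a').app M)) := by
    simp only [NatTrans.comp_app, Category.assoc, Functor.map_comp, NatTrans.naturality_assoc,
      Category.id_comp]
  exact key (τ.app M)

theorem entX_zero {d : ℕ} (a b : I) {l : List I} (hl : l.length = d) (M : C) :
    (entX D x (d + 1) 0 (a :: l) (b :: l)).app M = (seqFunctor Fi l).map (compX D x a b M) := by
  rw [entX_zero', D.inclSeq_projSeq_self hl, NatTrans.id_app, Category.id_comp]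

theorem entT_zero {d : ℕ} (a b a' b' : I) {l : List I} (hl : l.length = d) (M : C) :
    (entT D τ (d + 2) 0 (a :: b :: l) (a' :: b' :: l)).app M =
      (seqFunctor Fi l).map (compT D τ a b a' b' M) := by
  rw [entT_zero', D.inclSeq_projSeq_self hl, NatTrans.id_app, Category.id_comp]

theorem entX_ne [F.Additive] {d r : ℕ} (hx : ∀ a b M, a ≠ b → compX D x a b M = 0)
    {m l : List I} (h : m ≠ l) : entX D x d r m l = 0 := by
  have := D.additive_component
  induction d generalizing r m l with
  | zero => rw [entX, powX_of_le x (by omega), zero_comp, comp_zero]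
  | succ d ih =>
    match m, l with
    | [], _ => rw [entX, D.inclSeq_of_length_ne (by simp), zero_comp]
    | _, [] => rw [entX, D.projSeq_of_length_ne (by simp), comp_zero, comp_zero]
    | a :: m, b :: l =>
      ext M
      match r with
      | 0 =>
        rw [entX_zero']
        by_cases hml : m = l
        · have hab : a ≠ b := fun hab => h (by rw [hab, hml])
          rw [hx a b M hab, Functor.map_zero, comp_zero]
          rfl
        · rw [D.inclSeq_projSeq_ne hml, zero_app_eq, zero_comp]
          rfl
      | r + 1 =>
        rw [entX_succ']
        by_cases hab : a = b
        · rw [ih fun hml => h (by rw [hab, hml]), zero_app_eq, zero_comp]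
          rfl
        · rw [D.incl_proj_ne_app hab, Functor.map_zero, comp_zero]
          rfl

theorem entT_ne [F.Additive] {d r : ℕ}
    (hτ : ∀ a b a' b' M, ¬ (a = b' ∧ b = a') → compT D τ a b a' b' M = 0)
    {m l : List I} (h : m ≠ swapAt r l) : entT D τ d r m l = 0 := by
  have := D.additive_component
  induction d generalizing r m l with
  | zero => rw [entT, powT_of_le τ (by omega), zero_comp, comp_zero]
  | succ d ih =>
    match m, l with
    | [], _ => rw [entT, D.inclSeq_of_length_ne (by simp), zero_comp]
    | _, [] => rw [entT, D.projSeq_of_length_ne (by simp), comp_zero, comp_zero]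
    | a :: m, b :: l =>
      match r with
      | 0 =>
        match d, m, l with
        | 0, _, _ => rw [entT, powT_of_le τ (by omega), zero_comp, comp_zero]
        | d + 1, [], _ => rw [entT, D.inclSeq_of_length_ne (by simp), zero_comp]
        | d + 1, _, [] => rw [entT, D.projSeq_of_length_ne (by simp), comp_zero, comp_zero]
        | d + 1, a' :: m, b' :: l =>
          ext M
          rw [entT_zero']
          by_cases hml : m = l
          · rw [hτ, Functor.map_zero, comp_zero]
            · rfl
            · rintro ⟨rfl, rfl⟩
              exact h (by rw [hml]; rfl)
          · rw [D.inclSeq_projSeq_ne hml, zero_app_eq, zero_comp]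
            rfl
      | r + 1 =>
        ext M
        rw [entT_succ']
        by_cases hab : a = b
        · rw [ih fun hml => h (by rw [hab, hml]; rfl), zero_app_eq, zero_comp]
          rfl
        · rw [D.incl_proj_ne_app hab, Functor.map_zero, comp_zero]
          rfl

end Entries

end Decomp

/-! ### Matrices of the homomorphisms `ψ` -/

section Of

variable {k : Type w} [Field k] {I : Type u} [Quiver.{v} I] {d : ℕ}
  {α : {α : I →₀ ℕ // α.degree = d}}

open Classical in
theorem KLRd.of_add (z w : KLRAlg k α.1) : KLRd.of k α (z + w) = KLRd.of k α z + KLRd.of k α w :=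
  Subtype.ext (Pi.single_add (f := fun α : {α : I →₀ ℕ // α.degree = d} => KLRAlg k α.1) α z w)

open Classical in
theorem KLRd.of_smul (c : k) (z : KLRAlg k α.1) : KLRd.of k α (c • z) = c • KLRd.of k α z :=
  Subtype.ext (Pi.single_smul (f := fun α : {α : I →₀ ℕ // α.degree = d} => KLRAlg k α.1) α c z)

open Classical in
theorem KLRd.of_mul (z w : KLRAlg k α.1) : KLRd.of k α (z * w) = KLRd.of k α z * KLRd.of k α w :=
  Subtype.ext (Pi.single_mul (α := fun α : {α : I →₀ ℕ // α.degree = d} => KLRAlg k α.1) α z w)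

open Classical in
theorem KLRd.of_apply_self (z : KLRAlg k α.1) : (KLRd.of k α z).1 α = z :=
  Pi.single_eq_same (M := fun α : {α : I →₀ ℕ // α.degree = d} => KLRAlg k α.1) α z

open Classical in
theorem KLRd.of_apply_ne {β : {α : I →₀ ℕ // α.degree = d}} (h : β ≠ α) (z : KLRAlg k α.1) :
    (KLRd.of k α z).1 β = 0 :=
  Pi.single_eq_of_ne (M := fun α : {α : I →₀ ℕ // α.degree = d} => KLRAlg k α.1) h z

end Of

section Comp

variable {k : Type w} [Field k] {I : Type u} [Quiver.{v} I]
  {C : Type u₁} [Category.{v₁} C] [Preadditive C] [Linear k C]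
  {gr : (I →₀ ℤ) → ObjectProperty C} {Ei Fi : I → (C ⥤ C)} (ρ : QuasiCatRep k gr Ei Fi)
  (α : I →₀ ℕ)

instance : ρ.F.Additive := ρ.additive_F

namespace QuasiCatRep

include ρ in
theorem additive_component (i : I) : (Fi i).Additive := ρ.decompF.additive_component i

/-- The endomorphism of `F^d` given by an element of `R_α`. -/
noncomputable def endo (z : KLRAlg k α) : iter ρ.F α.degree ⟶ iter ρ.F α.degree :=
  (ρ.ψ α.degree (KLRd.of k ⟨α, rfl⟩ z)).unop

theorem comp_eq (z : KLRAlg k α) (i j : SeqOf α) :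
    ρ.comp α z i j = ρ.decompF.inclSeq α.degree i.1 ≫ ρ.endo α z ≫
      ρ.decompF.projSeq α.degree j.1 := rfl

theorem endo_mul (z w : KLRAlg k α) : ρ.endo α (z * w) = ρ.endo α z ≫ ρ.endo α w := by
  rw [endo, KLRd.of_mul, map_mul]
  rfl

theorem endo_add (z w : KLRAlg k α) : ρ.endo α (z + w) = ρ.endo α z + ρ.endo α w := by
  rw [endo, KLRd.of_add, map_add]
  rfl

theorem endo_smul (c : k) (z : KLRAlg k α) : ρ.endo α (c • z) = c • ρ.endo α z := by
  rw [endo, KLRd.of_smul, map_smul]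
  rfl

theorem comp_add (z w : KLRAlg k α) (i j : SeqOf α) :
    ρ.comp α (z + w) i j = ρ.comp α z i j + ρ.comp α w i j := by
  rw [comp_eq, endo_add, Preadditive.add_comp, Preadditive.comp_add]
  rfl

theorem comp_smul (c : k) (z : KLRAlg k α) (i j : SeqOf α) :
    ρ.comp α (c • z) i j = c • ρ.comp α z i j := by
  rw [comp_eq, endo_smul, Linear.smul_comp, Linear.comp_smul]
  rfl

/-- The matrix entry as a linear map. -/
noncomputable def compHom (i j : SeqOf α) :
    KLRAlg k α →ₗ[k] (seqFunctor Fi i.1 ⟶ seqFunctor Fi j.1) where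
  toFun z := ρ.comp α z i j
  map_add' z w := ρ.comp_add α z w i j
  map_smul' c z := ρ.comp_smul α c z i j

theorem comp_neg (z : KLRAlg k α) (i j : SeqOf α) : ρ.comp α (-z) i j = -ρ.comp α z i j :=
  map_neg (ρ.compHom α i j) z

theorem comp_zero (i j : SeqOf α) : ρ.comp α 0 i j = 0 := map_zero (ρ.compHom α i j)

theorem endo_e (i : SeqOf α) : ρ.endo α (KLRAlg.e k i) =
    ρ.decompF.projSeq α.degree i.1 ≫ ρ.decompF.inclSeq α.degree i.1 := ρ.ψ_e _ ⟨α, rfl⟩ i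

theorem endo_sum {ι : Type*} (s : Finset ι) (f : ι → KLRAlg k α) :
    ρ.endo α (∑ i ∈ s, f i) = ∑ i ∈ s, ρ.endo α (f i) :=
  map_sum ({ toFun := ρ.endo α, map_zero' := by
                have := ρ.endo_smul α 0 0
                rwa [zero_smul, zero_smul] at this
             map_add' := ρ.endo_add α } :
    KLRAlg k α →+ (iter ρ.F α.degree ⟶ iter ρ.F α.degree)) f s

/-- Insert `1 = ∑ e(m)` between the factors; `e(m)` acts as the projector to `F_m`, so this is the
multiplication of matrices. -/
theorem comp_mul (z w : KLRAlg k α) (i j : SeqOf α) :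
    ρ.comp α (z * w) i j = ∑ m, ρ.comp α z i m ≫ ρ.comp α w m j := by
  have h : z * w = ∑ m : SeqOf α, z * (KLRAlg.e k m * w) := by
    rw [← Finset.mul_sum, ← Finset.sum_mul, KLRAlg.sum_e, one_mul]
  rw [comp_eq, h, endo_sum, Preadditive.sum_comp, Preadditive.comp_sum]
  refine Finset.sum_congr rfl fun m _ => ?_
  rw [endo_mul, endo_mul, endo_e, comp_eq, comp_eq]
  simp only [Category.assoc]

theorem comp_mul_e_self (z : KLRAlg k α) (i j : SeqOf α) :
    ρ.comp α (z * KLRAlg.e k j) i j = ρ.comp α z i j := by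
  rw [comp_eq, endo_mul, endo_e, comp_eq]
  simp only [Category.assoc, ρ.decompF.inclSeq_projSeq_self (SeqOf.length_eq j), Category.comp_id]

theorem comp_mul_e_ne (z : KLRAlg k α) (i : SeqOf α) {j l : SeqOf α} (h : j ≠ l) :
    ρ.comp α (z * KLRAlg.e k l) i j = 0 := by
  rw [comp_eq, endo_mul, endo_e]
  have := ρ.decompF.inclSeq_projSeq_ne (d := α.degree) (l := l.1) (l' := j.1)
    fun h' => h (Subtype.ext h'.symm)
  simp only [Category.assoc, this, CategoryTheory.Limits.comp_zero]

theorem comp_e_mul_ne (z : KLRAlg k α) {i l : SeqOf α} (j : SeqOf α) (h : i ≠ l) :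
    ρ.comp α (KLRAlg.e k l * z) i j = 0 := by
  rw [comp_eq, endo_mul, endo_e]
  have := ρ.decompF.inclSeq_projSeq_ne (d := α.degree) (l := i.1) (l' := l.1)
    fun h' => h (Subtype.ext h')
  simp only [← Category.assoc, this, CategoryTheory.Limits.zero_comp]

theorem comp_one_self (i : SeqOf α) : ρ.comp α 1 i i = 𝟙 _ := by
  rw [← ρ.comp_mul_e_self, one_mul, comp_eq, endo_e, Category.assoc,
    ρ.decompF.inclSeq_projSeq_self (SeqOf.length_eq i), Category.comp_id,
    ρ.decompF.inclSeq_projSeq_self (SeqOf.length_eq i)]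

theorem comp_one_ne {i j : SeqOf α} (h : i ≠ j) : ρ.comp α 1 i j = 0 := by
  rw [← ρ.comp_mul_e_self, one_mul, ← mul_one (KLRAlg.e k j), ρ.comp_e_mul_ne α _ _ h]

theorem comp_x (r : ℕ) (i j : SeqOf α) :
    ρ.comp α (KLRAlg.x k α r) i j = entX ρ.decompF ρ.x α.degree r i.1 j.1 := by
  by_cases hr : r < α.degree
  · rw [← ρ.comp_mul_e_self, comp_eq, endo, ρ.ψ_x _ ⟨α, rfl⟩ j r hr, entX, Category.assoc,
      Category.assoc, ρ.decompF.inclSeq_projSeq_self (SeqOf.length_eq j), Category.comp_id]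
  · rw [KLRAlg.x_out k α r (not_lt.1 hr), comp_zero, entX, powX_of_le _ (not_lt.1 hr),
      Limits.zero_comp, Limits.comp_zero]

theorem comp_t (r : ℕ) (i j : SeqOf α) :
    ρ.comp α (KLRAlg.t k α r) i j = entT ρ.decompF ρ.τ α.degree r i.1 j.1 := by
  by_cases hr : r + 1 < α.degree
  · rw [← ρ.comp_mul_e_self, comp_eq, endo, ρ.ψ_t _ ⟨α, rfl⟩ j r hr, entT, Category.assoc,
      Category.assoc, ρ.decompF.inclSeq_projSeq_self (SeqOf.length_eq j), Category.comp_id]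
  · rw [KLRAlg.t_out k α r (not_lt.1 hr), comp_zero, entT, powT_of_le _ (not_lt.1 hr),
      Limits.zero_comp, Limits.comp_zero]

theorem comp_t_ne (r : ℕ) {i j : SeqOf α} (h : i ≠ j.swap r) :
    ρ.comp α (KLRAlg.t k α r) i j = 0 := by
  rw [← ρ.comp_mul_e_self, KLRAlg.t_mul_e, ρ.comp_e_mul_ne α _ _ h]

theorem comp_x_ne (r : ℕ) {i j : SeqOf α} (h : i ≠ j) :
    ρ.comp α (KLRAlg.x k α r) i j = 0 := by
  have hx := KLRAlg.mk_rel (KLRRel.x_mul_e (k := k) (α := α) r j)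
  rw [map_mul, map_mul] at hx
  rw [← ρ.comp_mul_e_self]
  exact (congrArg (fun z => ρ.comp α z i j) hx).trans (ρ.comp_e_mul_ne α _ _ h)

end QuasiCatRep

end Comp

/-! ### Homomorphisms given by matrices -/

section Matrices

variable {k : Type w} [Field k] {I : Type u} [Quiver.{v} I]
  {C : Type u₁} [Category.{v₁} C] [Preadditive C] [Linear k C]
  {F : C ⥤ C} {Fi : I → (C ⥤ C)} (D : FunctorDecomp F Fi)
  (c : ∀ α : I →₀ ℕ, KLRAlg k α →ₗ[k] ∀ i j : SeqOf α, seqFunctor Fi i.1 ⟶ seqFunctor Fi j.1)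

/-- The endomorphism of `F^d` with a given matrix. -/
noncomputable def matEnd (d : ℕ) (α : I →₀ ℕ) (z : KLRAlg k α) : iter F d ⟶ iter F d :=
  ∑ i : SeqOf α, ∑ j : SeqOf α, D.projSeq d i.1 ≫ c α z i j ≫ D.inclSeq d j.1

theorem matEnd_add (d : ℕ) (α : I →₀ ℕ) (z w : KLRAlg k α) :
    matEnd D c d α (z + w) = matEnd D c d α z + matEnd D c d α w := by
  simp only [matEnd, map_add, Pi.add_apply, Preadditive.add_comp, Preadditive.comp_add,
    Finset.sum_add_distrib]

theorem matEnd_smul (d : ℕ) (α : I →₀ ℕ) (a : k) (z : KLRAlg k α) :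
    matEnd D c d α (a • z) = a • matEnd D c d α z := by
  simp only [matEnd, map_smul, Pi.smul_apply, Linear.smul_comp, Linear.comp_smul, Finset.smul_sum]

theorem matEnd_zero (d : ℕ) (α : I →₀ ℕ) : matEnd D c d α 0 = 0 := by
  simp only [matEnd, map_zero, Pi.zero_apply, zero_comp, comp_zero, Finset.sum_const_zero]

theorem matEnd_projSeq [F.Additive] {d : ℕ} {α : I →₀ ℕ} (z : KLRAlg k α) (hd : α.degree = d)
    (l : SeqOf α) :
    matEnd D c d α z ≫ D.projSeq d l.1 = ∑ i : SeqOf α, D.projSeq d i.1 ≫ c α z i l := by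
  classical
  rw [matEnd, Preadditive.sum_comp]
  refine Finset.sum_congr rfl fun i _ => ?_
  rw [Preadditive.sum_comp, Finset.sum_eq_single_of_mem l (Finset.mem_univ _)]
  · rw [Category.assoc, Category.assoc, D.inclSeq_projSeq_self ((SeqOf.length_eq l).trans hd),
      Category.comp_id]
  · intro j _ hj
    rw [Category.assoc, Category.assoc, D.inclSeq_projSeq_ne fun h => hj (Subtype.ext h),
      comp_zero, comp_zero]

theorem inclSeq_matEnd_projSeq [F.Additive] {d : ℕ} {α : I →₀ ℕ} (z : KLRAlg k α)
    (hd : α.degree = d) (m l : SeqOf α) :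
    D.inclSeq d m.1 ≫ matEnd D c d α z ≫ D.projSeq d l.1 = c α z m l := by
  classical
  rw [matEnd_projSeq D c z hd, Preadditive.comp_sum,
    Finset.sum_eq_single_of_mem m (Finset.mem_univ _)]
  · rw [← Category.assoc, D.inclSeq_projSeq_self ((SeqOf.length_eq m).trans hd), Category.id_comp]
  · intro j _ hj
    rw [← Category.assoc, D.inclSeq_projSeq_ne fun h => hj (Subtype.ext h.symm), zero_comp]

theorem matEnd_comp [F.Additive] (hc : ∀ α z w i j, c α (z * w) i j = ∑ m, c α z i m ≫ c α w m j)
    {d : ℕ} {α : I →₀ ℕ} (hd : α.degree = d) (z w : KLRAlg k α) :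
    matEnd D c d α (z * w) = matEnd D c d α z ≫ matEnd D c d α w := by
  conv_rhs => rw [matEnd.eq_def D c d α w, Preadditive.comp_sum]
  simp only [Preadditive.comp_sum, ← Category.assoc (matEnd D c d α z), matEnd_projSeq D c z hd]
  simp only [matEnd, hc, Preadditive.sum_comp, Preadditive.comp_sum, Category.assoc]
  exact (Finset.sum_congr rfl fun i _ => Finset.sum_comm).trans
    (Finset.sum_comm.trans (Finset.sum_congr rfl fun m _ => Finset.sum_comm))

theorem matEnd_comp_ne [F.Additive] (d : ℕ) {α β : I →₀ ℕ} (h : α ≠ β) (z : KLRAlg k α)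
    (w : KLRAlg k β) : matEnd D c d α z ≫ matEnd D c d β w = 0 := by
  simp only [matEnd, Preadditive.sum_comp, Preadditive.comp_sum, Category.assoc]
  refine Finset.sum_eq_zero fun i _ => Finset.sum_eq_zero fun j _ =>
    Finset.sum_eq_zero fun m _ => Finset.sum_eq_zero fun l _ => ?_
  have := D.inclSeq_projSeq_ne (d := d) (l := l.1) (l' := i.1) fun h' =>
    h (l.2.symm.trans ((congrArg wt h').trans i.2))
  rw [← Category.assoc (D.inclSeq d l.1), this, zero_comp, comp_zero, comp_zero]

/-- The homomorphism `R_d → End(F^d)^op` given by a multiplicative family of matrices. -/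
noncomputable def matHom [F.Additive]
    (hc : ∀ α z w i j, c α (z * w) i j = ∑ m, c α z i m ≫ c α w m j) (d : ℕ) :
    KLRd k I d →ₙₐ[k] (End (iter F d))ᵐᵒᵖ where
  toFun f := MulOpposite.op (∑ᶠ α, matEnd D c d α.1 (f.1 α) : iter F d ⟶ iter F d)
  map_smul' a f := by
    congr 1
    change ∑ᶠ α, matEnd D c d α.1 (a • f.1 α) = a • ∑ᶠ α, matEnd D c d α.1 (f.1 α)
    simp only [matEnd_smul]
    exact (smul_finsum a _).symm
  map_zero' := by
    congr 1
    change ∑ᶠ α : {α : I →₀ ℕ // α.degree = d}, matEnd D c d α.1 0 = 0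
    simp only [matEnd_zero, finsum_zero]
  map_add' f g := by
    congr 1
    change ∑ᶠ α, matEnd D c d α.1 (f.1 α + g.1 α) = _
    simp only [matEnd_add]
    exact finsum_add_distrib
      (f.2.subset fun α hα h => hα (by change matEnd D c d α.1 (f.1 α) = 0; rw [h, matEnd_zero]))
      (g.2.subset fun α hα h => hα (by change matEnd D c d α.1 (g.1 α) = 0; rw [h, matEnd_zero]))
  map_mul' f g := by
    classical
    congr 1
    change ∑ᶠ α, matEnd D c d α.1 (f.1 α * g.1 α) =
      (∑ᶠ α, matEnd D c d α.1 (f.1 α)) ≫ ∑ᶠ α, matEnd D c d α.1 (g.1 α)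
    -- All the sums involved can be taken over the union of the two finite supports.
    have key (s : (α : {α : I →₀ ℕ // α.degree = d}) → KLRAlg k α.1)
        (hs : ∀ α, s α ≠ 0 → α ∈ f.2.toFinset ∪ g.2.toFinset) :
        ∑ᶠ α, matEnd D c d α.1 (s α) =
          ∑ α ∈ f.2.toFinset ∪ g.2.toFinset, matEnd D c d α.1 (s α) :=
      finsum_eq_sum_of_support_subset _ fun α hα => hs α fun h => hα (by
        change matEnd D c d α.1 (s α) = 0
        rw [h, matEnd_zero])
    have hf (α) (h : f.1 α ≠ 0) : α ∈ f.2.toFinset ∪ g.2.toFinset :=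
      Finset.mem_union_left _ ((Set.Finite.mem_toFinset _).2 h)
    have hg (α) (h : g.1 α ≠ 0) : α ∈ f.2.toFinset ∪ g.2.toFinset :=
      Finset.mem_union_right _ ((Set.Finite.mem_toFinset _).2 h)
    rw [key (fun α => f.1 α * g.1 α) fun α h => hf α fun h' => h (by
        change f.1 α * g.1 α = 0
        rw [h', zero_mul]), key f.1 hf, key g.1 hg, Preadditive.sum_comp]
    refine Finset.sum_congr rfl fun α hα => ?_
    rw [Preadditive.comp_sum, Finset.sum_eq_single_of_mem α hα, matEnd_comp D c hc α.2]
    intro β _ hβ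
    exact matEnd_comp_ne D c d (fun h => hβ (Subtype.ext h.symm)) _ _

theorem matHom_of [F.Additive]
    (hc : ∀ α z w i j, c α (z * w) i j = ∑ m, c α z i m ≫ c α w m j) {d : ℕ}
    (α : {α : I →₀ ℕ // α.degree = d}) (z : KLRAlg k α.1) :
    (matHom D c hc d (KLRd.of k α z)).unop = matEnd D c d α.1 z := by
  change ∑ᶠ β, matEnd D c d β.1 ((KLRd.of k α z).1 β) = _
  rw [finsum_eq_single _ α, KLRd.of_apply_self]
  intro β hβ
  rw [KLRd.of_apply_ne hβ, matEnd_zero]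

/-- An endomorphism with a single nonzero column is determined by this column. -/
theorem matEnd_eq_of_column [F.Additive] {d : ℕ} {α : I →₀ ℕ} (z : KLRAlg k α)
    (i : SeqOf α) (y : iter F d ⟶ iter F d)
    (h0 : ∀ m l : SeqOf α, l ≠ i → c α z m l = 0)
    (h1 : ∀ m : SeqOf α, c α z m i = D.inclSeq d m.1 ≫ y ≫ D.projSeq d i.1)
    (h2 : ∀ l : List I, l.length = d → wt l ≠ α → D.inclSeq d l ≫ y ≫ D.projSeq d i.1 = 0) :
    matEnd D c d α z = y ≫ D.projSeq d i.1 ≫ D.inclSeq d i.1 := by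
  classical
  have h3 : matEnd D c d α z =
      ∑ m : SeqOf α, D.projSeq d m.1 ≫ c α z m i ≫ D.inclSeq d i.1 :=
    Finset.sum_congr rfl fun m _ => by
      rw [Finset.sum_eq_single_of_mem i (Finset.mem_univ _)]
      intro l _ hl
      rw [h0 m l hl, zero_comp, comp_zero]
  ext M
  refine D.iter_hom_ext_left d fun l hl => ?_
  suffices h : D.inclSeq d l ≫ matEnd D c d α z =
      D.inclSeq d l ≫ y ≫ D.projSeq d i.1 ≫ D.inclSeq d i.1 from NatTrans.congr_app h M
  rw [h3, Preadditive.comp_sum]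
  by_cases hw : wt l = α
  · obtain ⟨m, rfl⟩ := SeqOf.exists_val hw
    rw [Finset.sum_eq_single_of_mem m (Finset.mem_univ _), ← Category.assoc,
      D.inclSeq_projSeq_self hl, Category.id_comp, h1]
    · simp only [Category.assoc]
    · intro m' _ hm'
      rw [← Category.assoc, D.inclSeq_projSeq_ne fun h => hm' (Subtype.ext h.symm), zero_comp]
  · have h4 := h2 l hl hw
    rw [← Category.assoc, ← Category.assoc, Category.assoc _ y, h4, zero_comp]
    refine Finset.sum_eq_zero fun m _ => ?_
    rw [← Category.assoc, D.inclSeq_projSeq_ne fun h => hw (by rw [h]; exact m.2), zero_comp]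

end Matrices

/-! ### The action of the balanced KLR algebra -/

section SeqFunctorAppend

variable {C : Type u₁} [Category.{v₁} C] {J : Type u}

theorem seqFunctor_append_obj (G : J → (C ⥤ C)) (l l' : List J) (X : C) :
    (seqFunctor G (l ++ l')).obj X = (seqFunctor G l').obj ((seqFunctor G l).obj X) := by
  induction l generalizing X with
  | nil => rfl
  | cons i l ih => exact ih ((G i).obj X)

end SeqFunctorAppend

section

variable {k : Type w} [Field k] {I : Type u} [Quiver.{v} I]
  {C : Type u₁} [Category.{v₁} C] [Preadditive C] [Linear k C]
  {gr : (I →₀ ℤ) → ObjectProperty C} {Ei Fi : I → (C ⥤ C)} (ρ : QuasiCatRep k gr Ei Fi)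
  {α : I →₀ ℕ}

theorem QuasiCatRep.comp_e_mul_self (z : KLRAlg k α) (i j : SeqOf α) :
    ρ.comp α (KLRAlg.e k i * z) i j = ρ.comp α z i j := by
  rw [comp_eq, endo_mul, endo_e, comp_eq]
  simp only [← Category.assoc, ρ.decompF.inclSeq_projSeq_self (SeqOf.length_eq i),
    Category.id_comp]

end

section Action

variable {k : Type w} [Field k] {I : Type u} [Quiver.{v} I] {I₁ : Set I}
  {C : Type u₁} [Category.{v₁} C] [Abelian C] [Linear k C]
  {gr : (Doubled I₁ →₀ ℤ) → ObjectProperty C}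
  {Ei Fi : Doubled I₁ → (C ⥤ C)} (ρ : QuasiCatRep k gr Ei Fi)
  {P : ObjectProperty C}

omit [Quiver.{v} I] in
theorem IsAdmissible.stable_phiSeq (hP : IsAdmissible gr Ei Fi P) (l : List I) (X : C)
    (hX : P X) : P ((seqFunctor Fi (phiSeq I₁ l)).obj X) := by
  induction l generalizing X with
  | nil => exact hX
  | cons i l ih =>
    change P ((seqFunctor Fi (phiVertex I₁ i ++ phiSeq I₁ l)).obj X)
    rw [seqFunctor_append_obj]
    exact ih _ (hP.stable_F i ⟨X, hX⟩)

include ρ in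
-- By (a) and (b) the functor of `φ(pre)` preserves the subcategory, and by (c) the next functor
-- vanishes on it.
theorem IsAdmissible.isZero_of_two (hP : IsAdmissible gr Ei Fi P) (pre : List I) (i : I)
    (hi : i ∈ I₁) (suf : List (Doubled I₁)) (X : C) (hX : P X) :
    IsZero ((seqFunctor Fi (phiSeq I₁ pre ++ Doubled.two i hi :: suf)).obj X) := by
  have := ρ.additive_component
  rw [seqFunctor_append_obj]
  exact Functor.map_isZero (seqFunctor Fi suf) (hP.F_two_eq_zero i hi _ (hP.stable_phiSeq pre X hX))

/-- The ideal of the elements of a KLR algebra that act by zero on a subcategory. -/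
noncomputable def annIdeal (P : ObjectProperty C) (γ : Doubled I₁ →₀ ℕ) :
    TwoSidedIdeal (KLRAlg k γ) :=
  .mk' {z | ∀ i j, Functor.whiskerLeft P.ι (ρ.comp γ z i j) = 0}
    (fun i j => by rw [ρ.comp_zero]; rfl)
    (fun {y z} hy hz i j => by
      rw [ρ.comp_add]
      ext X
      exact (congrArg₂ (· + ·) (NatTrans.congr_app (hy i j) X)
        (NatTrans.congr_app (hz i j) X)).trans (add_zero _))
    (fun {y} hy i j => by
      rw [ρ.comp_neg]
      ext X
      exact (congrArg (-·) (NatTrans.congr_app (hy i j) X)).trans neg_zero)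
    (fun {y z} hz i j => by
      rw [ρ.comp_mul]
      ext X
      rw [Functor.whiskerLeft_app, sum_app_eq]
      refine Finset.sum_eq_zero fun m _ => ?_
      rw [NatTrans.comp_app]
      exact (congrArg _ (NatTrans.congr_app (hz m j) X)).trans comp_zero)
    (fun {y z} hy i j => by
      rw [ρ.comp_mul]
      ext X
      rw [Functor.whiskerLeft_app, sum_app_eq]
      refine Finset.sum_eq_zero fun m _ => ?_
      rw [NatTrans.comp_app]
      exact (congrArg (· ≫ _) (NatTrans.congr_app (hy i m) X)).trans zero_comp)

theorem mem_annIdeal {γ : Doubled I₁ →₀ ℕ} {z : KLRAlg k γ} :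
    z ∈ annIdeal ρ P γ ↔ ∀ i j, Functor.whiskerLeft P.ι (ρ.comp γ z i j) = 0 :=
  TwoSidedIdeal.mem_mk' _ _ _ _ _ _ _

theorem eSeq_mem_annIdeal {γ : Doubled I₁ →₀ ℕ} (l : List (Doubled I₁))
    (h : ∀ X, P X → IsZero ((seqFunctor Fi l).obj X)) :
    KLRAlg.eSeq k γ l ∈ annIdeal ρ P γ := by
  by_cases hl : wt l = γ
  · obtain ⟨m, rfl⟩ := SeqOf.exists_val hl
    rw [KLRAlg.eSeq_val, mem_annIdeal]
    intro i j
    by_cases him : i = m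
    · subst him
      ext X
      exact (h X.obj X.property).eq_of_src _ _
    · rw [← mul_one (KLRAlg.e k m), ρ.comp_e_mul_ne γ _ _ him]
      rfl
  · rw [KLRAlg.eSeq_of_ne k hl]
    exact (annIdeal ρ P γ).zero_mem

/-- As `𝐞` is the sum of the `e(φ(m))`, this follows from `eSeq_mul_mul_eSeq_mem` for the
annihilator of the subcategory, which contains the special idempotents by `isZero_of_two`. -/
theorem unordered_mem_annIdeal (hP : IsAdmissible gr Ei Fi P) {β : I →₀ ℕ}
    (i : SeqOf (phiRoot I₁ β)) (hi : Unordered i.1) (a b : KLRAlg k (phiRoot I₁ β)) :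
    a * KLRAlg.e k i * b * ordIdem k (phiRoot I₁ β) ∈ annIdeal ρ P (phiRoot I₁ β) := by
  rw [← sum_eSeq_phiSeq, Finset.mul_sum]
  refine TwoSidedIdeal.finsetSum_mem _ _ _ fun m _ => ?_
  have h := eSeq_mul_mul_eSeq_mem (k := k) (annIdeal ρ P (phiRoot I₁ β))
    (fun pre i hi suf => eSeq_mem_annIdeal ρ _ (hP.isZero_of_two ρ pre i hi suf)) i.1
    ((unordered_iff i.1).1 hi) b m.1
  rw [KLRAlg.eSeq_val] at h
  rw [mul_assoc a, mul_assoc a]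
  exact TwoSidedIdeal.mul_mem_left _ _ _ h

theorem comp_ordIdem_mul {γ : Doubled I₁ →₀ ℕ} (z : KLRAlg k γ) (i : OrdSeq γ) (j : SeqOf γ) :
    ρ.comp γ (ordIdem k γ * z) i.1 j = ρ.comp γ z i.1 j := by
  rw [ordIdem, Finset.sum_mul]
  refine (map_sum (ρ.compHom γ i.1 j) _ _).trans
    ((Finset.sum_eq_single_of_mem i (Finset.mem_univ _) fun l _ hl => ?_).trans
      (ρ.comp_e_mul_self z i.1 j))
  exact ρ.comp_e_mul_ne γ z j fun h => hl (Subtype.ext h.symm)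

theorem comp_ordIdem_mul_of_not {γ : Doubled I₁ →₀ ℕ} (z : KLRAlg k γ) {i : SeqOf γ}
    (hi : ¬ WellOrdered i.1) (j : SeqOf γ) :
    ρ.comp γ (ordIdem k γ * z) i j = 0 := by
  rw [ordIdem, Finset.sum_mul]
  refine (map_sum (ρ.compHom γ i j) _ _).trans (Finset.sum_eq_zero fun l _ => ?_)
  refine ρ.comp_e_mul_ne γ z j fun h => hi ?_
  rw [h]
  exact l.2

theorem OrdCorner.ordIdem_mul_val {γ : Doubled I₁ →₀ ℕ} (z : OrdCorner k γ) :
    ordIdem k γ * z.1 = z.1 := ((Subsemigroup.mem_corner_iff (ordIdem_idem k γ)).1 z.2).1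

/-- The rows of the second matrix that belong to sequences that are not well-ordered vanish, since
`z = 𝐞 z`. So the matrices over the well-ordered sequences are multiplicative. -/
theorem comp_mul_ordCorner {γ : Doubled I₁ →₀ ℕ} (y z : OrdCorner k γ) (i j : SeqOf γ) :
    ρ.comp γ (y.1 * z.1) i j = ∑ m : OrdSeq γ, ρ.comp γ y.1 i m.1 ≫ ρ.comp γ z.1 m.1 j := by
  rw [ρ.comp_mul]
  refine (Fintype.sum_of_injective (fun m : OrdSeq γ => m.1) Subtype.val_injective _ _
    (fun m hm => ?_) fun _ => rfl).symm
  rw [← OrdCorner.ordIdem_mul_val z, comp_ordIdem_mul_of_not ρ _ fun h => hm ⟨⟨m, h⟩, rfl⟩,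
    comp_zero]

/-- The natural endomorphism of `F_γ` given by an element of `𝐞 R_γ 𝐞`. -/
noncomputable def ordEnd (P : ObjectProperty C) (γ : Doubled I₁ →₀ ℕ) (z : KLRAlg k γ) :
    ordFunctor P Fi γ ⟶ ordFunctor P Fi γ :=
  ∑ i : OrdSeq γ, ∑ j : OrdSeq γ,
    ordProj P Fi i ≫ Functor.whiskerLeft P.ι (ρ.comp γ z i.1 j.1) ≫ ordIncl P Fi j

omit [Quiver.{v} I] in
theorem ordIncl_ordProj_self {γ : Doubled I₁ →₀ ℕ} (i : OrdSeq γ) :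
    ordIncl P Fi i ≫ ordProj P Fi i = 𝟙 _ := biproduct.ι_π_self _ _

omit [Quiver.{v} I] in
theorem ordIncl_ordProj_ne {γ : Doubled I₁ →₀ ℕ} {i j : OrdSeq γ} (h : i ≠ j) :
    ordIncl P Fi i ≫ ordProj P Fi j = 0 := biproduct.ι_π_ne _ h

omit [Quiver.{v} I] in
theorem sum_ordProj_ordIncl (γ : Doubled I₁ →₀ ℕ) :
    ∑ i : OrdSeq γ, ordProj P Fi i ≫ ordIncl P Fi i = 𝟙 (ordFunctor P Fi γ) := by
  classical
  refine biproduct.hom_ext _ _ fun l => ?_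
  change (∑ i : OrdSeq γ, ordProj P Fi i ≫ ordIncl P Fi i) ≫ ordProj P Fi l =
    𝟙 (ordFunctor P Fi γ) ≫ ordProj P Fi l
  rw [Preadditive.sum_comp, Finset.sum_eq_single_of_mem l (Finset.mem_univ _)]
  · rw [Category.assoc, ordIncl_ordProj_self, Category.comp_id, Category.id_comp]
  · intro j _ hj
    rw [Category.assoc, ordIncl_ordProj_ne hj, comp_zero]

theorem ordEnd_ordProj {γ : Doubled I₁ →₀ ℕ} (z : KLRAlg k γ) (l : OrdSeq γ) :
    ordEnd ρ P γ z ≫ ordProj P Fi l =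
      ∑ i : OrdSeq γ, ordProj P Fi i ≫ Functor.whiskerLeft P.ι (ρ.comp γ z i.1 l.1) := by
  classical
  rw [ordEnd, Preadditive.sum_comp]
  refine Finset.sum_congr rfl fun i _ => ?_
  rw [Preadditive.sum_comp, Finset.sum_eq_single_of_mem l (Finset.mem_univ _)]
  · rw [Category.assoc, Category.assoc, ordIncl_ordProj_self, Category.comp_id]
  · intro j _ hj
    rw [Category.assoc, Category.assoc, ordIncl_ordProj_ne hj, comp_zero, comp_zero]

theorem ordIncl_ordEnd_ordProj {γ : Doubled I₁ →₀ ℕ} (z : KLRAlg k γ) (m l : OrdSeq γ) :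
    ordIncl P Fi m ≫ ordEnd ρ P γ z ≫ ordProj P Fi l =
      Functor.whiskerLeft P.ι (ρ.comp γ z m.1 l.1) := by
  classical
  rw [ordEnd_ordProj, Preadditive.comp_sum, Finset.sum_eq_single_of_mem m (Finset.mem_univ _)]
  · rw [← Category.assoc, ordIncl_ordProj_self, Category.id_comp]
  · intro j _ hj
    rw [← Category.assoc, ordIncl_ordProj_ne hj.symm, zero_comp]

omit [Quiver.{v} I] in
theorem ordFunctor_hom_ext {γ : Doubled I₁ →₀ ℕ} {f g : ordFunctor P Fi γ ⟶ ordFunctor P Fi γ}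
    (h : ∀ m l : OrdSeq γ, ordIncl P Fi m ≫ f ≫ ordProj P Fi l =
      ordIncl P Fi m ≫ g ≫ ordProj P Fi l) : f = g := by
  refine biproduct.hom_ext' _ _ fun m => biproduct.hom_ext _ _ fun l => ?_
  have := h m l
  rw [← Category.assoc, ← Category.assoc] at this
  exact this

theorem whiskerLeft_sum {ι : Type*} (s : Finset ι) {G H : C ⥤ C} (f : ι → (G ⟶ H)) :
    Functor.whiskerLeft P.ι (∑ i ∈ s, f i) = ∑ i ∈ s, Functor.whiskerLeft P.ι (f i) := by
  classical
  induction s using Finset.induction_on with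
  | empty => rfl
  | insert a s ha ih => rw [Finset.sum_insert ha, Finset.sum_insert ha, ← ih]; rfl

theorem ordEnd_mul {γ : Doubled I₁ →₀ ℕ} (y z : OrdCorner k γ) :
    ordEnd ρ P γ (y.1 * z.1) = ordEnd ρ P γ y.1 ≫ ordEnd ρ P γ z.1 := by
  refine ordFunctor_hom_ext fun m l => ?_
  rw [ordIncl_ordEnd_ordProj, comp_mul_ordCorner, whiskerLeft_sum, Category.assoc, ordEnd_ordProj,
    Preadditive.comp_sum, Preadditive.comp_sum]
  refine Finset.sum_congr rfl fun n _ => ?_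
  rw [← Category.assoc (ordEnd _ _ _ _), ← Category.assoc, ordIncl_ordEnd_ordProj]
  rfl

theorem ordEnd_add {γ : Doubled I₁ →₀ ℕ} (y z : KLRAlg k γ) :
    ordEnd ρ P γ (y + z) = ordEnd ρ P γ y + ordEnd ρ P γ z := by
  refine ordFunctor_hom_ext fun m l => ?_
  rw [Preadditive.add_comp, Preadditive.comp_add]
  simp only [ordIncl_ordEnd_ordProj, ρ.comp_add]
  rfl

theorem ordEnd_smul {γ : Doubled I₁ →₀ ℕ} (c : k) (z : KLRAlg k γ) :
    ordEnd ρ P γ (c • z) = c • ordEnd ρ P γ z := by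
  refine ordFunctor_hom_ext fun m l => ?_
  rw [Linear.smul_comp, Linear.comp_smul]
  simp only [ordIncl_ordEnd_ordProj, ρ.comp_smul]
  rfl

theorem ordEnd_ordIdem (γ : Doubled I₁ →₀ ℕ) : ordEnd ρ P γ (ordIdem k γ) = 𝟙 _ := by
  classical
  refine ordFunctor_hom_ext fun m l => ?_
  rw [ordIncl_ordEnd_ordProj, ← mul_one (ordIdem k γ), comp_ordIdem_mul, Category.id_comp]
  by_cases hml : m = l
  · subst hml
    rw [ρ.comp_one_self, ordIncl_ordProj_self]
    rfl
  · rw [ρ.comp_one_ne γ fun h => hml (Subtype.ext h), ordIncl_ordProj_ne hml]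
    rfl

theorem ordEnd_smul_ordIdem (γ : Doubled I₁ →₀ ℕ) (c : k) :
    ordEnd ρ P γ (c • ordIdem k γ) = algebraMap k (End (ordFunctor P Fi γ)) c := by
  rw [Algebra.algebraMap_eq_smul_one, ordEnd_smul, ordEnd_ordIdem]
  rfl

/-- The homomorphism `𝐞 R_γ 𝐞 → End(F_γ)^op`. -/
noncomputable def cornerHom (P : ObjectProperty C) (γ : Doubled I₁ →₀ ℕ) :
    OrdCorner k γ →ₐ[k] (End (ordFunctor P Fi γ))ᵐᵒᵖ where
  toFun z := MulOpposite.op (ordEnd ρ P γ z.1)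
  map_one' := congrArg MulOpposite.op (ordEnd_ordIdem ρ γ)
  map_mul' y z := congrArg MulOpposite.op (ordEnd_mul ρ y z)
  map_zero' := congrArg MulOpposite.op (by
    have := ordEnd_smul ρ (P := P) (γ := γ) 0 0
    rwa [zero_smul, zero_smul] at this)
  map_add' y z := congrArg MulOpposite.op (ordEnd_add ρ y.1 z.1)
  commutes' c := by
    rw [MulOpposite.algebraMap_apply]
    exact congrArg MulOpposite.op (ordEnd_smul_ordIdem ρ γ c)

/-- This is the asserted factorization through the balanced algebra. -/
theorem cornerHom_rel (hP : IsAdmissible gr Ei Fi P) {β : I →₀ ℕ}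
    {y z : OrdCorner k (phiRoot I₁ β)} (h : BalancedRel k (phiRoot I₁ β) y z) :
    cornerHom ρ P (phiRoot I₁ β) y = cornerHom ρ P (phiRoot I₁ β) z := by
  obtain ⟨i, hi, a, b⟩ := h
  rw [map_zero]
  refine congrArg MulOpposite.op (ordFunctor_hom_ext (g := 0) fun m l => ?_)
  rw [ordIncl_ordEnd_ordProj, zero_comp, comp_zero]
  refine (mem_annIdeal ρ).1 ?_ m.1 l.1
  rw [OrdCorner.val_mk, mul_assoc]
  exact TwoSidedIdeal.mul_mem_left _ _ _ (unordered_mem_annIdeal ρ hP i hi a b)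

/-- The homomorphism `S_{φ(β)} → End(F_{φ(β)})^op` induced by the representation. -/
noncomputable def balancedHom (hP : IsAdmissible gr Ei Fi P) (β : I →₀ ℕ) :
    BalancedKLR k (phiRoot I₁ β) →ₐ[k] (End (ordFunctor P Fi (phiRoot I₁ β)))ᵐᵒᵖ :=
  RingQuot.liftAlgHom k ⟨cornerHom ρ P (phiRoot I₁ β), fun _ _ h => cornerHom_rel ρ hP h⟩

theorem balancedHom_proj (hP : IsAdmissible gr Ei Fi P) (β : I →₀ ℕ)
    (z : OrdCorner k (phiRoot I₁ β)) :
    balancedHom ρ hP β (BalancedKLR.proj k _ z) = cornerHom ρ P (phiRoot I₁ β) z :=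
  RingQuot.liftAlgHom_mkAlgHom_apply k _ _ z

theorem ordIncl_balancedHom_ordProj (hP : IsAdmissible gr Ei Fi P) (β : I →₀ ℕ)
    (z : OrdCorner k (phiRoot I₁ β)) (i j : OrdSeq (phiRoot I₁ β)) :
    ordIncl P Fi i ≫ (balancedHom ρ hP β (BalancedKLR.proj k _ z)).unop ≫ ordProj P Fi j =
      Functor.whiskerLeft P.ι (ρ.comp (phiRoot I₁ β) z.1 i.1 j.1) := by
  rw [balancedHom_proj]
  exact ordIncl_ordEnd_ordProj ρ z.1 i j

end Action

/-! ### Matrix entries and concatenation of sequences -/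

section Append

variable {C : Type u₁} [Category.{v₁} C] [Preadditive C] {J : Type u}

theorem append_cons_hom_app (G : J → (C ⥤ C)) (i : J) (l l' : List J) (X : C) :
    (seqFunctorAppend G (i :: l) l').hom.app X =
      (seqFunctorAppend G l l').hom.app ((G i).obj X) := Category.comp_id _

theorem append_cons_inv_app (G : J → (C ⥤ C)) (i : J) (l l' : List J) (X : C) :
    (seqFunctorAppend G (i :: l) l').inv.app X =
      (seqFunctorAppend G l l').inv.app ((G i).obj X) := Category.id_comp _

variable {F : C ⥤ C} {Fi : J → (C ⥤ C)} (D : FunctorDecomp F Fi) (x : F ⟶ F)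
  (τ : F ⋙ F ⟶ F ⋙ F)

theorem entX_append_left (u m l : List J) (d r : ℕ) (X : C) :
    (entX D x (u.length + d) (u.length + r) (u ++ m) (u ++ l)).app X =
      (seqFunctorAppend Fi u m).hom.app X ≫ (entX D x d r m l).app ((seqFunctor Fi u).obj X) ≫
        (seqFunctorAppend Fi u l).inv.app X := by
  induction u generalizing X with
  | nil =>
    rw [List.length_nil, Nat.zero_add, Nat.zero_add]
    exact ((Category.id_comp _).trans (Category.comp_id _)).symm
  | cons a u ih =>
    rw [List.length_cons, Nat.add_right_comm, Nat.add_right_comm u.length 1 r,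
      append_cons_hom_app, append_cons_inv_app]
    exact (entX_succ D x _ _ a _ _ X).trans (ih _)

theorem entT_append_left (u m l : List J) (d r : ℕ) (X : C) :
    (entT D τ (u.length + d) (u.length + r) (u ++ m) (u ++ l)).app X =
      (seqFunctorAppend Fi u m).hom.app X ≫ (entT D τ d r m l).app ((seqFunctor Fi u).obj X) ≫
        (seqFunctorAppend Fi u l).inv.app X := by
  induction u generalizing X with
  | nil =>
    rw [List.length_nil, Nat.zero_add, Nat.zero_add]
    exact ((Category.id_comp _).trans (Category.comp_id _)).symm
  | cons a u ih =>
    rw [List.length_cons, Nat.add_right_comm, Nat.add_right_comm u.length 1 r,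
      append_cons_hom_app, append_cons_inv_app]
    exact (entT_succ D τ _ _ a _ _ X).trans (ih _)

theorem append_map_append (l v : List J) {X Y : C} (f : X ⟶ Y) :
    (seqFunctor Fi (l ++ v)).map f = (seqFunctorAppend Fi l v).hom.app X ≫
      (seqFunctor Fi v).map ((seqFunctor Fi l).map f) ≫ (seqFunctorAppend Fi l v).inv.app Y := by
  have h := (seqFunctorAppend Fi l v).hom.naturality_assoc f
    ((seqFunctorAppend Fi l v).inv.app Y)
  rw [Iso.hom_inv_id_app, Category.comp_id] at h
  exact h

theorem entX_append_right (l v : List J) {r : ℕ} (hr : r < l.length) (X : C) :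
    (entX D x (l.length + v.length) r (l ++ v) (l ++ v)).app X =
      (seqFunctorAppend Fi l v).hom.app X ≫
        (seqFunctor Fi v).map ((entX D x l.length r l l).app X) ≫
          (seqFunctorAppend Fi l v).inv.app X := by
  induction l generalizing r X with
  | nil => simp at hr
  | cons a l ih =>
    rw [List.length_cons, Nat.add_right_comm, append_cons_hom_app, append_cons_inv_app]
    match r with
    | 0 =>
      rw [entX_zero D x a a rfl]
      exact (entX_zero D x a a (List.length_append) X).trans (append_map_append l v _)
    | r + 1 =>
      rw [entX_succ]
      exact (entX_succ D x _ _ a _ _ X).trans (ih (by simpa using hr) _)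

theorem entT_append_right (l v : List J) {r : ℕ} (hr : r + 1 < l.length) (X : C) :
    (entT D τ (l.length + v.length) r (swapAt r l ++ v) (l ++ v)).app X =
      (seqFunctorAppend Fi (swapAt r l) v).hom.app X ≫
        (seqFunctor Fi v).map ((entT D τ l.length r (swapAt r l) l).app X) ≫
          (seqFunctorAppend Fi l v).inv.app X := by
  induction l generalizing r X with
  | nil => simp at hr
  | cons a l ih =>
    match r, l with
    | 0, [] => simp at hr
    | 0, b :: l =>
      rw [append_cons_inv_app, append_cons_inv_app, List.length_cons, List.length_cons,
        Nat.add_right_comm, Nat.add_right_comm l.length]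
      change (entT D τ (l.length + v.length + 2) 0 (b :: a :: (l ++ v)) (a :: b :: (l ++ v))).app X
        = (seqFunctorAppend Fi (b :: a :: l) v).hom.app X ≫ (seqFunctor Fi v).map
          ((entT D τ (l.length + 2) 0 (b :: a :: l) (a :: b :: l)).app X) ≫ _
      rw [append_cons_hom_app, append_cons_hom_app, entT_zero D τ _ _ _ _ rfl]
      exact (entT_zero D τ _ _ _ _ List.length_append X).trans (append_map_append l v _)
    | r + 1, l =>
      rw [append_cons_inv_app, List.length_cons, Nat.add_right_comm]
      change (entT D τ (l.length + v.length + 1) (r + 1) (a :: (swapAt r l ++ v))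
        (a :: (l ++ v))).app X = (seqFunctorAppend Fi (a :: swapAt r l) v).hom.app X ≫
          (seqFunctor Fi v).map ((entT D τ (l.length + 1) (r + 1) (a :: swapAt r l)
            (a :: l)).app X) ≫ _
      rw [append_cons_hom_app, entT_succ D τ l.length r a (swapAt r l) l X]
      exact (entT_succ D τ _ _ a _ _ X).trans (ih (by simpa using hr) _)

end Append

/-! ### Elements that act on some of the strands only -/

section Local

variable {k : Type w} [Field k] {J : Type u} [Quiver.{v} J]
  {C : Type u₁} [Category.{v₁} C] [Preadditive C] [Linear k C]
  {gr : (J →₀ ℤ) → ObjectProperty C} {Ei Fi : J → (C ⥤ C)} (ρ : QuasiCatRep k gr Ei Fi)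
  {α β : J →₀ ℕ}

/-- The matrix of `z'` is the image of the matrix of `z` under a functor. -/
def IsLocal (emb : SeqOf α → SeqOf β) (H : (C ⥤ C) ⥤ (C ⥤ C))
    (κ : ∀ l : SeqOf α, seqFunctor Fi (emb l).1 ≅ H.obj (seqFunctor Fi l.1))
    (z : KLRAlg k α) (z' : KLRAlg k β) : Prop :=
  ∀ l, (∀ m ∉ Set.range emb, ρ.comp β z' m (emb l) = 0) ∧
    ∀ l', ρ.comp β z' (emb l') (emb l) = (κ l').hom ≫ H.map (ρ.comp α z l' l) ≫ (κ l).inv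

namespace IsLocal

variable {ρ} {emb : SeqOf α → SeqOf β} {H : (C ⥤ C) ⥤ (C ⥤ C)}
  {κ : ∀ l : SeqOf α, seqFunctor Fi (emb l).1 ≅ H.obj (seqFunctor Fi l.1)}

theorem neg [H.Additive] {z : KLRAlg k α} {z' : KLRAlg k β} (h : IsLocal ρ emb H κ z z') :
    IsLocal ρ emb H κ (-z) (-z') := fun l =>
  ⟨fun m hm => by rw [ρ.comp_neg, (h l).1 m hm, neg_zero], fun l' => by
    rw [ρ.comp_neg, (h l).2, ρ.comp_neg, H.map_neg, Preadditive.neg_comp, Preadditive.comp_neg]⟩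

/-- A column with an index in the range of `emb` has no entries outside this range, so the matrix
product for `β` reduces to the one for `α`. Locality therefore needs to be checked only for
generators. -/
theorem mul [H.Additive] (hemb : Function.Injective emb) {y z : KLRAlg k α} {y' z' : KLRAlg k β}
    (hy : IsLocal ρ emb H κ y y') (hz : IsLocal ρ emb H κ z z') :
    IsLocal ρ emb H κ (y * z) (y' * z') := fun l => by
  have key (m) : ρ.comp β (y' * z') m (emb l) =
      ∑ n : SeqOf α, ρ.comp β y' m (emb n) ≫ ρ.comp β z' (emb n) (emb l) := by
    rw [ρ.comp_mul]
    exact (Fintype.sum_of_injective emb hemb _ _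
      (fun n hn => by rw [(hz l).1 n hn, comp_zero]) fun _ => rfl).symm
  refine ⟨fun m hm => ?_, fun l' => ?_⟩
  · rw [key]
    exact Finset.sum_eq_zero fun n _ => by rw [(hy n).1 m hm, zero_comp]
  · rw [key, ρ.comp_mul, H.map_sum, Preadditive.sum_comp, Preadditive.comp_sum]
    refine Finset.sum_congr rfl fun n _ => ?_
    rw [(hy n).2, (hz l).2, H.map_comp]
    simp only [Category.assoc, Iso.inv_hom_id_assoc]

theorem tStar {I₁ : Set J} {gr : (Doubled I₁ →₀ ℤ) → ObjectProperty C}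
    {Ei Fi : Doubled I₁ → (C ⥤ C)} {ρ : QuasiCatRep k gr Ei Fi} {α β : Doubled I₁ →₀ ℕ}
    {emb : SeqOf α → SeqOf β} [H.Additive]
    {κ : ∀ l : SeqOf α, seqFunctor Fi (emb l).1 ≅ H.obj (seqFunctor Fi l.1)}
    (hemb : Function.Injective emb) {s N : ℕ}
    (ht : ∀ r, r + 1 < N → IsLocal ρ emb H κ (KLRAlg.t k α r) (KLRAlg.t k β (s + r)))
    (p : ℕ) (a b : J) (hp : p + (phiVertex I₁ a).length + (phiVertex I₁ b).length ≤ N) :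
    IsLocal ρ emb H κ (tStar k α p a b) (tStar k β (s + p) a b) := by
  unfold QuasiCat.tStar
  unfold phiVertex at hp
  split_ifs at hp ⊢ <;> simp only [List.length_cons, List.length_nil] at hp
  · exact ((((ht _ (by omega)).mul hemb (ht _ (by omega))).mul hemb (ht _ (by omega))).mul hemb
      (ht _ (by omega))).neg
  · exact (((ht _ (by omega)).mul hemb (ht _ (by omega))).mul hemb (ht _ (by omega))).mul hemb
      (ht _ (by omega))
  · exact (ht _ (by omega)).mul hemb (ht _ (by omega))
  · exact (ht _ (by omega)).mul hemb (ht _ (by omega))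
  · exact ht _ (by omega)

end IsLocal

/-- Concatenation on the left. -/
def appendLeft (u : List J) (h : wt u + α = β) (l : SeqOf α) : SeqOf β :=
  ⟨u ++ l.1, by rw [wt_append, l.2, h]⟩

/-- Concatenation on the right. -/
def appendRight (v : List J) (h : α + wt v = β) (l : SeqOf α) : SeqOf β :=
  ⟨l.1 ++ v, by rw [wt_append, l.2, h]⟩

omit [Quiver.{v} J] in
theorem appendLeft_injective (u : List J) (h : wt u + α = β) :
    Function.Injective (appendLeft u h) := fun _ _ hl =>
  Subtype.ext (List.append_cancel_left (congrArg (fun i : SeqOf β => i.1) hl))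

omit [Quiver.{v} J] in
theorem appendRight_injective (v : List J) (h : α + wt v = β) :
    Function.Injective (appendRight v h) := fun _ _ hl =>
  Subtype.ext (List.append_cancel_right (congrArg (fun i : SeqOf β => i.1) hl))

theorem isLocal_left_t (u : List J) (h : wt u + α = β) (r : ℕ) :
    IsLocal ρ (appendLeft u h) ((Functor.whiskeringLeft C C C).obj (seqFunctor Fi u))
      (fun l => seqFunctorAppend Fi u l.1) (KLRAlg.t k α r) (KLRAlg.t k β (u.length + r)) := by
  have hβ : u.length + α.degree = β.degree := by rw [← h, map_add, degree_wt]
  refine fun l => ⟨fun m hm => ρ.comp_t_ne β _ fun hml => hm ⟨l.swap r, ?_⟩, fun l' => ?_⟩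
  · rw [hml]
    exact Subtype.ext (swapAt_append_left u l.1 r).symm
  · rw [ρ.comp_t, ρ.comp_t, ← hβ]
    ext X
    exact entT_append_left ρ.decompF ρ.τ u l'.1 l.1 _ _ X

theorem isLocal_left_x (u : List J) (h : wt u + α = β) (r : ℕ) :
    IsLocal ρ (appendLeft u h) ((Functor.whiskeringLeft C C C).obj (seqFunctor Fi u))
      (fun l => seqFunctorAppend Fi u l.1) (KLRAlg.x k α r) (KLRAlg.x k β (u.length + r)) := by
  have hβ : u.length + α.degree = β.degree := by rw [← h, map_add, degree_wt]
  refine fun l => ⟨fun m hm => ρ.comp_x_ne β _ fun hml => hm ⟨l, hml.symm⟩, fun l' => ?_⟩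
  rw [ρ.comp_x, ρ.comp_x, ← hβ]
  ext X
  exact entX_append_left ρ.decompF ρ.x u l'.1 l.1 _ _ X

/-- The bound on `r` matters: beyond it `τ_r` is zero in `R_α`, while in `R_β` it may involve
strands of `v`. -/
theorem isLocal_right_t (v : List J) (h : α + wt v = β) {r : ℕ} (hr : r + 1 < α.degree) :
    IsLocal ρ (appendRight v h) ((Functor.whiskeringRight C C C).obj (seqFunctor Fi v))
      (fun l => seqFunctorAppend Fi l.1 v) (KLRAlg.t k α r) (KLRAlg.t k β (0 + r)) := by
  have := ρ.additive_component
  have hβ : α.degree + v.length = β.degree := by rw [← h, map_add, degree_wt]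
  rw [Nat.zero_add]
  have hs (l : SeqOf α) : (appendRight v h l).swap r = appendRight v h (l.swap r) :=
    Subtype.ext (swapAt_append_right l.1 v r (by rwa [SeqOf.length_eq]))
  refine fun l => ⟨fun m hm => ρ.comp_t_ne β _ fun hml => hm ⟨l.swap r, ?_⟩, fun l' => ?_⟩
  · rw [hml, hs]
  · by_cases hl : l' = l.swap r
    · subst hl
      rw [ρ.comp_t, ρ.comp_t, ← hβ, ← SeqOf.length_eq l]
      ext X
      exact entT_append_right ρ.decompF ρ.τ l.1 v (by rwa [SeqOf.length_eq]) X
    · rw [ρ.comp_t_ne α r hl, ρ.comp_t_ne β r, Functor.map_zero, zero_comp, comp_zero]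
      rw [hs]
      exact fun h' => hl (appendRight_injective v h h')

theorem isLocal_right_x (v : List J) (h : α + wt v = β) {r : ℕ} (hr : r < α.degree) :
    IsLocal ρ (appendRight v h) ((Functor.whiskeringRight C C C).obj (seqFunctor Fi v))
      (fun l => seqFunctorAppend Fi l.1 v) (KLRAlg.x k α r) (KLRAlg.x k β r) := by
  have := ρ.additive_component
  have hβ : α.degree + v.length = β.degree := by rw [← h, map_add, degree_wt]
  refine fun l => ⟨fun m hm => ρ.comp_x_ne β _ fun hml => hm ⟨l, hml.symm⟩, fun l' => ?_⟩
  by_cases hl : l' = l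
  · subst hl
    rw [ρ.comp_x, ρ.comp_x, ← hβ, ← SeqOf.length_eq l']
    ext X
    exact entX_append_right ρ.decompF ρ.x l'.1 v (by rwa [SeqOf.length_eq]) X
  · rw [ρ.comp_x_ne α r hl, ρ.comp_x_ne β r, Functor.map_zero, zero_comp, comp_zero]
    exact fun h' => hl (appendRight_injective v h h')

end Local

/-! ### Adjunctions between the components of decomposed functors -/

section Grading

variable {C : Type u₁} [Category.{v₁} C] [Preadditive C]

/-- On a graded piece the transformation maps between objects of different degrees and so vanishes;
each object is a finite direct sum of such pieces. -/
theorem natTrans_eq_zero {Q : Type*} {gr : Q → ObjectProperty C} (hgr : IsDecomposition gr)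
    {G : C ⥤ C} (θ : 𝟭 C ⟶ G) (δ : Q → Q) (hδ : ∀ q, q ≠ δ q)
    (hG : ∀ q X, gr q X → gr (δ q) (G.obj X)) (X : C) : θ.app X = 0 := by
  obtain ⟨s, Y, b, hY, ⟨hb⟩, ⟨e⟩⟩ := hgr.exists_sum X
  have h1 : θ.app b.pt = 0 := by
    refine Cofan.IsColimit.hom_ext hb.isColimit _ _ fun q => ?_
    change b.ι q ≫ θ.app b.pt = b.ι q ≫ 0
    have h2 : θ.app (Y q) = 0 :=
      hgr.hom_eq_zero q.1 (δ q.1) (hδ q.1) _ _ (hY q) (hG _ _ (hY q)) _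
    exact ((θ.naturality (b.ι q)).trans (by rw [h2, zero_comp])).trans comp_zero.symm
  have h3 : e.hom ≫ θ.app X = 0 := (θ.naturality e.hom).trans (by rw [h1, zero_comp])
  rw [← cancel_epi e.hom, h3, comp_zero]

theorem natTrans_eq_zero' {Q : Type*} {gr : Q → ObjectProperty C} (hgr : IsDecomposition gr)
    {G : C ⥤ C} (θ : G ⟶ 𝟭 C) (δ : Q → Q) (hδ : ∀ q, q ≠ δ q)
    (hG : ∀ q X, gr q X → gr (δ q) (G.obj X)) (X : C) : θ.app X = 0 := by
  obtain ⟨s, Y, b, hY, ⟨hb⟩, ⟨e⟩⟩ := hgr.exists_sum X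
  have h1 : θ.app b.pt = 0 := by
    refine Fan.IsLimit.hom_ext hb.isLimit _ _ fun q => ?_
    change θ.app b.pt ≫ b.π q = 0 ≫ b.π q
    have h2 : θ.app (Y q) = 0 :=
      hgr.hom_eq_zero (δ q.1) q.1 (hδ q.1).symm _ _ (hG _ _ (hY q)) (hY q) _
    exact ((θ.naturality (b.π q)).symm.trans (by rw [h2, comp_zero])).trans zero_comp.symm
  have h3 : θ.app X ≫ e.inv = 0 := (θ.naturality e.inv).symm.trans (by rw [h1, comp_zero])
  rw [← cancel_mono e.inv, h3, zero_comp]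

end Grading

section Adjunction

variable {C : Type u₁} [Category.{v₁} C] [Preadditive C] {I : Type u}
  {L R : C ⥤ C} {Li Ri : I → (C ⥤ C)} (DL : FunctorDecomp L Li) (DR : FunctorDecomp R Ri)

/-- The adjunction between the components of decomposed adjoint functors. -/
noncomputable def componentAdjunction (adj : L ⊣ R)
    (h₁ : ∀ (i j : I), i ≠ j → ∀ {X Y : C} (f : (Li i).obj X ⟶ Y),
      adj.homEquiv X Y ((DL.proj i).app X ≫ f) ≫ (DR.proj j).app Y = 0)
    (h₂ : ∀ (i j : I), i ≠ j → ∀ {X Y : C} (g : X ⟶ (Ri i).obj Y),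
      (DL.incl j).app X ≫ (adj.homEquiv X Y).symm (g ≫ (DR.incl i).app Y) = 0)
    (i : I) : Li i ⊣ Ri i :=
  .mkOfHomEquiv
    { homEquiv := fun X Y =>
        { toFun := fun f => adj.homEquiv X Y ((DL.proj i).app X ≫ f) ≫ (DR.proj i).app Y
          invFun := fun g => (DL.incl i).app X ≫ (adj.homEquiv X Y).symm (g ≫ (DR.incl i).app Y)
          left_inv := fun f => by
            -- By `h₁` the morphism has no components in `R_j` for `j ≠ i`, so projecting to `R_i`
            -- and including again changes nothing.
            have h : (adj.homEquiv X Y ((DL.proj i).app X ≫ f) ≫ (DR.proj i).app Y) ≫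
                (DR.incl i).app Y = adj.homEquiv X Y ((DL.proj i).app X ≫ f) := by
              refine DR.hom_ext_right fun j => ?_
              by_cases hij : i = j
              · subst hij
                rw [Category.assoc, DR.incl_proj_self_app, Category.comp_id]
              · rw [Category.assoc, DR.incl_proj_ne_app hij, comp_zero, h₁ i j hij]
            change (DL.incl i).app X ≫ (adj.homEquiv X Y).symm ((adj.homEquiv X Y
              ((DL.proj i).app X ≫ f) ≫ (DR.proj i).app Y) ≫ (DR.incl i).app Y) = f
            rw [h, Equiv.symm_apply_apply, DL.incl_proj_self_app_assoc]
          right_inv := fun g => by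
            have h : (DL.proj i).app X ≫ (DL.incl i).app X ≫
                (adj.homEquiv X Y).symm (g ≫ (DR.incl i).app Y) =
                  (adj.homEquiv X Y).symm (g ≫ (DR.incl i).app Y) := by
              refine DL.hom_ext_left fun j => ?_
              by_cases hij : i = j
              · subst hij
                rw [DL.incl_proj_self_app_assoc]
              · rw [← Category.assoc, DL.incl_proj_ne_app (Ne.symm hij), zero_comp, h₂ i j hij]
            change adj.homEquiv X Y ((DL.proj i).app X ≫ (DL.incl i).app X ≫
              (adj.homEquiv X Y).symm (g ≫ (DR.incl i).app Y)) ≫ (DR.proj i).app Y = g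
            rw [h, Equiv.apply_symm_apply, Category.assoc, DR.incl_proj_self_app,
              Category.comp_id] }
      homEquiv_naturality_left_symm := fun {X' X Y} f g => by
        change (DL.incl i).app X' ≫ (adj.homEquiv X' Y).symm ((f ≫ g) ≫ (DR.incl i).app Y) =
          (Li i).map f ≫ (DL.incl i).app X ≫ (adj.homEquiv X Y).symm (g ≫ (DR.incl i).app Y)
        rw [Category.assoc, Adjunction.homEquiv_naturality_left_symm,
          (DL.incl i).naturality_assoc]
      homEquiv_naturality_right := fun {X Y Y'} f g => by
        change adj.homEquiv X Y' ((DL.proj i).app X ≫ f ≫ g) ≫ (DR.proj i).app Y' =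
          (adj.homEquiv X Y ((DL.proj i).app X ≫ f) ≫ (DR.proj i).app Y) ≫ (Ri i).map g
        rw [← Category.assoc ((DL.proj i).app X), Adjunction.homEquiv_naturality_right,
          Category.assoc, Category.assoc, (DR.proj i).naturality] }

include DL DR in
/-- The components of decomposed adjoint functors that shift the degrees of a decomposition of the
category accordingly are adjoint. -/
theorem nonempty_componentAdjunction (adj : L ⊣ R) {Q : Type*} {gr : Q → ObjectProperty C}
    (hgr : IsDecomposition gr) (δ δ' : I → Q → Q) (hδ : ∀ i j, i ≠ j → ∀ q, q ≠ δ' j (δ i q))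
    (hδ' : ∀ i j, i ≠ j → ∀ q, q ≠ δ i (δ' j q))
    (hL : ∀ i q X, gr q X → gr (δ i q) ((Li i).obj X))
    (hR : ∀ i q X, gr q X → gr (δ' i q) ((Ri i).obj X)) (i : I) : Nonempty (Li i ⊣ Ri i) := by
  -- The part of the unit that passes through `L_i` and `R_j` with `i ≠ j` is a natural
  -- transformation that changes the degree.
  have unit (i j : I) (hij : i ≠ j) (X : C) :
      adj.homEquiv X _ ((DL.proj i).app X) ≫ (DR.proj j).app ((Li i).obj X) = 0 := by
    let θ : 𝟭 C ⟶ Li i ⋙ Ri j :=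
      { app := fun X => adj.homEquiv X _ ((DL.proj i).app X) ≫ (DR.proj j).app ((Li i).obj X)
        naturality := fun X Y f => by
          change f ≫ adj.homEquiv Y _ ((DL.proj i).app Y) ≫ (DR.proj j).app ((Li i).obj Y) =
            (adj.homEquiv X _ ((DL.proj i).app X) ≫ (DR.proj j).app ((Li i).obj X)) ≫
              (Ri j).map ((Li i).map f)
          rw [Category.assoc, ← (DR.proj j).naturality, ← Category.assoc, ← Category.assoc,
            ← Adjunction.homEquiv_naturality_left, ← Adjunction.homEquiv_naturality_right,
            (DL.proj i).naturality] }
    exact natTrans_eq_zero hgr θ (fun q => δ' j (δ i q)) (hδ i j hij)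
      (fun q X hX => hR _ _ _ (hL _ _ _ hX)) X
  -- The same argument for the parts of the counit.
  have counit (i j : I) (hij : i ≠ j) (Y : C) :
      (DL.incl i).app ((Ri j).obj Y) ≫ (adj.homEquiv _ Y).symm ((DR.incl j).app Y) = 0 := by
    let θ : Ri j ⋙ Li i ⟶ 𝟭 C :=
      { app := fun Y =>
          (DL.incl i).app ((Ri j).obj Y) ≫ (adj.homEquiv _ Y).symm ((DR.incl j).app Y)
        naturality := fun X Y f => by
          change (Li i).map ((Ri j).map f) ≫ (DL.incl i).app ((Ri j).obj Y) ≫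
            (adj.homEquiv _ Y).symm ((DR.incl j).app Y) =
            ((DL.incl i).app ((Ri j).obj X) ≫ (adj.homEquiv _ X).symm ((DR.incl j).app X)) ≫ f
          rw [(DL.incl i).naturality_assoc, ← Adjunction.homEquiv_naturality_left_symm,
            Category.assoc, ← Adjunction.homEquiv_naturality_right_symm, (DR.incl j).naturality] }
    exact natTrans_eq_zero' hgr θ (fun q => δ i (δ' j q)) (hδ' i j hij)
      (fun q X hX => hL _ _ _ (hR _ _ _ hX)) Y
  refine ⟨componentAdjunction DL DR adj (fun i j hij X Y f => ?_) (fun i j hij X Y g => ?_) i⟩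
  · rw [Adjunction.homEquiv_naturality_right, Category.assoc, (DR.proj j).naturality,
      ← Category.assoc, unit i j hij, zero_comp]
  · rw [Adjunction.homEquiv_naturality_left_symm, ← (DL.incl j).naturality_assoc,
      counit j i hij.symm, comp_zero]

/-- The sum of a family of adjunctions. -/
noncomputable def sumAdjunction (adj : ∀ i, Li i ⊣ Ri i) : L ⊣ R :=
  .mkOfHomEquiv
    { homEquiv := fun X Y =>
        { toFun := fun f => DR.lift fun i => (adj i).homEquiv X Y ((DL.incl i).app X ≫ f)
          invFun := fun g => DL.desc fun i => ((adj i).homEquiv X Y).symm (g ≫ (DR.proj i).app Y)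
          left_inv := fun f => DL.hom_ext_left fun i => by
            rw [DL.incl_desc, DR.lift_proj, Equiv.symm_apply_apply]
          right_inv := fun g => DR.hom_ext_right fun i => by
            rw [DR.lift_proj, DL.incl_desc, Equiv.apply_symm_apply] }
      homEquiv_naturality_left_symm := fun {X' X Y} f g => DL.hom_ext_left fun i => by
        change (DL.incl i).app X' ≫ DL.desc _ = (DL.incl i).app X' ≫ L.map f ≫ DL.desc _
        rw [DL.incl_desc, ← (DL.incl i).naturality_assoc, DL.incl_desc, Category.assoc,
          Adjunction.homEquiv_naturality_left_symm]
      homEquiv_naturality_right := fun {X Y Y'} f g => DR.hom_ext_right fun i => by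
        change DR.lift _ ≫ _ = (DR.lift _ ≫ R.map g) ≫ _
        rw [DR.lift_proj, Category.assoc, (DR.proj i).naturality, DR.lift_proj_assoc,
          ← Category.assoc, Adjunction.homEquiv_naturality_right] }

end Adjunction

/-! ### Locally finite sums of functors -/

section Sum

variable {C : Type u₁} [Category.{v₁} C] [Preadditive C] [HasFiniteBiproducts C] {I : Type u}
  (G : I → (C ⥤ C)) (hG : ∀ X, {i | ¬ IsZero ((G i).obj X)}.Finite)

/-- The value of a locally finite sum of functors. -/
noncomputable def sumObj (X : C) : C :=
  ⨁ fun i : {i // i ∈ (hG X).toFinset} => (G i.1).obj X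

open Classical in
/-- The inclusion of a summand. -/
noncomputable def sumIncl (i : I) (X : C) : (G i).obj X ⟶ sumObj G hG X :=
  if h : i ∈ (hG X).toFinset then
    biproduct.ι (fun i : {i // i ∈ (hG X).toFinset} => (G i.1).obj X) ⟨i, h⟩
  else 0

open Classical in
/-- The projection to a summand. -/
noncomputable def sumProj (i : I) (X : C) : sumObj G hG X ⟶ (G i).obj X :=
  if h : i ∈ (hG X).toFinset then
    biproduct.π (fun i : {i // i ∈ (hG X).toFinset} => (G i.1).obj X) ⟨i, h⟩
  else 0

omit [Preadditive C] [HasFiniteBiproducts C] in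
theorem isZero_of_notMem_toFinset {X : C} {i : I} (h : i ∉ (hG X).toFinset) :
    IsZero ((G i).obj X) := by
  by_contra h'
  exact h ((Set.Finite.mem_toFinset _).2 h')

theorem sumIncl_of_mem {i : I} {X : C} (h : i ∈ (hG X).toFinset) :
    sumIncl G hG i X =
      biproduct.ι (fun i : {i // i ∈ (hG X).toFinset} => (G i.1).obj X) ⟨i, h⟩ := dif_pos h

theorem sumProj_of_mem {i : I} {X : C} (h : i ∈ (hG X).toFinset) :
    sumProj G hG i X =
      biproduct.π (fun i : {i // i ∈ (hG X).toFinset} => (G i.1).obj X) ⟨i, h⟩ := dif_pos h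

theorem sumIncl_sumProj_self (i : I) (X : C) : sumIncl G hG i X ≫ sumProj G hG i X = 𝟙 _ := by
  by_cases h : i ∈ (hG X).toFinset
  · rw [sumIncl_of_mem G hG h, sumProj_of_mem G hG h]
    exact biproduct.ι_π_self _ _
  · exact (isZero_of_notMem_toFinset G hG h).eq_of_src _ _

theorem sumIncl_sumProj_self_assoc (i : I) {X Y : C} (f : (G i).obj X ⟶ Y) :
    sumIncl G hG i X ≫ sumProj G hG i X ≫ f = f := by
  rw [← Category.assoc, sumIncl_sumProj_self, Category.id_comp]

theorem sumIncl_sumProj_ne {i j : I} (hij : i ≠ j) (X : C) :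
    sumIncl G hG i X ≫ sumProj G hG j X = 0 := by
  by_cases h : i ∈ (hG X).toFinset
  · by_cases h' : j ∈ (hG X).toFinset
    · rw [sumIncl_of_mem G hG h, sumProj_of_mem G hG h']
      exact biproduct.ι_π_ne _ fun h => hij (congrArg Subtype.val h)
    · exact (isZero_of_notMem_toFinset G hG h').eq_of_tgt _ _
  · exact (isZero_of_notMem_toFinset G hG h).eq_of_src _ _

theorem sum_sumProj_sumIncl (X : C) (s : Finset I) (hs : ∀ i ∉ s, IsZero ((G i).obj X)) :
    ∑ i ∈ s, sumProj G hG i X ≫ sumIncl G hG i X = 𝟙 _ := by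
  classical
  have key (i : I) : (∑ j ∈ s, sumProj G hG j X ≫ sumIncl G hG j X) ≫ sumProj G hG i X =
      sumProj G hG i X := by
    by_cases h : i ∈ s
    · rw [Preadditive.sum_comp, Finset.sum_eq_single_of_mem i h]
      · rw [Category.assoc, sumIncl_sumProj_self, Category.comp_id]
      · intro j _ hj
        rw [Category.assoc, sumIncl_sumProj_ne G hG hj, comp_zero]
    · exact (hs _ h).eq_of_tgt _ _
  refine biproduct.hom_ext _ _ fun l => ?_
  have h := key l.1
  rw [sumProj_of_mem G hG l.2] at h
  exact h.trans (Category.id_comp _).symm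

/-- The action of a locally finite sum of functors on morphisms. -/
noncomputable def sumMap {X Y : C} (f : X ⟶ Y) : sumObj G hG X ⟶ sumObj G hG Y :=
  ∑ i ∈ (hG X).toFinset, sumProj G hG i X ≫ (G i).map f ≫ sumIncl G hG i Y

theorem sumIncl_sumMap (i : I) {X Y : C} (f : X ⟶ Y) :
    sumIncl G hG i X ≫ sumMap G hG f = (G i).map f ≫ sumIncl G hG i Y := by
  classical
  by_cases hi : i ∈ (hG X).toFinset
  · rw [sumMap, Preadditive.comp_sum, Finset.sum_eq_single_of_mem i hi,
      sumIncl_sumProj_self_assoc]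
    intro j _ hj
    rw [← Category.assoc, sumIncl_sumProj_ne G hG hj.symm, zero_comp]
  · exact (isZero_of_notMem_toFinset G hG hi).eq_of_src _ _

theorem sumMap_sumProj (i : I) {X Y : C} (f : X ⟶ Y) :
    sumMap G hG f ≫ sumProj G hG i Y = sumProj G hG i X ≫ (G i).map f := by
  classical
  rw [sumMap, Preadditive.sum_comp]
  by_cases hi : i ∈ (hG X).toFinset
  · rw [Finset.sum_eq_single_of_mem i hi, Category.assoc, Category.assoc,
      sumIncl_sumProj_self, Category.comp_id]
    intro j _ hj
    rw [Category.assoc, Category.assoc, sumIncl_sumProj_ne G hG hj, comp_zero, comp_zero]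
  · rw [zero_of_isZero (isZero_of_notMem_toFinset G hG hi) ((G i).map f), comp_zero]
    refine Finset.sum_eq_zero fun j hj => ?_
    have hji : j ≠ i := by rintro rfl; exact hi hj
    rw [Category.assoc, Category.assoc, sumIncl_sumProj_ne G hG hji, comp_zero, comp_zero]

/-- The locally finite sum of a family of functors. -/
noncomputable def sumFunctor : C ⥤ C where
  obj := sumObj G hG
  map := sumMap G hG
  map_id X := by
    simp only [sumMap, CategoryTheory.Functor.map_id, Category.id_comp]
    exact sum_sumProj_sumIncl G hG X _ fun i => isZero_of_notMem_toFinset G hG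
  map_comp {X Y Z} f g := by
    rw [sumMap, sumMap.eq_def G hG f, Preadditive.sum_comp]
    refine Finset.sum_congr rfl fun i _ => ?_
    rw [Functor.map_comp, Category.assoc, Category.assoc, Category.assoc, sumIncl_sumMap]

/-- The decomposition of a locally finite sum of functors. -/
noncomputable def sumDecomp : FunctorDecomp (sumFunctor G hG) G where
  incl i :=
    { app := sumIncl G hG i
      naturality := fun _ _ f => (sumIncl_sumMap G hG i f).symm }
  proj i :=
    { app := sumProj G hG i
      naturality := fun _ _ f => sumMap_sumProj G hG i f }
  incl_proj_self i := by
    ext X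
    exact sumIncl_sumProj_self G hG i X
  incl_proj_ne i j h := by
    ext X
    exact sumIncl_sumProj_ne G hG h X
  locallyFinite := hG
  total := sum_sumProj_sumIncl G hG

end Sum

/-! ### The restricted functors -/

section Components

variable {k : Type w} [Field k] {J : Type u} [Quiver.{v} J]
  {C : Type u₁} [Category.{v₁} C] [Preadditive C] [Linear k C]
  {gr : (J →₀ ℤ) → ObjectProperty C} {Ei Fi : J → (C ⥤ C)} (ρ : QuasiCatRep k gr Ei Fi)

omit [Quiver.{v} J] in
theorem sub_single_add_single_ne {i j : J} (hij : i ≠ j) (q : J →₀ ℤ) :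
    q ≠ q - Finsupp.single i 1 + Finsupp.single j 1 := fun h => by
  classical
  have := DFunLike.congr_fun h j
  rw [Finsupp.add_apply, Finsupp.sub_apply, Finsupp.single_apply, if_neg hij,
    Finsupp.single_eq_same] at this
  omega

instance : ρ.E.Additive := ρ.additive_E

instance : ρ.E.Linear k := ρ.linear_E

instance : ρ.F.Linear k := ρ.linear_F

namespace QuasiCatRep

include ρ in
theorem additive_component_E (i : J) : (Ei i).Additive := ρ.decompE.additive_component i

include ρ in
theorem linear_component_E (i : J) : (Ei i).Linear k := ρ.decompE.linear_component i

include ρ in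
theorem linear_component (i : J) : (Fi i).Linear k := ρ.decompF.linear_component i

include ρ in
theorem nonempty_adjunction_EF (j : J) : Nonempty (Ei j ⊣ Fi j) :=
  nonempty_componentAdjunction ρ.decompE ρ.decompF ρ.adjEF ρ.isDecomposition
    (fun i q => q - Finsupp.single i 1) (fun i q => q + Finsupp.single i 1)
    (fun _ _ hij q => sub_single_add_single_ne hij q)
    (fun i j hij q => by
      rw [add_sub_right_comm]
      exact sub_single_add_single_ne hij q)
    ρ.gr_E ρ.gr_F j

include ρ in
theorem nonempty_adjunction_FE (j : J) : Nonempty (Fi j ⊣ Ei j) :=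
  nonempty_componentAdjunction ρ.decompF ρ.decompE ρ.adjFE ρ.isDecomposition
    (fun i q => q + Finsupp.single i 1) (fun i q => q - Finsupp.single i 1)
    (fun i j hij q => by
      rw [add_sub_right_comm]
      exact sub_single_add_single_ne hij.symm q)
    (fun i j hij q => sub_single_add_single_ne hij.symm q)
    ρ.gr_F ρ.gr_E j

end QuasiCatRep

end Components

/-! ### Adjunctions, finiteness and exactness on the subcategory -/

section Restrict

variable {k : Type w} [Field k] {I : Type u} [Quiver.{v} I] {I₁ : Set I}
  {C : Type u₁} [Category.{v₁} C] [Abelian C] [Linear k C]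
  {gr : (Doubled I₁ →₀ ℤ) → ObjectProperty C}
  {Ei Fi : Doubled I₁ → (C ⥤ C)} (ρ : QuasiCatRep k gr Ei Fi)
  {P : ObjectProperty C} (hP : IsAdmissible gr Ei Fi P)

include ρ in
theorem nonempty_adjunction_phiVertex_EF (i : I) :
    Nonempty (seqFunctor Ei (phiVertex I₁ i).reverse ⊣ seqFunctor Fi (phiVertex I₁ i)) := by
  unfold phiVertex
  split_ifs with h
  · obtain ⟨a⟩ := ρ.nonempty_adjunction_EF (.one i h)
    obtain ⟨b⟩ := ρ.nonempty_adjunction_EF (.two i h)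
    exact ⟨b.comp a⟩
  · exact ρ.nonempty_adjunction_EF (.zero i h)

include ρ in
theorem nonempty_adjunction_phiVertex_FE (i : I) :
    Nonempty (seqFunctor Fi (phiVertex I₁ i) ⊣ seqFunctor Ei (phiVertex I₁ i).reverse) := by
  unfold phiVertex
  split_ifs with h
  · obtain ⟨a⟩ := ρ.nonempty_adjunction_FE (.one i h)
    obtain ⟨b⟩ := ρ.nonempty_adjunction_FE (.two i h)
    exact ⟨a.comp b⟩
  · exact ρ.nonempty_adjunction_FE (.zero i h)

include ρ in
-- The subcategory is full, so an adjunction between functors that preserve it restricts to it.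
theorem nonempty_adjunction_res_EF (i : I) : Nonempty (resE hP i ⊣ resF hP i) :=
  (nonempty_adjunction_phiVertex_EF ρ i).map fun a =>
    a.restrictFullyFaithful P.fullyFaithfulι P.fullyFaithfulι
      (P.liftCompιIso _ (hP.stable_E i)).symm (P.liftCompιIso _ (hP.stable_F i)).symm

include ρ in
theorem nonempty_adjunction_res_FE (i : I) : Nonempty (resF hP i ⊣ resE hP i) :=
  (nonempty_adjunction_phiVertex_FE ρ i).map fun a =>
    a.restrictFullyFaithful P.fullyFaithfulι P.fullyFaithfulι
      (P.liftCompιIso _ (hP.stable_F i)).symm (P.liftCompιIso _ (hP.stable_E i)).symm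

include ρ in
theorem resF_additive (i : I) : (resF hP i).Additive := by
  have := ρ.additive_component
  exact ⟨fun {X Y f g} => P.hom_ext ((seqFunctor Fi (phiVertex I₁ i)).map_add)⟩

include ρ in
theorem resE_additive (i : I) : (resE hP i).Additive := by
  have := ρ.additive_component_E
  exact ⟨fun {X Y f g} => P.hom_ext ((seqFunctor Ei (phiVertex I₁ i).reverse).map_add)⟩

include ρ in
theorem resF_linear (i : I) : (resF hP i).Linear k := by
  have := ρ.additive_component
  have := ρ.linear_component
  exact ⟨fun {X Y} f c => P.hom_ext (CategoryTheory.Functor.Linear.map_smul f.hom c)⟩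

include ρ in
theorem resE_linear (i : I) : (resE hP i).Linear k := by
  have := ρ.additive_component_E
  have := ρ.linear_component_E
  exact ⟨fun {X Y} f c => P.hom_ext (CategoryTheory.Functor.Linear.map_smul f.hom c)⟩

open Classical in
/-- The first entry of `φ(i)`. -/
noncomputable def phiHead (I₁ : Set I) (i : I) : Doubled I₁ :=
  if h : i ∈ I₁ then .one i h else .zero i h

open Classical in
/-- The last entry of `φ(i)`. -/
noncomputable def phiLast (I₁ : Set I) (i : I) : Doubled I₁ :=
  if h : i ∈ I₁ then .two i h else .zero i h

omit [Quiver.{v} I] in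
theorem phiHead_injective : Function.Injective (phiHead I₁) := fun i j h => by
  unfold phiHead at h
  split_ifs at h <;> cases h <;> rfl

omit [Quiver.{v} I] in
theorem phiLast_injective : Function.Injective (phiLast I₁) := fun i j h => by
  unfold phiLast at h
  split_ifs at h <;> cases h <;> rfl

include ρ in
-- If the functor of the first entry of `φ(i)` kills `X`, then so does `F_i`; and `i` is determined
-- by this first entry. For `E_i` the last entry plays this role, because the order is reversed.
theorem resF_locallyFinite (X : P.FullSubcategory) :
    {i | ¬ IsZero ((resF hP i).obj X)}.Finite := by
  have := ρ.additive_component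
  refine ((ρ.decompF.locallyFinite X.obj).preimage phiHead_injective.injOn).subset
    fun i hi h => hi ?_
  refine IsZero.of_full_of_faithful_of_isZero P.ι _ ?_
  change IsZero ((seqFunctor Fi (phiVertex I₁ i)).obj X.obj)
  unfold phiHead at h
  unfold phiVertex
  split_ifs at h ⊢
  · exact Functor.map_isZero (Fi _) h
  · exact h

include ρ in
theorem resE_locallyFinite (X : P.FullSubcategory) :
    {i | ¬ IsZero ((resE hP i).obj X)}.Finite := by
  have := ρ.additive_component_E
  refine ((ρ.decompE.locallyFinite X.obj).preimage phiLast_injective.injOn).subset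
    fun i hi h => hi ?_
  refine IsZero.of_full_of_faithful_of_isZero P.ι _ ?_
  change IsZero ((seqFunctor Ei (phiVertex I₁ i).reverse).obj X.obj)
  unfold phiLast at h
  unfold phiVertex
  split_ifs at h ⊢
  · exact Functor.map_isZero (Ei _) h
  · exact h

include ρ in
theorem gr_resF (i : I) (α : I →₀ ℤ) (X : P.FullSubcategory) (hX : gr (phiRoot I₁ α) X.obj) :
    gr (phiRoot I₁ (α + Finsupp.single i 1)) ((resF hP i).obj X).obj := by
  change gr _ ((seqFunctor Fi (phiVertex I₁ i)).obj X.obj)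
  rw [map_add]
  by_cases h : i ∈ I₁
  · simp only [phiVertex, h, dite_true]
    have h1 : phiRoot I₁ (Finsupp.single i (1 : ℤ)) =
        Finsupp.single (.one i h) 1 + Finsupp.single (.two i h) 1 := by simp [phiRoot, h]
    rw [h1, ← add_assoc]
    exact ρ.gr_F _ _ _ (ρ.gr_F _ _ _ hX)
  · simp only [phiVertex, h, dite_false]
    have h1 : phiRoot I₁ (Finsupp.single i (1 : ℤ)) = Finsupp.single (.zero i h) 1 := by
      simp [phiRoot, h]
    rw [h1]
    exact ρ.gr_F _ _ _ hX

include ρ in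
theorem gr_resE (i : I) (α : I →₀ ℤ) (X : P.FullSubcategory) (hX : gr (phiRoot I₁ α) X.obj) :
    gr (phiRoot I₁ (α - Finsupp.single i 1)) ((resE hP i).obj X).obj := by
  change gr _ ((seqFunctor Ei (phiVertex I₁ i).reverse).obj X.obj)
  rw [map_sub]
  by_cases h : i ∈ I₁
  · simp only [phiVertex, h, dite_true]
    have h1 : phiRoot I₁ (Finsupp.single i (1 : ℤ)) =
        Finsupp.single (.two i h) 1 + Finsupp.single (.one i h) 1 := by
      simp [phiRoot, h, add_comm]
    rw [h1, ← sub_sub]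
    exact ρ.gr_E _ _ _ (ρ.gr_E _ _ _ hX)
  · simp only [phiVertex, h, dite_false]
    have h1 : phiRoot I₁ (Finsupp.single i (1 : ℤ)) = Finsupp.single (.zero i h) 1 := by
      simp [phiRoot, h]
    rw [h1]
    exact ρ.gr_E _ _ _ hX

include hP in
omit [Quiver.{v} I] in
theorem IsAdmissible.hasFiniteBiproducts : HasFiniteBiproducts P.FullSubcategory := by
  have := hP.abelian.finiteProducts
  have : HasFiniteProducts P.FullSubcategory := ⟨fun n => inferInstance⟩
  exact HasFiniteBiproducts.of_hasFiniteProducts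

/-- The functor `E = ⨁ E_i` on the subcategory. -/
noncomputable def resSumE : P.FullSubcategory ⥤ P.FullSubcategory :=
  haveI := hP.hasFiniteBiproducts
  sumFunctor (resE hP) (resE_locallyFinite ρ hP)

/-- The functor `F = ⨁ F_i` on the subcategory. -/
noncomputable def resSumF : P.FullSubcategory ⥤ P.FullSubcategory :=
  haveI := hP.hasFiniteBiproducts
  sumFunctor (resF hP) (resF_locallyFinite ρ hP)

/-- The decomposition of the functor `E` on the subcategory. -/
noncomputable def resDecompE : FunctorDecomp (resSumE ρ hP) (resE hP) :=
  haveI := hP.hasFiniteBiproducts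
  sumDecomp (resE hP) (resE_locallyFinite ρ hP)

/-- The decomposition of the functor `F` on the subcategory. -/
noncomputable def resDecompF : FunctorDecomp (resSumF ρ hP) (resF hP) :=
  haveI := hP.hasFiniteBiproducts
  sumDecomp (resF hP) (resF_locallyFinite ρ hP)

instance : (resSumE ρ hP).Additive :=
  have := resE_additive ρ hP
  (resDecompE ρ hP).additive

instance : (resSumF ρ hP).Additive :=
  have := resF_additive ρ hP
  (resDecompF ρ hP).additive

instance : (resSumE ρ hP).Linear k :=
  have := resE_linear ρ hP
  (resDecompE ρ hP).linear

instance : (resSumF ρ hP).Linear k :=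
  have := resF_linear ρ hP
  (resDecompF ρ hP).linear

/-- The functors `E` and `F` on the subcategory are adjoint. -/
noncomputable def resAdjEF : resSumE ρ hP ⊣ resSumF ρ hP :=
  sumAdjunction (resDecompE ρ hP) (resDecompF ρ hP) fun i =>
    (nonempty_adjunction_res_EF ρ hP i).some

/-- The functors `F` and `E` on the subcategory are adjoint. -/
noncomputable def resAdjFE : resSumF ρ hP ⊣ resSumE ρ hP :=
  sumAdjunction (resDecompF ρ hP) (resDecompE ρ hP) fun i =>
    (nonempty_adjunction_res_FE ρ hP i).some

/-- A functor that is both a left and a right adjoint preserves finite colimits and finite limits.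
-/
theorem resSumE_exact :
    PreservesFiniteLimits (resSumE ρ hP) ∧ PreservesFiniteColimits (resSumE ρ hP) := by
  have := (resAdjFE ρ hP).rightAdjoint_preservesLimits.{0, 0}
  have := (resAdjEF ρ hP).leftAdjoint_preservesColimits.{0, 0}
  exact ⟨PreservesLimitsOfSize.preservesFiniteLimits _,
    PreservesColimitsOfSize.preservesFiniteColimits _⟩

theorem resSumF_exact :
    PreservesFiniteLimits (resSumF ρ hP) ∧ PreservesFiniteColimits (resSumF ρ hP) := by
  have := (resAdjEF ρ hP).rightAdjoint_preservesLimits.{0, 0}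
  have := (resAdjFE ρ hP).leftAdjoint_preservesColimits.{0, 0}
  exact ⟨PreservesLimitsOfSize.preservesFiniteLimits _,
    PreservesColimitsOfSize.preservesFiniteColimits _⟩

end Restrict

/-! ### Natural transformations given by their components -/

section Diag

variable {C : Type u₁} [Category.{v₁} C] [Preadditive C] {I : Type u}
  {F : C ⥤ C} {Fi : I → (C ⥤ C)} (D : FunctorDecomp F Fi)

/-- The endomorphism of a decomposed functor with given diagonal components. -/
noncomputable def diagHom (f : ∀ i, Fi i ⟶ Fi i) : F ⟶ F where
  app M := D.desc fun i => (f i).app M ≫ (D.incl i).app M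
  naturality M N g := D.hom_ext_left fun i => by
    rw [← (D.incl i).naturality_assoc, D.incl_desc, D.incl_desc_assoc, Category.assoc,
      ← (D.incl i).naturality, (f i).naturality_assoc]

theorem incl_diagHom (f : ∀ i, Fi i ⟶ Fi i) (i : I) (M : C) :
    (D.incl i).app M ≫ (diagHom D f).app M = (f i).app M ≫ (D.incl i).app M := D.incl_desc _ i

theorem compX_diagHom_self (f : ∀ i, Fi i ⟶ Fi i) (i : I) (M : C) :
    compX D (diagHom D f) i i M = (f i).app M := by
  rw [compX, ← Category.assoc, incl_diagHom, Category.assoc, D.incl_proj_self_app,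
    Category.comp_id]

theorem compX_diagHom_ne (f : ∀ i, Fi i ⟶ Fi i) {i j : I} (h : i ≠ j) (M : C) :
    compX D (diagHom D f) i j M = 0 := by
  rw [compX, ← Category.assoc, incl_diagHom, Category.assoc, D.incl_proj_ne_app h, comp_zero]

omit [Preadditive C] in
theorem End.of_pow_succ {X : C} (f : X ⟶ X) (n : ℕ) :
    (End.of f ^ (n + 1) : End X) = (f ≫ (End.of f ^ n : End X) : X ⟶ X) :=
  pow_succ (End.of f) n

omit [Preadditive C] in
theorem comp_pow_eq {X Y : C} {f : X ⟶ X} {g : Y ⟶ Y} {h : X ⟶ Y} (hc : h ≫ g = f ≫ h) (n : ℕ) :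
    h ≫ (End.of g ^ n : End Y) = (End.of f ^ n : End X) ≫ h := by
  induction n with
  | zero => exact (Category.comp_id h).trans (Category.id_comp h).symm
  | succ n ih =>
    rw [End.of_pow_succ, End.of_pow_succ, reassoc_of% hc, ih]
    exact (Category.assoc _ _ _).symm

/-- Only finitely many components are nonzero at `M`, and the sum of their nilpotency exponents
bounds each of them. -/
theorem isNilpotent_diagHom {f : ∀ i, Fi i ⟶ Fi i} {M : C}
    (hf : ∀ i, IsNilpotent (End.of ((f i).app M))) :
    IsNilpotent (End.of ((diagHom D f).app M)) := by
  choose n hn using hf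
  refine ⟨∑ i ∈ D.supp M, n i, D.hom_ext_left (g := 0) fun i => ?_⟩
  rw [comp_zero]
  by_cases hi : i ∈ D.supp M
  · refine (comp_pow_eq (incl_diagHom D f i M) _).trans ?_
    have h0 : (End.of ((f i).app M) ^ (∑ i ∈ D.supp M, n i) : End _) = 0 :=
      pow_eq_zero_of_le (Finset.single_le_sum (fun _ _ => Nat.zero_le _) hi) (hn i)
    rw [h0]
    exact zero_comp
  · exact (D.isZero_of_notMem_supp hi).eq_of_src _ _

/-- A transformation without off-diagonal components preserves each summand, so a power that
vanishes on the sum vanishes on the summand. -/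
theorem isNilpotent_compX {x : F ⟶ F} (hx : ∀ i j M, i ≠ j → compX D x i j M = 0) (i : I) {M : C}
    (h : IsNilpotent (End.of (x.app M))) : IsNilpotent (End.of (compX D x i i M)) := by
  obtain ⟨n, hn⟩ := h
  have h1 : (D.incl i).app M ≫ x.app M = compX D x i i M ≫ (D.incl i).app M := by
    refine D.hom_ext_right fun j => ?_
    by_cases hij : i = j
    · subst hij
      rw [Category.assoc, Category.assoc, D.incl_proj_self_app, Category.comp_id]
      rfl
    · rw [Category.assoc, Category.assoc, D.incl_proj_ne_app hij, comp_zero]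
      exact hx i j M hij
  refine ⟨n, ?_⟩
  have h2 := comp_pow_eq h1 n
  rw [hn] at h2
  have h3 : ((End.of (compX D x i i M) ^ n : End _) ≫ (D.incl i).app M) ≫ (D.proj i).app M = 0 := by
    rw [← h2]
    exact (congrArg (· ≫ _) comp_zero).trans zero_comp
  rwa [Category.assoc, D.incl_proj_self_app, Category.comp_id] at h3

theorem isNilpotent_map (G : C ⥤ C) [G.Additive] {M : C} {f : M ⟶ M}
    (h : IsNilpotent (End.of f)) : IsNilpotent (End.of (G.map f)) := by
  obtain ⟨n, hn⟩ := h
  refine ⟨n, (map_pow (G.mapEnd M) (End.of f) n).symm.trans ?_⟩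
  rw [hn]
  exact G.map_zero _ _

include D in
theorem sq_hom_ext [F.Additive] {M N : C} {f g : F.obj (F.obj M) ⟶ N}
    (h : ∀ a b, (D.incl b).app ((Fi a).obj M) ≫ F.map ((D.incl a).app M) ≫ f =
      (D.incl b).app ((Fi a).obj M) ≫ F.map ((D.incl a).app M) ≫ g) : f = g := by
  have h1 (f : F.obj (F.obj M) ⟶ N) : f = ∑ a ∈ D.supp M,
      F.map ((D.proj a).app M) ≫ F.map ((D.incl a).app M) ≫ f := by
    conv_lhs => rw [← Category.id_comp f, ← F.map_id, ← D.total_supp, F.map_sum,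
      Preadditive.sum_comp]
    simp only [F.map_comp, Category.assoc]
  rw [h1 f, h1 g]
  exact Finset.sum_congr rfl fun a _ => congrArg _ (D.hom_ext_left fun b => h a b)

variable [F.Additive] (g : ∀ a b, Fi a ⋙ Fi b ⟶ Fi b ⋙ Fi a)

/-- A component of an endomorphism of the square of a decomposed functor. -/
def permComp (a b : I) (M : C) : (Fi b).obj ((Fi a).obj M) ⟶ (Fi a).obj ((Fi b).obj M) :=
  (g a b).app M

omit [Preadditive C] in
theorem permComp_naturality (a b : I) {M N : C} (f : M ⟶ N) :
    (Fi b).map ((Fi a).map f) ≫ permComp g a b N =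
      permComp g a b M ≫ (Fi a).map ((Fi b).map f) := (g a b).naturality f

/-- The value of an endomorphism of the square of a decomposed functor with given components. -/
noncomputable def permApp (M : C) : F.obj (F.obj M) ⟶ F.obj (F.obj M) :=
  ∑ a ∈ D.supp M, F.map ((D.proj a).app M) ≫ D.desc fun b =>
    permComp g a b M ≫ (D.incl a).app ((Fi b).obj M) ≫ F.map ((D.incl b).app M)

theorem incl_permApp (a b : I) (M : C) :
    (D.incl b).app ((Fi a).obj M) ≫ F.map ((D.incl a).app M) ≫ permApp D g M =
      permComp g a b M ≫ (D.incl a).app ((Fi b).obj M) ≫ F.map ((D.incl b).app M) := by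
  classical
  have := D.additive_component
  by_cases ha : a ∈ D.supp M
  · rw [permApp, Preadditive.comp_sum, Finset.sum_eq_single_of_mem a ha, ← F.map_comp_assoc,
      D.incl_proj_self_app, F.map_id, Category.id_comp, D.incl_desc]
    intro c _ hc
    rw [← F.map_comp_assoc, D.incl_proj_ne_app hc.symm, F.map_zero, zero_comp]
  · exact ((Fi b).map_isZero (D.isZero_of_notMem_supp ha)).eq_of_src _ _

/-- The endomorphism of the square of a decomposed functor with given components. -/
noncomputable def permHom : F ⋙ F ⟶ F ⋙ F where
  app M := permApp D g M
  naturality M N f := by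
    change F.map (F.map f) ≫ permApp D g N = permApp D g M ≫ F.map (F.map f)
    refine sq_hom_ext D fun a b => ?_
    have h1 : F.map ((D.incl a).app M) ≫ F.map (F.map f) =
        F.map ((Fi a).map f) ≫ F.map ((D.incl a).app N) := by
      rw [← F.map_comp, ← F.map_comp, (D.incl a).naturality]
    have h2 : F.map ((D.incl b).app M) ≫ F.map (F.map f) =
        F.map ((Fi b).map f) ≫ F.map ((D.incl b).app N) := by
      rw [← F.map_comp, ← F.map_comp, (D.incl b).naturality]
    have h3 := congrArg (· ≫ F.map (F.map f)) (incl_permApp D g a b M)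
    simp only [Category.assoc] at h3
    rw [h3, reassoc_of% h1, h2, ← (D.incl b).naturality_assoc, incl_permApp,
      ← (D.incl a).naturality_assoc, reassoc_of% (permComp_naturality g a b f)]

theorem compT_permHom_self (a b : I) (M : C) :
    compT D (permHom D g) a b b a M = permComp g a b M := by
  have h1 : F.map ((D.incl b).app M) ≫ (D.proj a).app (F.obj M) ≫ (Fi a).map ((D.proj b).app M) =
      (D.proj a).app ((Fi b).obj M) := by
    rw [(D.proj a).naturality_assoc, ← (Fi a).map_comp, D.incl_proj_self_app,
      CategoryTheory.Functor.map_id, Category.comp_id]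
  have h2 := congrArg (· ≫ (D.proj a).app (F.obj M) ≫ (Fi a).map ((D.proj b).app M))
    (incl_permApp D g a b M)
  simp only [Category.assoc, h1, D.incl_proj_self_app, Category.comp_id] at h2
  exact h2

theorem compT_permHom_ne {a b a' b' : I} (h : ¬ (a = b' ∧ b = a')) (M : C) :
    compT D (permHom D g) a b a' b' M = 0 := by
  have := D.additive_component
  have h1 : (D.incl a).app ((Fi b).obj M) ≫ F.map ((D.incl b).app M) ≫
      (D.proj b').app (F.obj M) ≫ (Fi b').map ((D.proj a').app M) = 0 := by
    rw [(D.proj b').naturality_assoc, ← (Fi b').map_comp]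
    by_cases hb : b = a'
    · rw [← Category.assoc, D.incl_proj_ne_app fun ha => h ⟨ha, hb⟩, zero_comp]
    · rw [D.incl_proj_ne_app hb, CategoryTheory.Functor.map_zero, comp_zero, comp_zero]
  have h2 := congrArg (· ≫ (D.proj b').app (F.obj M) ≫ (Fi b').map ((D.proj a').app M))
    (incl_permApp D g a b M)
  simp only [Category.assoc, h1, comp_zero] at h2
  exact h2

end Diag

/-! ### Nilpotency -/

section Nilpotent

variable {k : Type w} [Field k] {J : Type u} [Quiver.{v} J]
  {C : Type u₁} [Category.{v₁} C] [Preadditive C] [Linear k C]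
  {gr : (J →₀ ℤ) → ObjectProperty C} {Ei Fi : J → (C ⥤ C)} (ρ : QuasiCatRep k gr Ei Fi)

/-- In the algebra for one strand the dot commutes with `e(b)`, and `ψ₁` sends `e(b)` to the
projector to `F_b`. -/
theorem QuasiCatRep.compX_ne {a b : J} (h : a ≠ b) (M : C) :
    compX ρ.decompF ρ.x a b M = 0 := by
  have h1 : (wt [b]).degree = 1 := by rw [degree_wt]; rfl
  obtain ⟨j, hj⟩ := SeqOf.exists_val (α := wt [b]) (l := [b]) rfl
  have hx := KLRAlg.mk_rel (KLRRel.x_mul_e (k := k) (α := wt [b]) 0 j)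
  rw [map_mul, map_mul] at hx
  have h2 := ρ.ψ_x 1 ⟨wt [b], h1⟩ j 0 Nat.zero_lt_one
  have h3 : (ρ.ψ 1 (KLRd.of k ⟨wt [b], h1⟩ (KLRAlg.e k j * KLRAlg.x k (wt [b]) 0))).unop =
      (ρ.decompF.projSeq 1 j.1 ≫ ρ.decompF.inclSeq 1 j.1) ≫
        (ρ.ψ 1 (KLRd.of k ⟨wt [b], h1⟩ (KLRAlg.x k (wt [b]) 0))).unop := by
    rw [← ρ.ψ_e 1 ⟨wt [b], h1⟩ j, KLRd.of_mul, map_mul]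
    rfl
  have h4 : powX ρ.x 1 0 ≫ ρ.decompF.projSeq 1 j.1 ≫ ρ.decompF.inclSeq 1 j.1 = _ :=
    h2.symm.trans ((congrArg (fun z => (ρ.ψ 1 (KLRd.of k ⟨wt [b], h1⟩ z)).unop) hx).trans h3)
  generalize (ρ.ψ 1 (KLRd.of k ⟨wt [b], h1⟩ (KLRAlg.x k (wt [b]) 0))).unop = y at h4
  rw [hj] at h4
  have h5 : entX ρ.decompF ρ.x 1 0 [a] [b] = 0 := by
    have h6 := congrArg (fun f => ρ.decompF.inclSeq 1 [a] ≫ f ≫ ρ.decompF.projSeq 1 [b]) h4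
    have h7 : ρ.decompF.inclSeq 1 [a] ≫ ρ.decompF.projSeq 1 [b] = 0 :=
      ρ.decompF.inclSeq_projSeq_ne (by simpa using h)
    have h8 : ρ.decompF.inclSeq 1 [b] ≫ ρ.decompF.projSeq 1 [b] = 𝟙 _ :=
      ρ.decompF.inclSeq_projSeq_self rfl
    simp only [Category.assoc, h8, Category.comp_id] at h6
    rw [reassoc_of% h7, zero_comp] at h6
    exact h6
  have h9 := entX_zero ρ.decompF ρ.x a b (l := []) rfl M
  exact h9.symm.trans (NatTrans.congr_app h5 M)

/-- The dot on the strand applied first is the image of a diagonal component of `x` under the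
functor of the other strands. It is needed for the dot of a cable, which is placed on the first
strand. -/
theorem QuasiCatRep.isNilpotent_comp_x {α : J →₀ ℕ} (i : SeqOf α) {h : J} {t : List J}
    (hi : i.1 = h :: t) (M : C) :
    IsNilpotent (End.of ((ρ.comp α (KLRAlg.x k α 0) i i).app M)) := by
  have := ρ.additive_component
  rw [ρ.comp_x, ← SeqOf.length_eq i]
  generalize i.1 = l at hi ⊢
  subst hi
  have h1 := entX_zero ρ.decompF ρ.x h h (l := t) rfl M
  have h2 := isNilpotent_map (seqFunctor Fi t)
    (isNilpotent_compX ρ.decompF (fun _ _ _ hij => ρ.compX_ne hij _) h (ρ.nilpotent_x M))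
  rw [← h1] at h2
  exact h2

end Nilpotent

/-! ### Comparison of the matrix entries on the subcategory and on the ambient category -/

section Cast

variable {C : Type u₁} [Category.{v₁} C] {J : Type u}

/-- The isomorphism between the functors of equal sequences. -/
def seqCast (G : J → (C ⥤ C)) {l l' : List J} (h : l = l') : seqFunctor G l ≅ seqFunctor G l' :=
  eqToIso (congrArg (seqFunctor G) h)

theorem seqCast_cons_hom_app (G : J → (C ⥤ C)) {l l' : List J} (h : l = l') (i : J) (X : C) :
    (seqCast G (congrArg (i :: ·) h)).hom.app X = (seqCast G h).hom.app ((G i).obj X) := by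
  subst h
  rfl

variable [Preadditive C]

/-- Coherence: the two ways to split a triple concatenation agree up to the identification of the
two bracketings of the list. -/
theorem append_append_hom (G : J → (C ⥤ C)) (A B v : List J) (X : C) :
    (seqFunctorAppend G A (B ++ v)).hom.app X ≫
      (seqFunctorAppend G B v).hom.app ((seqFunctor G A).obj X) =
    (seqCast G (List.append_assoc A B v).symm).hom.app X ≫
      (seqFunctorAppend G (A ++ B) v).hom.app X ≫
        (seqFunctor G v).map ((seqFunctorAppend G A B).hom.app X) := by
  induction A generalizing X with
  | nil =>
    have h1 : (seqFunctorAppend G B v).hom.app X = 𝟙 _ ≫ (seqFunctorAppend G B v).hom.app X ≫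
        (seqFunctor G v).map (𝟙 ((seqFunctor G B).obj X)) := by
      rw [Category.id_comp, CategoryTheory.Functor.map_id]
      exact (Category.comp_id _).symm
    exact (Category.id_comp _).trans h1
  | cons a A ih =>
    rw [append_cons_hom_app, append_cons_hom_app]
    refine (ih ((G a).obj X)).trans ?_
    rw [← seqCast_cons_hom_app]
    refine congrArg _ ?_
    have h1 : (seqFunctorAppend G (a :: A ++ B) v).hom.app X =
      (seqFunctorAppend G (A ++ B) v).hom.app ((G a).obj X) := append_cons_hom_app G a (A ++ B) v X
    rw [h1]
    rfl

end Cast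

section Local

variable {k : Type w} [Field k] {J : Type u} [Quiver.{v} J]
  {C : Type u₁} [Category.{v₁} C] [Preadditive C] [Linear k C]
  {gr : (J →₀ ℤ) → ObjectProperty C} {Ei Fi : J → (C ⥤ C)} (ρ : QuasiCatRep k gr Ei Fi)

/-- The sequence `l` as an element of `J^α`. -/
abbrev SeqOf.mk {α : J →₀ ℕ} (l : List J) (h : wt l = α) : SeqOf α := ⟨l, h⟩

theorem QuasiCatRep.comp_cast {α : J →₀ ℕ} (z : KLRAlg k α) {m m' l l' : List J} (hm : wt m = α)
    (hl : wt l = α) (hm' : m = m') (hl' : l = l') :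
    ρ.comp α z (.mk m hm) (.mk l hl) = (seqCast Fi hm').hom ≫
      ρ.comp α z (.mk m' (hm' ▸ hm)) (.mk l' (hl' ▸ hl)) ≫ (seqCast Fi hl').inv := by
  subst hm' hl'
  exact ((Category.id_comp _).trans (Category.comp_id _)).symm

end Local

section Compare

variable {k : Type w} [Field k] {I : Type u} [Quiver.{v} I] {I₁ : Set I}
  {C : Type u₁} [Category.{v₁} C] [Abelian C] [Linear k C]
  {gr : (Doubled I₁ →₀ ℤ) → ObjectProperty C}
  {Ei Fi : Doubled I₁ → (C ⥤ C)} (ρ : QuasiCatRep k gr Ei Fi)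
  {P : ObjectProperty C} (hP : IsAdmissible gr Ei Fi P)

omit [Quiver.{v} I] in
theorem length_phiVertex_pos (a : I) : 0 < (phiVertex I₁ a).length := by
  unfold phiVertex
  split_ifs <;> simp

theorem comp_tStar_left {α β : Doubled I₁ →₀ ℕ} (u : List (Doubled I₁)) (h : wt u + α = β)
    (p : ℕ) (a b : I) (m l : SeqOf α) (X : C) :
    (ρ.comp β (tStar k β (u.length + p) a b) (appendLeft u h m) (appendLeft u h l)).app X =
      (seqFunctorAppend Fi u m.1).hom.app X ≫
        (ρ.comp α (tStar k α p a b) m l).app ((seqFunctor Fi u).obj X) ≫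
          (seqFunctorAppend Fi u l.1).inv.app X :=
  NatTrans.congr_app ((IsLocal.tStar (appendLeft_injective u h)
    (fun r _ => isLocal_left_t ρ u h r) p a b le_rfl l).2 m) X

theorem comp_tStar_right {α β : Doubled I₁ →₀ ℕ} (v : List (Doubled I₁)) (h : α + wt v = β)
    (a b : I) (hab : (phiVertex I₁ a).length + (phiVertex I₁ b).length ≤ α.degree)
    (m l : SeqOf α) (X : C) :
    (ρ.comp β (tStar k β 0 a b) (appendRight v h m) (appendRight v h l)).app X =
      (seqFunctorAppend Fi m.1 v).hom.app X ≫
        (seqFunctor Fi v).map ((ρ.comp α (tStar k α 0 a b) m l).app X) ≫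
          (seqFunctorAppend Fi l.1 v).inv.app X := by
  have := ρ.additive_component
  exact NatTrans.congr_app ((IsLocal.tStar (s := 0) (appendRight_injective v h)
    (fun r hr => isLocal_right_t ρ v h hr) 0 a b (by rwa [Nat.zero_add]) l).2 m) X

/-- The endomorphism `x` of the functor `F_a` on the subcategory. -/
noncomputable def resX (a : I) : resF hP a ⟶ resF hP a where
  app X := P.homMk ((ρ.comp (wt (phiVertex I₁ a)) (KLRAlg.x k _ 0) (.mk (phiVertex I₁ a) rfl)
    (.mk (phiVertex I₁ a) rfl)).app X.obj)
  naturality _ _ f := P.hom_ext ((ρ.comp (wt (phiVertex I₁ a)) (KLRAlg.x k _ 0)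
    (.mk (phiVertex I₁ a) rfl) (.mk (phiVertex I₁ a) rfl)).naturality f.hom)

omit [Quiver.{v} I] in
theorem wt_append_comm (l l' : List (Doubled I₁)) : wt (l' ++ l) = wt (l ++ l') :=
  wt_perm List.perm_append_comm

/-- The crossing of `φ(a)` and `φ(b)` as a natural transformation. -/
noncomputable def phiCrossing (a b : I) :
    seqFunctor Fi (phiVertex I₁ b) ⋙ seqFunctor Fi (phiVertex I₁ a) ⟶
      seqFunctor Fi (phiVertex I₁ a) ⋙ seqFunctor Fi (phiVertex I₁ b) :=
  (seqFunctorAppend Fi (phiVertex I₁ b) (phiVertex I₁ a)).inv ≫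
    ρ.comp (wt (phiVertex I₁ a ++ phiVertex I₁ b)) (tStar k _ 0 a b)
      (.mk (phiVertex I₁ b ++ phiVertex I₁ a) (wt_append_comm _ _))
      (.mk (phiVertex I₁ a ++ phiVertex I₁ b) rfl) ≫
    (seqFunctorAppend Fi (phiVertex I₁ a) (phiVertex I₁ b)).hom

/-- The endomorphism `τ` on the subcategory, from `F_a F_b` to `F_b F_a`. -/
noncomputable def resT (b a : I) : resF hP b ⋙ resF hP a ⟶ resF hP a ⋙ resF hP b where
  app X := P.homMk ((phiCrossing ρ a b).app X.obj)
  naturality _ _ f := P.hom_ext ((phiCrossing ρ a b).naturality f.hom)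

omit [Quiver.{v} I] [Linear k C] in
theorem resSeqIso_cons_hom_app (a : I) (l : List I) (X : P.FullSubcategory) :
    (resSeqIso hP (a :: l)).hom.app X = (resSeqIso hP l).hom.app ((resF hP a).obj X) ≫
      (seqFunctorAppend Fi (phiVertex I₁ a) (phiSeq I₁ l)).inv.app X.obj := by
  change 𝟙 _ ≫ (resSeqIso hP l).hom.app ((resF hP a).obj X) ≫ 𝟙 _ ≫
    (seqFunctor Fi (phiSeq I₁ l)).map (𝟙 ((seqFunctor Fi (phiVertex I₁ a)).obj X.obj)) ≫ 𝟙 _ ≫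
      (seqFunctorAppend Fi (phiVertex I₁ a) (phiSeq I₁ l)).inv.app X.obj = _
  refine (Category.id_comp _).trans (congrArg _ ((Category.id_comp _).trans ?_))
  exact (congrArg (· ≫ _) ((seqFunctor Fi (phiSeq I₁ l)).map_id _)).trans
    ((Category.id_comp _).trans (Category.id_comp _))

omit [Abelian C] [Linear k C] [Quiver.{v} I] in
theorem iso_inv_eq_of_hom_eq {A B M : C} {e : A ≅ B} {e₁ : A ≅ M} {f : B ≅ M}
    (h : e.hom = e₁.hom ≫ f.inv) : e.inv = f.hom ≫ e₁.inv := by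
  rw [← cancel_epi e.hom, e.hom_inv_id, h]
  simp

omit [Quiver.{v} I] [Linear k C] in
theorem resSeqIso_cons_inv_app (a : I) (l : List I) (X : P.FullSubcategory) :
    (resSeqIso hP (a :: l)).inv.app X =
      (seqFunctorAppend Fi (phiVertex I₁ a) (phiSeq I₁ l)).hom.app X.obj ≫
        (resSeqIso hP l).inv.app ((resF hP a).obj X) :=
  iso_inv_eq_of_hom_eq (e := (resSeqIso hP (a :: l)).app X)
    (e₁ := (resSeqIso hP l).app ((resF hP a).obj X))
    (f := (seqFunctorAppend Fi (phiVertex I₁ a) (phiSeq I₁ l)).app X.obj)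
    (resSeqIso_cons_hom_app hP a l X)

omit [Quiver.{v} I] [Linear k C] in
theorem seqFunctor_map_hom (l : List I) {X Y : P.FullSubcategory} (f : X ⟶ Y) :
    ((seqFunctor (resF hP) l).map f).hom = (resSeqIso hP l).hom.app X ≫
      (seqFunctor Fi (phiSeq I₁ l)).map f.hom ≫ (resSeqIso hP l).inv.app Y := by
  have h1 := (resSeqIso hP l).hom.naturality f
  have h2 := congrArg (· ≫ (resSeqIso hP l).inv.app Y) h1
  have h3 := (resSeqIso hP l).hom_inv_id_app Y
  refine (Category.comp_id _).symm.trans ((congrArg _ h3.symm).trans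
    ((Category.assoc _ _ _).symm.trans (h2.trans (Category.assoc _ _ _))))

omit [Abelian C] [Linear k C] [Quiver.{v} I] in
theorem conj_eq_conj {A M B A' M' B' : C} {s : A ⟶ M} {g : M ⟶ M'} {s' : M' ⟶ A'} {t : A ⟶ B}
    {t' : B' ⟶ A'} {c : B ⟶ B'} (e : B ≅ M) (e' : B' ≅ M') (ht : t = s ≫ e.inv)
    (ht' : t' = e'.hom ≫ s') (hc : c = e.hom ≫ g ≫ e'.inv) : s ≫ g ≫ s' = t ≫ c ≫ t' := by
  subst ht ht' hc
  simp

omit [Abelian C] [Linear k C] [Quiver.{v} I] in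
theorem conj_eq_map_conj (V : C ⥤ C) {B B₁ N M B' B₁' N' M' : C} {e : B ≅ V.obj M}
    {e' : B' ≅ V.obj M'} {c : B ⟶ B'} {c₁ : B₁ ⟶ B₁'} {c₀ : N ⟶ N'} (κ : B ≅ B₁) (κ' : B' ≅ B₁')
    (p : B₁ ≅ V.obj N) (p' : B₁' ≅ V.obj N') (q : N ≅ M) (q' : N' ≅ M')
    (he : e.hom = κ.hom ≫ p.hom ≫ V.map q.hom) (he' : e'.hom = κ'.hom ≫ p'.hom ≫ V.map q'.hom)
    (hc : c = κ.hom ≫ c₁ ≫ κ'.inv) (hc₁ : c₁ = p.hom ≫ V.map c₀ ≫ p'.inv) :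
    c = e.hom ≫ V.map (q.inv ≫ c₀ ≫ q'.hom) ≫ e'.inv := by
  rw [← Category.assoc, ← Category.assoc, Iso.eq_comp_inv, he', hc, hc₁, he]
  simp only [Category.assoc, Iso.inv_hom_id_assoc, V.map_comp]
  rw [← V.map_comp_assoc q.hom, q.hom_inv_id, V.map_id, Category.id_comp]

/-- Induction on the strands to the left. Without them the dot sits on the first cable, and the
strands to the right are whiskered on; each further cable on the left is split off by left locality.
On both sides of the comparison the recursion has the same shape. -/
theorem hom_entX_append (l₁ l₂ : List I) (a : I) {γ : Doubled I₁ →₀ ℕ}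
    (h : wt (phiSeq I₁ (l₁ ++ a :: l₂)) = γ) (X : P.FullSubcategory) :
    ((entX (resDecompF ρ hP) (diagHom (resDecompF ρ hP) (resX ρ hP)) (l₁ ++ a :: l₂).length
      l₁.length (l₁ ++ a :: l₂) (l₁ ++ a :: l₂)).app X).hom =
      (resSeqIso hP (l₁ ++ a :: l₂)).hom.app X ≫
        (ρ.comp γ (KLRAlg.x k γ (phiSeq I₁ l₁).length) (.mk _ h) (.mk _ h)).app X.obj ≫
          (resSeqIso hP (l₁ ++ a :: l₂)).inv.app X := by
  induction l₁ generalizing X γ with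
  | nil =>
    have h1 := entX_zero (resDecompF ρ hP) (diagHom (resDecompF ρ hP) (resX ρ hP)) a a (l := l₂)
      rfl X
    rw [compX_diagHom_self] at h1
    have h2 := (congrArg (fun f => f.hom) h1).trans (seqFunctor_map_hom hP l₂ _)
    have h3 := NatTrans.congr_app ((isLocal_right_x ρ (phiSeq I₁ l₂)
      (α := wt (phiVertex I₁ a)) (β := γ) (by rw [← h, ← wt_append]; rfl)
      (by rw [degree_wt]; exact length_phiVertex_pos a) (.mk (phiVertex I₁ a) rfl)).2
        (.mk (phiVertex I₁ a) rfl)) X.obj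
    exact h2.trans (conj_eq_conj
      ((seqFunctorAppend Fi (phiVertex I₁ a) (phiSeq I₁ l₂)).app X.obj)
      ((seqFunctorAppend Fi (phiVertex I₁ a) (phiSeq I₁ l₂)).app X.obj)
      (resSeqIso_cons_hom_app hP a l₂ X) (resSeqIso_cons_inv_app hP a l₂ X) h3)
  | cons c l₁ ih =>
    have h1 := entX_succ (resDecompF ρ hP) (diagHom (resDecompF ρ hP) (resX ρ hP))
      (l₁ ++ a :: l₂).length l₁.length c (l₁ ++ a :: l₂) (l₁ ++ a :: l₂) X
    have h2 := (congrArg (fun f => f.hom) h1).trans (ih rfl ((resF hP c).obj X))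
    have h3 := NatTrans.congr_app ((isLocal_left_x ρ (phiVertex I₁ c)
      (α := wt (phiSeq I₁ (l₁ ++ a :: l₂))) (β := γ) (by rw [← h, ← wt_append]; rfl)
      (phiSeq I₁ l₁).length (.mk (phiSeq I₁ (l₁ ++ a :: l₂)) rfl)).2
        (.mk (phiSeq I₁ (l₁ ++ a :: l₂)) rfl)) X.obj
    have h4 : (phiSeq I₁ (c :: l₁)).length = (phiVertex I₁ c).length + (phiSeq I₁ l₁).length :=
      List.length_append
    rw [h4]
    exact h2.trans (conj_eq_conj
      ((seqFunctorAppend Fi (phiVertex I₁ c) (phiSeq I₁ (l₁ ++ a :: l₂))).app X.obj)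
      ((seqFunctorAppend Fi (phiVertex I₁ c) (phiSeq I₁ (l₁ ++ a :: l₂))).app X.obj)
      (resSeqIso_cons_hom_app hP c (l₁ ++ a :: l₂) X)
      (resSeqIso_cons_inv_app hP c (l₁ ++ a :: l₂) X) h3)

theorem comp_tStar_append (l : List I) (a b : I) {γ : Doubled I₁ →₀ ℕ}
    (h : wt (phiSeq I₁ (b :: a :: l)) = γ) (h' : wt (phiSeq I₁ (a :: b :: l)) = γ) (X : C) :
    (ρ.comp γ (tStar k γ 0 a b) (.mk _ h) (.mk _ h')).app X =
      ((seqFunctorAppend Fi (phiVertex I₁ b) (phiSeq I₁ (a :: l))).app X ≪≫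
        (seqFunctorAppend Fi (phiVertex I₁ a) (phiSeq I₁ l)).app
          ((seqFunctor Fi (phiVertex I₁ b)).obj X)).hom ≫
      (seqFunctor Fi (phiSeq I₁ l)).map ((phiCrossing ρ a b).app X) ≫
      ((seqFunctorAppend Fi (phiVertex I₁ a) (phiSeq I₁ (b :: l))).app X ≪≫
        (seqFunctorAppend Fi (phiVertex I₁ b) (phiSeq I₁ l)).app
          ((seqFunctor Fi (phiVertex I₁ a)).obj X)).inv := by
  have hv : wt (phiVertex I₁ a ++ phiVertex I₁ b) + wt (phiSeq I₁ l) = γ := by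
    rw [← h', ← wt_append, List.append_assoc]
    rfl
  refine conj_eq_map_conj (seqFunctor Fi (phiSeq I₁ l))
    ((seqCast Fi (List.append_assoc (phiVertex I₁ b) (phiVertex I₁ a) (phiSeq I₁ l)).symm).app X)
    ((seqCast Fi (List.append_assoc (phiVertex I₁ a) (phiVertex I₁ b) (phiSeq I₁ l)).symm).app X)
    ((seqFunctorAppend Fi (phiVertex I₁ b ++ phiVertex I₁ a) (phiSeq I₁ l)).app X)
    ((seqFunctorAppend Fi (phiVertex I₁ a ++ phiVertex I₁ b) (phiSeq I₁ l)).app X)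
    ((seqFunctorAppend Fi (phiVertex I₁ b) (phiVertex I₁ a)).app X)
    ((seqFunctorAppend Fi (phiVertex I₁ a) (phiVertex I₁ b)).app X)
    (append_append_hom Fi _ _ _ X) (append_append_hom Fi _ _ _ X)
    (NatTrans.congr_app (ρ.comp_cast (tStar k γ 0 a b) h h' _ _) X) ?_
  exact comp_tStar_right ρ (phiSeq I₁ l) hv a b (by rw [degree_wt, List.length_append])
    (.mk (phiVertex I₁ b ++ phiVertex I₁ a) (wt_append_comm _ _))
    (.mk (phiVertex I₁ a ++ phiVertex I₁ b) rfl) X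

/-- The same induction as for dots; in the initial case two cables have to be separated from the
strands to the right, hence `comp_tStar_append`. -/
theorem hom_entT_append (l₁ l₂ : List I) (a b : I) {γ : Doubled I₁ →₀ ℕ}
    (h : wt (phiSeq I₁ (l₁ ++ b :: a :: l₂)) = γ) (h' : wt (phiSeq I₁ (l₁ ++ a :: b :: l₂)) = γ)
    (X : P.FullSubcategory) :
    ((entT (resDecompF ρ hP) (permHom (resDecompF ρ hP) (resT ρ hP))
      (l₁ ++ a :: b :: l₂).length l₁.length (l₁ ++ b :: a :: l₂) (l₁ ++ a :: b :: l₂)).app X).hom =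
      (resSeqIso hP (l₁ ++ b :: a :: l₂)).hom.app X ≫
        (ρ.comp γ (tStar k γ (phiSeq I₁ l₁).length a b) (.mk _ h) (.mk _ h')).app X.obj ≫
          (resSeqIso hP (l₁ ++ a :: b :: l₂)).inv.app X := by
  induction l₁ generalizing X γ with
  | nil =>
    have h1 := entT_zero (resDecompF ρ hP) (permHom (resDecompF ρ hP) (resT ρ hP)) b a a b
      (l := l₂) rfl X
    rw [compT_permHom_self] at h1
    have h2 := (congrArg (fun f => f.hom) h1).trans (seqFunctor_map_hom hP l₂ _)
    have h3 (a b : I) : (resSeqIso hP (b :: a :: l₂)).hom.app X =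
        (resSeqIso hP l₂).hom.app ((resF hP a).obj ((resF hP b).obj X)) ≫
        ((seqFunctorAppend Fi (phiVertex I₁ b) (phiSeq I₁ (a :: l₂))).app X.obj ≪≫
          (seqFunctorAppend Fi (phiVertex I₁ a) (phiSeq I₁ l₂)).app
            ((seqFunctor Fi (phiVertex I₁ b)).obj X.obj)).inv :=
      (resSeqIso_cons_hom_app hP b (a :: l₂) X).trans ((congrArg (· ≫ _)
        (resSeqIso_cons_hom_app hP a l₂ ((resF hP b).obj X))).trans (Category.assoc _ _ _))
    exact h2.trans (conj_eq_conj
      ((seqFunctorAppend Fi (phiVertex I₁ b) (phiSeq I₁ (a :: l₂))).app X.obj ≪≫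
          (seqFunctorAppend Fi (phiVertex I₁ a) (phiSeq I₁ l₂)).app
            ((seqFunctor Fi (phiVertex I₁ b)).obj X.obj))
      ((seqFunctorAppend Fi (phiVertex I₁ a) (phiSeq I₁ (b :: l₂))).app X.obj ≪≫
          (seqFunctorAppend Fi (phiVertex I₁ b) (phiSeq I₁ l₂)).app
            ((seqFunctor Fi (phiVertex I₁ a)).obj X.obj))
      (h3 a b)
      (iso_inv_eq_of_hom_eq (e := (resSeqIso hP (a :: b :: l₂)).app X)
        (e₁ := (resSeqIso hP l₂).app ((resF hP b).obj ((resF hP a).obj X))) (h3 b a))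
      (comp_tStar_append ρ l₂ a b h h' X.obj))
  | cons c l₁ ih =>
    have h0 : wt (phiSeq I₁ (l₁ ++ b :: a :: l₂)) = wt (phiSeq I₁ (l₁ ++ a :: b :: l₂)) := by
      rw [wt_phiSeq, wt_phiSeq]
      exact congrArg _ (wt_perm ((List.Perm.swap a b l₂).append_left l₁))
    have h1 := entT_succ (resDecompF ρ hP) (permHom (resDecompF ρ hP) (resT ρ hP))
      (l₁ ++ a :: b :: l₂).length l₁.length c (l₁ ++ b :: a :: l₂) (l₁ ++ a :: b :: l₂) X
    have h2 := (congrArg (fun f => f.hom) h1).trans (ih h0 rfl ((resF hP c).obj X))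
    have h3 := comp_tStar_left ρ (phiVertex I₁ c)
      (α := wt (phiSeq I₁ (l₁ ++ a :: b :: l₂))) (β := γ) (by rw [← h', ← wt_append]; rfl)
      (phiSeq I₁ l₁).length a b (.mk (phiSeq I₁ (l₁ ++ b :: a :: l₂)) h0)
      (.mk (phiSeq I₁ (l₁ ++ a :: b :: l₂)) rfl) X.obj
    have h4 : (phiSeq I₁ (c :: l₁)).length = (phiVertex I₁ c).length + (phiSeq I₁ l₁).length :=
      List.length_append
    rw [h4]
    exact h2.trans (conj_eq_conj
      ((seqFunctorAppend Fi (phiVertex I₁ c) (phiSeq I₁ (l₁ ++ b :: a :: l₂))).app X.obj)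
      ((seqFunctorAppend Fi (phiVertex I₁ c) (phiSeq I₁ (l₁ ++ a :: b :: l₂))).app X.obj)
      (resSeqIso_cons_hom_app hP c (l₁ ++ b :: a :: l₂) X)
      (resSeqIso_cons_inv_app hP c (l₁ ++ a :: b :: l₂) X) h3)

end Compare

/-! ### The representation on the subcategory -/

section Unwhisker

variable {C : Type u₁} [Category.{v₁} C] {D : Type*} [Category* D] {P : ObjectProperty C}
  {G H : D ⥤ P.FullSubcategory}

/-- The natural transformation to a full subcategory given by its components. -/
def unwhisker (θ : G ⋙ P.ι ⟶ H ⋙ P.ι) : G ⟶ H where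
  app X := P.homMk (θ.app X)
  naturality _ _ f := P.hom_ext (θ.naturality f)

theorem natTrans_hom_ext {f g : G ⟶ H} (h : ∀ X, (f.app X).hom = (g.app X).hom) : f = g :=
  NatTrans.ext (funext fun X => P.hom_ext (h X))

theorem natTrans_ext_of_whiskerRight {f g : G ⟶ H}
    (h : Functor.whiskerRight f P.ι = Functor.whiskerRight g P.ι) : f = g :=
  natTrans_hom_ext fun X => NatTrans.congr_app h X

theorem comp_conj_comp {A B K K' B' A' : C} {s : A ⟶ B} {ι : B ⟶ K} {T : K ⟶ K'} {p : K' ⟶ B'}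
    {t : B' ⟶ A'} {v : B ⟶ B'} (h : ι ≫ T ≫ p = v) :
    (s ≫ ι) ≫ T ≫ p ≫ t = s ≫ v ≫ t := by
  rw [← h]
  simp only [Category.assoc]

end Unwhisker

section Restrict

variable {k : Type w} [Field k] {I : Type u} [Quiver.{v} I] {I₁ : Set I}
  {C : Type u₁} [Category.{v₁} C] [Abelian C] [Linear k C]
  {gr : (Doubled I₁ →₀ ℤ) → ObjectProperty C}
  {Ei Fi : Doubled I₁ → (C ⥤ C)} (ρ : QuasiCatRep k gr Ei Fi)
  {P : ObjectProperty C} (hP : IsAdmissible gr Ei Fi P)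

theorem isNilpotent_diagHom_resX (M : P.FullSubcategory) :
    IsNilpotent (End.of ((diagHom (resDecompF ρ hP) (resX ρ hP)).app M)) := by
  refine isNilpotent_diagHom _ fun a => ?_
  obtain ⟨b, t, hb⟩ := List.exists_cons_of_length_pos (length_phiVertex_pos (I₁ := I₁) a)
  obtain ⟨n, hn⟩ := ρ.isNilpotent_comp_x (α := wt (phiVertex I₁ a)) (.mk (phiVertex I₁ a) rfl) hb
    M.obj
  refine ⟨n, P.hom_ext ?_⟩
  exact (map_pow (P.ι.mapEnd ((resF hP a).obj M)) (End.of ((resX ρ hP a).app M)) n).trans hn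

theorem comp_mul_ordIdem {γ : Doubled I₁ →₀ ℕ} (z : KLRAlg k γ) (i : SeqOf γ) (j : OrdSeq γ) :
    ρ.comp γ (z * ordIdem k γ) i j.1 = ρ.comp γ z i j.1 := by
  rw [ordIdem, Finset.mul_sum]
  refine (map_sum (ρ.compHom γ i j.1) _ _).trans
    ((Finset.sum_eq_single_of_mem j (Finset.mem_univ _) fun l _ hl => ?_).trans
      (ρ.comp_mul_e_self γ z i j.1))
  exact ρ.comp_mul_e_ne γ z i fun h => hl (Subtype.ext h.symm)

theorem ordIncl_balancedHom_cls_ordProj {β : I →₀ ℕ} (z : KLRAlg k (phiRoot I₁ β))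
    (i j : OrdSeq (phiRoot I₁ β)) :
    ordIncl P Fi i ≫ (balancedHom ρ hP β (BalancedKLR.cls k _ z)).unop ≫ ordProj P Fi j =
      Functor.whiskerLeft P.ι (ρ.comp (phiRoot I₁ β) z i.1 j.1) := by
  refine (ordIncl_balancedHom_ordProj ρ hP β _ i j).trans ?_
  rw [OrdCorner.val_mk, comp_mul_ordIdem, comp_ordIdem_mul]

variable {β : I →₀ ℕ} (Φ : KLRAlg k β →ₐ[k] BalancedKLR k (phiRoot I₁ β))

/-- The inclusion of `F_i` into the sum of the functors of the well-ordered sequences. -/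
noncomputable def resIncl (i : SeqOf β) :
    seqFunctor (resF hP) i.1 ⋙ P.ι ⟶ ordFunctor P Fi (phiRoot I₁ β) :=
  (resSeqIso hP i.1).hom ≫ ordIncl P Fi (phiOrd I₁ i)

/-- The projection to `F_i` from the sum of the functors of the well-ordered sequences. -/
noncomputable def resProj (i : SeqOf β) :
    ordFunctor P Fi (phiRoot I₁ β) ⟶ seqFunctor (resF hP) i.1 ⋙ P.ι :=
  ordProj P Fi (phiOrd I₁ i) ≫ (resSeqIso hP i.1).inv

omit [Quiver.{v} I] [Linear k C] in
theorem resProj_resIncl (i : SeqOf β) :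
    resProj hP i ≫ resIncl hP i = ordProj P Fi (phiOrd I₁ i) ≫ ordIncl P Fi (phiOrd I₁ i) :=
  (Category.assoc _ _ _).trans (congrArg _ ((resSeqIso hP i.1).inv_hom_id_assoc _))

omit [Quiver.{v} I] [Linear k C] in
theorem sum_resProj_resIncl : ∑ i : SeqOf β, resProj hP i ≫ resIncl hP i = 𝟙 _ := by
  simp only [resProj_resIncl]
  rw [(phiOrd_bijective β).sum_comp fun m => ordProj P Fi m ≫ ordIncl P Fi m, sum_ordProj_ordIncl]

/-- The natural endomorphism given by `Φ(z)`. -/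
noncomputable def ordAct (z : KLRAlg k β) :
    ordFunctor P Fi (phiRoot I₁ β) ⟶ ordFunctor P Fi (phiRoot I₁ β) :=
  (balancedHom ρ hP β (Φ z)).unop

theorem ordAct_add (y z : KLRAlg k β) :
    ordAct ρ hP Φ (y + z) = ordAct ρ hP Φ y + ordAct ρ hP Φ z := by
  rw [ordAct, map_add, map_add]
  rfl

theorem ordAct_smul (c : k) (z : KLRAlg k β) :
    ordAct ρ hP Φ (c • z) = c • ordAct ρ hP Φ z := by
  rw [ordAct, map_smul, map_smul]
  rfl

theorem ordAct_mul (y z : KLRAlg k β) :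
    ordAct ρ hP Φ (y * z) = ordAct ρ hP Φ y ≫ ordAct ρ hP Φ z := by
  rw [ordAct, map_mul, map_mul]
  rfl

/-- The component `F_i ⟶ F_j` of the endomorphism given by `Φ(z)`. -/
noncomputable def resEntry (z : KLRAlg k β) (i j : SeqOf β) :
    seqFunctor (resF hP) i.1 ⟶ seqFunctor (resF hP) j.1 :=
  unwhisker (resIncl hP i ≫ ordAct ρ hP Φ z ≫ resProj hP j)

theorem whiskerRight_resEntry (z : KLRAlg k β) (i j : SeqOf β) :
    Functor.whiskerRight (resEntry ρ hP Φ z i j) P.ι =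
      resIncl hP i ≫ ordAct ρ hP Φ z ≫ resProj hP j := rfl

theorem resEntry_add (y z : KLRAlg k β) (i j : SeqOf β) :
    resEntry ρ hP Φ (y + z) i j = resEntry ρ hP Φ y i j + resEntry ρ hP Φ z i j := by
  refine natTrans_ext_of_whiskerRight ?_
  change _ = Functor.whiskerRight (resEntry ρ hP Φ y i j) P.ι +
    Functor.whiskerRight (resEntry ρ hP Φ z i j) P.ι
  simp only [whiskerRight_resEntry, ordAct_add, Preadditive.add_comp, Preadditive.comp_add]

theorem resEntry_smul (c : k) (z : KLRAlg k β) (i j : SeqOf β) :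
    resEntry ρ hP Φ (c • z) i j = c • resEntry ρ hP Φ z i j := by
  refine natTrans_ext_of_whiskerRight ?_
  change _ = c • Functor.whiskerRight (resEntry ρ hP Φ z i j) P.ι
  simp only [whiskerRight_resEntry, ordAct_smul, Linear.smul_comp, Linear.comp_smul]

/-- The identity of `ordFunctor` is the sum of the projectors to the `F_m` with `m ∈ I^β`, because
`φ` is a bijection to the well-ordered sequences; it is inserted between the two factors. -/
theorem resEntry_mul (y z : KLRAlg k β) (i j : SeqOf β) :
    resEntry ρ hP Φ (y * z) i j = ∑ m, resEntry ρ hP Φ y i m ≫ resEntry ρ hP Φ z m j := by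
  have h2 (f g : ordFunctor P Fi (phiRoot I₁ β) ⟶ ordFunctor P Fi (phiRoot I₁ β)) :
      f ≫ g = ∑ m : SeqOf β, f ≫ (resProj hP m ≫ resIncl hP m) ≫ g := by
    rw [← Preadditive.comp_sum, ← Preadditive.sum_comp, sum_resProj_resIncl, Category.id_comp]
  have h3 : Functor.whiskerRight (∑ m, resEntry ρ hP Φ y i m ≫ resEntry ρ hP Φ z m j) P.ι =
      ∑ m, Functor.whiskerRight (resEntry ρ hP Φ y i m ≫ resEntry ρ hP Φ z m j) P.ι :=
    map_sum (AddMonoidHom.mk' (fun f : seqFunctor (resF hP) i.1 ⟶ seqFunctor (resF hP) j.1 =>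
      Functor.whiskerRight f P.ι) fun _ _ => rfl) _ _
  refine natTrans_ext_of_whiskerRight (Eq.trans ?_ h3.symm)
  rw [whiskerRight_resEntry, ordAct_mul, h2]
  simp only [Preadditive.comp_sum, Preadditive.sum_comp]
  refine Finset.sum_congr rfl fun m _ => ?_
  rw [Functor.whiskerRight_comp, whiskerRight_resEntry, whiskerRight_resEntry]
  simp only [Category.assoc]

theorem hom_resEntry_of_cls {z : KLRAlg k β} {y : KLRAlg k (phiRoot I₁ β)}
    (h : Φ z = BalancedKLR.cls k _ y) (i j : SeqOf β) (X : P.FullSubcategory) :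
    ((resEntry ρ hP Φ z i j).app X).hom = (resSeqIso hP i.1).hom.app X ≫
      (ρ.comp (phiRoot I₁ β) y (phiOrd I₁ i).1 (phiOrd I₁ j).1).app X.obj ≫
        (resSeqIso hP j.1).inv.app X := by
  have h1 := ordIncl_balancedHom_cls_ordProj ρ hP y (phiOrd I₁ i) (phiOrd I₁ j)
  rw [← h] at h1
  have h2 : resIncl hP i ≫ ordAct ρ hP Φ z ≫ resProj hP j = (resSeqIso hP i.1).hom ≫
      Functor.whiskerLeft P.ι (ρ.comp (phiRoot I₁ β) y (phiOrd I₁ i).1 (phiOrd I₁ j).1) ≫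
        (resSeqIso hP j.1).inv :=
    comp_conj_comp h1
  exact NatTrans.congr_app h2 X

theorem resEntry_eq_zero_of_cls {z : KLRAlg k β} {y : KLRAlg k (phiRoot I₁ β)}
    (h : Φ z = BalancedKLR.cls k _ y) {i j : SeqOf β}
    (hy : ρ.comp (phiRoot I₁ β) y (phiOrd I₁ i).1 (phiOrd I₁ j).1 = 0) :
    resEntry ρ hP Φ z i j = 0 :=
  natTrans_hom_ext fun X => (hom_resEntry_of_cls ρ hP Φ h i j X).trans (by
    rw [hy]
    exact (congrArg _ zero_comp).trans comp_zero)

omit [Quiver.{v} I] in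
theorem phiOrd_val_ne {i j : SeqOf β} (h : i ≠ j) : (phiOrd I₁ i).1 ≠ (phiOrd I₁ j).1 :=
  fun h' => h ((phiOrd_bijective β).1 (Subtype.ext h'))

variable {Φ}

theorem resEntry_ne {z : KLRAlg k β} {y : KLRAlg k (phiRoot I₁ β)} {i : SeqOf β}
    (h : Φ z = BalancedKLR.cls k _ (y * KLRAlg.e k (phiOrd I₁ i).1)) (m : SeqOf β) {l : SeqOf β}
    (hl : l ≠ i) : resEntry ρ hP Φ z m l = 0 :=
  resEntry_eq_zero_of_cls ρ hP Φ h (ρ.comp_mul_e_ne _ y _ (phiOrd_val_ne hl))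

theorem resEntry_e (hΦ : IsDoublingHom k Φ) (i : SeqOf β) :
    resEntry ρ hP Φ (KLRAlg.e k i) i i = 𝟙 _ := by
  refine natTrans_hom_ext fun X => (hom_resEntry_of_cls ρ hP Φ (hΦ.map_e i) i i X).trans ?_
  rw [← one_mul (KLRAlg.e k (phiOrd I₁ i).1), ρ.comp_mul_e_self, ρ.comp_one_self]
  exact (congrArg _ (Category.id_comp _)).trans ((resSeqIso hP i.1).hom_inv_id_app X)

/-- The diagonal entry is `hom_entX_append`; off the diagonal both sides vanish, in the ambient
category because dots commute with the idempotents. -/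
theorem resEntry_x (hΦ : IsDoublingHom k Φ) (i m : SeqOf β) {r d : ℕ} (hd : β.degree = d)
    (hr : r < d) :
    resEntry ρ hP Φ (KLRAlg.x k β r * KLRAlg.e k i) m i =
      entX (resDecompF ρ hP) (diagHom (resDecompF ρ hP) (resX ρ hP)) d r m.1 i.1 := by
  have hd' := (SeqOf.length_eq i).trans hd
  subst hd'
  by_cases h : m = i
  · subst h
    obtain ⟨l₁, l₂, h1, h2⟩ := eq_append_cons_of_getElem? (List.getElem?_eq_getElem hr)
    generalize m.1[r] = a at h1
    refine natTrans_hom_ext fun X =>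
      (hom_resEntry_of_cls ρ hP Φ (hΦ.map_x m r hr) m m X).trans ?_
    rw [ρ.comp_mul_e_self]
    obtain ⟨l, hl⟩ := m
    dsimp only at h1
    subst h1 h2
    rw [phiPos_append_cons]
    exact (hom_entX_append ρ hP l₁ l₂ a (phiOrd I₁ ⟨_, hl⟩).1.2 X).symm
  · rw [entX_ne _ _ (fun a b M hab => compX_diagHom_ne _ _ hab M) fun h' => h (Subtype.ext h')]
    refine resEntry_eq_zero_of_cls ρ hP Φ (hΦ.map_x i r hr) ?_
    rw [ρ.comp_mul_e_self, ρ.comp_x_ne _ _ (phiOrd_val_ne h)]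

theorem comp_tStar_ne (i m : SeqOf β) {r : ℕ} (hr : r + 1 < i.1.length) (h : m ≠ i.swap r) :
    ρ.comp (phiRoot I₁ β) (tStar k _ (phiPos I₁ i.1 r) i.1[r] i.1[r + 1])
      (phiOrd I₁ m).1 (phiOrd I₁ i).1 = 0 := by
  have h1 := ty_tStar (k := k) (I₁ := I₁) i r hr
  have h2 : KLRAlg.e k (phiOrd I₁ (i.swap r)).1 *
      (tStar k _ (phiPos I₁ i.1 r) i.1[r] i.1[r + 1] * KLRAlg.e k (phiOrd I₁ i).1) =
      tStar k _ (phiPos I₁ i.1 r) i.1[r] i.1[r + 1] * KLRAlg.e k (phiOrd I₁ i).1 := by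
    rw [← eSeq_phiSeq, ← eSeq_phiSeq]
    exact h1
  rw [← ρ.comp_mul_e_self, ← h2, ρ.comp_e_mul_ne _ _ _ (phiOrd_val_ne h)]

theorem resEntry_t (hΦ : IsDoublingHom k Φ) (i m : SeqOf β) {r d : ℕ} (hd : β.degree = d)
    (hr : r + 1 < d) :
    resEntry ρ hP Φ (KLRAlg.t k β r * KLRAlg.e k i) m i =
      entT (resDecompF ρ hP) (permHom (resDecompF ρ hP) (resT ρ hP)) d r m.1 i.1 := by
  have hd' := (SeqOf.length_eq i).trans hd
  subst hd'
  have h0 := hΦ.map_t i r _ _ (List.getElem?_eq_getElem (by omega)) (List.getElem?_eq_getElem hr)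
  by_cases h : m = i.swap r
  · have h4 : m.1 = swapAt r i.1 := congrArg Subtype.val h
    obtain ⟨l₁, l₂, h1, h2⟩ := eq_append_cons_cons_of_getElem?
      (List.getElem?_eq_getElem (by omega : r < i.1.length)) (List.getElem?_eq_getElem hr)
    refine natTrans_hom_ext fun X => (hom_resEntry_of_cls ρ hP Φ h0 m i X).trans ?_
    rw [ρ.comp_mul_e_self]
    clear h h0
    generalize i.1[r + 1] = b at h1
    generalize i.1[r] = a at h1
    obtain ⟨l, hl⟩ := i
    obtain ⟨m, hm⟩ := m
    dsimp only at h1 h4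
    subst h1 h2
    rw [swapAt_append_cons_cons] at h4
    subst h4
    rw [phiPos_append_cons]
    exact (hom_entT_append ρ hP l₁ l₂ a b (phiOrd I₁ ⟨_, hm⟩).1.2 (phiOrd I₁ ⟨_, hl⟩).1.2 X).symm
  · rw [entT_ne _ _ (fun a b a' b' M hab => compT_permHom_ne _ _ hab M)
      fun h' => h (Subtype.ext h')]
    refine resEntry_eq_zero_of_cls ρ hP Φ h0 ?_
    rw [ρ.comp_mul_e_self, comp_tStar_ne ρ i m hr h]

end Restrict

section Restrict

variable {k : Type w} [Field k] {I : Type u} [Quiver.{v} I] {I₁ : Set I}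
  {C : Type u₁} [Category.{v₁} C] [Abelian C] [Linear k C]
  {gr : (Doubled I₁ →₀ ℤ) → ObjectProperty C}
  {Ei Fi : Doubled I₁ → (C ⥤ C)} (ρ : QuasiCatRep k gr Ei Fi)
  {P : ObjectProperty C} (hP : IsAdmissible gr Ei Fi P)
  (Φ : ∀ β : I →₀ ℕ, KLRAlg k β →ₐ[k] BalancedKLR k (phiRoot I₁ β))

/-- The matrices of the endomorphisms given by the homomorphisms `Φ`. -/
noncomputable def resMatrix (β : I →₀ ℕ) : KLRAlg k β →ₗ[k]
    ∀ i j : SeqOf β, seqFunctor (resF hP) i.1 ⟶ seqFunctor (resF hP) j.1 where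
  toFun z i j := resEntry ρ hP (Φ β) z i j
  map_add' y z := funext fun i => funext fun j => resEntry_add ρ hP (Φ β) y z i j
  map_smul' c z := funext fun i => funext fun j => resEntry_smul ρ hP (Φ β) c z i j

theorem resMatrix_mul (β : I →₀ ℕ) (y z : KLRAlg k β) (i j : SeqOf β) :
    resMatrix ρ hP Φ β (y * z) i j =
      ∑ m, resMatrix ρ hP Φ β y i m ≫ resMatrix ρ hP Φ β z m j :=
  resEntry_mul ρ hP (Φ β) y z i j

/-- The representation on the subcategory. -/
noncomputable def resRep (hΦ : ∀ β, IsDoublingHom k (Φ β)) :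
    QuasiCatRep k (fun α : I →₀ ℤ => (gr (phiRoot I₁ α)).inverseImage P.ι) (resE hP) (resF hP) where
  isDecomposition := hP.decomposition
  E := resSumE ρ hP
  F := resSumF ρ hP
  additive_E := inferInstance
  additive_F := inferInstance
  linear_E := inferInstance
  linear_F := inferInstance
  exact_E := resSumE_exact ρ hP
  exact_F := resSumF_exact ρ hP
  adjEF := resAdjEF ρ hP
  adjFE := resAdjFE ρ hP
  x := diagHom (resDecompF ρ hP) (resX ρ hP)
  τ := permHom (resDecompF ρ hP) (resT ρ hP)
  decompE := resDecompE ρ hP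
  decompF := resDecompF ρ hP
  gr_E i α X hX := gr_resE ρ hP i α X hX
  gr_F i α X hX := gr_resF ρ hP i α X hX
  ψ := matHom (resDecompF ρ hP) (resMatrix ρ hP Φ) (resMatrix_mul ρ hP Φ)
  ψ_e d α i := by
    refine (matHom_of _ _ _ α _).trans ?_
    rw [← Category.id_comp ((resDecompF ρ hP).projSeq d i.1 ≫ _)]
    -- The factor `1` brings the class into the form `y * e(φ(i))` required by `resEntry_ne`.
    have he : Φ α.1 (KLRAlg.e k i) = BalancedKLR.cls k _ (1 * KLRAlg.e k (phiOrd I₁ i).1) := by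
      rw [one_mul, (hΦ α.1).map_e]
    refine matEnd_eq_of_column _ _ _ i _ (fun m l hl => resEntry_ne ρ hP he m hl)
      (fun m => ?_) fun l hl hw => ?_
    · rw [Category.id_comp]
      by_cases h : m = i
      · subst h
        rw [(resDecompF ρ hP).inclSeq_projSeq_self ((SeqOf.length_eq m).trans α.2)]
        exact resEntry_e ρ hP (hΦ α.1) m
      · rw [(resDecompF ρ hP).inclSeq_projSeq_ne fun h' => h (Subtype.ext h')]
        refine resEntry_eq_zero_of_cls ρ hP _ he ?_
        rw [ρ.comp_mul_e_self, ρ.comp_one_ne _ (phiOrd_val_ne h)]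
    -- Sequences of another weight do not index rows of the matrix, so their contribution is
    -- excluded separately.
    · rw [Category.id_comp, (resDecompF ρ hP).inclSeq_projSeq_ne (l := l) (l' := i.1)
        fun h' => hw (h' ▸ i.2)]
  ψ_x d α i r hr := by
    refine (matHom_of _ _ _ α _).trans ?_
    refine matEnd_eq_of_column _ _ _ i _
      (fun m l hl => resEntry_ne ρ hP
        ((hΦ α.1).map_x i r (by rw [SeqOf.length_eq, α.2]; exact hr)) m hl)
      (fun m => resEntry_x ρ hP (hΦ α.1) i m α.2 hr) fun l hl hw => ?_
    exact entX_ne _ _ (fun a b M hab => compX_diagHom_ne _ _ hab M) fun h' => hw (h' ▸ i.2)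
  ψ_t d α i r hr := by
    have hr' : r + 1 < i.1.length := by rw [SeqOf.length_eq, α.2]; exact hr
    refine (matHom_of _ _ _ α _).trans ?_
    refine matEnd_eq_of_column _ _ _ i _
      (fun m l hl => resEntry_ne ρ hP ((hΦ α.1).map_t i r _ _
        (List.getElem?_eq_getElem (by omega)) (List.getElem?_eq_getElem hr')) m hl)
      (fun m => resEntry_t ρ hP (hΦ α.1) i m α.2 hr) fun l hl hw => ?_
    -- An exchange of entries preserves the weight, so there are no entries of `τ` between different
    -- weights.
    exact entT_ne _ _ (fun a b a' b' M hab => compT_permHom_ne _ _ hab M)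
      fun h' => hw (h'.symm ▸ (i.swap r).2)
  nilpotent_x M := isNilpotent_diagHom_resX ρ hP M

theorem resRep_comp (hΦ : ∀ β, IsDoublingHom k (Φ β)) (β : I →₀ ℕ) (z : KLRAlg k β)
    (i j : SeqOf β) : (resRep ρ hP Φ hΦ).comp β z i j = resEntry ρ hP (Φ β) z i j := by
  have h := matHom_of (resDecompF ρ hP) (resMatrix ρ hP Φ)
    (resMatrix_mul ρ hP Φ) ⟨β, rfl⟩ z
  refine Eq.trans ?_ (inclSeq_matEnd_projSeq (resDecompF ρ hP) (resMatrix ρ hP Φ) z rfl i j)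
  rw [← h]
  rfl

theorem whiskerRight_resRep_comp (hΦ : ∀ β, IsDoublingHom k (Φ β)) (β : I →₀ ℕ)
    (z : KLRAlg k β) (i j : SeqOf β) :
    Functor.whiskerRight ((resRep ρ hP Φ hΦ).comp β z i j) P.ι =
      (resSeqIso hP i.1).hom ≫ ordIncl P Fi (phiOrd I₁ i) ≫ (balancedHom ρ hP β (Φ β z)).unop ≫
        ordProj P Fi (phiOrd I₁ j) ≫ (resSeqIso hP j.1).inv := by
  rw [resRep_comp, whiskerRight_resEntry]
  exact Category.assoc _ _ _

end Restrict

end QuasiCat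

open QuasiCat in
theorem mainTheorem3
    (k : Type w) [Field k]
    {I : Type u} [Quiver.{v} I] [hfin : ∀ i j : I, Finite (i ⟶ j)]
    (hloop : ∀ i : I, IsEmpty (i ⟶ i))
    (I₁ : Set I) (hI₁ : ∀ i ∈ I₁, ∀ j ∈ I₁, IsEmpty (i ⟶ j))
    {C : Type u₁} [Category.{v₁} C] [Abelian C] [Linear k C]
    [homFinite : ∀ X Y : C, Module.Finite k (X ⟶ Y)]
    (gr : (Doubled I₁ →₀ ℤ) → ObjectProperty C)
    (Ei Fi : Doubled I₁ → (C ⥤ C))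
    (ρ : QuasiCatRep k gr Ei Fi)
    (P : ObjectProperty C) (hP : IsAdmissible gr Ei Fi P) :
    ∃ ρ' : QuasiCatRep k (fun α : I →₀ ℤ => (gr (phiRoot I₁ α)).inverseImage P.ι)
        (resE hP) (resF hP),
      ∀ α : I →₀ ℕ,
        ∃ (Φ : KLRAlg k α →ₐ[k] BalancedKLR k (phiRoot I₁ α))
          (Ψ : BalancedKLR k (phiRoot I₁ α) →ₐ[k] (End (ordFunctor P Fi (phiRoot I₁ α)))ᵐᵒᵖ),
          IsDoublingHom k Φ ∧
          (∀ (z : OrdCorner k (phiRoot I₁ α)) (i j : OrdSeq (phiRoot I₁ α)),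
            ordIncl P Fi i ≫ (Ψ (BalancedKLR.proj k _ z)).unop ≫ ordProj P Fi j =
              Functor.whiskerLeft P.ι (ρ.comp (phiRoot I₁ α) z.1 i.1 j.1)) ∧
          ∀ (z : KLRAlg k α) (i j : SeqOf α),
            Functor.whiskerRight (ρ'.comp α z i j) P.ι =
              (resSeqIso hP i.1).hom ≫ ordIncl P Fi (phiOrd I₁ i) ≫ (Ψ (Φ z)).unop ≫
                ordProj P Fi (phiOrd I₁ j) ≫ (resSeqIso hP j.1).inv := by
  -- That there are no arrows within `I₁` enters the proof as the vanishing of the numbers of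
  -- arrows.
  have hΦ (β : I →₀ ℕ) := exists_isDoublingHom k I₁ β fun i hi j hj => by
    have := hI₁ i hi j hj
    exact Nat.card_of_isEmpty
  -- The representation involves all weights at once, so the homomorphisms are chosen for all of
  -- them beforehand.
  choose Φ hΦ using hΦ
  exact ⟨resRep ρ hP Φ hΦ, fun α => ⟨Φ α, balancedHom ρ hP α, hΦ α,
    ordIncl_balancedHom_ordProj ρ hP α, whiskerRight_resRep_comp ρ hP Φ hΦ α⟩⟩
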